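/- Let $F=\mathbb F_q$ be a finite field. A conic of $\mathrm{PG}(2,q)$ is a nonzero ternary quadratic form $f=\sum_{i\le j}a_{ij}X_iX_j$ up to scalars; it is a double line ($c\,\ell^2$), a pair of real lines ($\ell m$ with $\ell,m$ independent linear forms over $\mathbb F_q$), a pair of imaginary lines ($c\,\ell\,\ell^\sigma$ with $c\in\mathbb F_q^*$, $\ell,\ell^\sigma$ independent conjugate linear forms over $\mathbb F_{q^2}$), or non-singular ($4a_{00}a_{11}a_{22}+a_{01}a_{02}a_{12}-a_{00}a_{12}^2-a_{11}a_{02}^2-a_{22}a_{01}^2\ne0$). A web is a $4$-dimensional space $\mathcal W$ of quadratic forms; webs are projectively equivalent if an invertible linear substitution of the variables maps one to the other. A point $(y_0,\dots,y_5)$ of $\mathrm{PG}(5,q)$ is identified with the symmetric matrix $M=\begin{bmatrix}y_0&y_1&y_2\\y_1&y_3&y_4\\y_2&y_4&y_5\end{bmatrix}$, its rank is the rank of $M$, and $K\cong\mathrm{PGL}(3,q)$ acts by $M\mapsto AMA^T$. The conic $f$ corresponds to the hyperplane $a_{00}Y_0+a_{01}Y_1+a_{02}Y_2+a_{11}Y_3+a_{12}Y_4+a_{22}Y_5=0$,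 and the four types of conics give the hyperplane classes $\mathcal H_1,\mathcal H_{2,r},\mathcal H_{2,i},\mathcal H_3$. The web $\mathcal W_L$ of a line $L$ of $\mathrm{PG}(5,q)$ consists of the forms whose hyperplanes contain $L$. $OD_4(L)=[h_1,h_{2,r},h_{2,i},h_3]$ counts the hyperplanes of each class through $L$. (1) $L\mapsto\mathcal W_L$ is a bijection from lines of $\mathrm{PG}(5,q)$ to webs, and two lines are in the same $K$-orbit if and only if their webs are projectively equivalent. $OD_4(L)$ is the list of numbers of double lines, pairs of real lines, pairs of imaginary lines and non-singular conics in $\mathcal W_L$. (2) There are exactly $15$ $K$-orbits of lines. Representatives of the lines (all points with the coordinates below, $(x,y)\neq(0,0)$, unlisted coordinates being $0$) and their webs (spans) are as follows, where any parameters satisfying the conditions may be chosen, independently in each row, without changing the orbit: - $o_5$: $y_0=x,\ y_3=y$; $\langle X_0X_1,X_0X_2,X_1X_2,X_2^2\rangle$. - $o_6$: $y_0=x,\ y_1=y$; $\langle X_0X_2,X_1^2,X_1X_2,X_2^2\rangle$. - $o_{8,1}$: $y_0=x,\ y_3=y,\ y_5=-y$; $\langle X_0X_1,X_0X_2,X_1X_2,X_1^2+X_2^2\rangle$.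 - $o_{8,2}$ ($q$ odd): $y_0=x,\ y_3=y,\ y_5=-\delta y$; $\langle X_0X_1,X_0X_2,X_1X_2,\delta X_1^2+X_2^2\rangle$. - $o_{8,3}$ ($q$ even): $y_0=x,\ y_4=y$; $\langle X_0X_1,X_0X_2,X_1^2,X_2^2\rangle$. - $o_9$: $y_0=x,\ y_2=y_3=y$; $\langle X_0X_1,X_0X_2-X_1^2,X_1X_2,X_2^2\rangle$. - $o_{10}$: $y_0=vx,\ y_1=y,\ y_3=x+uy$; $\langle v^{-1}X_0^2+uX_0X_1-X_1^2,X_0X_2,X_1X_2,X_2^2\rangle$. - $o_{12,1}$: $y_1=x,\ y_4=y$; $\langle X_0^2,X_0X_2,X_1^2,X_2^2\rangle$. - $o_{12,3}$ ($q$ even): $y_1=x,\ y_3=x+y,\ y_4=y$; $\langle X_0^2,X_0X_2,X_0X_1+X_1X_2+X_1^2,X_2^2\rangle$. - $o_{13,1}$: $y_1=x,\ y_3=y,\ y_5=-y$; $\langle X_0^2,X_0X_2,X_1^2+X_2^2,X_1X_2\rangle$. - $o_{13,2}$ ($q$ odd): $y_1=x,\ y_3=y,\ y_5=-\delta y$;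 $\langle X_0^2,X_0X_2,\delta X_1^2+X_2^2,X_1X_2\rangle$. - $o_{13,3}$ ($q$ even): $y_1=x,\ y_3=x+y,\ y_5=y$; $\langle X_0^2,X_0X_2,X_1^2+X_0X_1+X_2^2,X_1X_2\rangle$. - $o_{14,1}$: $y_0=x,\ y_3=-(x+y),\ y_5=y$; $\langle X_0X_1,X_0X_2,X_0^2+X_1^2+X_2^2,X_1X_2\rangle$. - $o_{14,2}$ ($q$ odd): $y_0=x,\ y_3=-\delta(x+y),\ y_5=y$; $\langle X_0X_1,X_0X_2,\delta X_0^2+X_1^2+\delta X_2^2,X_1X_2\rangle$. - $o_{15,1}$ ($-v$ a square) and $o_{15,2}$ ($q$ odd, $-v$ a non-square): $y_0=vy,\ y_1=x,\ y_3=ux+y,\ y_5=x$; $\langle X_0X_2,X_1X_2,X_0X_1-X_2^2,v^{-1}X_0^2+uX_0X_1-X_1^2\rangle$. - $o_{16,1}$: $y_2=y_3=x,\ y_4=y$; $\langle X_0^2,X_0X_1,X_0X_2-X_1^2,X_2^2\rangle$. - $o_{16,3}$ ($q$ even): $y_2=y_3=x,\ y_4=y_5=y$; $\langle X_0^2,X_0X_1,X_0X_2+X_1^2,X_1X_2+X_2^2\rangle$.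 - $o_{17}$: $y_0=\alpha^{-1}x,\ y_1=y,\ y_3=\beta y-\gamma x,\ y_4=x,\ y_5=y$; $\langle X_0X_2,X_0X_1-X_2^2,\alpha X_0^2-X_1X_2,\beta X_0X_1-X_1^2-\gamma X_1X_2\rangle$. Here $\delta$ is a non-square, $v\ne0$ and $v\lambda^2+uv\lambda-1\neq0$ for all $\lambda\in\mathbb F_q$, and $\lambda^3+\gamma\lambda^2-\beta\lambda+\alpha\neq0$ for all $\lambda\in\mathbb F_q$. The orbits not restricted to one parity, together with those for the parity of $q$, are nonempty, pairwise distinct, and cover all lines. (3) $OD_4$ of a line in these orbits is as follows. For all $q$: $o_5$: $[1,2q^2+q,0,q^3-q^2]$; $o_6$: $[q+1,\frac{3q^2+q}2,\frac{q^2-q}2,q^3-q^2]$; $o_9$: $[1,q^2+q,0,q^3]$; $o_{10}$: $[1,q^2+q,q^2,q^3-q^2]$; $o_{17}$: $[1,\frac{q^2+q}2,\frac{q^2-q}2,q^3+q]$. For $q$ odd: $o_{8,1}$: $[2,q^2+\frac{3q-1}2,\frac{q-1}2,q^3-q]$; $o_{8,2}$: $[0,q^2+\frac{3q+1}2,\frac{q+1}2,q^3-q]$;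 $o_{12,1}$: $[q+2,q^2+\frac{q-1}2,q^2-\frac{q+1}2,q^3-q^2]$; $o_{13,1}$: $[3,\frac{q^2+3q-2}2,\frac{q^2+q-2}2,q^3-q]$; $o_{13,2}$: $[1,\frac{q^2+3q}2,\frac{q^2+q}2,q^3-q]$; $o_{14,1}$: $[4,\frac{q^2-1}2+2q-1,\frac{q^2-1}2+q-1,q^3-2q]$; $o_{14,2}$: $[0,\frac{q^2+1}2+2q,\frac{q^2+1}2+q,q^3-2q]$; $o_{15,1}$ and $o_{16,1}$: $[2,\frac{q^2-1}2+q,\frac{q^2-1}2,q^3]$; $o_{15,2}$: $[0,\frac{q^2+1}2+q,\frac{q^2+1}2,q^3]$. For $q$ even: $o_{8,1}$: $[1,q^2+\frac32q,\frac q2,q^3-q]$; $o_{8,3}$: $[q+1,q^2+q,0,q^3-q]$; $o_{12,1}$: $[q^2+q+1,\frac{q^2+q}2,\frac{q^2-q}2,q^3-q^2]$; $o_{12,3}$: $[q+1,q^2+\frac q2,q^2-\frac q2,q^3-q^2]$; $o_{13,1}$: $[q+1,\frac{q^2}2+q,\frac{q^2}2,q^3-q]$; $o_{13,3}$: $[1,\frac{q^2+3q}2,\frac{q^2+q}2,q^3-q]$;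 $o_{14,1}$: $[1,\frac{q^2}2+2q,\frac{q^2}2+q,q^3-2q]$; $o_{15,1}$ and $o_{16,3}$: $[1,\frac{q^2}2+q,\frac{q^2}2,q^3]$; $o_{16,1}$: $[q+1,\frac{q^2+q}2,\frac{q^2-q}2,q^3]$. (4) Two webs have the same numbers of conics of the four types (equivalently, two lines have the same $OD_4$) if and only if the webs are projectively equivalent (the lines are in the same $K$-orbit), except that the following pairs of different orbits share their distribution: $\{o_{15,1},o_{16,1}\}$ for $q$ odd, $\{o_{15,1},o_{16,3}\}$ for $q$ even and, for $q=2$ only, also $\{o_{10},o_{14,1}\}$. (5) Let $\nu(u)=(u_0^2,u_0u_1,u_0u_2,u_1^2,u_1u_2,u_2^2)$. Each point $P$ of rank $2$ lies in the span of $\nu(m)$ for a unique line $m$ of $\mathrm{PG}(2,q)$; put $\mathcal C(P)=\nu(m)$. For $q$ odd, $P$ is exterior if it lies on a tangent line of $\mathcal C(P)$ (a line in the plane of $\mathcal C(P)$ meeting it in exactly one point) and interior otherwise. For $q$ odd, a line $L$ belongs to $o_{15,1}$ or $o_{16,1}$ if and only if it has exactly one exterior point of rank $2$ and $q$ points of rank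 $3$; for $q$ even, $L$ belongs to $o_{15,1}$ or $o_{16,3}$ if and only if it has exactly one point of rank $2$ outside the nucleus plane $Y_0=Y_3=Y_5=0$ and $q$ points of rank $3$. For such $L$, with $P$ its point of rank $2$, there is a unique hyperplane of $\mathcal H_1$ containing $\mathcal C(P)$; $L$ belongs to $o_{16,1}$ ($q$ odd), respectively $o_{16,3}$ ($q$ even), if and only if that hyperplane contains $L$, and to $o_{15,1}$ otherwise. -/

import Mathlib

open MvPolynomial
open scoped LinearAlgebra.Projectivization

universe u

namespace WebsOfConics

/-! ### Conics of the plane over a field, as ternary quadratic forms up to a nonzero scalar -/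

section Conics

variable {F : Type u} [Field F]

/-- Ternary forms of degree two. -/
noncomputable abbrev Forms (F : Type u) [Field F] : Submodule F (MvPolynomial (Fin 3) F) :=
  homogeneousSubmodule (Fin 3) F 2

/-- The linear form with the given coefficients. -/
noncomputable def linForm (a : Fin 3 → F) : MvPolynomial (Fin 3) F :=
  ∑ i, C (a i) * X i

/-- The coefficient of `X i * X j` in `f`. -/
noncomputable def qcoeff (f : MvPolynomial (Fin 3) F) (i j : Fin 3) : F :=
  coeff (Finsupp.single i 1 + Finsupp.single j 1) f

/-- The discriminant of a ternary quadratic form (in every characteristic). -/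
noncomputable def disc (f : MvPolynomial (Fin 3) F) : F :=
  4 * qcoeff f 0 0 * qcoeff f 1 1 * qcoeff f 2 2 + qcoeff f 0 1 * qcoeff f 0 2 * qcoeff f 1 2
    - qcoeff f 0 0 * qcoeff f 1 2 ^ 2 - qcoeff f 1 1 * qcoeff f 0 2 ^ 2
    - qcoeff f 2 2 * qcoeff f 0 1 ^ 2

def IsDoubleLine (f : MvPolynomial (Fin 3) F) : Prop :=
  ∃ (c : F) (a : Fin 3 → F), c ≠ 0 ∧ a ≠ 0 ∧ f = C c * linForm a ^ 2

/-- A pair of distinct lines, both defined over `F`. -/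
def IsRealLinePair (f : MvPolynomial (Fin 3) F) : Prop :=
  ∃ a b : Fin 3 → F, LinearIndependent F ![a, b] ∧ f = linForm a * linForm b

/-- A pair of distinct lines over a quadratic extension `E` of `F` which are conjugate under the
nontrivial automorphism of `E` over `F`. -/
def IsImaginaryLinePair (f : MvPolynomial (Fin 3) F) : Prop :=
  ∃ (E : Type u) (_ : Field E) (_ : Algebra F E) (s : E ≃ₐ[F] E),
    Module.finrank F E = 2 ∧ s ≠ AlgEquiv.refl ∧
    ∃ (c : F) (a : Fin 3 → E), c ≠ 0 ∧ LinearIndependent E ![a, fun i => s (a i)] ∧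
      map (algebraMap F E) f = C (algebraMap F E c) * linForm a * linForm (fun i => s (a i))

def IsNonsingular (f : MvPolynomial (Fin 3) F) : Prop :=
  f ∈ Forms F ∧ disc f ≠ 0

/-- A web of conics: a linear system of projective dimension three. -/
def IsWeb (W : Submodule F (MvPolynomial (Fin 3) F)) : Prop :=
  W ≤ Forms F ∧ Module.finrank F W = 4

/-- The substitution `X i ↦ ∑ j, A i j * X j` of variables. -/
noncomputable def substForm (A : Matrix (Fin 3) (Fin 3) F) :
    MvPolynomial (Fin 3) F →ₗ[F] MvPolynomial (Fin 3) F :=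
  (aeval fun i => linForm (A i)).toLinearMap

/-- Projective equivalence of linear systems of conics. -/
def ProjEquiv (W W' : Submodule F (MvPolynomial (Fin 3) F)) : Prop :=
  ∃ A : GL (Fin 3) F, W' = W.map (substForm (A : Matrix (Fin 3) (Fin 3) F))

/-- The numbers of double lines, pairs of real lines, pairs of conjugate imaginary lines and
non-singular conics in a linear system of conics. -/
noncomputable def conicDistribution (W : Submodule F (MvPolynomial (Fin 3) F)) : Fin 4 → ℕ :=
  ![{p : ℙ F (MvPolynomial (Fin 3) F) | p.submodule ≤ W ∧ IsDoubleLine p.rep}.ncard,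
    {p : ℙ F (MvPolynomial (Fin 3) F) | p.submodule ≤ W ∧ IsRealLinePair p.rep}.ncard,
    {p : ℙ F (MvPolynomial (Fin 3) F) | p.submodule ≤ W ∧ IsImaginaryLinePair p.rep}.ncard,
    {p : ℙ F (MvPolynomial (Fin 3) F) | p.submodule ≤ W ∧ IsNonsingular p.rep}.ncard]

end Conics

/-! ### The five-dimensional projective space, the group `K`, hyperplanes -/

section Space

variable {F : Type u} [Field F]

/-- The symmetric matrix of a point `(y 0, ..., y 5)`. -/
def toMat (y : Fin 6 → F) : Matrix (Fin 3) (Fin 3) F :=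
  !![y 0, y 1, y 2; y 1, y 3, y 4; y 2, y 4, y 5]

/-- The coordinates of the point with a given symmetric matrix. -/
def toVec (M : Matrix (Fin 3) (Fin 3) F) : Fin 6 → F :=
  ![M 0 0, M 0 1, M 0 2, M 1 1, M 1 2, M 2 2]

/-- The action `M ↦ A * M * Aᵀ` of a matrix `A` on the points, written as symmetric matrices. -/
def lift (A : Matrix (Fin 3) (Fin 3) F) : (Fin 6 → F) →ₗ[F] (Fin 6 → F) where
  toFun y := toVec (A * toMat y * A.transpose)
  map_add' y z := by
    have h : toMat (y + z) = toMat y + toMat z := by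
      ext i j; fin_cases i <;> fin_cases j <;> rfl
    rw [h, mul_add, add_mul]
    ext i; fin_cases i <;> rfl
  map_smul' c y := by
    have h : toMat (c • y) = c • toMat y := by
      ext i j; fin_cases i <;> fin_cases j <;> rfl
    rw [h, Matrix.mul_smul, Matrix.smul_mul]
    ext i; fin_cases i <;> rfl

/-- Lines of the five-dimensional projective space. -/
def IsLine (L : Submodule F (Fin 6 → F)) : Prop := Module.finrank F L = 2

/-- Two subspaces lie in the same `K`-orbit. -/
def KEquiv (L M : Submodule F (Fin 6 → F)) : Prop :=
  ∃ A : GL (Fin 3) F, M = L.map (lift (A : Matrix (Fin 3) (Fin 3) F))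

/-- The dual coordinates `(a00, a01, a02, a11, a12, a22)` of a quadratic form. -/
noncomputable def formCoords (f : MvPolynomial (Fin 3) F) : Fin 6 → F :=
  ![qcoeff f 0 0, qcoeff f 0 1, qcoeff f 0 2, qcoeff f 1 1, qcoeff f 1 2, qcoeff f 2 2]

/-- The hyperplane `a00 Y0 + a01 Y1 + a02 Y2 + a11 Y3 + a12 Y4 + a22 Y5 = 0` corresponding to the
conic with equation `f = 0`. -/
noncomputable def hyperplaneOf (f : MvPolynomial (Fin 3) F) : Submodule F (Fin 6 → F) where
  carrier := {y | formCoords f ⬝ᵥ y = 0}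
  add_mem' {y z} hy hz := by
    change formCoords f ⬝ᵥ y = 0 at hy
    change formCoords f ⬝ᵥ z = 0 at hz
    change formCoords f ⬝ᵥ (y + z) = 0
    rw [dotProduct_add, hy, hz, add_zero]
  zero_mem' := dotProduct_zero _
  smul_mem' c y hy := by
    change formCoords f ⬝ᵥ y = 0 at hy
    change formCoords f ⬝ᵥ (c • y) = 0
    rw [dotProduct_smul, hy, smul_zero]

/-- The linear system of the conics whose hyperplanes contain the subspace `L`. For a line `L`
this is the web of conics associated with `L`. -/
noncomputable def webOf (L : Submodule F (Fin 6 → F)) :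
    Submodule F (MvPolynomial (Fin 3) F) where
  carrier := {f | f ∈ Forms F ∧ L ≤ hyperplaneOf f}
  add_mem' {f g} hf hg := by
    refine ⟨add_mem hf.1 hg.1, fun y hy => ?_⟩
    have h1 : formCoords f ⬝ᵥ y = 0 := hf.2 hy
    have h2 : formCoords g ⬝ᵥ y = 0 := hg.2 hy
    have h3 : formCoords (f + g) = formCoords f + formCoords g := by
      ext i; fin_cases i <;> simp [formCoords, qcoeff]
    change formCoords (f + g) ⬝ᵥ y = 0
    rw [h3, add_dotProduct, h1, h2, add_zero]
  zero_mem' := by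
    refine ⟨zero_mem _, fun y _ => ?_⟩
    have h3 : formCoords (0 : MvPolynomial (Fin 3) F) = 0 := by
      ext i; fin_cases i <;> simp [formCoords, qcoeff]
    change formCoords (0 : MvPolynomial (Fin 3) F) ⬝ᵥ y = 0
    rw [h3, zero_dotProduct]
  smul_mem' c f hf := by
    refine ⟨Submodule.smul_mem _ c hf.1, fun y hy => ?_⟩
    have h1 : formCoords f ⬝ᵥ y = 0 := hf.2 hy
    have h3 : formCoords (c • f) = c • formCoords f := by
      ext i; fin_cases i <;> simp [formCoords, qcoeff]
    change formCoords (c • f) ⬝ᵥ y = 0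
    rw [h3, smul_dotProduct, h1, smul_zero]

/-- The orbit of hyperplanes corresponding to double lines. -/
def H1 (F : Type u) [Field F] : Set (Submodule F (Fin 6 → F)) :=
  {H | ∃ f, IsDoubleLine f ∧ H = hyperplaneOf f}

/-- The orbit of hyperplanes corresponding to pairs of real lines. -/
def H2r (F : Type u) [Field F] : Set (Submodule F (Fin 6 → F)) :=
  {H | ∃ f, IsRealLinePair f ∧ H = hyperplaneOf f}

/-- The orbit of hyperplanes corresponding to pairs of conjugate imaginary lines. -/
def H2i (F : Type u) [Field F] : Set (Submodule F (Fin 6 → F)) :=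
  {H | ∃ f, IsImaginaryLinePair f ∧ H = hyperplaneOf f}

/-- The orbit of hyperplanes corresponding to non-singular conics. -/
def H3 (F : Type u) [Field F] : Set (Submodule F (Fin 6 → F)) :=
  {H | ∃ f, IsNonsingular f ∧ H = hyperplaneOf f}

/-- The hyperplane-orbit distribution of a subspace. -/
noncomputable def hyperplaneOD (L : Submodule F (Fin 6 → F)) : Fin 4 → ℕ :=
  ![{H | H ∈ H1 F ∧ L ≤ H}.ncard, {H | H ∈ H2r F ∧ L ≤ H}.ncard,
    {H | H ∈ H2i F ∧ L ≤ H}.ncard, {H | H ∈ H3 F ∧ L ≤ H}.ncard]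

/-! ### Conics on the Veronese surface and the orbits of points -/

/-- The Veronese map. -/
def veronese (v : Fin 3 → F) : Fin 6 → F :=
  ![v 0 ^ 2, v 0 * v 1, v 0 * v 2, v 1 ^ 2, v 1 * v 2, v 2 ^ 2]

/-- Lines of the projective plane. -/
def IsPlaneLine (m : Submodule F (Fin 3 → F)) : Prop := Module.finrank F m = 2

/-- The conic on the Veronese surface which is the image of the line `m`. -/
def conicPoints (m : Submodule F (Fin 3 → F)) : Set (ℙ F (Fin 6 → F)) :=
  {P | ∃ v ∈ m, v ≠ 0 ∧ P.submodule = F ∙ veronese v}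

/-- The conic plane spanned by the image of the line `m`. -/
def conicPlane (m : Submodule F (Fin 3 → F)) : Submodule F (Fin 6 → F) :=
  Submodule.span F (veronese '' (m : Set (Fin 3 → F)))

/-- `T` is a tangent line of the conic that is the image of `m`: a line in the plane of the conic
which meets the conic in exactly one point. -/
def IsTangentLine (m : Submodule F (Fin 3 → F)) (T : Submodule F (Fin 6 → F)) : Prop :=
  IsLine T ∧ T ≤ conicPlane m ∧ ∃! P : ℙ F (Fin 6 → F), P ∈ conicPoints m ∧ P.submodule ≤ T

/-- The rank of a point. -/
noncomputable def ptRank (P : ℙ F (Fin 6 → F)) : ℕ := (toMat P.rep).rank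

/-- Points of rank two on a tangent line of a conic on the Veronese surface. -/
def IsExterior (P : ℙ F (Fin 6 → F)) : Prop :=
  ptRank P = 2 ∧ ∃ m T, IsPlaneLine m ∧ IsTangentLine m T ∧ P.submodule ≤ T

/-- Points of rank two on no tangent line of a conic on the Veronese surface. -/
def IsInterior (P : ℙ F (Fin 6 → F)) : Prop :=
  ptRank P = 2 ∧ ¬ ∃ m T, IsPlaneLine m ∧ IsTangentLine m T ∧ P.submodule ≤ T

/-- Points of rank two in the nucleus plane `Y0 = Y3 = Y5 = 0`. -/
def IsNuclear (P : ℙ F (Fin 6 → F)) : Prop :=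
  ptRank P = 2 ∧ P.rep 0 = 0 ∧ P.rep 3 = 0 ∧ P.rep 5 = 0

/-- Points of rank two outside the nucleus plane. -/
def IsNonNuclear (P : ℙ F (Fin 6 → F)) : Prop :=
  ptRank P = 2 ∧ ¬ (P.rep 0 = 0 ∧ P.rep 3 = 0 ∧ P.rep 5 = 0)

/-- The point-orbit distribution for odd order: the numbers of points of rank one, exterior points
of rank two, interior points of rank two, and points of rank three. -/
noncomputable def pointODOdd (L : Submodule F (Fin 6 → F)) : Fin 4 → ℕ :=
  ![{P : ℙ F (Fin 6 → F) | P.submodule ≤ L ∧ ptRank P = 1}.ncard,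
    {P : ℙ F (Fin 6 → F) | P.submodule ≤ L ∧ IsExterior P}.ncard,
    {P : ℙ F (Fin 6 → F) | P.submodule ≤ L ∧ IsInterior P}.ncard,
    {P : ℙ F (Fin 6 → F) | P.submodule ≤ L ∧ ptRank P = 3}.ncard]

/-- The point-orbit distribution for even order: the numbers of points of rank one, points of rank
two in the nucleus plane, other points of rank two, and points of rank three. -/
noncomputable def pointODEven (L : Submodule F (Fin 6 → F)) : Fin 4 → ℕ :=
  ![{P : ℙ F (Fin 6 → F) | P.submodule ≤ L ∧ ptRank P = 1}.ncard,
    {P : ℙ F (Fin 6 → F) | P.submodule ≤ L ∧ IsNuclear P}.ncard,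
    {P : ℙ F (Fin 6 → F) | P.submodule ≤ L ∧ IsNonNuclear P}.ncard,
    {P : ℙ F (Fin 6 → F) | P.submodule ≤ L ∧ ptRank P = 3}.ncard]

/-- `C(P)` is the image of `m`: the conic on the Veronese surface whose plane contains `P`. -/
def IsConicOf (P : ℙ F (Fin 6 → F)) (m : Submodule F (Fin 3 → F)) : Prop :=
  IsPlaneLine m ∧ P.submodule ≤ conicPlane m

/-- `H` is a hyperplane of the orbit `H1` containing the image of `m`. -/
def IsConicHyperplane (m : Submodule F (Fin 3 → F)) (H : Submodule F (Fin 6 → F)) : Prop :=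
  H ∈ H1 F ∧ ∀ P ∈ conicPoints m, P.submodule ≤ H

end Space

/-! ### The labels of the orbits, their representatives and the table of distributions -/

inductive Label
  | o5 | o6 | o8_1 | o8_2 | o8_3 | o9 | o10 | o12_1 | o12_3 | o13_1 | o13_2 | o13_3
  | o14_1 | o14_2 | o15_1 | o15_2 | o16_1 | o16_3 | o17

/-- The fifteen labels that occur for odd order, and the fifteen that occur for even order. -/
def Label.Occurs (q : ℕ) : Label → Prop
  | .o8_2 | .o13_2 | .o14_2 | .o15_2 => Odd q
  | .o8_3 | .o12_3 | .o13_3 | .o16_3 => Even q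
  | _ => True

section Table

variable {F : Type u} [Field F]

/-- The line of all points with matrix `M x y`, where `M` depends linearly on `(x, y)`. -/
def lineOf (M : F → F → Matrix (Fin 3) (Fin 3) F) : Submodule F (Fin 6 → F) :=
  Submodule.span F {toVec (M 1 0), toVec (M 0 1)}

/-- The linear system spanned by four quadratic forms. -/
noncomputable def systemOf (f g h k : MvPolynomial (Fin 3) F) : Submodule F (MvPolynomial (Fin 3) F) :=
  Submodule.span F {f, g, h, k}

/-- `v t ^ 2 + u v t - 1` has degree two and no root in `F`. -/
def QuadCond (a v : F) : Prop := v ≠ 0 ∧ ∀ t : F, v * t ^ 2 + a * v * t - 1 ≠ 0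

/-- `TableRow t L W`: the line `L` is a representative of the orbit with label `t`, and `W` is the
web of conics listed for it. -/
inductive TableRow :
    Label → Submodule F (Fin 6 → F) → Submodule F (MvPolynomial (Fin 3) F) → Prop
  | r5 : TableRow .o5 (lineOf fun x y => !![x, 0, 0; 0, y, 0; 0, 0, 0])
      (systemOf (X 0 * X 1) (X 0 * X 2) (X 1 * X 2) (X 2 ^ 2))
  | r6 : TableRow .o6 (lineOf fun x y => !![x, y, 0; y, 0, 0; 0, 0, 0])
      (systemOf (X 0 * X 2) (X 1 ^ 2) (X 1 * X 2) (X 2 ^ 2))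
  | r8_1 : TableRow .o8_1 (lineOf fun x y => !![x, 0, 0; 0, y, 0; 0, 0, -y])
      (systemOf (X 0 * X 1) (X 0 * X 2) (X 1 * X 2) (X 1 ^ 2 + X 2 ^ 2))
  | r8_2 (d : F) (hd : ¬ IsSquare d) :
      TableRow .o8_2 (lineOf fun x y => !![x, 0, 0; 0, y, 0; 0, 0, -d * y])
        (systemOf (X 0 * X 1) (X 0 * X 2) (X 1 * X 2) (C d * X 1 ^ 2 + X 2 ^ 2))
  | r8_3 (h2 : (2 : F) = 0) :
      TableRow .o8_3 (lineOf fun x y => !![x, 0, 0; 0, 0, y; 0, y, 0])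
        (systemOf (X 0 * X 1) (X 0 * X 2) (X 1 ^ 2) (X 2 ^ 2))
  | r9 : TableRow .o9 (lineOf fun x y => !![x, 0, y; 0, y, 0; y, 0, 0])
      (systemOf (X 0 * X 1) (X 0 * X 2 - X 1 ^ 2) (X 1 * X 2) (X 2 ^ 2))
  | r10 (a v : F) (hv : QuadCond a v) :
      TableRow .o10 (lineOf fun x y => !![v * x, y, 0; y, x + a * y, 0; 0, 0, 0])
        (systemOf (C v⁻¹ * X 0 ^ 2 + C a * X 0 * X 1 - X 1 ^ 2)
          (X 0 * X 2) (X 1 * X 2) (X 2 ^ 2))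
  | r12_1 : TableRow .o12_1 (lineOf fun x y => !![0, x, 0; x, 0, y; 0, y, 0])
      (systemOf (X 0 ^ 2) (X 0 * X 2) (X 1 ^ 2) (X 2 ^ 2))
  | r12_3 (h2 : (2 : F) = 0) :
      TableRow .o12_3 (lineOf fun x y => !![0, x, 0; x, x + y, y; 0, y, 0])
        (systemOf (X 0 ^ 2) (X 0 * X 2) (X 0 * X 1 + X 1 * X 2 + X 1 ^ 2) (X 2 ^ 2))
  | r13_1 : TableRow .o13_1 (lineOf fun x y => !![0, x, 0; x, y, 0; 0, 0, -y])
      (systemOf (X 0 ^ 2) (X 0 * X 2) (X 1 ^ 2 + X 2 ^ 2) (X 1 * X 2))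
  | r13_2 (d : F) (hd : ¬ IsSquare d) :
      TableRow .o13_2 (lineOf fun x y => !![0, x, 0; x, y, 0; 0, 0, -d * y])
        (systemOf (X 0 ^ 2) (X 0 * X 2) (C d * X 1 ^ 2 + X 2 ^ 2) (X 1 * X 2))
  | r13_3 (h2 : (2 : F) = 0) :
      TableRow .o13_3 (lineOf fun x y => !![0, x, 0; x, x + y, 0; 0, 0, y])
        (systemOf (X 0 ^ 2) (X 0 * X 2) (X 1 ^ 2 + X 0 * X 1 + X 2 ^ 2) (X 1 * X 2))
  | r14_1 : TableRow .o14_1 (lineOf fun x y => !![x, 0, 0; 0, -(x + y), 0; 0, 0, y])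
      (systemOf (X 0 * X 1) (X 0 * X 2) (X 0 ^ 2 + X 1 ^ 2 + X 2 ^ 2) (X 1 * X 2))
  | r14_2 (d : F) (hd : ¬ IsSquare d) :
      TableRow .o14_2 (lineOf fun x y => !![x, 0, 0; 0, -d * (x + y), 0; 0, 0, y])
        (systemOf (X 0 * X 1) (X 0 * X 2) (C d * X 0 ^ 2 + X 1 ^ 2 + C d * X 2 ^ 2) (X 1 * X 2))
  | r15_1 (a v : F) (hv : QuadCond a v) (hs : IsSquare (-v)) :
      TableRow .o15_1 (lineOf fun x y => !![v * y, x, 0; x, a * x + y, 0; 0, 0, x])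
        (systemOf (X 0 * X 2) (X 1 * X 2) (X 0 * X 1 - X 2 ^ 2)
          (C v⁻¹ * X 0 ^ 2 + C a * X 0 * X 1 - X 1 ^ 2))
  | r15_2 (a v : F) (hv : QuadCond a v) (hs : ¬ IsSquare (-v)) :
      TableRow .o15_2 (lineOf fun x y => !![v * y, x, 0; x, a * x + y, 0; 0, 0, x])
        (systemOf (X 0 * X 2) (X 1 * X 2) (X 0 * X 1 - X 2 ^ 2)
          (C v⁻¹ * X 0 ^ 2 + C a * X 0 * X 1 - X 1 ^ 2))
  | r16_1 : TableRow .o16_1 (lineOf fun x y => !![0, 0, x; 0, x, y; x, y, 0])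
      (systemOf (X 0 ^ 2) (X 0 * X 1) (X 0 * X 2 - X 1 ^ 2) (X 2 ^ 2))
  | r16_3 (h2 : (2 : F) = 0) :
      TableRow .o16_3 (lineOf fun x y => !![0, 0, x; 0, x, y; x, y, y])
        (systemOf (X 0 ^ 2) (X 0 * X 1) (X 0 * X 2 + X 1 ^ 2) (X 1 * X 2 + X 2 ^ 2))
  | r17 (a b c : F) (h : ∀ t : F, t ^ 3 + c * t ^ 2 - b * t + a ≠ 0) :
      TableRow .o17 (lineOf fun x y => !![a⁻¹ * x, y, 0; y, b * y - c * x, x; 0, x, y])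
        (systemOf (X 0 * X 2) (X 0 * X 1 - X 2 ^ 2) (C a * X 0 ^ 2 - X 1 * X 2)
          (C b * X 0 * X 1 - X 1 ^ 2 - C c * X 1 * X 2))

/-- The line `L` lies in the `K`-orbit of a representative with label `t`. -/
def HasType (t : Label) (L : Submodule F (Fin 6 → F)) : Prop :=
  ∃ L₀ W₀, TableRow t L₀ W₀ ∧ KEquiv L₀ L

end Table

/-- The hyperplane-orbit distributions for odd order `q`
(meaningful for the labels that occur). -/
def tableOdd (q : ℚ) : Label → Fin 4 → ℚ
  | .o5 => ![1, 2 * q ^ 2 + q, 0, q ^ 3 - q ^ 2]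
  | .o6 => ![q + 1, (3 * q ^ 2 + q) / 2, (q ^ 2 - q) / 2, q ^ 3 - q ^ 2]
  | .o8_1 => ![2, q ^ 2 + (3 * q - 1) / 2, (q - 1) / 2, q ^ 3 - q]
  | .o8_2 => ![0, q ^ 2 + (3 * q + 1) / 2, (q + 1) / 2, q ^ 3 - q]
  | .o9 => ![1, q ^ 2 + q, 0, q ^ 3]
  | .o10 => ![1, q ^ 2 + q, q ^ 2, q ^ 3 - q ^ 2]
  | .o12_1 => ![q + 2, q ^ 2 + (q - 1) / 2, q ^ 2 - (q + 1) / 2, q ^ 3 - q ^ 2]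
  | .o13_1 => ![3, (q ^ 2 + 3 * q - 2) / 2, (q ^ 2 + q - 2) / 2, q ^ 3 - q]
  | .o13_2 => ![1, (q ^ 2 + 3 * q) / 2, (q ^ 2 + q) / 2, q ^ 3 - q]
  | .o14_1 => ![4, (q ^ 2 - 1) / 2 + 2 * q - 1, (q ^ 2 - 1) / 2 + q - 1, q ^ 3 - 2 * q]
  | .o14_2 => ![0, (q ^ 2 + 1) / 2 + 2 * q, (q ^ 2 + 1) / 2 + q, q ^ 3 - 2 * q]
  | .o15_1 => ![2, (q ^ 2 - 1) / 2 + q, (q ^ 2 - 1) / 2, q ^ 3]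
  | .o15_2 => ![0, (q ^ 2 + 1) / 2 + q, (q ^ 2 + 1) / 2, q ^ 3]
  | .o16_1 => ![2, (q ^ 2 - 1) / 2 + q, (q ^ 2 - 1) / 2, q ^ 3]
  | .o17 => ![1, (q ^ 2 + q) / 2, (q ^ 2 - q) / 2, q ^ 3 + q]
  | .o8_3 | .o12_3 | .o13_3 | .o16_3 => 0

/-- The hyperplane-orbit distributions for even order `q`
(meaningful for the labels that occur). -/
def tableEven (q : ℚ) : Label → Fin 4 → ℚ
  | .o5 => ![1, 2 * q ^ 2 + q, 0, q ^ 3 - q ^ 2]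
  | .o6 => ![q + 1, (3 * q ^ 2 + q) / 2, (q ^ 2 - q) / 2, q ^ 3 - q ^ 2]
  | .o8_1 => ![1, q ^ 2 + 3 / 2 * q, q / 2, q ^ 3 - q]
  | .o8_3 => ![q + 1, q ^ 2 + q, 0, q ^ 3 - q]
  | .o9 => ![1, q ^ 2 + q, 0, q ^ 3]
  | .o10 => ![1, q ^ 2 + q, q ^ 2, q ^ 3 - q ^ 2]
  | .o12_1 => ![q ^ 2 + q + 1, (q ^ 2 + q) / 2, (q ^ 2 - q) / 2, q ^ 3 - q ^ 2]
  | .o12_3 => ![q + 1, q ^ 2 + q / 2, q ^ 2 - q / 2, q ^ 3 - q ^ 2]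
  | .o13_1 => ![q + 1, q ^ 2 / 2 + q, q ^ 2 / 2, q ^ 3 - q]
  | .o13_3 => ![1, (q ^ 2 + 3 * q) / 2, (q ^ 2 + q) / 2, q ^ 3 - q]
  | .o14_1 => ![1, q ^ 2 / 2 + 2 * q, q ^ 2 / 2 + q, q ^ 3 - 2 * q]
  | .o15_1 => ![1, q ^ 2 / 2 + q, q ^ 2 / 2, q ^ 3]
  | .o16_1 => ![q + 1, (q ^ 2 + q) / 2, (q ^ 2 - q) / 2, q ^ 3]
  | .o16_3 => ![1, q ^ 2 / 2 + q, q ^ 2 / 2, q ^ 3]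
  | .o17 => ![1, (q ^ 2 + q) / 2, (q ^ 2 - q) / 2, q ^ 3 + q]
  | .o8_2 | .o13_2 | .o14_2 | .o15_2 => 0

/-- The pairs of distinct labels with equal hyperplane-orbit distributions. -/
def Exceptional (q : ℕ) (t s : Label) : Prop :=
  (Odd q ∧ s(t, s) = s(Label.o15_1, Label.o16_1)) ∨
  (Even q ∧ s(t, s) = s(Label.o15_1, Label.o16_3)) ∨
  (q = 2 ∧ s(t, s) = s(Label.o10, Label.o14_1))

/-- The geometric criterion for a line `L` with a unique point `P` of rank two (of the type
described by `T`): the conic `C(P)` and the hyperplane of the orbit `H1` through `C(P)` are unique;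
if that hyperplane contains `L`, then `L` has label `s`, and otherwise it has label `t`. -/
def ConicCriterion {F : Type u} [Field F] (T : ℙ F (Fin 6 → F) → Prop) (t s : Label)
    (L : Submodule F (Fin 6 → F)) : Prop :=
  ∃ P m H, {P : ℙ F (Fin 6 → F) | P.submodule ≤ L ∧ T P} = {P} ∧
    {m | IsConicOf P m} = {m} ∧ {H | IsConicHyperplane m H} = {H} ∧
    (HasType s L ↔ L ≤ H) ∧ (HasType t L ↔ ¬ L ≤ H)

end WebsOfConics

open WebsOfConics

/-!
Symmetric `3 × 3` matrices are dual to ternary quadratic forms, and under this duality the web of a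
line `L` is the orthogonal complement `ann L` in coordinates (`formOf_mem_webOf`). Substitution in
forms is adjoint to congruence of matrices (`formCoords_substForm_dotProduct`), which gives the
correspondence between lines and webs and between the two notions of equivalence.

*Distributions.* A nonzero form `c` is of exactly one of the four kinds, and its kind is visible in
the numbers of its zeros, of its singular vectors and of the linear forms dividing it
(`kinds_weights`). These three numbers count the nonzero vectors for which `c` annihilates a point
of the Veronese surface, a tangent space of that surface, or the space of all matrices with a given
kernel vector. Since the dimension of `ann L ⊓ ann S` is determined by that of `L ⊓ S`, double
counting (`sumNonzero_ann`) turns the sum of such a number over the web into a sum over the points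
of the line; for the zeros and the linear factors, the latter depends on the ranks of these points
only, and this gives two relations besides the total number of conics. The number of double lines
is the number of points of the plane isotropic for all matrices of `L`. Thus the distribution and
the profile of `L`, which consists of its numbers of points of rank one and of rank at most two and
of its number of double lines, determine each other (`conicDistribution_of_profile`,
`profile_eq_of_conicDistribution_eq`). The profiles of the representatives are computed directly,
and the tables follow. Lines with different profiles are inequivalent; the remaining pairs are
separated by two further invariants, an isotropic kernel vector of a singular point for the label
`o15_1` on the one hand and `o16_1` or `o16_3` on the other, and a common kernel vector of all
matrices for `o10` and `o14_1` if `q = 2`.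

*Classification.* A line with a point of rank one is reduced by the congruence normal forms of
binary quadratic forms (`exists_hasType_of_rank_one`). If there is a singular point of rank two, its
kernel vector is made the first basis vector, and the cases in which it is isotropic for the whole
line or not are treated separately (`exists_hasType_isotropic`, `exists_hasType_not_isotropic`). If
all points have rank three, then the sum over the singular vectors shows that there is exactly one
double line in the web, that is, one vector isotropic for `L`; with it as first basis vector the
determinant on the line becomes a binary cubic form without zeros, which determines the line. Two
such cubic forms are equivalent because their zeros lie in the same cubic extension, where the zero
of one is a fractional linear function of the zero of the other (`exists_substitution`). That the
other representatives do not depend on their parameters rests on the fact that irreducible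
quadratic polynomials over a finite field form one class under affine substitutions, by means of
the discriminant for odd order and of the Artin-Schreier invariant for even order; for `o15_2`
the similarities of an anisotropic binary form are needed as well (`kEquiv_o15_anisotropic`).

*Points of rank two.* The conic of such a point is the image of the line dual to the kernel vector
`a` of its matrix, its plane is the space of all matrices with kernel vector `a`, and the only
hyperplane of a double line containing it is that of the square of the linear form `a`. It contains
`L` exactly if `a` is isotropic for `L`, which is the invariant separating the two orbits. A point
of rank two is exterior exactly if it lies in a tangent space of the Veronese surface; on a line
with a single singular point, of rank two, this is equivalent to the existence of a double line in
the web (`isoCount_ne_zero_iff`).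
-/

namespace WebsOfConics

variable {F : Type u} [Field F]

/-! ### Symmetric matrices, the congruence action and the associated bilinear forms -/

theorem toVec_toMat {R : Type u} (y : Fin 6 → R) : toVec (toMat y) = y := by
  ext i; fin_cases i <;> rfl

theorem toMat_toVec {R : Type u} {M : Matrix (Fin 3) (Fin 3) R} (h : M.transpose = M) :
    toMat (toVec M) = M := by
  have h' : ∀ i j, M i j = M j i := fun i j => by rw [← Matrix.transpose_apply M, h]
  ext i j
  fin_cases i <;> fin_cases j <;> simp [toMat, toVec] <;> exact h' _ _

theorem toMat_transpose {R : Type u} (y : Fin 6 → R) : (toMat y).transpose = toMat y := by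
  ext i j; fin_cases i <;> fin_cases j <;> rfl

theorem lift_apply (A : Matrix (Fin 3) (Fin 3) F) (y : Fin 6 → F) :
    lift A y = toVec (A * toMat y * A.transpose) := rfl

theorem toMat_lift (A : Matrix (Fin 3) (Fin 3) F) (y : Fin 6 → F) :
    toMat (lift A y) = A * toMat y * A.transpose := by
  rw [lift_apply, toMat_toVec]
  simp [Matrix.transpose_mul, toMat_transpose, Matrix.mul_assoc]

theorem lift_mul (A B : Matrix (Fin 3) (Fin 3) F) : lift (A * B) = lift A ∘ₗ lift B := by
  refine LinearMap.ext fun y => ?_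
  rw [LinearMap.comp_apply, lift_apply A, toMat_lift, lift_apply (A * B)]
  simp only [Matrix.transpose_mul, Matrix.mul_assoc]

theorem lift_one : lift (1 : Matrix (Fin 3) (Fin 3) F) = LinearMap.id := by
  refine LinearMap.ext fun y => ?_
  simp [lift_apply, toVec_toMat]

theorem lift_inv_lift (A : GL (Fin 3) F) (y : Fin 6 → F) :
    lift (A⁻¹ : GL (Fin 3) F).1 (lift A.1 y) = y := by
  rw [← LinearMap.comp_apply, ← lift_mul, ← Units.val_mul, inv_mul_cancel, Units.val_one, lift_one]
  rfl

theorem lift_lift_inv (A : GL (Fin 3) F) (y : Fin 6 → F) :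
    lift A.1 (lift (A⁻¹ : GL (Fin 3) F).1 y) = y := by
  rw [← LinearMap.comp_apply, ← lift_mul, ← Units.val_mul, mul_inv_cancel, Units.val_one, lift_one]
  rfl

theorem lift_injective (A : GL (Fin 3) F) : Function.Injective (lift A.1) :=
  Function.LeftInverse.injective (lift_inv_lift A)

theorem KEquiv.refl (L : Submodule F (Fin 6 → F)) : KEquiv L L :=
  ⟨1, by rw [Units.val_one, lift_one, Submodule.map_id]⟩

theorem KEquiv.symm {L M : Submodule F (Fin 6 → F)} (h : KEquiv L M) : KEquiv M L := by
  obtain ⟨A, rfl⟩ := h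
  refine ⟨A⁻¹, ?_⟩
  rw [← Submodule.map_comp, ← lift_mul, ← Units.val_mul, inv_mul_cancel, Units.val_one, lift_one,
    Submodule.map_id]

theorem KEquiv.trans {L M N : Submodule F (Fin 6 → F)} (h : KEquiv L M) (h' : KEquiv M N) :
    KEquiv L N := by
  obtain ⟨A, rfl⟩ := h
  obtain ⟨B, rfl⟩ := h'
  exact ⟨B * A, by rw [Units.val_mul, lift_mul, Submodule.map_comp]⟩

/-- The value at `(a, b)` of the symmetric bilinear form whose matrix is the point `y`. -/
def bil (y : Fin 6 → F) (a b : Fin 3 → F) : F := a ⬝ᵥ (toMat y).mulVec b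

theorem bil_eq (y : Fin 6 → F) (a b : Fin 3 → F) :
    bil y a b = y 0 * (a 0 * b 0) + y 1 * (a 0 * b 1 + a 1 * b 0) + y 2 * (a 0 * b 2 + a 2 * b 0)
      + y 3 * (a 1 * b 1) + y 4 * (a 1 * b 2 + a 2 * b 1) + y 5 * (a 2 * b 2) := by
  simp [bil, toMat, dotProduct, Matrix.mulVec, Fin.sum_univ_three]
  ring

theorem bil_comm (y : Fin 6 → F) (a b : Fin 3 → F) : bil y a b = bil y b a := by
  rw [bil_eq, bil_eq]; ring

theorem bil_add (y z : Fin 6 → F) (a b : Fin 3 → F) : bil (y + z) a b = bil y a b + bil z a b := by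
  simp only [bil_eq, Pi.add_apply]; ring

theorem bil_smul (c : F) (y : Fin 6 → F) (a b : Fin 3 → F) : bil (c • y) a b = c * bil y a b := by
  simp only [bil_eq, Pi.smul_apply, smul_eq_mul]; ring

theorem bil_lift (A : Matrix (Fin 3) (Fin 3) F) (y : Fin 6 → F) (a b : Fin 3 → F) :
    bil (lift A y) a b = bil y (A.transpose.mulVec a) (A.transpose.mulVec b) := by
  rw [bil, bil, toMat_lift, ← Matrix.mulVec_mulVec, ← Matrix.mulVec_mulVec, Matrix.dotProduct_mulVec,
    Matrix.mulVec_transpose A a]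

theorem bil_veronese (v a b : Fin 3 → F) : bil (veronese v) a b = (a ⬝ᵥ v) * (b ⬝ᵥ v) := by
  rw [bil_eq]; simp [veronese, dotProduct, Fin.sum_univ_three]; ring

theorem lift_veronese (A : Matrix (Fin 3) (Fin 3) F) (v : Fin 3 → F) :
    lift A (veronese v) = veronese (A.mulVec v) := by
  ext i
  fin_cases i <;>
    simp [lift_apply, toVec, toMat, veronese, Matrix.mul_apply, Matrix.mulVec, dotProduct,
      Fin.sum_univ_three] <;> ring

/-! ### Quadratic forms and their coordinates -/

/-- The quadratic form with the given coordinates `(a00, a01, a02, a11, a12, a22)`. -/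
noncomputable def formOf (c : Fin 6 → F) : MvPolynomial (Fin 3) F :=
  C (c 0) * X 0 ^ 2 + C (c 1) * X 0 * X 1 + C (c 2) * X 0 * X 2 + C (c 3) * X 1 ^ 2
    + C (c 4) * X 1 * X 2 + C (c 5) * X 2 ^ 2

/-- The coordinates of the product of the linear forms with coefficients `a` and `b`. -/
def prodCoords (a b : Fin 3 → F) : Fin 6 → F :=
  ![a 0 * b 0, a 0 * b 1 + a 1 * b 0, a 0 * b 2 + a 2 * b 0, a 1 * b 1, a 1 * b 2 + a 2 * b 1,
    a 2 * b 2]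

theorem linForm_mul_linForm (a b : Fin 3 → F) :
    linForm a * linForm b = formOf (prodCoords a b) := by
  simp only [linForm, Fin.sum_univ_three, formOf, prodCoords, Matrix.cons_val, map_add, map_mul]
  ring

theorem prodCoords_dotProduct (a b : Fin 3 → F) (y : Fin 6 → F) :
    prodCoords a b ⬝ᵥ y = bil y a b := by
  rw [bil_eq]
  simp [prodCoords, dotProduct, Fin.sum_univ_six]
  ring

theorem formOf_add (c d : Fin 6 → F) : formOf (c + d) = formOf c + formOf d := by
  simp only [formOf, Pi.add_apply, map_add]; ring

theorem formOf_smul (k : F) (c : Fin 6 → F) : formOf (k • c) = k • formOf c := by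
  simp only [formOf, Pi.smul_apply, smul_eq_mul, map_mul, MvPolynomial.smul_eq_C_mul]; ring

theorem formOf_zero : formOf (0 : Fin 6 → F) = 0 := by simp [formOf]

theorem formCoords_add (f g : MvPolynomial (Fin 3) F) :
    formCoords (f + g) = formCoords f + formCoords g := by
  ext i; fin_cases i <;> simp [formCoords, qcoeff]

theorem formCoords_smul (k : F) (f : MvPolynomial (Fin 3) F) :
    formCoords (k • f) = k • formCoords f := by
  ext i; fin_cases i <;> simp [formCoords, qcoeff]

theorem qcoeff_C_mul_X_mul_X (k : F) (a b i j : Fin 3) :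
    qcoeff (C k * X a * X b) i j =
      if (Finsupp.single a 1 + Finsupp.single b 1 : Fin 3 →₀ ℕ)
        = Finsupp.single i 1 + Finsupp.single j 1 then k else 0 := by
  have : (C k * X a * X b : MvPolynomial (Fin 3) F)
      = monomial (Finsupp.single a 1 + Finsupp.single b 1) k := by
    rw [X, X, mul_assoc, monomial_mul, C_mul_monomial]; simp
  rw [qcoeff, this, coeff_monomial]

theorem formCoords_formOf (c : Fin 6 → F) : formCoords (formOf c) = c := by
  have key : ∀ a b i j : Fin 3,
      (Finsupp.single a 1 + Finsupp.single b 1 : Fin 3 →₀ ℕ)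
        = Finsupp.single i 1 + Finsupp.single j 1 ↔ (a = i ∧ b = j) ∨ (a = j ∧ b = i) := by
    intro a b i j
    simp only [Finsupp.ext_iff, Finsupp.add_apply, Finsupp.single_apply, Fin.forall_fin_succ]
    revert a b i j
    decide
  have hadd : ∀ (f g : MvPolynomial (Fin 3) F) i j, qcoeff (f + g) i j = qcoeff f i j + qcoeff g i j :=
    fun f g i j => by simp [qcoeff]
  ext i
  fin_cases i <;>
    simp only [formCoords, formOf, pow_two, ← mul_assoc, hadd, qcoeff_C_mul_X_mul_X, key] <;>
    simp

theorem formOf_mem (c : Fin 6 → F) : formOf c ∈ Forms F := by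
  have h : ∀ (k : F) (a b : Fin 3), C k * X a * X b ∈ Forms F := fun k a b => by
    rw [mem_homogeneousSubmodule]
    exact ((isHomogeneous_C _ k).mul (isHomogeneous_X F a)).mul (isHomogeneous_X F b)
  simp only [formOf, pow_two, ← mul_assoc]
  exact add_mem (add_mem (add_mem (add_mem (add_mem (h _ _ _) (h _ _ _)) (h _ _ _)) (h _ _ _))
    (h _ _ _)) (h _ _ _)

theorem eq_zero_of_formCoords_eq_zero {f : MvPolynomial (Fin 3) F} (hf : f ∈ Forms F)
    (h : formCoords f = 0) : f = 0 := by
  ext d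
  rw [coeff_zero]
  by_contra hd
  have hdeg : d.degree = 2 := by
    by_contra hne
    exact hd (((mem_homogeneousSubmodule 2 f).1 hf).coeff_eq_zero hne)
  have hsum : d 0 + d 1 + d 2 = 2 := by
    have := Finsupp.degree_eq_sum d
    rw [hdeg, Fin.sum_univ_three] at this
    exact this.symm
  have hq : ∀ i j : Fin 3, i ≤ j → qcoeff f i j = 0 := by
    have h0 := fun i => congrFun h i
    intro i j hij
    have e0 := h0 0; have e1 := h0 1; have e2 := h0 2
    have e3 := h0 3; have e4 := h0 4; have e5 := h0 5
    simp [formCoords] at e0 e1 e2 e3 e4 e5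
    fin_cases i <;> fin_cases j <;> simp at hij ⊢ <;> assumption
  have hex : ∃ i j : Fin 3, i ≤ j ∧ d = Finsupp.single i 1 + Finsupp.single j 1 := by
    have key : ∀ i j : Fin 3, d = Finsupp.single i 1 + Finsupp.single j 1 ↔
        ∀ k, d k = (if i = k then 1 else 0) + (if j = k then 1 else 0) := by
      intro i j
      simp [Finsupp.ext_iff, Finsupp.single_apply]
    simp only [key, Fin.forall_fin_succ, Fin.exists_fin_succ]
    simp
    have h0 : d 0 ≤ 2 := by omega
    have h1 : d 1 ≤ 2 := by omega
    omega
  obtain ⟨i, j, hij, rfl⟩ := hex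
  exact hd (hq i j hij)

theorem formOf_formCoords {f : MvPolynomial (Fin 3) F} (hf : f ∈ Forms F) :
    formOf (formCoords f) = f := by
  rw [← sub_eq_zero]
  apply eq_zero_of_formCoords_eq_zero (sub_mem (formOf_mem _) hf)
  rw [sub_eq_add_neg, ← neg_one_smul F f, formCoords_add, formCoords_smul, formCoords_formOf]
  simp

theorem formOf_injective : Function.Injective (formOf (F := F)) :=
  Function.LeftInverse.injective formCoords_formOf

/-- `formOf` as a linear map. -/
noncomputable def formOfLinear (F : Type u) [Field F] :
    (Fin 6 → F) →ₗ[F] MvPolynomial (Fin 3) F where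
  toFun := formOf
  map_add' := formOf_add
  map_smul' := formOf_smul

theorem substForm_formOf (A : Matrix (Fin 3) (Fin 3) F) (c : Fin 6 → F) :
    substForm A (formOf c) = formOf (∑ k, c k • (![prodCoords (A 0) (A 0), prodCoords (A 0) (A 1),
      prodCoords (A 0) (A 2), prodCoords (A 1) (A 1), prodCoords (A 1) (A 2),
      prodCoords (A 2) (A 2)] : Fin 6 → Fin 6 → F) k) := by
  simp only [Fin.sum_univ_six, formOf_add, formOf_smul, Matrix.cons_val, ← linForm_mul_linForm,
    MvPolynomial.smul_eq_C_mul]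
  simp [substForm, formOf, MvPolynomial.algebraMap_eq]
  ring

theorem substForm_mem (A : Matrix (Fin 3) (Fin 3) F) {f : MvPolynomial (Fin 3) F}
    (hf : f ∈ Forms F) : substForm A f ∈ Forms F := by
  rw [← formOf_formCoords hf, substForm_formOf]; exact formOf_mem _

/-- Substitution in forms is adjoint to the action on points. -/
theorem formCoords_substForm_dotProduct (A : Matrix (Fin 3) (Fin 3) F)
    {f : MvPolynomial (Fin 3) F} (hf : f ∈ Forms F) (y : Fin 6 → F) :
    formCoords (substForm A f) ⬝ᵥ y = formCoords f ⬝ᵥ lift A y := by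
  have h : ∀ i j, (A * toMat y * A.transpose) i j = bil y (A i) (A j) := by
    intro i j
    simp only [Matrix.mul_apply, Matrix.transpose_apply, toMat, Fin.sum_univ_three, bil_eq]
    simp
    ring
  conv_lhs => rw [← formOf_formCoords hf]
  rw [substForm_formOf, formCoords_formOf, sum_dotProduct]
  simp only [smul_dotProduct, Fin.sum_univ_six, Matrix.cons_val, prodCoords_dotProduct, ← h]
  simp [lift_apply, toVec, dotProduct, Fin.sum_univ_six]

theorem substForm_mul (A B : Matrix (Fin 3) (Fin 3) F) (f : MvPolynomial (Fin 3) F) :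
    substForm (A * B) f = substForm B (substForm A f) := by
  have h : (aeval fun i => linForm ((A * B) i)) =
      (aeval fun i => linForm (B i)).comp (aeval fun i => linForm (A i) :
        MvPolynomial (Fin 3) F →ₐ[F] MvPolynomial (Fin 3) F) := by
    ext1 i
    simp [linForm, Matrix.mul_apply, Fin.sum_univ_three, MvPolynomial.algebraMap_eq]
    ring
  simp only [substForm, AlgHom.toLinearMap_apply, h, AlgHom.comp_apply]

theorem substForm_one (f : MvPolynomial (Fin 3) F) : substForm 1 f = f := by
  have h : (aeval fun i => linForm ((1 : Matrix (Fin 3) (Fin 3) F) i)) = AlgHom.id F _ := by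
    ext1 i
    fin_cases i <;> simp [linForm, Matrix.one_apply]
  simp only [substForm, AlgHom.toLinearMap_apply, h, AlgHom.id_apply]

theorem substForm_inv_substForm (A : GL (Fin 3) F) (f : MvPolynomial (Fin 3) F) :
    substForm (A⁻¹ : GL (Fin 3) F).1 (substForm A.1 f) = f := by
  rw [← substForm_mul, ← Units.val_mul, mul_inv_cancel, Units.val_one, substForm_one]

/-! ### Orthogonal complements, and the correspondence between lines and webs -/

/-- The orthogonal complement of a subspace for the standard dot product. -/
def ann {n : ℕ} (L : Submodule F (Fin n → F)) : Submodule F (Fin n → F) :=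
  LinearMap.BilinForm.orthogonal (dotProductBilin F F) L

theorem mem_ann {n : ℕ} {L : Submodule F (Fin n → F)} {c : Fin n → F} :
    c ∈ ann L ↔ ∀ y ∈ L, c ⬝ᵥ y = 0 := by
  simp only [ann, LinearMap.BilinForm.mem_orthogonal_iff, dotProductBilin_apply_apply]
  exact forall₂_congr fun y _ => by rw [dotProduct_comm]

theorem dotProductBilin_nondegenerate (n : ℕ) :
    LinearMap.BilinForm.Nondegenerate (dotProductBilin F F : LinearMap.BilinForm F (Fin n → F)) := by
  constructor
  · intro x hx
    refine dotProduct_eq_zero x fun w => hx w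
  · intro x hx
    refine dotProduct_eq_zero x fun w => ?_
    rw [dotProduct_comm]; exact hx w

theorem finrank_ann {n : ℕ} (L : Submodule F (Fin n → F)) :
    Module.finrank F (ann L) = n - Module.finrank F L := by
  rw [ann, LinearMap.BilinForm.finrank_orthogonal (dotProductBilin_nondegenerate n),
    Module.finrank_fin_fun]

theorem ann_ann {n : ℕ} (L : Submodule F (Fin n → F)) : ann (ann L) = L :=
  LinearMap.BilinForm.orthogonal_orthogonal (dotProductBilin_nondegenerate n)
    (fun x y h => by
      rw [dotProductBilin_apply_apply] at *
      rw [dotProduct_comm]; exact h) L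

theorem ann_sup {n : ℕ} (L M : Submodule F (Fin n → F)) : ann (L ⊔ M) = ann L ⊓ ann M := by
  ext c
  simp only [Submodule.mem_inf, mem_ann]
  constructor
  · exact fun h => ⟨fun y hy => h y (Submodule.mem_sup_left hy),
      fun y hy => h y (Submodule.mem_sup_right hy)⟩
  · rintro ⟨h1, h2⟩ y hy
    obtain ⟨a, ha, b, hb, rfl⟩ := Submodule.mem_sup.1 hy
    rw [dotProduct_add, h1 a ha, h2 b hb, add_zero]

theorem mem_hyperplaneOf {f : MvPolynomial (Fin 3) F} {y : Fin 6 → F} :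
    y ∈ hyperplaneOf f ↔ formCoords f ⬝ᵥ y = 0 := Iff.rfl

theorem mem_webOf {L : Submodule F (Fin 6 → F)} {f : MvPolynomial (Fin 3) F} :
    f ∈ webOf L ↔ f ∈ Forms F ∧ ∀ y ∈ L, formCoords f ⬝ᵥ y = 0 := Iff.rfl

/-- In coordinates, the web of `L` is the orthogonal complement of `L`. -/
theorem formOf_mem_webOf {L : Submodule F (Fin 6 → F)} {c : Fin 6 → F} :
    formOf c ∈ webOf L ↔ c ∈ ann L := by
  rw [mem_webOf, formCoords_formOf, mem_ann]
  exact and_iff_right (formOf_mem c)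

theorem webOf_eq_map (L : Submodule F (Fin 6 → F)) : webOf L = (ann L).map (formOfLinear F) := by
  ext f
  constructor
  · intro hf
    refine ⟨formCoords f, ?_, formOf_formCoords hf.1⟩
    rw [SetLike.mem_coe, ← formOf_mem_webOf, formOf_formCoords hf.1]; exact hf
  · rintro ⟨c, hc, rfl⟩
    exact formOf_mem_webOf.2 hc

theorem finrank_webOf (L : Submodule F (Fin 6 → F)) :
    Module.finrank F (webOf L) = 6 - Module.finrank F L := by
  rw [webOf_eq_map, ← finrank_ann]
  exact (Submodule.equivMapOfInjective (formOfLinear F) formOf_injective _).finrank_eq.symm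

theorem isWeb_webOf {L : Submodule F (Fin 6 → F)} (hL : IsLine L) : IsWeb (webOf L) :=
  ⟨fun _ hf => hf.1, by rw [finrank_webOf, hL]⟩

theorem webOf_injective : Function.Injective (webOf (F := F)) := by
  intro L M h
  rw [← ann_ann L, ← ann_ann M]
  congr 1
  ext c
  rw [← formOf_mem_webOf, h, formOf_mem_webOf]

theorem existsUnique_line_of_isWeb {W : Submodule F (MvPolynomial (Fin 3) F)} (hW : IsWeb W) :
    ∃! L, IsLine L ∧ webOf L = W := by
  set D := W.comap (formOfLinear F) with hD
  have hmap : D.map (formOfLinear F) = W := by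
    rw [hD, Submodule.map_comap_eq_of_le]
    exact fun f hf => ⟨formCoords f, formOf_formCoords (hW.1 hf)⟩
  have hfin : Module.finrank F D = 4 := by
    rw [(Submodule.equivMapOfInjective (formOfLinear F) formOf_injective D).finrank_eq, hmap, hW.2]
  refine ⟨ann D, ⟨?_, ?_⟩, fun M hM => webOf_injective ?_⟩
  · rw [IsLine, finrank_ann, hfin]
  · rw [webOf_eq_map, ann_ann, hmap]
  · rw [hM.2, webOf_eq_map, ann_ann, hmap]

theorem map_substForm_webOf (A : GL (Fin 3) F) (L : Submodule F (Fin 6 → F)) :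
    (webOf (L.map (lift A.1))).map (substForm A.1) = webOf L := by
  have key : ∀ (B : GL (Fin 3) F) (M : Submodule F (Fin 6 → F)) f, f ∈ webOf (M.map (lift B.1)) →
      substForm B.1 f ∈ webOf M := by
    intro B M f hf
    refine ⟨substForm_mem _ hf.1, fun y hy => ?_⟩
    rw [mem_hyperplaneOf, formCoords_substForm_dotProduct _ hf.1]
    exact hf.2 (Submodule.mem_map_of_mem hy)
  apply le_antisymm
  · rintro _ ⟨f, hf, rfl⟩
    exact key A L f hf
  · intro f hf
    refine ⟨substForm (A⁻¹ : GL (Fin 3) F).1 f, key A⁻¹ _ f ?_, ?_⟩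
    · rwa [← Submodule.map_comp, ← lift_mul, ← Units.val_mul, inv_mul_cancel, Units.val_one,
        lift_one, Submodule.map_id]
    · have := substForm_inv_substForm A⁻¹ f
      rwa [inv_inv] at this

theorem kEquiv_iff_projEquiv (L L' : Submodule F (Fin 6 → F)) :
    KEquiv L L' ↔ ProjEquiv (webOf L) (webOf L') := by
  constructor
  · intro h
    obtain ⟨A, rfl⟩ := h.symm
    exact ⟨A, (map_substForm_webOf A L').symm⟩
  · rintro ⟨A, hA⟩
    refine KEquiv.symm ⟨A, webOf_injective ?_⟩
    rw [← map_substForm_webOf A L'] at hA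
    have hinj : Function.Injective (substForm A.1) :=
      Function.LeftInverse.injective (substForm_inv_substForm A)
    exact (Submodule.map_injective_of_injective hinj hA).symm

/-! ### Counting points of projective spaces -/

section Counting

variable {V : Type*} [AddCommGroup V] [Module F V]

/-- Each point of a projective space is represented by `q - 1` nonzero vectors. -/
theorem ncard_projectivization_mul (Q : V → Prop) (hQ : ∀ (c : F) v, c ≠ 0 → Q v → Q (c • v)) :
    {p : ℙ F V | Q p.rep}.ncard * (Nat.card F - 1) = {v : V | v ≠ 0 ∧ Q v}.ncard := by
  rw [← Nat.card_units, ← Nat.card_coe_set_eq, ← Nat.card_coe_set_eq, ← Nat.card_prod]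
  refine Nat.card_eq_of_bijective (fun x : {p : ℙ F V | Q p.rep} × Fˣ =>
    (⟨x.2 • x.1.1.rep, ?_, hQ _ _ x.2.ne_zero x.1.2⟩ : {v : V | v ≠ 0 ∧ Q v})) ⟨?_, ?_⟩
  · exact (smul_ne_zero_iff_ne x.2).2 x.1.1.rep_nonzero
  · rintro ⟨⟨p, hp⟩, a⟩ ⟨⟨p', hp'⟩, a'⟩ h
    simp only [Subtype.mk.injEq] at h
    have hpp : p = p' := by
      rw [← p.mk_rep, ← p'.mk_rep, Projectivization.mk_eq_mk_iff]
      exact ⟨a⁻¹ * a', by rw [mul_smul, ← h, inv_smul_smul]⟩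
    subst hpp
    have : a = a' := by
      ext
      exact smul_left_injective F p.rep_nonzero h
    rw [this]
  · rintro ⟨v, hv, hQv⟩
    obtain ⟨a, ha⟩ := Projectivization.exists_smul_eq_mk_rep F v hv
    refine ⟨⟨⟨Projectivization.mk F v hv, ?_⟩, a⁻¹⟩, ?_⟩
    · rw [Set.mem_ofPred_eq, ← ha]; exact hQ _ _ a.ne_zero hQv
    · simp only [← ha, inv_smul_smul]

theorem submodule_le_iff {L : Submodule F V} {P : ℙ F V} : P.submodule ≤ L ↔ P.rep ∈ L := by
  rw [Projectivization.submodule_eq, Submodule.span_singleton_le_iff_mem]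

theorem ncard_points_mul (L : Submodule F V) (Q : V → Prop)
    (hQ : ∀ (c : F) v, c ≠ 0 → Q v → Q (c • v)) :
    {p : ℙ F V | p.submodule ≤ L ∧ Q p.rep}.ncard * (Nat.card F - 1)
      = {v : V | v ≠ 0 ∧ v ∈ L ∧ Q v}.ncard := by
  rw [← ncard_projectivization_mul (fun v => v ∈ L ∧ Q v)
    fun c v hc h => ⟨L.smul_mem c h.1, hQ c v hc h.2⟩]
  simp only [submodule_le_iff]

theorem rep_mk_iff (Q : V → Prop) (hQ : ∀ (c : F) v, c ≠ 0 → Q v → Q (c • v)) {v : V}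
    (hv : v ≠ 0) : Q (Projectivization.mk F v hv).rep ↔ Q v := by
  obtain ⟨a, ha⟩ := Projectivization.exists_smul_eq_mk_rep F v hv
  rw [← ha]
  refine ⟨fun h => ?_, hQ _ _ a.ne_zero⟩
  have := hQ (a⁻¹ : Fˣ) _ (Units.ne_zero _) h
  rwa [← Units.smul_def, inv_smul_smul] at this

open Classical in
/-- The points of the line spanned by `y` and `z` are `z` and the points `y + t z`. -/
theorem ncard_points_span_pair [Finite F] {y z : V} (h : LinearIndependent F ![y, z]) (Q : V → Prop)
    (hQ : ∀ (c : F) v, c ≠ 0 → Q v → Q (c • v)) :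
    {p : ℙ F V | p.submodule ≤ Submodule.span F {y, z} ∧ Q p.rep}.ncard
      = (if Q z then 1 else 0) + {t : F | Q (y + t • z)}.ncard := by
  have hz : z ≠ 0 := h.ne_zero 1
  rw [LinearIndependent.pair_iff] at h
  have hyt : ∀ t : F, y + t • z ≠ 0 := fun t ht => by simpa using (h 1 t (by simpa using ht)).1
  have hset : {p : ℙ F V | p.submodule ≤ Submodule.span F {y, z} ∧ Q p.rep}
      = {p | p = Projectivization.mk F z hz ∧ Q z}
        ∪ (fun t : F => Projectivization.mk F (y + t • z) (hyt t)) '' {t | Q (y + t • z)} := by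
    ext p
    simp only [Set.mem_ofPred_eq, Set.mem_union, Set.mem_image]
    constructor
    · rintro ⟨hp, hQp⟩
      rw [submodule_le_iff, Submodule.mem_span_pair] at hp
      obtain ⟨a, b, hab⟩ := hp
      by_cases ha : a = 0
      · left
        have hb : b ≠ 0 := by
          rintro rfl
          apply p.rep_nonzero
          rw [← hab, ha]; simp
        have hzp : p = Projectivization.mk F z hz := by
          rw [← p.mk_rep, Projectivization.mk_eq_mk_iff']
          exact ⟨b, by rw [← hab, ha]; simp⟩
        refine ⟨hzp, ?_⟩
        rwa [hzp, rep_mk_iff Q hQ] at hQp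
      · right
        have hzp : Projectivization.mk F (y + (a⁻¹ * b) • z) (hyt _) = p := by
          rw [← p.mk_rep, Projectivization.mk_eq_mk_iff']
          exact ⟨a⁻¹, by rw [← hab, smul_add, smul_smul, smul_smul, inv_mul_cancel₀ ha, one_smul]⟩
        refine ⟨a⁻¹ * b, ?_, hzp⟩
        rwa [← hzp, rep_mk_iff Q hQ] at hQp
    · rintro (⟨rfl, hq⟩ | ⟨t, ht, rfl⟩)
      · refine ⟨?_, (rep_mk_iff Q hQ hz).2 hq⟩
        rw [Projectivization.submodule_mk, Submodule.span_singleton_le_iff_mem]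
        exact Submodule.subset_span (by simp)
      · refine ⟨?_, (rep_mk_iff Q hQ _).2 ht⟩
        rw [Projectivization.submodule_mk, Submodule.span_singleton_le_iff_mem]
        exact Submodule.mem_span_pair.2 ⟨1, t, by simp⟩
  have hinj : Function.Injective (fun t : F => Projectivization.mk F (y + t • z) (hyt t)) := by
    intro s t hst
    rw [Projectivization.mk_eq_mk_iff'] at hst
    obtain ⟨a, ha⟩ := hst
    have hc := h (a - 1) (a * t - s) (by
      have : a • (y + t • z) - (y + s • z) = 0 := sub_eq_zero.2 ha
      rw [← this]; module)
    rw [sub_eq_zero] at hc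
    rw [hc.1, one_mul, sub_eq_zero] at hc
    exact hc.2.symm
  rw [hset, Set.ncard_union_eq _ _ ((Set.toFinite _).image _), Set.ncard_image_of_injective _ hinj]
  · congr 1
    split_ifs with hq
    · simp [hq]
    · simp [hq]
  · rw [Set.disjoint_left]
    rintro p ⟨rfl, _⟩ ⟨t, _, ht⟩
    rw [Projectivization.mk_eq_mk_iff'] at ht
    obtain ⟨a, ha⟩ := ht
    have := (h 1 (t - a) (by rw [sub_smul, ha]; module)).1
    exact one_ne_zero this
  · exact (Set.finite_singleton (Projectivization.mk F z hz)).subset fun p hp => hp.1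

end Counting

/-! ### Hyperplanes and conics -/

theorem hyperplaneOf_eq_iff {f g : MvPolynomial (Fin 3) F} (hf : f ∈ Forms F) (hg : g ∈ Forms F) :
    hyperplaneOf f = hyperplaneOf g ↔ ∃ c : F, c ≠ 0 ∧ f = c • g := by
  have hann : ∀ f : MvPolynomial (Fin 3) F, hyperplaneOf f = ann (F ∙ formCoords f) := by
    intro f; ext y
    simp only [mem_hyperplaneOf, mem_ann, Submodule.mem_span_singleton]
    constructor
    · rintro h _ ⟨a, rfl⟩
      rw [dotProduct_smul, dotProduct_comm, h, smul_zero]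
    · intro h
      rw [dotProduct_comm]; exact h _ ⟨1, one_smul _ _⟩
  constructor
  · intro h
    rw [hann, hann] at h
    have h2 : (F ∙ formCoords f) = F ∙ formCoords g := by rw [← ann_ann (F ∙ formCoords f), h, ann_ann]
    obtain ⟨a, ha⟩ := Submodule.span_singleton_eq_span_singleton.1 h2.symm
    refine ⟨a, a.ne_zero, ?_⟩
    rw [← formOf_formCoords hf, ← ha, Units.smul_def, formOf_smul, formOf_formCoords hg]
  · rintro ⟨c, hc, rfl⟩
    ext y
    rw [mem_hyperplaneOf, mem_hyperplaneOf, formCoords_smul, smul_dotProduct, smul_eq_zero]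
    exact or_iff_right hc

/-- Hyperplanes through `L` of a given kind correspond to conics of that kind in the web. -/
theorem ncard_hyperplanes (L : Submodule F (Fin 6 → F)) (T : MvPolynomial (Fin 3) F → Prop)
    (hT : ∀ f, T f → f ∈ Forms F ∧ f ≠ 0) (hT' : ∀ (c : F) f, c ≠ 0 → T f → T (c • f)) :
    {H | (∃ f, T f ∧ H = hyperplaneOf f) ∧ L ≤ H}.ncard
      = {p : ℙ F (MvPolynomial (Fin 3) F) | p.submodule ≤ webOf L ∧ T p.rep}.ncard := by
  symm
  refine Set.ncard_congr (fun p _ => hyperplaneOf p.rep) ?_ ?_ ?_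
  · rintro p ⟨hp, hTp⟩
    exact ⟨⟨_, hTp, rfl⟩, (submodule_le_iff.1 hp).2⟩
  · rintro p p' ⟨hp, hTp⟩ ⟨hp', hTp'⟩ h
    obtain ⟨c, hc, h⟩ := (hyperplaneOf_eq_iff (hT _ hTp).1 (hT _ hTp').1).1 h
    rw [← p.mk_rep, ← p'.mk_rep, Projectivization.mk_eq_mk_iff']
    exact ⟨c, h.symm⟩
  · rintro H ⟨⟨f, hf, rfl⟩, hL⟩
    obtain ⟨a, ha⟩ := Projectivization.exists_smul_eq_mk_rep F f (hT f hf).2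
    have hrep : hyperplaneOf (Projectivization.mk F f (hT f hf).2).rep = hyperplaneOf f := by
      rw [← ha, Units.smul_def,
        hyperplaneOf_eq_iff (Submodule.smul_mem _ _ (hT f hf).1) (hT f hf).1]
      exact ⟨a, a.ne_zero, rfl⟩
    refine ⟨Projectivization.mk F f (hT f hf).2, ⟨?_, (rep_mk_iff T hT' _).2 hf⟩, hrep⟩
    rw [submodule_le_iff]
    refine ⟨?_, by rw [hrep]; exact hL⟩
    rw [← ha]; exact Submodule.smul_mem _ _ (hT f hf).1

/-- The conics of a given kind in the web of `L`, counted through their coordinate vectors. -/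
theorem ncard_conics_mul (L : Submodule F (Fin 6 → F)) (T : MvPolynomial (Fin 3) F → Prop)
    (hT' : ∀ (c : F) f, c ≠ 0 → T f → T (c • f)) :
    {p : ℙ F (MvPolynomial (Fin 3) F) | p.submodule ≤ webOf L ∧ T p.rep}.ncard * (Nat.card F - 1)
      = {c : Fin 6 → F | c ≠ 0 ∧ c ∈ ann L ∧ T (formOf c)}.ncard := by
  rw [ncard_points_mul _ _ hT', ← Set.ncard_image_of_injective _ formOf_injective]
  congr 1
  ext f
  simp only [Set.mem_ofPred_eq, Set.mem_image]
  constructor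
  · rintro ⟨h0, hf, h⟩
    have := formOf_formCoords hf.1
    refine ⟨formCoords f, ⟨?_, ?_, ?_⟩, this⟩
    · intro hc; apply h0; rw [← this, hc, formOf_zero]
    · rw [← formOf_mem_webOf, this]; exact hf
    · rwa [this]
  · rintro ⟨c, ⟨h0, hc, h⟩, rfl⟩
    refine ⟨fun h1 => h0 (formOf_injective (h1.trans formOf_zero.symm)), formOf_mem_webOf.2 hc, h⟩

/-! ### Changes of coordinates, tangent spaces and conic planes -/

/-- Two independent vectors extend to a basis, whose members are the columns of `A`. -/
theorem exists_GL_of_linearIndependent {v w : Fin 3 → F} (h : LinearIndependent F ![v, w]) :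
    ∃ A : GL (Fin 3) F, A.1.mulVec (Pi.single 1 1) = v ∧ A.1.mulVec (Pi.single 2 1) = w := by
  rw [← crossProduct_ne_zero_iff_linearIndependent] at h
  have hu : ∃ u : Fin 3 → F, u ⬝ᵥ crossProduct v w ≠ 0 := by
    by_contra hcon
    push Not at hcon
    exact h (dotProduct_eq_zero _ fun u => by rw [dotProduct_comm]; exact hcon u)
  obtain ⟨u, hu⟩ := hu
  let M : Matrix (Fin 3) (Fin 3) F := (Matrix.of ![u, v, w]).transpose
  have hdet : M.det ≠ 0 := by
    rw [Matrix.det_transpose]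
    rw [triple_product_eq_det] at hu
    exact hu
  refine ⟨Matrix.GeneralLinearGroup.mkOfDetNeZero M hdet, ?_, ?_⟩ <;>
  · rw [Matrix.mulVec_single_one]; rfl

theorem exists_GL_of_ne_zero {v : Fin 3 → F} (h : v ≠ 0) :
    ∃ A : GL (Fin 3) F, A.1.mulVec (Pi.single 0 1) = v := by
  have key : ∀ M : Matrix (Fin 3) (Fin 3) F, M.det ≠ 0 → M.mulVec (Pi.single 0 1) = v →
      ∃ A : GL (Fin 3) F, A.1.mulVec (Pi.single 0 1) = v :=
    fun M hM hv => ⟨Matrix.GeneralLinearGroup.mkOfDetNeZero M hM, hv⟩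
  have hcol : ∀ M : Matrix (Fin 3) (Fin 3) F, (∀ i, M i 0 = v i) → M.mulVec (Pi.single 0 1) = v :=
    fun M hM => by rw [Matrix.mulVec_single_one]; ext i; exact hM i
  by_cases h0 : v 0 = 0
  · by_cases h1 : v 1 = 0
    · have h2 : v 2 ≠ 0 := fun h2 => h (by ext i; fin_cases i <;> assumption)
      refine key !![v 0, 1, 0; v 1, 0, 1; v 2, 0, 0] ?_ (hcol _ ?_)
      · rw [Matrix.det_fin_three]; simp [h2]
      · intro i; fin_cases i <;> rfl
    · refine key !![v 0, 1, 0; v 1, 0, 0; v 2, 0, 1] ?_ (hcol _ ?_)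
      · rw [Matrix.det_fin_three]; simp [h1]
      · intro i; fin_cases i <;> rfl
  · refine key !![v 0, 0, 0; v 1, 1, 0; v 2, 0, 1] ?_ (hcol _ ?_)
    · rw [Matrix.det_fin_three]; simp [h0]
    · intro i; fin_cases i <;> rfl

/-- The point with matrix `v wᵀ + w vᵀ`. -/
def symProd (v w : Fin 3 → F) : Fin 6 → F :=
  ![2 * (v 0 * w 0), v 0 * w 1 + v 1 * w 0, v 0 * w 2 + v 2 * w 0, 2 * (v 1 * w 1),
    v 1 * w 2 + v 2 * w 1, 2 * (v 2 * w 2)]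

theorem bil_symProd (v w a b : Fin 3 → F) :
    bil (symProd v w) a b = (a ⬝ᵥ v) * (b ⬝ᵥ w) + (a ⬝ᵥ w) * (b ⬝ᵥ v) := by
  rw [bil_eq]; simp [symProd, dotProduct, Fin.sum_univ_three]; ring

theorem ext_bil {y z : Fin 6 → F} (h : ∀ a b, bil y a b = bil z a b) : y = z := by
  have h' := fun i j : Fin 3 => h (Pi.single i 1) (Pi.single j 1)
  simp only [bil_eq] at h'
  ext k
  fin_cases k
  · simpa using h' 0 0
  · simpa using h' 0 1
  · simpa using h' 0 2
  · simpa using h' 1 1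
  · simpa using h' 1 2
  · simpa using h' 2 2

theorem dotProduct_mulVec_transpose (A : Matrix (Fin 3) (Fin 3) F) (a v : Fin 3 → F) :
    A.transpose.mulVec a ⬝ᵥ v = a ⬝ᵥ A.mulVec v := by
  rw [Matrix.mulVec_transpose, Matrix.dotProduct_mulVec]

theorem lift_symProd (A : Matrix (Fin 3) (Fin 3) F) (v w : Fin 3 → F) :
    lift A (symProd v w) = symProd (A.mulVec v) (A.mulVec w) := by
  refine ext_bil fun a b => ?_
  simp only [bil_lift, bil_symProd, dotProduct_mulVec_transpose]

/-- The tangent space of the cone over the Veronese surface at the image of `v`. -/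
def tangentSpace (v : Fin 3 → F) : Submodule F (Fin 6 → F) where
  carrier := {y | ∃ (w : Fin 3 → F) (k : F), y = symProd v w + k • veronese v}
  add_mem' := by
    rintro _ _ ⟨w, k, rfl⟩ ⟨w', k', rfl⟩
    refine ⟨w + w', k + k', ext_bil fun a b => ?_⟩
    simp only [bil_add, bil_smul, bil_symProd, dotProduct_add]; ring
  zero_mem' := ⟨0, 0, ext_bil fun a b => by rw [bil_add, bil_smul, bil_symProd]; simp [bil_eq]⟩
  smul_mem' := by
    rintro c _ ⟨w, k, rfl⟩
    refine ⟨c • w, c * k, ext_bil fun a b => ?_⟩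
    simp only [bil_add, bil_smul, bil_symProd, dotProduct_smul, smul_eq_mul]; ring

/-- The points whose matrix annihilates `a`. -/
def kerSpace (a : Fin 3 → F) : Submodule F (Fin 6 → F) where
  carrier := {y | ∀ b, bil y a b = 0}
  add_mem' hy hz b := by rw [bil_add, hy, hz, add_zero]
  zero_mem' b := by simp [bil_eq]
  smul_mem' c y hy b := by rw [bil_smul, hy, mul_zero]

theorem mem_tangentSpace {v : Fin 3 → F} {y : Fin 6 → F} :
    y ∈ tangentSpace v ↔ ∃ (w : Fin 3 → F) (k : F), y = symProd v w + k • veronese v := Iff.rfl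

theorem mem_kerSpace {a : Fin 3 → F} {y : Fin 6 → F} :
    y ∈ kerSpace a ↔ ∀ b, bil y a b = 0 := Iff.rfl

theorem mem_kerSpace_iff_mulVec {a : Fin 3 → F} {y : Fin 6 → F} :
    y ∈ kerSpace a ↔ (toMat y).mulVec a = 0 := by
  rw [mem_kerSpace]
  constructor
  · intro h
    exact dotProduct_eq_zero _ fun b => by rw [dotProduct_comm, ← bil, bil_comm]; exact h b
  · intro h b
    rw [bil_comm, bil, h, dotProduct_zero]

theorem map_lift_tangentSpace (A : GL (Fin 3) F) (v : Fin 3 → F) :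
    (tangentSpace v).map (lift A.1) = tangentSpace (A.1.mulVec v) := by
  have key : ∀ (B : GL (Fin 3) F) v y, y ∈ tangentSpace v → lift B.1 y ∈ tangentSpace (B.1.mulVec v) := by
    rintro B v _ ⟨w, k, rfl⟩
    exact ⟨B.1.mulVec w, k, by rw [map_add, map_smul, lift_symProd, lift_veronese]⟩
  apply le_antisymm
  · rintro _ ⟨y, hy, rfl⟩
    exact key A v y hy
  · intro y hy
    refine ⟨lift (A⁻¹ : GL (Fin 3) F).1 y, ?_, lift_lift_inv A y⟩
    have := key A⁻¹ _ _ hy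
    rwa [Matrix.mulVec_mulVec, ← Units.val_mul, inv_mul_cancel, Units.val_one,
      Matrix.one_mulVec] at this

theorem lift_mem_tangentSpace_iff (A : GL (Fin 3) F) (v : Fin 3 → F) (y : Fin 6 → F) :
    lift A.1 y ∈ tangentSpace (A.1.mulVec v) ↔ y ∈ tangentSpace v := by
  rw [← map_lift_tangentSpace]
  exact ⟨fun ⟨z, hz, h⟩ => lift_injective A h ▸ hz, fun h => ⟨y, h, rfl⟩⟩

theorem lift_mem_kerSpace_iff (A : GL (Fin 3) F) (a : Fin 3 → F) (y : Fin 6 → F) :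
    lift A.1 y ∈ kerSpace a ↔ y ∈ kerSpace (A.1.transpose.mulVec a) := by
  simp only [mem_kerSpace, bil_lift]
  constructor
  · intro h b
    have := h ((A⁻¹ : GL (Fin 3) F).1.transpose.mulVec b)
    rwa [Matrix.mulVec_mulVec, ← Matrix.transpose_mul, ← Units.val_mul, inv_mul_cancel,
      Units.val_one, Matrix.transpose_one, Matrix.one_mulVec] at this
  · exact fun h b => h _

theorem tangentSpace_single (y : Fin 6 → F) :
    y ∈ tangentSpace (Pi.single 0 1 : Fin 3 → F) ↔ y 3 = 0 ∧ y 4 = 0 ∧ y 5 = 0 := by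
  rw [mem_tangentSpace]
  constructor
  · rintro ⟨w, k, rfl⟩; simp [symProd, veronese]
  · rintro ⟨h3, h4, h5⟩
    refine ⟨![0, y 1, y 2], y 0, ?_⟩
    ext i; fin_cases i <;> simp [symProd, veronese, h3, h4, h5]

theorem kerSpace_single (y : Fin 6 → F) :
    y ∈ kerSpace (Pi.single 0 1 : Fin 3 → F) ↔ y 0 = 0 ∧ y 1 = 0 ∧ y 2 = 0 := by
  rw [mem_kerSpace]
  constructor
  · intro h
    have h0 := h (Pi.single 0 1); have h1 := h (Pi.single 1 1); have h2 := h (Pi.single 2 1)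
    simp [bil_eq] at h0 h1 h2
    exact ⟨h0, h1, h2⟩
  · rintro ⟨h0, h1, h2⟩ b
    simp [bil_eq, h0, h1, h2]

/-- A subspace given by the vanishing of three of the six coordinates has dimension three; `e` lists
the other coordinates and `g` is its partial inverse. -/
theorem finrank_eq_three_of_coords {S : Submodule F (Fin 6 → F)} (e : Fin 3 → Fin 6)
    (g : Fin 6 → Option (Fin 3)) (hg : ∀ i, g (e i) = some i)
    (hS : ∀ y, y ∈ S ↔ ∀ i, g i = none → y i = 0) (he : ∀ i k, g i = some k → i = e k) :
    Module.finrank F S = 3 := by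
  let T : (Fin 3 → F) →ₗ[F] (Fin 6 → F) :=
    { toFun := fun w i => (g i).elim 0 w
      map_add' := fun w w' => by ext i; cases h : g i <;> simp [h]
      map_smul' := fun c w => by ext i; cases h : g i <;> simp [h] }
  have hT : ∀ w i, T w i = (g i).elim 0 w := fun _ _ => rfl
  have hinj : Function.Injective T := by
    intro w w' h
    ext i
    have := congrFun h (e i)
    simpa [hT, hg] using this
  have hrange : LinearMap.range T = S := by
    ext y
    rw [hS]
    constructor
    · rintro ⟨w, rfl⟩ i hi
      simp [hT, hi]
    · intro h
      refine ⟨fun k => y (e k), ?_⟩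
      ext i
      rw [hT]
      cases hi : g i with
      | none => simpa using (h i hi).symm
      | some k => simp [he i k hi]
  rw [← hrange, LinearMap.finrank_range_of_inj hinj, Module.finrank_fin_fun]

theorem finrank_tangentSpace {v : Fin 3 → F} (hv : v ≠ 0) :
    Module.finrank F (tangentSpace v) = 3 := by
  obtain ⟨A, rfl⟩ := exists_GL_of_ne_zero hv
  rw [← map_lift_tangentSpace,
    ← (Submodule.equivMapOfInjective (lift A.1) (lift_injective A) _).finrank_eq]
  refine finrank_eq_three_of_coords ![0, 1, 2] ![some 0, some 1, some 2, none, none, none]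
    (by decide) (fun y => ?_) (by decide)
  rw [tangentSpace_single]
  simp [Fin.forall_fin_succ]

theorem finrank_kerSpace {a : Fin 3 → F} (ha : a ≠ 0) : Module.finrank F (kerSpace a) = 3 := by
  obtain ⟨A, rfl⟩ := exists_GL_of_ne_zero ha
  let B : GL (Fin 3) F := Matrix.GeneralLinearGroup.mkOfDetNeZero A.1.transpose
    (by rw [Matrix.det_transpose]; exact A.det.ne_zero)
  have hmap : (kerSpace (A.1.mulVec (Pi.single 0 1))).map (lift B.1) = kerSpace (Pi.single 0 1) := by
    have key : ∀ y, lift B.1 y ∈ kerSpace (Pi.single 0 1) ↔ y ∈ kerSpace (A.1.mulVec (Pi.single 0 1)) := by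
      intro y
      rw [lift_mem_kerSpace_iff]
      have : B.1.transpose = A.1 := Matrix.transpose_transpose _
      rw [this]
    ext y
    constructor
    · rintro ⟨z, hz, rfl⟩
      exact (key z).2 hz
    · intro h
      refine ⟨lift (B⁻¹ : GL (Fin 3) F).1 y, ?_, lift_lift_inv B y⟩
      rw [SetLike.mem_coe, ← key, lift_lift_inv]; exact h
  rw [(Submodule.equivMapOfInjective (lift B.1) (lift_injective B) _).finrank_eq, hmap]
  refine finrank_eq_three_of_coords ![3, 4, 5] ![none, none, none, some 0, some 1, some 2]
    (by decide) (fun y => ?_) (by decide)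
  rw [kerSpace_single]
  simp [Fin.forall_fin_succ]

/-- A matrix annihilating `a` comes from the symmetric square of the plane orthogonal to `a`. -/
theorem exists_of_mem_kerSpace {a v w : Fin 3 → F} (ha : a ≠ 0) (h : LinearIndependent F ![v, w])
    (hv : a ⬝ᵥ v = 0) (hw : a ⬝ᵥ w = 0) {y : Fin 6 → F} (hy : y ∈ kerSpace a) :
    ∃ r s t : F, y = r • veronese v + s • symProd v w + t • veronese w := by
  obtain ⟨A, rfl, rfl⟩ := exists_GL_of_linearIndependent h
  rw [← lift_lift_inv A y, lift_mem_kerSpace_iff] at hy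
  rw [← dotProduct_mulVec_transpose] at hv hw
  set c := A.1.transpose.mulVec a with hc
  simp at hv hw
  have hc0 : c 0 ≠ 0 := by
    intro h0
    apply ha
    have : c = 0 := by ext i; fin_cases i <;> assumption
    rw [hc] at this
    have h2 := congrArg ((A⁻¹ : GL (Fin 3) F).1.transpose.mulVec) this
    rwa [Matrix.mulVec_mulVec, ← Matrix.transpose_mul, ← Units.val_mul, mul_inv_cancel,
      Units.val_one, Matrix.transpose_one, Matrix.one_mulVec, Matrix.mulVec_zero] at h2
  have hy' : lift (A⁻¹ : GL (Fin 3) F).1 y ∈ kerSpace (Pi.single 0 1 : Fin 3 → F) := by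
    intro b
    have h2 := hy b
    rw [bil_eq] at h2 ⊢
    simp [hv, hw, -Matrix.coe_units_inv] at h2 ⊢
    have : c 0 * (lift (A⁻¹ : GL (Fin 3) F).1 y 0 * b 0 + lift (A⁻¹ : GL (Fin 3) F).1 y 1 * b 1
      + lift (A⁻¹ : GL (Fin 3) F).1 y 2 * b 2) = 0 := by linear_combination h2
    exact (mul_eq_zero.1 this).resolve_left hc0
  rw [kerSpace_single] at hy'
  refine ⟨lift (A⁻¹ : GL (Fin 3) F).1 y 3, lift (A⁻¹ : GL (Fin 3) F).1 y 4,
    lift (A⁻¹ : GL (Fin 3) F).1 y 5, ?_⟩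
  conv_lhs => rw [← lift_lift_inv A y]
  rw [← lift_veronese, ← lift_veronese, ← lift_symProd, ← map_smul, ← map_smul, ← map_smul,
    ← map_add, ← map_add]
  congr 1
  ext i
  fin_cases i <;> simp [veronese, symProd, hy', -Matrix.coe_units_inv]

/-! ### Zeros, singular points and linear factors of the four kinds of conics -/

/-- The number of nonzero zeros of the quadratic form with coordinates `c`. -/
noncomputable def zeroCount (c : Fin 6 → F) : ℕ :=
  {v : Fin 3 → F | v ≠ 0 ∧ c ⬝ᵥ veronese v = 0}.ncard

/-- The number of nonzero singular vectors of the quadratic form with coordinates `c`. -/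
noncomputable def singCount (c : Fin 6 → F) : ℕ :=
  {v : Fin 3 → F | v ≠ 0 ∧ c ∈ ann (tangentSpace v)}.ncard

/-- The number of linear forms dividing the quadratic form with coordinates `c`. -/
noncomputable def factorCount (c : Fin 6 → F) : ℕ :=
  {a : Fin 3 → F | a ≠ 0 ∧ c ∈ ann (kerSpace a)}.ncard

theorem ncard_ne_zero_mem [Finite F] {V : Type*} [AddCommGroup V] [Module F V]
    [Module.Finite F V] (S : Submodule F V) :
    {v : V | v ≠ 0 ∧ v ∈ S}.ncard + 1 = Nat.card F ^ Module.finrank F S := by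
  have : Finite V := Module.finite_of_finite F
  rw [← Module.natCard_eq_pow_finrank]
  have h : {v : V | v ≠ 0 ∧ v ∈ S} = (S : Set V) \ {0} := by
    ext v; simp [and_comm]
  have h2 : Nat.card S = (S : Set V).ncard := rfl
  rw [h, h2, Set.ncard_sdiff_singleton_add_one S.zero_mem (Set.toFinite _)]

theorem finrank_ann_span_singleton {a : Fin 3 → F} (ha : a ≠ 0) :
    Module.finrank F (ann (F ∙ a)) = 2 := by
  rw [finrank_ann, finrank_span_singleton ha]

theorem mem_ann_span_singleton {n : ℕ} {a v : Fin n → F} : v ∈ ann (F ∙ a) ↔ a ⬝ᵥ v = 0 := by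
  rw [mem_ann]
  constructor
  · intro h; rw [dotProduct_comm]; exact h a (Submodule.mem_span_singleton_self a)
  · intro h y hy
    obtain ⟨c, rfl⟩ := Submodule.mem_span_singleton.1 hy
    rw [dotProduct_smul, dotProduct_comm, h, smul_zero]

theorem mem_ann_span_pair {n : ℕ} {a b v : Fin n → F} :
    v ∈ ann (Submodule.span F {a, b}) ↔ a ⬝ᵥ v = 0 ∧ b ⬝ᵥ v = 0 := by
  have h : Submodule.span F {a, b} = (F ∙ a) ⊔ (F ∙ b) := by
    rw [← Submodule.span_union]; rfl
  rw [h, ann_sup, Submodule.mem_inf, mem_ann_span_singleton, mem_ann_span_singleton]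

theorem finrank_span_pair {V : Type*} [AddCommGroup V] [Module F V] {a b : V}
    (h : LinearIndependent F ![a, b]) : Module.finrank F (Submodule.span F {a, b}) = 2 := by
  have := finrank_span_eq_card h
  rwa [Matrix.range_cons_cons_empty, Fintype.card_fin] at this

/-- The plane orthogonal to a nonzero vector has a basis. -/
theorem exists_basis_ann {a : Fin 3 → F} (ha : a ≠ 0) :
    ∃ v w : Fin 3 → F, LinearIndependent F ![v, w] ∧ a ⬝ᵥ v = 0 ∧ a ⬝ᵥ w = 0 ∧
      ∀ u, a ⬝ᵥ u = 0 → ∃ r s : F, u = r • v + s • w := by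
  have hfin := finrank_ann_span_singleton ha
  let e := Module.finBasisOfFinrankEq F _ hfin
  refine ⟨e 0, e 1, ?_, mem_ann_span_singleton.1 (e 0).2, mem_ann_span_singleton.1 (e 1).2, ?_⟩
  · have := e.linearIndependent.map' (Submodule.subtype _) (Submodule.ker_subtype _)
    convert! this using 1
    ext i j; fin_cases i <;> rfl
  · intro u hu
    have := e.sum_repr ⟨u, mem_ann_span_singleton.2 hu⟩
    rw [Fin.sum_univ_two] at this
    exact ⟨_, _, (congrArg Subtype.val this).symm⟩

section Extension

variable {E : Type u} [Field E] [Algebra F E]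

/-- Evaluation of a linear form over an extension at a rational vector. -/
def evalE (α : Fin 3 → E) (v : Fin 3 → F) : E := ∑ i, α i * algebraMap F E (v i)

/-- The kernel of a linear form over an extension, as a space of rational vectors. -/
def kerE (F : Type u) [Field F] {E : Type u} [Field E] [Algebra F E] (α : Fin 3 → E) :
    Submodule F (Fin 3 → F) where
  carrier := {v | evalE α v = 0}
  add_mem' {v w} hv hw := by
    change evalE α v = 0 at hv
    change evalE α w = 0 at hw
    change evalE α (v + w) = 0
    simp only [evalE, Fin.sum_univ_three, Pi.add_apply, map_add] at *
    linear_combination hv + hw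
  zero_mem' := by change evalE α 0 = 0; simp [evalE]
  smul_mem' c v hv := by
    change evalE α v = 0 at hv
    change evalE α (c • v) = 0
    simp only [evalE, Fin.sum_univ_three, Pi.smul_apply, smul_eq_mul, map_mul] at *
    linear_combination (algebraMap F E c) * hv

theorem mem_kerE {α : Fin 3 → E} {v : Fin 3 → F} : v ∈ kerE F α ↔ evalE α v = 0 := Iff.rfl

theorem exists_evalE_ne_zero {α : Fin 3 → E} (hα : α ≠ 0) : ∃ v : Fin 3 → F, evalE α v ≠ 0 := by
  by_contra h
  push Not at h
  apply hα
  ext i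
  have := h (Pi.single i 1)
  simp only [evalE, Pi.single_apply, apply_ite (algebraMap F E), map_one, map_zero, mul_ite, mul_one,
    mul_zero, Finset.sum_ite_eq', Finset.mem_univ, if_true] at this
  exact this

/-- The quadratic form with coordinates `c` becomes `k` times the product of the linear forms `α`
and `β` over `E`. -/
def FactorsAs (c : Fin 6 → F) (k : E) (α β : Fin 3 → E) : Prop :=
  k ≠ 0 ∧ α ≠ 0 ∧ β ≠ 0 ∧ ∀ i, algebraMap F E (c i) = k * prodCoords α β i

theorem FactorsAs.map_dotProduct {c : Fin 6 → F} {k : E} {α β : Fin 3 → E}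
    (h : FactorsAs c k α β) (y : Fin 6 → F) :
    algebraMap F E (c ⬝ᵥ y) = k * bil (fun i => algebraMap F E (y i)) α β := by
  rw [← prodCoords_dotProduct]
  simp only [dotProduct, map_sum, map_mul, h.2.2.2, Finset.mul_sum, mul_assoc]

theorem FactorsAs.veronese {c : Fin 6 → F} {k : E} {α β : Fin 3 → E}
    (h : FactorsAs c k α β) (v : Fin 3 → F) :
    algebraMap F E (c ⬝ᵥ veronese v) = k * (evalE α v * evalE β v) := by
  rw [h.map_dotProduct, bil_eq]
  congr 1
  simp only [WebsOfConics.veronese, evalE, Fin.sum_univ_three, Matrix.cons_val, map_mul, map_pow]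
  ring

theorem FactorsAs.symProd {c : Fin 6 → F} {k : E} {α β : Fin 3 → E}
    (h : FactorsAs c k α β) (v w : Fin 3 → F) :
    algebraMap F E (c ⬝ᵥ symProd v w)
      = k * (evalE α v * evalE β w + evalE α w * evalE β v) := by
  rw [h.map_dotProduct, bil_eq]
  congr 1
  simp only [WebsOfConics.symProd, evalE, Fin.sum_univ_three, Matrix.cons_val, map_mul, map_add,
    map_ofNat]
  ring

theorem FactorsAs.veronese_iff {c : Fin 6 → F} {k : E} {α β : Fin 3 → E}
    (h : FactorsAs c k α β) (v : Fin 3 → F) :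
    c ⬝ᵥ WebsOfConics.veronese v = 0 ↔ v ∈ kerE F α ∨ v ∈ kerE F β := by
  rw [← (algebraMap F E).injective.eq_iff, map_zero, h.veronese, mul_eq_zero, mul_eq_zero]
  exact or_iff_right h.1

theorem FactorsAs.tangentSpace_iff {c : Fin 6 → F} {k : E} {α β : Fin 3 → E}
    (h : FactorsAs c k α β) (v : Fin 3 → F) :
    c ∈ ann (tangentSpace v) ↔ v ∈ kerE F α ∧ v ∈ kerE F β := by
  rw [mem_ann]
  constructor
  · intro hc
    have h1 : evalE α v * evalE β v = 0 := by
      have := hc _ ⟨0, 1, rfl⟩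
      rw [dotProduct_add, dotProduct_smul] at this
      have h0 : WebsOfConics.symProd v (0 : Fin 3 → F) = 0 := by
        ext i; fin_cases i <;> simp [WebsOfConics.symProd]
      rw [h0, dotProduct_zero, zero_add, one_smul, h.veronese_iff] at this
      exact mul_eq_zero.2 this
    have h2 : ∀ w : Fin 3 → F, evalE α v * evalE β w + evalE α w * evalE β v = 0 := by
      intro w
      have := hc _ ⟨w, 0, rfl⟩
      rw [zero_smul, add_zero, ← (algebraMap F E).injective.eq_iff, map_zero, h.symProd] at this
      exact (mul_eq_zero.1 this).resolve_left h.1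
    rw [mem_kerE, mem_kerE]
    obtain ⟨w, hw⟩ := exists_evalE_ne_zero (F := F) h.2.1
    obtain ⟨w', hw'⟩ := exists_evalE_ne_zero (F := F) h.2.2.1
    rcases mul_eq_zero.1 h1 with h3 | h3
    · refine ⟨h3, ?_⟩
      have := h2 w
      rw [h3, zero_mul, zero_add] at this
      exact (mul_eq_zero.1 this).resolve_left hw
    · refine ⟨?_, h3⟩
      have := h2 w'
      rw [h3, mul_zero, add_zero] at this
      exact (mul_eq_zero.1 this).resolve_right hw'
  · rintro ⟨h1, h2⟩ _ ⟨w, r, rfl⟩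
    rw [mem_kerE] at h1 h2
    rw [dotProduct_add, dotProduct_smul, (h.veronese_iff v).2 (Or.inl h1), smul_zero, add_zero,
      ← (algebraMap F E).injective.eq_iff, map_zero, h.symProd, h1, h2]
    ring

/-- A rational line on which the form vanishes identically lies in the kernel of one of the factors:
vectors `v`, `w` of the line outside the two kernels would contradict `α v * β w + α w * β v = 0`. -/
theorem FactorsAs.of_kerSpace {c : Fin 6 → F} {k : E} {α β : Fin 3 → E}
    (h : FactorsAs c k α β) {a : Fin 3 → F} (hc : c ∈ ann (kerSpace a)) :
    ann (F ∙ a) ≤ kerE F α ∨ ann (F ∙ a) ≤ kerE F β := by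
  by_contra hcon
  push Not at hcon
  obtain ⟨h1, h2⟩ := hcon
  obtain ⟨v, hv, hv'⟩ := SetLike.not_le_iff_exists.1 h1
  obtain ⟨w, hw, hw'⟩ := SetLike.not_le_iff_exists.1 h2
  rw [mem_ann_span_singleton] at hv hw
  have hver : ∀ v : Fin 3 → F, a ⬝ᵥ v = 0 → WebsOfConics.veronese v ∈ kerSpace a := by
    intro v hv b
    rw [bil_veronese, hv, zero_mul]
  have hs : WebsOfConics.symProd v w ∈ kerSpace a := by
    intro b
    rw [bil_symProd, hv, hw]; ring
  rw [mem_ann] at hc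
  have e1 := (h.veronese_iff v).1 (hc _ (hver v hv))
  have e2 := (h.veronese_iff w).1 (hc _ (hver w hw))
  have e3 := hc _ hs
  rw [← (algebraMap F E).injective.eq_iff, map_zero, h.symProd] at e3
  have e4 := (mul_eq_zero.1 e3).resolve_left h.1
  rw [mem_kerE] at e1 e2 hv' hw'
  have e1' := e1.resolve_left hv'
  have e2' := e2.resolve_right hw'
  rw [mem_kerE] at e1'
  rw [e1', e2', mul_zero, add_zero] at e4
  rcases mul_eq_zero.1 e4 with h5 | h5
  · exact hv' h5
  · exact hw' h5

end Extension

theorem kerE_self (a : Fin 3 → F) : kerE F (E := F) a = ann (F ∙ a) := by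
  ext v
  rw [mem_kerE, mem_ann_span_singleton]
  simp [evalE, dotProduct]

theorem factorsAs_self {c : Fin 6 → F} {k : F} {a b : Fin 3 → F} (hk : k ≠ 0) (ha : a ≠ 0)
    (hb : b ≠ 0) (h : c = k • prodCoords a b) : FactorsAs (E := F) c k a b :=
  ⟨hk, ha, hb, fun i => by rw [h]; simp⟩

theorem FactorsAs.kerSpace_iff {c : Fin 6 → F} {k : F} {a b : Fin 3 → F}
    (h : FactorsAs (E := F) c k a b) {d : Fin 3 → F} (hd : d ≠ 0) :
    c ∈ ann (kerSpace d) ↔ d ∈ (F ∙ a) ∨ d ∈ (F ∙ b) := by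
  have hle : ∀ a : Fin 3 → F, a ≠ 0 → ann (F ∙ d) ≤ ann (F ∙ a) → d ∈ (F ∙ a) := by
    intro a ha hle
    have := Submodule.eq_of_le_of_finrank_eq hle
      (by rw [finrank_ann_span_singleton hd, finrank_ann_span_singleton ha])
    rw [← ann_ann (F ∙ a), ← this, ann_ann]
    exact Submodule.mem_span_singleton_self d
  constructor
  · intro hc
    have := h.of_kerSpace hc
    rw [kerE_self, kerE_self] at this
    exact this.imp (hle a h.2.1) (hle b h.2.2.1)
  · intro hd'
    rw [mem_ann]
    intro y hy
    have hy' := h.map_dotProduct y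
    simp only [Algebra.algebraMap_self, RingHom.id_apply] at hy'
    rw [hy']
    have hz : bil y a b = 0 := by
      rcases hd' with hd' | hd' <;> obtain ⟨t, rfl⟩ := Submodule.mem_span_singleton.1 hd'
      · have := hy b
        have ht : t ≠ 0 := by rintro rfl; simp at hd
        have h2 : bil y (t • a) b = t * bil y a b := by
          rw [bil_eq, bil_eq]; simp; ring
        rw [h2] at this
        exact (mul_eq_zero.1 this).resolve_left ht
      · have := hy a
        have ht : t ≠ 0 := by rintro rfl; simp at hd
        have h2 : bil y (t • b) a = t * bil y a b := by
          rw [bil_eq, bil_eq]; simp; ring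
        rw [h2] at this
        exact (mul_eq_zero.1 this).resolve_left ht
    rw [hz, mul_zero]

theorem isDoubleLine_iff {c : Fin 6 → F} : IsDoubleLine (formOf c) ↔
    ∃ (k : F) (a : Fin 3 → F), k ≠ 0 ∧ a ≠ 0 ∧ c = k • prodCoords a a := by
  refine exists_congr fun k => exists_congr fun a => and_congr_right fun _ => and_congr_right fun _ => ?_
  rw [pow_two, linForm_mul_linForm, ← MvPolynomial.smul_eq_C_mul, ← formOf_smul,
    formOf_injective.eq_iff]

theorem isRealLinePair_iff {c : Fin 6 → F} : IsRealLinePair (formOf c) ↔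
    ∃ a b : Fin 3 → F, LinearIndependent F ![a, b] ∧ c = prodCoords a b := by
  refine exists_congr fun a => exists_congr fun b => and_congr_right fun _ => ?_
  rw [linForm_mul_linForm, formOf_injective.eq_iff]

theorem map_formOf {E : Type u} [Field E] [Algebra F E] (c : Fin 6 → F) :
    map (algebraMap F E) (formOf c) = formOf (fun i => algebraMap F E (c i)) := by
  simp [formOf]

theorem isImaginaryLinePair_iff {c : Fin 6 → F} : IsImaginaryLinePair (formOf c) ↔
    ∃ (E : Type u) (_ : Field E) (_ : Algebra F E) (s : E ≃ₐ[F] E),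
      Module.finrank F E = 2 ∧ s ≠ AlgEquiv.refl ∧
      ∃ (k : F) (a : Fin 3 → E), k ≠ 0 ∧ LinearIndependent E ![a, fun i => s (a i)] ∧
        FactorsAs c (algebraMap F E k) a (fun i => s (a i)) := by
  refine exists_congr fun E => exists_congr fun _ => exists_congr fun _ => exists_congr fun s =>
    and_congr_right fun _ => and_congr_right fun _ => exists_congr fun k => exists_congr fun a =>
    and_congr_right fun hk => and_congr_right fun hi => ?_
  rw [map_formOf, mul_assoc, linForm_mul_linForm, ← MvPolynomial.smul_eq_C_mul, ← formOf_smul,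
    formOf_injective.eq_iff, FactorsAs, funext_iff]
  have h0 : a ≠ 0 := hi.ne_zero 0
  have h1 : (fun i => s (a i)) ≠ 0 := hi.ne_zero 1
  simp [hk, h0, h1]

section Weights

variable [Finite F]

theorem weights_doubleLine {c : Fin 6 → F} (h : IsDoubleLine (formOf c)) :
    zeroCount c + 1 = Nat.card F ^ 2 ∧ singCount c + 1 = Nat.card F ^ 2 ∧
      factorCount c + 1 = Nat.card F := by
  obtain ⟨k, a, hk, ha, rfl⟩ := isDoubleLine_iff.1 h
  have hf := factorsAs_self hk ha ha rfl
  have h2 := ncard_ne_zero_mem (ann (F ∙ a))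
  have h3 := ncard_ne_zero_mem (F ∙ a)
  rw [finrank_ann_span_singleton ha] at h2
  rw [finrank_span_singleton ha, pow_one] at h3
  refine ⟨?_, ?_, ?_⟩
  · rw [← h2, zeroCount]
    simp only [hf.veronese_iff, kerE_self, or_self]
  · rw [← h2, singCount]
    simp only [hf.tangentSpace_iff, kerE_self, and_self]
  · rw [← h3, factorCount]
    congr 2
    ext d
    exact and_congr_right fun hd => by rw [hf.kerSpace_iff hd, or_self]

theorem weights_realLinePair {c : Fin 6 → F} (h : IsRealLinePair (formOf c)) :
    zeroCount c + Nat.card F + 1 = 2 * Nat.card F ^ 2 ∧ singCount c + 1 = Nat.card F ∧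
      factorCount c + 2 = 2 * Nat.card F := by
  obtain ⟨a, b, hi, rfl⟩ := isRealLinePair_iff.1 h
  have ha : a ≠ 0 := hi.ne_zero 0
  have hb : b ≠ 0 := hi.ne_zero 1
  have hf : FactorsAs (E := F) (prodCoords a b) 1 a b :=
    factorsAs_self one_ne_zero ha hb (one_smul _ _).symm
  have h2 := ncard_ne_zero_mem (ann (F ∙ a))
  have h2' := ncard_ne_zero_mem (ann (F ∙ b))
  have h3 := ncard_ne_zero_mem (F ∙ a)
  have h3' := ncard_ne_zero_mem (F ∙ b)
  have h4 := ncard_ne_zero_mem (ann (Submodule.span F {a, b}))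
  rw [finrank_ann_span_singleton ha] at h2
  rw [finrank_ann_span_singleton hb] at h2'
  rw [finrank_span_singleton ha, pow_one] at h3
  rw [finrank_span_singleton hb, pow_one] at h3'
  rw [finrank_ann, finrank_span_pair hi, pow_one] at h4
  have hset : {v : Fin 3 → F | v ≠ 0 ∧ v ∈ ann (Submodule.span F {a, b})} =
      {v | v ≠ 0 ∧ v ∈ ann (F ∙ a)} ∩ {v | v ≠ 0 ∧ v ∈ ann (F ∙ b)} := by
    ext v
    simp only [Set.mem_inter_iff, Set.mem_ofPred_eq, mem_ann_span_singleton, mem_ann_span_pair]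
    tauto
  refine ⟨?_, ?_, ?_⟩
  · have hset2 : {v : Fin 3 → F | v ≠ 0 ∧ prodCoords a b ⬝ᵥ veronese v = 0} =
        {v | v ≠ 0 ∧ v ∈ ann (F ∙ a)} ∪ {v | v ≠ 0 ∧ v ∈ ann (F ∙ b)} := by
      ext v
      simp only [Set.mem_union, Set.mem_ofPred_eq, hf.veronese_iff, kerE_self]
      tauto
    have := Set.ncard_union_add_ncard_inter {v | v ≠ 0 ∧ v ∈ ann (F ∙ a)}
      {v | v ≠ 0 ∧ v ∈ ann (F ∙ b)}
    rw [← hset2, ← hset] at this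
    rw [zeroCount]
    omega
  · rw [singCount, ← h4]
    congr 2
    ext v
    simp only [Set.mem_ofPred_eq, hf.tangentSpace_iff, kerE_self, mem_ann_span_singleton,
      mem_ann_span_pair]
  · have hset2 : {v : Fin 3 → F | v ≠ 0 ∧ prodCoords a b ∈ ann (kerSpace v)} =
        {v | v ≠ 0 ∧ v ∈ F ∙ a} ∪ {v | v ≠ 0 ∧ v ∈ F ∙ b} := by
      ext v
      simp only [Set.mem_union, Set.mem_ofPred_eq, ← and_or_left]
      exact and_congr_right fun hd => hf.kerSpace_iff hd
    rw [factorCount, hset2, Set.ncard_union_eq]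
    · omega
    · rw [Set.disjoint_left]
      rintro v ⟨hv, hva⟩ ⟨_, hvb⟩
      obtain ⟨r, rfl⟩ := Submodule.mem_span_singleton.1 hva
      obtain ⟨t, ht⟩ := Submodule.mem_span_singleton.1 hvb
      have := (LinearIndependent.pair_iff.1 hi r (-t) (by rw [neg_smul, ht, add_neg_cancel])).1
      exact hv (by rw [this, zero_smul])

/-- A linear form over a quadratic extension that is independent of its conjugate vanishes at exactly
one rational point. -/
theorem finrank_kerE {E : Type u} [Field E] [Algebra F E] (s : E ≃ₐ[F] E)
    (hE : Module.finrank F E = 2) {a : Fin 3 → E}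
    (hi : LinearIndependent E ![a, fun i => s (a i)]) : Module.finrank F (kerE F a) = 1 := by
  let T : (Fin 3 → F) →ₗ[F] E :=
    { toFun := evalE a
      map_add' := fun v w => by simp [evalE, Fin.sum_univ_three]; ring
      map_smul' := fun c v => by simp [evalE, Fin.sum_univ_three, Algebra.smul_def]; ring }
  have hker : LinearMap.ker T = kerE F a := rfl
  have hsum := LinearMap.finrank_range_add_finrank_ker T
  rw [hker, Module.finrank_fin_fun] at hsum
  have : Module.Finite F E := Module.finite_of_finrank_pos (by omega)
  have hle : Module.finrank F (LinearMap.range T) ≤ 2 := hE ▸ Submodule.finrank_le _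
  have hge : ¬ Module.finrank F (LinearMap.range T) ≤ 1 := by
    intro h1
    obtain ⟨e, he⟩ := finrank_le_one_iff.1 h1
    have hmem : ∀ i, ∃ r : F, a i = algebraMap F E r * e := by
      intro i
      obtain ⟨r, hr⟩ := he ⟨T (Pi.single i 1), LinearMap.mem_range_self _ _⟩
      refine ⟨r, ?_⟩
      have := congrArg Subtype.val hr
      rw [Submodule.coe_smul, Algebra.smul_def] at this
      rw [this]
      change a i = evalE a (Pi.single i 1)
      simp only [evalE, Pi.single_apply, apply_ite (algebraMap F E), map_one, map_zero, mul_ite,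
        mul_one, mul_zero, Finset.sum_ite_eq', Finset.mem_univ, if_true]
    choose r hr using hmem
    have := (LinearIndependent.pair_iff.1 hi (s e) (-e) (by
      ext i
      simp only [Pi.add_apply, Pi.smul_apply, smul_eq_mul, Pi.zero_apply, hr, map_mul,
        AlgEquiv.commutes]
      ring)).2
    have he0 : (e : E) = 0 := neg_eq_zero.1 this
    apply hi.ne_zero 0
    ext i
    simp [hr, he0]
  omega

theorem weights_imaginaryLinePair {c : Fin 6 → F} (h : IsImaginaryLinePair (formOf c)) :
    zeroCount c + 1 = Nat.card F ∧ singCount c + 1 = Nat.card F ∧ factorCount c = 0 := by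
  obtain ⟨E, _, _, s, hE, hs, k, a, hk, hi, hf⟩ := isImaginaryLinePair_iff.1 h
  have hfin := finrank_kerE s hE hi
  have hker : kerE F (fun i => s (a i)) = kerE F a := by
    ext v
    have hev : evalE (fun i => s (a i)) v = s (evalE a v) := by
      simp [evalE]
    rw [mem_kerE, mem_kerE, hev]
    exact map_eq_zero_iff s s.injective
  have h2 := ncard_ne_zero_mem (kerE F a)
  rw [hfin, pow_one] at h2
  refine ⟨?_, ?_, ?_⟩
  · rw [← h2, zeroCount]
    simp only [hf.veronese_iff, hker, or_self]
  · rw [← h2, singCount]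
    simp only [hf.tangentSpace_iff, hker, and_self]
  · rw [factorCount, Set.ncard_eq_zero (Set.toFinite _), Set.eq_empty_iff_forall_notMem]
    rintro d ⟨hd, hd'⟩
    have h3 := hf.of_kerSpace hd'
    rw [hker, or_self] at h3
    have h4 := Submodule.finrank_mono h3
    rw [hfin, finrank_ann_span_singleton hd] at h4
    omega

end Weights

/-- The discriminant in terms of coordinates. -/
def discCoords (c : Fin 6 → F) : F :=
  4 * c 0 * c 3 * c 5 + c 1 * c 2 * c 4 - c 0 * c 4 ^ 2 - c 3 * c 2 ^ 2 - c 5 * c 1 ^ 2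

theorem disc_formOf (c : Fin 6 → F) : disc (formOf c) = discCoords c := by
  have h := formCoords_formOf c
  have h' := fun i => congrFun h i
  have h0 := h' 0; have h1 := h' 1; have h2 := h' 2
  have h3 := h' 3; have h4 := h' 4; have h5 := h' 5
  simp [formCoords] at h0 h1 h2 h3 h4 h5
  rw [disc, discCoords, h0, h1, h2, h3, h4, h5]

theorem isNonsingular_iff {c : Fin 6 → F} : IsNonsingular (formOf c) ↔ discCoords c ≠ 0 := by
  rw [IsNonsingular, disc_formOf]; exact and_iff_right (formOf_mem c)

theorem mem_ann_tangentSpace {c : Fin 6 → F} {v : Fin 3 → F} :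
    c ∈ ann (tangentSpace v) ↔ c ⬝ᵥ veronese v = 0 ∧ ∀ w, c ⬝ᵥ symProd v w = 0 := by
  rw [mem_ann]
  constructor
  · intro h
    refine ⟨?_, fun w => h _ ⟨w, 0, by simp⟩⟩
    have h0 : symProd v (0 : Fin 3 → F) = 0 := by
      ext i; fin_cases i <;> simp [symProd]
    exact h _ ⟨0, 1, by simp [h0]⟩
  · rintro ⟨h1, h2⟩ _ ⟨w, k, rfl⟩
    rw [dotProduct_add, dotProduct_smul, h1, h2, smul_zero, add_zero]

theorem ann_tangentSpace_coords {c : Fin 6 → F} {v : Fin 3 → F}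
    (h : c ∈ ann (tangentSpace v)) :
    2 * c 0 * v 0 + c 1 * v 1 + c 2 * v 2 = 0 ∧ c 1 * v 0 + 2 * c 3 * v 1 + c 4 * v 2 = 0 ∧
      c 2 * v 0 + c 4 * v 1 + 2 * c 5 * v 2 = 0 ∧
      c 0 * v 0 ^ 2 + c 1 * (v 0 * v 1) + c 2 * (v 0 * v 2) + c 3 * v 1 ^ 2 + c 4 * (v 1 * v 2)
        + c 5 * v 2 ^ 2 = 0 := by
  obtain ⟨h1, h2⟩ := mem_ann_tangentSpace.1 h
  have e0 := h2 (Pi.single 0 1)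
  have e1 := h2 (Pi.single 1 1)
  have e2 := h2 (Pi.single 2 1)
  simp [dotProduct, Fin.sum_univ_six, symProd, veronese] at h1 e0 e1 e2
  exact ⟨by linear_combination e0, by linear_combination e1, by linear_combination e2, h1⟩

/-- If the form has a singular vector with, say, `v 0 ≠ 0`, then the equations for a singular
vector express three coefficients through the others, and the discriminant vanishes identically. -/
theorem discCoords_eq_zero_of_singular {c : Fin 6 → F} {v : Fin 3 → F} (hv : v ≠ 0)
    (h : c ∈ ann (tangentSpace v)) : discCoords c = 0 := by
  obtain ⟨e0, e1, e2, e⟩ := ann_tangentSpace_coords h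
  have hex : v 0 ≠ 0 ∨ v 1 ≠ 0 ∨ v 2 ≠ 0 := by
    by_contra hcon
    push Not at hcon
    exact hv (by ext i; fin_cases i <;> simp [hcon])
  rcases hex with hi | hi | hi
  · have c1 : c 1 = -(2 * c 3 * (v 1 / v 0) + c 4 * (v 2 / v 0)) := by
      field_simp; linear_combination e1
    have c2 : c 2 = -(c 4 * (v 1 / v 0) + 2 * c 5 * (v 2 / v 0)) := by
      field_simp; linear_combination e2
    have c0 : c 0 = -(c 1 * (v 1 / v 0) + c 2 * (v 2 / v 0) + c 3 * (v 1 / v 0) ^ 2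
        + c 4 * (v 1 / v 0) * (v 2 / v 0) + c 5 * (v 2 / v 0) ^ 2) := by
      field_simp; linear_combination e
    rw [discCoords, c0, c1, c2]; ring
  · have c1 : c 1 = -(2 * c 0 * (v 0 / v 1) + c 2 * (v 2 / v 1)) := by
      field_simp; linear_combination e0
    have c4 : c 4 = -(c 2 * (v 0 / v 1) + 2 * c 5 * (v 2 / v 1)) := by
      field_simp; linear_combination e2
    have c3 : c 3 = -(c 1 * (v 0 / v 1) + c 4 * (v 2 / v 1) + c 0 * (v 0 / v 1) ^ 2
        + c 2 * (v 0 / v 1) * (v 2 / v 1) + c 5 * (v 2 / v 1) ^ 2) := by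
      field_simp; linear_combination e
    rw [discCoords, c3, c1, c4]; ring
  · have c2 : c 2 = -(2 * c 0 * (v 0 / v 2) + c 1 * (v 1 / v 2)) := by
      field_simp; linear_combination e0
    have c4 : c 4 = -(c 1 * (v 0 / v 2) + 2 * c 3 * (v 1 / v 2)) := by
      field_simp; linear_combination e1
    have c5 : c 5 = -(c 2 * (v 0 / v 2) + c 4 * (v 1 / v 2) + c 0 * (v 0 / v 2) ^ 2
        + c 1 * (v 0 / v 2) * (v 1 / v 2) + c 3 * (v 1 / v 2) ^ 2) := by
      field_simp; linear_combination e
    rw [discCoords, c5, c2, c4]; ring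

theorem discCoords_eq_zero_of_factor {c : Fin 6 → F} {a : Fin 3 → F} (ha : a ≠ 0)
    (h : c ∈ ann (kerSpace a)) : discCoords c = 0 := by
  have hver : ∀ v : Fin 3 → F, a ⬝ᵥ v = 0 → c ⬝ᵥ veronese v = 0 := by
    intro v hv
    refine mem_ann.1 h _ fun b => ?_
    rw [bil_veronese, hv, zero_mul]
  have hs : ∀ v w : Fin 3 → F, a ⬝ᵥ v = 0 → a ⬝ᵥ w = 0 → c ⬝ᵥ symProd v w = 0 := by
    intro v w hv hw
    refine mem_ann.1 h _ fun b => ?_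
    rw [bil_symProd, hv, hw]; ring
  have hex : a 0 ≠ 0 ∨ a 1 ≠ 0 ∨ a 2 ≠ 0 := by
    by_contra hcon
    push Not at hcon
    exact ha (by ext i; fin_cases i <;> simp [hcon])
  rcases hex with hi | hi | hi
  · have h1 : a ⬝ᵥ ![-(a 1 / a 0), 1, 0] = 0 := by
      simp [dotProduct, Fin.sum_univ_three]; field_simp; ring
    have h2 : a ⬝ᵥ ![-(a 2 / a 0), 0, 1] = 0 := by
      simp [dotProduct, Fin.sum_univ_three]; field_simp; ring
    have e1 := hver _ h1; have e2 := hver _ h2; have e3 := hs _ _ h1 h2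
    simp [dotProduct, Fin.sum_univ_six, veronese, symProd] at e1 e2 e3
    generalize a 1 / a 0 = s at *
    generalize a 2 / a 0 = t at *
    have c3 : c 3 = c 1 * s - c 0 * s ^ 2 := by linear_combination e1
    have c5 : c 5 = c 2 * t - c 0 * t ^ 2 := by linear_combination e2
    have c4 : c 4 = c 1 * t + c 2 * s - 2 * c 0 * s * t := by linear_combination e3
    rw [discCoords, c3, c4, c5]; ring
  · have h1 : a ⬝ᵥ ![1, -(a 0 / a 1), 0] = 0 := by
      simp [dotProduct, Fin.sum_univ_three]; field_simp; ring
    have h2 : a ⬝ᵥ ![0, -(a 2 / a 1), 1] = 0 := by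
      simp [dotProduct, Fin.sum_univ_three]; field_simp; ring
    have e1 := hver _ h1; have e2 := hver _ h2; have e3 := hs _ _ h1 h2
    simp [dotProduct, Fin.sum_univ_six, veronese, symProd] at e1 e2 e3
    generalize a 0 / a 1 = s at *
    generalize a 2 / a 1 = t at *
    have c0 : c 0 = c 1 * s - c 3 * s ^ 2 := by linear_combination e1
    have c5 : c 5 = c 4 * t - c 3 * t ^ 2 := by linear_combination e2
    have c2 : c 2 = c 1 * t + c 4 * s - 2 * c 3 * s * t := by linear_combination e3
    rw [discCoords, c0, c2, c5]; ring
  · have h1 : a ⬝ᵥ ![1, 0, -(a 0 / a 2)] = 0 := by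
      simp [dotProduct, Fin.sum_univ_three]; field_simp; ring
    have h2 : a ⬝ᵥ ![0, 1, -(a 1 / a 2)] = 0 := by
      simp [dotProduct, Fin.sum_univ_three]; field_simp; ring
    have e1 := hver _ h1; have e2 := hver _ h2; have e3 := hs _ _ h1 h2
    simp [dotProduct, Fin.sum_univ_six, veronese, symProd] at e1 e2 e3
    generalize a 0 / a 2 = s at *
    generalize a 1 / a 2 = t at *
    have c0 : c 0 = c 2 * s - c 5 * s ^ 2 := by linear_combination e1
    have c3 : c 3 = c 4 * t - c 5 * t ^ 2 := by linear_combination e2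
    have c1 : c 1 = c 2 * t + c 4 * s - 2 * c 5 * s * t := by linear_combination e3
    rw [discCoords, c0, c1, c3]; ring

/-- Every ternary quadratic form over a finite field has a nontrivial zero. -/
theorem exists_zero [Finite F] (c : Fin 6 → F) : ∃ v : Fin 3 → F, v ≠ 0 ∧ c ⬝ᵥ veronese v = 0 := by
  classical
  have := Fintype.ofFinite F
  obtain ⟨p, hp⟩ := CharP.exists F
  have hdeg : (formOf c).totalDegree < Fintype.card (Fin 3) := by
    have : (formOf c).totalDegree ≤ 2 :=
      ((mem_homogeneousSubmodule 2 _).1 (formOf_mem c)).totalDegree_le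
    simp; omega
  have hev : ∀ v : Fin 3 → F, eval v (formOf c) = c ⬝ᵥ veronese v := by
    intro v
    simp [formOf, dotProduct, Fin.sum_univ_six, veronese]; ring
  have hdvd := char_dvd_card_solutions p hdeg
  have hprime : p.Prime := CharP.char_is_prime F p
  have h1 : 1 < Fintype.card {x : Fin 3 → F // eval x (formOf c) = 0} := by
    refine lt_of_lt_of_le hprime.one_lt (Nat.le_of_dvd ?_ hdvd)
    exact Fintype.card_pos_iff.2 ⟨⟨0, by rw [hev]; simp [dotProduct, Fin.sum_univ_six, veronese]⟩⟩
  obtain ⟨⟨x, hx⟩, hne⟩ := Fintype.exists_ne_of_one_lt_card h1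
    ⟨0, by rw [hev]; simp [dotProduct, Fin.sum_univ_six, veronese]⟩
  refine ⟨x, fun h0 => hne (Subtype.ext h0), by rw [← hev]; exact hx⟩

theorem dotProduct_veronese_add (c : Fin 6 → F) (v w : Fin 3 → F) (t : F) :
    c ⬝ᵥ veronese (w + t • v)
      = c ⬝ᵥ veronese w + t * (c ⬝ᵥ symProd v w) + t ^ 2 * (c ⬝ᵥ veronese v) := by
  simp [dotProduct, Fin.sum_univ_six, veronese, symProd]; ring

/-- The polar form of the quadratic form with coordinates `c` at `v`. -/
def polarVec (c : Fin 6 → F) (v : Fin 3 → F) : Fin 3 → F :=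
  ![2 * c 0 * v 0 + c 1 * v 1 + c 2 * v 2, c 1 * v 0 + 2 * c 3 * v 1 + c 4 * v 2,
    c 2 * v 0 + c 4 * v 1 + 2 * c 5 * v 2]

theorem dotProduct_symProd (c : Fin 6 → F) (v w : Fin 3 → F) :
    c ⬝ᵥ symProd v w = polarVec c v ⬝ᵥ w := by
  simp [dotProduct, Fin.sum_univ_six, Fin.sum_univ_three, symProd, polarVec]; ring

theorem symProd_self (c : Fin 6 → F) (v : Fin 3 → F) :
    c ⬝ᵥ symProd v v = 2 * (c ⬝ᵥ veronese v) := by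
  simp [dotProduct, Fin.sum_univ_six, symProd, veronese]; ring

/-- A non-singular conic has `q + 1` points: the lines through one of its points other than the
tangent meet it in exactly one further point. -/
theorem weights_nonsingular [Finite F] {c : Fin 6 → F} (h : IsNonsingular (formOf c)) :
    zeroCount c + 1 = Nat.card F ^ 2 ∧ singCount c = 0 ∧ factorCount c = 0 := by
  rw [isNonsingular_iff] at h
  refine ⟨?_, ?_, ?_⟩
  · obtain ⟨v, hv, hfv⟩ := exists_zero c
    set d := polarVec c v with hd
    have hd0 : d ≠ 0 := by
      intro h0
      refine h (discCoords_eq_zero_of_singular hv (mem_ann_tangentSpace.2 ⟨hfv, fun w => ?_⟩))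
      rw [dotProduct_symProd, ← hd, h0, zero_dotProduct]
    have hdv : d ⬝ᵥ v = 0 := by
      rw [hd, ← dotProduct_symProd, symProd_self, hfv, mul_zero]
    have hline : ∀ w, d ⬝ᵥ w = 0 → c ⬝ᵥ veronese w = 0 → w ∈ (F ∙ v) := by
      intro w hw hfw
      by_contra hnot
      have hi : LinearIndependent F ![v, w] := by
        rw [LinearIndependent.pair_iff' hv]
        intro a ha
        exact hnot (Submodule.mem_span_singleton.2 ⟨a, ha⟩)
      refine h (discCoords_eq_zero_of_factor hd0 (mem_ann.2 fun y hy => ?_))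
      obtain ⟨r, s, t, rfl⟩ := exists_of_mem_kerSpace hd0 hi hdv hw hy
      rw [dotProduct_add, dotProduct_add, dotProduct_smul, dotProduct_smul, dotProduct_smul, hfv,
        hfw, dotProduct_symProd, ← hd, hw]
      simp
    let B : Set (Fin 3 → F) := {w | d ⬝ᵥ w ≠ 0 ∧ c ⬝ᵥ veronese w = 0}
    have hunion : {w : Fin 3 → F | w ≠ 0 ∧ c ⬝ᵥ veronese w = 0} = {w | w ≠ 0 ∧ w ∈ F ∙ v} ∪ B := by
      ext w
      simp only [Set.mem_union, Set.mem_ofPred_eq, B]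
      constructor
      · rintro ⟨hw, hfw⟩
        by_cases hdw : d ⬝ᵥ w = 0
        · exact Or.inl ⟨hw, hline w hdw hfw⟩
        · exact Or.inr ⟨hdw, hfw⟩
      · rintro (⟨hw, hwv⟩ | ⟨hdw, hfw⟩)
        · refine ⟨hw, ?_⟩
          obtain ⟨t, rfl⟩ := Submodule.mem_span_singleton.1 hwv
          have := dotProduct_veronese_add c v 0 t
          rw [zero_add] at this
          rw [this, hfv, dotProduct_symProd, dotProduct_zero]
          simp [dotProduct, Fin.sum_univ_six, veronese]
        · exact ⟨fun h0 => hdw (by rw [h0, dotProduct_zero]), hfw⟩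
    have hdisj : Disjoint {w | w ≠ 0 ∧ w ∈ F ∙ v} B := by
      rw [Set.disjoint_left]
      rintro w ⟨_, hwv⟩ ⟨hdw, _⟩
      obtain ⟨t, rfl⟩ := Submodule.mem_span_singleton.1 hwv
      exact hdw (by rw [dotProduct_smul, hdv, smul_zero])
    have hB : B.ncard * Nat.card F = {w : Fin 3 → F | d ⬝ᵥ w ≠ 0}.ncard := by
      rw [← Nat.card_coe_set_eq, ← Nat.card_coe_set_eq, ← Nat.card_prod]
      have hp : ∀ (w : Fin 3 → F) (t : F), d ⬝ᵥ (w + t • v) = d ⬝ᵥ w := fun w t => by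
        rw [dotProduct_add, dotProduct_smul, hdv, smul_zero, add_zero]
      refine Nat.card_eq_of_bijective (fun x : B × F =>
        (⟨x.1.1 + x.2 • v, by rw [Set.mem_ofPred_eq, hp]; exact x.1.2.1⟩ :
          {w : Fin 3 → F | d ⬝ᵥ w ≠ 0})) ⟨?_, ?_⟩
      · rintro ⟨⟨w, hw⟩, t⟩ ⟨⟨w', hw'⟩, t'⟩ heq
        simp only [Subtype.mk.injEq] at heq
        have hw2 : w' = w + (t - t') • v := by
          rw [sub_smul, ← add_sub_assoc, heq, add_sub_cancel_right]
        have h3 := dotProduct_veronese_add c v w (t - t')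
        rw [← hw2, hw.2, hw'.2, hfv, dotProduct_symProd, ← hd, mul_zero, add_zero, zero_add] at h3
        have h4 := (mul_eq_zero.1 h3.symm).resolve_right hw.1
        rw [h4, zero_smul, add_zero] at hw2
        rw [sub_eq_zero] at h4
        subst hw2 h4
        rfl
      · rintro ⟨u, hu⟩
        have hu' : d ⬝ᵥ u ≠ 0 := hu
        set t := (c ⬝ᵥ veronese u) / (d ⬝ᵥ u) with ht
        have h3 := dotProduct_veronese_add c v u (-t)
        rw [hfv, dotProduct_symProd, ← hd, mul_zero, add_zero, ht, neg_mul, div_mul_cancel₀ _ hu',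
          add_neg_cancel] at h3
        refine ⟨⟨⟨u + (-t) • v, ?_, h3⟩, t⟩, ?_⟩
        · rw [hp]; exact hu
        · simp
    have hcompl : {w : Fin 3 → F | d ⬝ᵥ w ≠ 0}.ncard + Nat.card F ^ 2 = Nat.card F ^ 3 := by
      have h1 : {w : Fin 3 → F | d ⬝ᵥ w ≠ 0} = ((ann (F ∙ d) : Submodule F _) : Set (Fin 3 → F))ᶜ := by
        ext w
        rw [Set.mem_compl_iff, SetLike.mem_coe, mem_ann_span_singleton]; rfl
      have h2 := Set.ncard_add_ncard_compl ((ann (F ∙ d) : Submodule F _) : Set (Fin 3 → F))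
      have h3 : ((ann (F ∙ d) : Submodule F _) : Set (Fin 3 → F)).ncard = Nat.card F ^ 2 := by
        rw [← finrank_ann_span_singleton hd0, ← Module.natCard_eq_pow_finrank]; rfl
      rw [h3, ← h1, Nat.card_fun, Nat.card_fin] at h2
      omega
    have hq := ncard_ne_zero_mem (F ∙ v)
    rw [finrank_span_singleton hv, pow_one] at hq
    rw [zeroCount, hunion, Set.ncard_union_eq hdisj]
    have hpos : 0 < Nat.card F := Nat.card_pos
    have hBq : B.ncard + Nat.card F = Nat.card F ^ 2 := by
      apply Nat.eq_of_mul_eq_mul_right hpos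
      rw [add_mul, hB, ← pow_succ, ← hcompl]; ring
    omega
  · rw [singCount, Set.ncard_eq_zero (Set.toFinite _), Set.eq_empty_iff_forall_notMem]
    rintro v ⟨hv, hc⟩
    exact h (discCoords_eq_zero_of_singular hv hc)
  · rw [factorCount, Set.ncard_eq_zero (Set.toFinite _), Set.eq_empty_iff_forall_notMem]
    rintro v ⟨hv, hc⟩
    exact h (discCoords_eq_zero_of_factor hv hc)

/-! ### Every conic is of one of the four kinds -/

/-- A quadratic polynomial without roots over a finite field splits over a quadratic extension,
with distinct conjugate roots. -/
theorem exists_quadratic_extension [Finite F] (b c : F) (h : ∀ t : F, t ^ 2 + b * t + c ≠ 0) :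
    ∃ (E : Type u) (_ : Field E) (_ : Algebra F E) (s : E ≃ₐ[F] E) (θ : E),
      Module.finrank F E = 2 ∧ s ≠ AlgEquiv.refl ∧ s θ ≠ θ ∧ θ + s θ = -algebraMap F E b ∧
        θ * s θ = algebraMap F E c := by
  have := Fintype.ofFinite F
  let p : Polynomial F := Polynomial.X ^ 2 + Polynomial.C b * Polynomial.X + Polynomial.C c
  have hdeg : p.natDegree = 2 := by
    simp only [p]; compute_degree!
  have hmonic : p.Monic := by
    simp only [p]; monicity!
  have hirr : Irreducible p := by
    rw [hmonic.irreducible_iff_roots_eq_zero_of_degree_le_three (by omega) (by omega),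
      Multiset.eq_zero_iff_forall_notMem]
    intro t ht
    have := (Polynomial.mem_roots'.1 ht).2
    simp [p, Polynomial.IsRoot] at this
    exact h t this
  have := Fact.mk hirr
  have hfin : Module.finrank F (AdjoinRoot p) = 2 := by
    rw [(AdjoinRoot.powerBasis hirr.ne_zero).finrank, AdjoinRoot.powerBasis_dim, hdeg]
  have : Module.Finite F (AdjoinRoot p) := Module.finite_of_finrank_pos (by omega)
  have : Finite (AdjoinRoot p) := Module.finite_of_finite F
  let s := FiniteField.frobeniusAlgEquivOfAlgebraic F (AdjoinRoot p)
  have hs : s ≠ AlgEquiv.refl := by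
    intro h1
    have h2 := FiniteField.orderOf_frobeniusAlgEquivOfAlgebraic F (AdjoinRoot p)
    rw [hfin] at h2
    change orderOf s = 2 at h2
    rw [h1] at h2
    have h3 : orderOf (1 : AdjoinRoot p ≃ₐ[F] AdjoinRoot p) = 1 := orderOf_one
    exact absurd (h3.symm.trans h2) (by norm_num)
  have hroot : (AdjoinRoot.root p) ^ 2 + algebraMap F _ b * AdjoinRoot.root p
      + algebraMap F _ c = 0 := by
    have := AdjoinRoot.eval₂_root p
    simpa [p] using this
  have hroot' : (s (AdjoinRoot.root p)) ^ 2 + algebraMap F _ b * s (AdjoinRoot.root p)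
      + algebraMap F _ c = 0 := by
    have := congrArg s hroot
    simpa only [map_add, map_mul, map_pow, AlgEquiv.commutes, map_zero] using this
  have hne : s (AdjoinRoot.root p) ≠ AdjoinRoot.root p := by
    intro h1
    apply hs
    have h2 : (s : AdjoinRoot p →ₐ[F] AdjoinRoot p) = AlgHom.id F _ :=
      AdjoinRoot.algHom_ext (by simpa using h1)
    ext x
    exact DFunLike.congr_fun h2 x
  have hsum : AdjoinRoot.root p + s (AdjoinRoot.root p) = -algebraMap F _ b := by
    have : (s (AdjoinRoot.root p) - AdjoinRoot.root p)
        * (AdjoinRoot.root p + s (AdjoinRoot.root p) + algebraMap F _ b) = 0 := by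
      linear_combination hroot' - hroot
    rcases mul_eq_zero.1 this with h1 | h1
    · exact absurd (sub_eq_zero.1 h1) hne
    · linear_combination h1
  exact ⟨AdjoinRoot p, inferInstance, inferInstance, s, AdjoinRoot.root p, hfin, hs, hne, hsum, by
    linear_combination (AdjoinRoot.root p) * hsum - hroot⟩

theorem prodCoords_combination {R : Type u} [Field R] (a b : Fin 3 → R) (r s t u : R) :
    prodCoords (r • a + s • b) (t • a + u • b) = (r * t) • prodCoords a a
      + (r * u + s * t) • prodCoords a b + (s * u) • prodCoords b b := by
  ext i; fin_cases i <;> simp [prodCoords] <;> ring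

theorem linearIndependent_combination {a b : Fin 3 → F} (h : LinearIndependent F ![a, b])
    {r s t u : F} (hd : r * u - s * t ≠ 0) :
    LinearIndependent F ![r • a + s • b, t • a + u • b] := by
  rw [LinearIndependent.pair_iff] at h ⊢
  intro x y hxy
  obtain ⟨h1, h2⟩ := h (x * r + y * t) (x * s + y * u) (by rw [← hxy]; module)
  constructor
  · have : x * (r * u - s * t) = 0 := by linear_combination u * h1 - t * h2
    exact (mul_eq_zero.1 this).resolve_right hd
  · have : y * (r * u - s * t) = 0 := by linear_combination r * h2 - s * h1
    exact (mul_eq_zero.1 this).resolve_right hd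

/-- A singular form, written as a binary form in two independent linear forms. -/
theorem kind_of_binary [Finite F] {a b : Fin 3 → F} (h : LinearIndependent F ![a, b]) {p q r : F}
    (hne : ¬ (p = 0 ∧ q = 0 ∧ r = 0)) {c : Fin 6 → F}
    (hc : c = p • prodCoords a a + q • prodCoords a b + r • prodCoords b b) :
    IsDoubleLine (formOf c) ∨ IsRealLinePair (formOf c) ∨ IsImaginaryLinePair (formOf c) := by
  have hdl := @isDoubleLine_iff F _ c
  have hrp := @isRealLinePair_iff F _ c
  by_cases hp : p = 0
  · by_cases hq : q = 0
    · have hr : r ≠ 0 := fun hr => hne ⟨hp, hq, hr⟩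
      refine Or.inl (hdl.2 ⟨r, b, hr, h.ne_zero 1, ?_⟩)
      rw [hc, hp, hq]; simp
    · refine Or.inr (Or.inl (hrp.2 ⟨(0 : F) • a + (1 : F) • b, q • a + r • b,
        linearIndependent_combination h (by simpa using hq), ?_⟩))
      rw [hc, prodCoords_combination, hp]; simp
  · by_cases hroot : ∃ t : F, p * t ^ 2 + q * t + r = 0
    · obtain ⟨t, ht⟩ := hroot
      by_cases hd : q + 2 * p * t = 0
      · refine Or.inl (hdl.2 ⟨p, (1 : F) • a + (-t) • b, hp, ?_, ?_⟩)
        · have := linearIndependent_combination h (r := 1) (s := -t) (t := 0) (u := 1) (by simp)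
          exact this.ne_zero 0
        · rw [hc, prodCoords_combination, smul_add, smul_add, smul_smul, smul_smul, smul_smul]
          congr 2
          · congr 1; ring
          · congr 1; linear_combination hd
          · linear_combination ht - t * hd
      · refine Or.inr (Or.inl (hrp.2 ⟨(1 : F) • a + (-t) • b, p • a + (q + p * t) • b,
          linearIndependent_combination h (fun h0 => hd (by linear_combination h0)), ?_⟩))
        rw [hc, prodCoords_combination]
        congr 2
        · congr 1; ring
        · congr 1; ring
        · linear_combination ht
    · push Not at hroot
      obtain ⟨E, _, _, s, θ, hE, hs, hθ, hsum, hprod⟩ := exists_quadratic_extension (q / p) (r / p)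
        (fun t ht => hroot t (by field_simp at ht; linear_combination ht))
      refine Or.inr (Or.inr (isImaginaryLinePair_iff.2 ⟨E, _, _, s, hE, hs, p,
        fun i => algebraMap F E (a i) - θ * algebraMap F E (b i), hp, ?_, ?_⟩))
      · rw [← crossProduct_ne_zero_iff_linearIndependent] at h ⊢
        intro h0
        apply h
        have hi := fun i => congrFun h0 i
        have hθ' : s θ - θ ≠ 0 := sub_ne_zero.2 hθ
        have key : ∀ x : F, (s θ - θ) * algebraMap F E x = 0 → x = 0 := by
          intro x hx
          have := (mul_eq_zero.1 hx).resolve_left hθ'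
          exact (map_eq_zero _).1 this
        have e0 := hi 0; have e1 := hi 1; have e2 := hi 2
        simp [cross_apply] at e0 e1 e2
        rw [cross_apply]
        have f0 := key (a 1 * b 2 - a 2 * b 1) (by
          simp only [map_sub, map_mul]; linear_combination -e0)
        have f1 := key (a 2 * b 0 - a 0 * b 2) (by
          simp only [map_sub, map_mul]; linear_combination -e1)
        have f2 := key (a 0 * b 1 - a 1 * b 0) (by
          simp only [map_sub, map_mul]; linear_combination -e2)
        rw [f0, f1, f2]
        ext i; fin_cases i <;> rfl
      · have hp' : algebraMap F E p ≠ 0 := (map_ne_zero _).2 hp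
        have hq' : algebraMap F E q = -algebraMap F E p * (θ + s θ) := by
          rw [hsum, map_div₀]; field_simp
        have hr' : algebraMap F E r = algebraMap F E p * (θ * s θ) := by
          rw [hprod, map_div₀]; field_simp
        have hab : ∀ (x : Fin 3 → F), x ≠ 0 → ∃ i, algebraMap F E (x i) ≠ 0 := by
          intro x hx
          obtain ⟨i, hi⟩ := Function.ne_iff.1 hx
          exact ⟨i, (map_ne_zero _).2 hi⟩
        have hne0 : (fun i => algebraMap F E (a i) - θ * algebraMap F E (b i)) ≠ 0 := by
          intro h0
          -- conjugating the equation `a = θ b` shows that `b`, and then `a`, would vanish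
          have hi := fun i => congrFun h0 i
          simp only [Pi.zero_apply] at hi
          obtain ⟨i, hbi⟩ := hab b (h.ne_zero 1)
          have h1 := hi i
          have h2 := congrArg s h1
          simp only [map_sub, map_mul, AlgEquiv.commutes, map_zero] at h2
          have : (s θ - θ) * algebraMap F E (b i) = 0 := by linear_combination h1 - h2
          rcases mul_eq_zero.1 this with h3 | h3
          · exact hθ (sub_eq_zero.1 h3)
          · exact hbi h3
        refine ⟨hp', hne0, fun h0 => hne0 ?_, fun i => ?_⟩
        · ext i
          have := congrFun h0 i
          exact (map_eq_zero_iff s s.injective).1 this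
        · rw [hc]
          simp only [map_sub, map_mul, AlgEquiv.commutes]
          fin_cases i <;>
            simp only [prodCoords, Pi.add_apply, Pi.smul_apply, smul_eq_mul, map_add, map_mul, hq',
              hr', Fin.zero_eta, Fin.mk_one, Fin.reduceFinMk, Matrix.cons_val] <;> ring

/-- In every characteristic, a form of zero discriminant has a singular vector. -/
theorem exists_singular [Finite F] {c : Fin 6 → F} (h : discCoords c = 0) :
    ∃ v : Fin 3 → F, v ≠ 0 ∧ c ∈ ann (tangentSpace v) := by
  have hmk : ∀ v : Fin 3 → F, polarVec c v = 0 → c ⬝ᵥ veronese v = 0 →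
      c ∈ ann (tangentSpace v) := fun v h1 h2 =>
    mem_ann_tangentSpace.2 ⟨h2, fun w => by rw [dotProduct_symProd, h1, zero_dotProduct]⟩
  by_cases h2 : (2 : F) = 0
  · have h4 : (4 : F) = 0 := by linear_combination 2 * h2
    by_cases hv : (![c 4, c 2, c 1] : Fin 3 → F) = 0
    · have e0 := congrFun hv 0; have e1 := congrFun hv 1; have e2 := congrFun hv 2
      simp at e0 e1 e2
      have hsq : ∀ x : F, ∃ y, y ^ 2 = x := fun x => by
        obtain ⟨y, hy⟩ := FiniteField.isSquare_of_char_two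
          (CharP.ringChar_of_prime_eq_zero Nat.prime_two (by exact_mod_cast h2)) x
        exact ⟨y, by rw [hy, pow_two]⟩
      obtain ⟨r, hr⟩ := hsq (c 0)
      obtain ⟨s, hs⟩ := hsq (c 3)
      have hpol : ∀ v, polarVec c v = 0 := by
        intro v; ext i; fin_cases i <;> simp [polarVec, e0, e1, e2, h2]
      by_cases hrs : r = 0 ∧ s = 0
      · refine ⟨![1, 0, 0], fun h0 => one_ne_zero (congrFun h0 0), hmk _ (hpol _) ?_⟩
        simp [dotProduct, Fin.sum_univ_six, veronese, ← hr, hrs.1]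
      · refine ⟨![s, r, 0], fun h0 => hrs ⟨congrFun h0 1, congrFun h0 0⟩, hmk _ (hpol _) ?_⟩
        simp [dotProduct, Fin.sum_univ_six, veronese, ← hr, ← hs, e2]
        linear_combination r ^ 2 * s ^ 2 * h2
    · refine ⟨_, hv, hmk _ ?_ ?_⟩
      · ext i
        fin_cases i <;> simp [polarVec, h2]
        · linear_combination c 1 * c 2 * h2
        · linear_combination c 1 * c 4 * h2
        · linear_combination c 2 * c 4 * h2
      · rw [discCoords, h4] at h
        simp [dotProduct, Fin.sum_univ_six, veronese]
        linear_combination -h + 2 * (c 1 * c 2 * c 4) * h2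
  · let G : Matrix (Fin 3) (Fin 3) F :=
      !![2 * c 0, c 1, c 2; c 1, 2 * c 3, c 4; c 2, c 4, 2 * c 5]
    have hdet : G.det = 0 := by
      rw [Matrix.det_fin_three]; simp [G]; rw [discCoords] at h; linear_combination 2 * h
    obtain ⟨v, hv, hGv⟩ := Matrix.exists_mulVec_eq_zero_iff.2 hdet
    have hpol : polarVec c v = 0 := by
      rw [← hGv]
      ext i; fin_cases i <;> simp [polarVec, G, Matrix.mulVec, dotProduct, Fin.sum_univ_three]
    refine ⟨v, hv, hmk v hpol ?_⟩
    have := symProd_self c v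
    rw [dotProduct_symProd, hpol, zero_dotProduct] at this
    exact (mul_eq_zero.1 this.symm).resolve_left h2

/-- A singular vector, moved to the first basis vector, makes a singular form a binary form in the
other two coordinates. -/
theorem kind_of_conic [Finite F] {c : Fin 6 → F} (hc : c ≠ 0) :
    IsDoubleLine (formOf c) ∨ IsRealLinePair (formOf c) ∨ IsImaginaryLinePair (formOf c) ∨
      IsNonsingular (formOf c) := by
  rw [isNonsingular_iff]
  by_cases h : discCoords c = 0
  swap
  · exact Or.inr (Or.inr (Or.inr h))
  obtain ⟨v, hv, hcv⟩ := exists_singular h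
  obtain ⟨A, rfl⟩ := exists_GL_of_ne_zero hv
  have hf := formOf_mem c
  set d := formCoords (substForm A.1 (formOf c)) with hd
  have hdy : ∀ y, d ⬝ᵥ y = c ⬝ᵥ lift A.1 y := fun y => by
    rw [hd, formCoords_substForm_dotProduct A.1 hf, formCoords_formOf]
  have hd0 : ∀ y : Fin 6 → F, y 3 = 0 ∧ y 4 = 0 ∧ y 5 = 0 → d ⬝ᵥ y = 0 := by
    intro y hy
    rw [hdy]
    exact mem_ann.1 hcv _ ((lift_mem_tangentSpace_iff A _ y).2 ((tangentSpace_single y).2 hy))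
  have e0 := hd0 (Pi.single 0 1) (by simp)
  have e1 := hd0 (Pi.single 1 1) (by simp)
  have e2 := hd0 (Pi.single 2 1) (by simp)
  simp at e0 e1 e2
  have hback : substForm (A⁻¹ : GL (Fin 3) F).1 (formOf d) = formOf c := by
    rw [hd, formOf_formCoords (substForm_mem _ hf), substForm_inv_substForm]
  rw [substForm_formOf, formOf_injective.eq_iff] at hback
  have hi : LinearIndependent F ![(A⁻¹ : GL (Fin 3) F).1 1, (A⁻¹ : GL (Fin 3) F).1 2] := by
    have h1 := Matrix.linearIndependent_rows_of_isUnit (A⁻¹ : GL (Fin 3) F).isUnit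
    have h2 := h1.comp ![1, 2] (by decide)
    convert! h2 using 1
    ext i j; fin_cases i <;> rfl
  have hne : ¬ (d 3 = 0 ∧ d 4 = 0 ∧ d 5 = 0) := by
    rintro ⟨h3, h4, h5⟩
    apply hc
    rw [← hback]
    simp [Fin.sum_univ_six, e0, e1, e2, h3, h4, h5]
  have := kind_of_binary hi hne (c := c) (by
    rw [← hback]
    simp only [Fin.sum_univ_six, e0, e1, e2, zero_smul, zero_add, Matrix.cons_val])
  tauto

/-! ### Double counting -/

section DoubleCount

open Classical in
/-- The members of the web of `L` lying in the annihilators of subspaces `S i` of dimension `s`,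
counted through the points that `L` shares with these subspaces. -/
theorem sum_ncard_ann [Fintype F] {ι : Type*} [Fintype ι] (L : Submodule F (Fin 6 → F))
    (hL : IsLine L) (S : ι → Submodule F (Fin 6 → F)) {s : ℕ} (hs : s ≤ 4)
    (hS : ∀ i, Module.finrank F (S i) = s) :
    ∑ c : ann L, {i | c.1 ∈ ann (S i)}.ncard
      = Fintype.card F ^ (4 - s) * ∑ y : L, {i | y.1 ∈ S i}.ncard := by
  have key : ∀ (M : Submodule F (Fin 6 → F)) (P : ι → Submodule F (Fin 6 → F)),
      ∑ c : M, {i | c.1 ∈ P i}.ncard = ∑ i, Nat.card (M ⊓ P i : Submodule F (Fin 6 → F)) := by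
    intro M P
    have h1 : ∀ c : M, {i | c.1 ∈ P i}.ncard = ∑ i, if c.1 ∈ P i then 1 else 0 := by
      intro c
      rw [Set.ncard_eq_toFinset_card', Finset.sum_boole, Nat.cast_id]
      congr 1
      ext i; simp
    simp only [h1]
    rw [Finset.sum_comm]
    refine Finset.sum_congr rfl fun i _ => ?_
    rw [Finset.sum_boole, Nat.cast_id, ← Fintype.card_subtype, ← Nat.card_eq_fintype_card]
    refine Nat.card_congr
      { toFun := fun x => ⟨x.1.1, x.1.2, x.2⟩
        invFun := fun x => ⟨⟨x.1, x.2.1⟩, x.2.2⟩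
        left_inv := fun _ => rfl
        right_inv := fun _ => rfl }
  rw [key (ann L) fun i => ann (S i), key L S, Finset.mul_sum]
  refine Finset.sum_congr rfl fun i _ => ?_
  have h3 : Nat.card (L ⊓ S i : Submodule F (Fin 6 → F)) = _ :=
    Module.natCard_eq_pow_finrank (K := F)
  rw [← ann_sup, h3, Module.natCard_eq_pow_finrank (K := F), finrank_ann,
    Nat.card_eq_fintype_card, ← pow_add]
  congr 1
  have h1 := Submodule.finrank_sup_add_finrank_inf_eq L (S i)
  rw [hS, hL] at h1
  have h2 : Module.finrank F (L ⊔ S i : Submodule F _) ≤ 6 := by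
    have := Submodule.finrank_le (L ⊔ S i); rwa [Module.finrank_fin_fun] at this
  omega

end DoubleCount

section Kinds

open Classical in
/-- The indicator function of a kind of conics. -/
noncomputable def ind (T : MvPolynomial (Fin 3) F → Prop) (c : Fin 6 → F) : ℤ :=
  if T (formOf c) then 1 else 0

/-- The four kinds are distinguished by the number of zeros, singular vectors and linear factors, so
that these numbers are linear combinations of the indicators of the kinds. -/
theorem kinds_weights [Finite F] {c : Fin 6 → F} (hc : c ≠ 0) :
    (ind IsDoubleLine c + ind IsRealLinePair c + ind IsImaginaryLinePair c + ind IsNonsingular c = 1) ∧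
    ((zeroCount c : ℤ) = (Nat.card F ^ 2 - 1) * ind IsDoubleLine c
      + (2 * Nat.card F ^ 2 - Nat.card F - 1) * ind IsRealLinePair c
      + (Nat.card F - 1) * ind IsImaginaryLinePair c + (Nat.card F ^ 2 - 1) * ind IsNonsingular c) ∧
    ((singCount c : ℤ) = (Nat.card F ^ 2 - 1) * ind IsDoubleLine c
      + (Nat.card F - 1) * ind IsRealLinePair c + (Nat.card F - 1) * ind IsImaginaryLinePair c) ∧
    ((factorCount c : ℤ) = (Nat.card F - 1) * ind IsDoubleLine c
      + (2 * Nat.card F - 2) * ind IsRealLinePair c) := by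
  have hq : 1 < Nat.card F := Finite.one_lt_card
  have hq2 : Nat.card F < Nat.card F ^ 2 := by nlinarith
  have w1 := @weights_doubleLine F _ _ c
  have w2 := @weights_realLinePair F _ _ c
  have w3 := @weights_imaginaryLinePair F _ _ c
  have w4 := @weights_nonsingular F _ _ c
  have hcast : (Nat.card F : ℤ) ^ 2 = ((Nat.card F ^ 2 : ℕ) : ℤ) := by push_cast; rfl
  rw [hcast]
  generalize Nat.card F ^ 2 = Q at *
  unfold ind
  by_cases h1 : IsDoubleLine (formOf c)
  · obtain ⟨a1, a2, a3⟩ := w1 h1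
    have n2 : ¬ IsRealLinePair (formOf c) := fun h => by
      obtain ⟨b1, b2, b3⟩ := w2 h; omega
    have n3 : ¬ IsImaginaryLinePair (formOf c) := fun h => by
      obtain ⟨b1, b2, b3⟩ := w3 h; omega
    have n4 : ¬ IsNonsingular (formOf c) := fun h => by
      obtain ⟨b1, b2, b3⟩ := w4 h; omega
    simp only [h1, n2, n3, n4, if_true, if_false]
    refine ⟨by norm_num, ?_, ?_, ?_⟩ <;> omega
  by_cases h2 : IsRealLinePair (formOf c)
  · obtain ⟨a1, a2, a3⟩ := w2 h2
    have n3 : ¬ IsImaginaryLinePair (formOf c) := fun h => by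
      obtain ⟨b1, b2, b3⟩ := w3 h; omega
    have n4 : ¬ IsNonsingular (formOf c) := fun h => by
      obtain ⟨b1, b2, b3⟩ := w4 h; omega
    simp only [h1, h2, n3, n4, if_true, if_false]
    refine ⟨by norm_num, ?_, ?_, ?_⟩ <;> omega
  by_cases h3 : IsImaginaryLinePair (formOf c)
  · obtain ⟨a1, a2, a3⟩ := w3 h3
    have n4 : ¬ IsNonsingular (formOf c) := fun h => by
      obtain ⟨b1, b2, b3⟩ := w4 h; omega
    simp only [h1, h2, h3, n4, if_true, if_false]
    refine ⟨by norm_num, ?_, ?_, ?_⟩ <;> omega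
  have h4 : IsNonsingular (formOf c) := by
    have := kind_of_conic hc; tauto
  obtain ⟨a1, a2, a3⟩ := w4 h4
  simp only [h1, h2, h3, h4, if_true, if_false]
  refine ⟨by norm_num, ?_, ?_, ?_⟩ <;> omega

end Kinds

/-- The number of nonzero vectors `v` whose image on the Veronese surface is proportional to `y`. -/
noncomputable def rankOneCount (y : Fin 6 → F) : ℕ :=
  {v : Fin 3 → F | v ≠ 0 ∧ y ∈ F ∙ veronese v}.ncard

/-- The number of nonzero vectors `v` such that `y` lies in the tangent space at `v`. -/
noncomputable def tanCount (y : Fin 6 → F) : ℕ :=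
  {v : Fin 3 → F | v ≠ 0 ∧ y ∈ tangentSpace v}.ncard

/-- The number of nonzero vectors in the kernel of the matrix of `y`. -/
noncomputable def kerCount (y : Fin 6 → F) : ℕ :=
  {a : Fin 3 → F | a ≠ 0 ∧ y ∈ kerSpace a}.ncard

theorem veronese_ne_zero {v : Fin 3 → F} (hv : v ≠ 0) : veronese v ≠ 0 := by
  intro h
  apply hv
  have h0 := congrFun h 0; have h1 := congrFun h 3; have h2 := congrFun h 5
  simp [veronese] at h0 h1 h2
  ext i; fin_cases i <;> assumption

theorem mem_ann_span_veronese {c : Fin 6 → F} {v : Fin 3 → F} :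
    c ∈ ann (F ∙ veronese v) ↔ c ⬝ᵥ veronese v = 0 := by
  rw [mem_ann_span_singleton, dotProduct_comm]

theorem ncard_subtype_ne_zero (Q : (Fin 3 → F) → Prop) :
    {i : {v : Fin 3 → F // v ≠ 0} | Q i.1}.ncard = {v | v ≠ 0 ∧ Q v}.ncard := by
  rw [← Set.ncard_image_of_injective _ Subtype.val_injective]
  congr 1
  ext v
  simp [and_comm]

/-- The number of coordinate vectors of conics of the given kind in the web of `L`. -/
noncomputable def kindCount (L : Submodule F (Fin 6 → F)) (T : MvPolynomial (Fin 3) F → Prop) : ℤ :=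
  ({c : Fin 6 → F | c ≠ 0 ∧ c ∈ ann L ∧ T (formOf c)}.ncard : ℤ)

section Sums

variable [Fintype F]

open Classical in
/-- Summation over the nonzero vectors of a subspace. -/
noncomputable def sumNonzero (L : Submodule F (Fin 6 → F)) (g : (Fin 6 → F) → ℤ) : ℤ :=
  ∑ y ∈ Finset.univ.filter (fun y : Fin 6 → F => y ≠ 0 ∧ y ∈ L), g y

theorem sumNonzero_add (L : Submodule F (Fin 6 → F)) (g h : (Fin 6 → F) → ℤ) :
    sumNonzero L (fun y => g y + h y) = sumNonzero L g + sumNonzero L h :=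
  Finset.sum_add_distrib

theorem sumNonzero_mul (L : Submodule F (Fin 6 → F)) (k : ℤ) (g : (Fin 6 → F) → ℤ) :
    sumNonzero L (fun y => k * g y) = k * sumNonzero L g :=
  (Finset.mul_sum _ _ _).symm

theorem sumNonzero_congr {L : Submodule F (Fin 6 → F)} {g h : (Fin 6 → F) → ℤ}
    (H : ∀ y ∈ L, y ≠ 0 → g y = h y) : sumNonzero L g = sumNonzero L h := by
  classical
  refine Finset.sum_congr rfl fun y hy => ?_
  obtain ⟨h1, h2⟩ := (Finset.mem_filter.1 hy).2
  exact H y h2 h1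

open Classical in
theorem sumNonzero_indicator (L : Submodule F (Fin 6 → F)) (Q : (Fin 6 → F) → Prop) :
    sumNonzero L (fun y => if Q y then 1 else 0) = ({y | y ≠ 0 ∧ y ∈ L ∧ Q y}.ncard : ℤ) := by
  rw [sumNonzero, Finset.sum_boole, Finset.filter_filter, Set.ncard_eq_toFinset_card']
  congr 2
  ext y; simp [and_assoc]

theorem sum_subtype_eq (L : Submodule F (Fin 6 → F)) (g : (Fin 6 → F) → ℕ) [Fintype L] :
    ((∑ y : L, g y.1 : ℕ) : ℤ) = g 0 + sumNonzero L (fun y => (g y : ℤ)) := by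
  classical
  have h1 : ∑ y : L, g y.1 = ∑ y ∈ Finset.univ.filter (fun y : Fin 6 → F => y ∈ L), g y := by
    rw [← Finset.sum_subtype_eq_sum_filter]
    exact Finset.sum_bij (fun y _ => y) (by simp) (by simp) (by simp) (by simp)
  have h2 : Finset.univ.filter (fun y : Fin 6 → F => y ∈ L)
      = insert 0 (Finset.univ.filter (fun y : Fin 6 → F => y ≠ 0 ∧ y ∈ L)) := by
    ext y
    by_cases hy : y = 0
    · simp [hy]
    · simp [hy]
  rw [h1, h2, Finset.sum_insert (by simp), sumNonzero]
  push_cast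
  rfl

theorem ncard_nonzero : {v : Fin 3 → F | v ≠ 0}.ncard + 1 = Fintype.card F ^ 3 := by
  have h : {v : Fin 3 → F | v ≠ 0} = Set.univ \ {0} := by ext; simp
  rw [h, Set.ncard_sdiff_singleton_add_one (Set.mem_univ _), Set.ncard_univ,
    Nat.card_eq_fintype_card]
  simp

/-- Double counting for one of the three families of subspaces indexed by nonzero vectors. -/
theorem sumNonzero_ann (L : Submodule F (Fin 6 → F)) (hL : IsLine L)
    (S : (Fin 3 → F) → Submodule F (Fin 6 → F)) {s : ℕ} (hs : s ≤ 4)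
    (hS : ∀ v, v ≠ 0 → Module.finrank F (S v) = s) :
    ((Fintype.card F : ℤ) ^ 3 - 1)
      + sumNonzero (ann L) (fun c => ({v | v ≠ 0 ∧ c ∈ ann (S v)}.ncard : ℤ))
    = (Fintype.card F : ℤ) ^ (4 - s) * ((Fintype.card F : ℤ) ^ 3 - 1
      + sumNonzero L (fun y => ({v | v ≠ 0 ∧ y ∈ S v}.ncard : ℤ))) := by
  classical
  have h := sum_ncard_ann L hL (fun i : {v : Fin 3 → F // v ≠ 0} => S i.1) hs fun i => hS i.1 i.2
  have hc : ∀ c : ann L, {i : {v : Fin 3 → F // v ≠ 0} | c.1 ∈ ann (S i.1)}.ncard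
      = {v | v ≠ 0 ∧ c.1 ∈ ann (S v)}.ncard := fun c =>
    ncard_subtype_ne_zero fun v => c.1 ∈ ann (S v)
  have hy : ∀ y : L, {i : {v : Fin 3 → F // v ≠ 0} | y.1 ∈ S i.1}.ncard
      = {v | v ≠ 0 ∧ y.1 ∈ S v}.ncard := fun y => ncard_subtype_ne_zero fun v => y.1 ∈ S v
  simp only [hc, hy] at h
  have h' := congrArg (Nat.cast : ℕ → ℤ) h
  rw [Nat.cast_mul, sum_subtype_eq (ann L) fun c => {v | v ≠ 0 ∧ c ∈ ann (S v)}.ncard,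
    sum_subtype_eq L fun y => {v | v ≠ 0 ∧ y ∈ S v}.ncard] at h'
  have h0 := ncard_nonzero (F := F)
  have h0' : ({v : Fin 3 → F | v ≠ 0}.ncard : ℤ) = (Fintype.card F : ℤ) ^ 3 - 1 := by
    have := congrArg (Nat.cast : ℕ → ℤ) h0
    push_cast at this
    linarith
  simp only [Submodule.zero_mem, and_true, h0', Nat.cast_pow] at h'
  exact h'

theorem sumNonzero_ind (L : Submodule F (Fin 6 → F)) (T : MvPolynomial (Fin 3) F → Prop) :
    sumNonzero (ann L) (ind T) = kindCount L T := by
  rw [kindCount, ← sumNonzero_indicator]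
  rfl

theorem kindCount_total (L : Submodule F (Fin 6 → F)) (hL : IsLine L) :
    kindCount L IsDoubleLine + kindCount L IsRealLinePair + kindCount L IsImaginaryLinePair
      + kindCount L IsNonsingular = (Fintype.card F : ℤ) ^ 4 - 1 := by
  classical
  simp only [← sumNonzero_ind, ← sumNonzero_add]
  have h1 := sumNonzero_indicator (ann L) fun _ => True
  rw [sumNonzero_congr (h := fun y => if True then 1 else 0)
    fun c _ hc => by simpa using (kinds_weights hc).1]
  simp only [if_true] at h1 ⊢
  rw [h1]
  have := ncard_ne_zero_mem (ann L)
  rw [finrank_ann, hL, Nat.card_eq_fintype_card] at this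
  have h2 := congrArg (Nat.cast : ℕ → ℤ) this
  push_cast at h2
  simp only [and_true]
  linarith

/-- Double counting of pairs consisting of a member of the web and one of its zeros. -/
theorem kindCount_zeros (L : Submodule F (Fin 6 → F)) (hL : IsLine L) :
    ((Fintype.card F : ℤ) ^ 3 - 1) + ((Fintype.card F ^ 2 - 1) * kindCount L IsDoubleLine
      + (2 * Fintype.card F ^ 2 - Fintype.card F - 1) * kindCount L IsRealLinePair
      + (Fintype.card F - 1) * kindCount L IsImaginaryLinePair
      + (Fintype.card F ^ 2 - 1) * kindCount L IsNonsingular)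
    = (Fintype.card F : ℤ) ^ 3 * ((Fintype.card F : ℤ) ^ 3 - 1
      + sumNonzero L (fun y => (rankOneCount y : ℤ))) := by
  have h := sumNonzero_ann L hL (fun v => F ∙ veronese v) (s := 1) (by norm_num)
    fun v hv => finrank_span_singleton (veronese_ne_zero hv)
  simp only [mem_ann_span_veronese] at h
  simp only [← sumNonzero_ind, ← sumNonzero_add, ← sumNonzero_mul]
  rw [← sumNonzero_congr (g := fun c => (zeroCount c : ℤ))
    fun c _ hc => by simpa only [Nat.card_eq_fintype_card] using (kinds_weights hc).2.1]
  exact h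

/-- Double counting of pairs consisting of a member of the web and one of its singular vectors. -/
theorem kindCount_sing (L : Submodule F (Fin 6 → F)) (hL : IsLine L) :
    ((Fintype.card F : ℤ) ^ 3 - 1) + ((Fintype.card F ^ 2 - 1) * kindCount L IsDoubleLine
      + (Fintype.card F - 1) * kindCount L IsRealLinePair
      + (Fintype.card F - 1) * kindCount L IsImaginaryLinePair)
    = (Fintype.card F : ℤ) * ((Fintype.card F : ℤ) ^ 3 - 1
      + sumNonzero L (fun y => (tanCount y : ℤ))) := by
  have h := sumNonzero_ann L hL tangentSpace (s := 3) (by norm_num)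
    fun v hv => finrank_tangentSpace hv
  simp only [← sumNonzero_ind, ← sumNonzero_add, ← sumNonzero_mul]
  rw [← sumNonzero_congr (g := fun c => (singCount c : ℤ))
    fun c _ hc => by simpa only [Nat.card_eq_fintype_card] using (kinds_weights hc).2.2.1]
  norm_num only [pow_one] at h
  exact h

/-- Double counting of pairs consisting of a member of the web and a linear form dividing it. -/
theorem kindCount_factor (L : Submodule F (Fin 6 → F)) (hL : IsLine L) :
    ((Fintype.card F : ℤ) ^ 3 - 1) + ((Fintype.card F - 1) * kindCount L IsDoubleLine
      + (2 * Fintype.card F - 2) * kindCount L IsRealLinePair)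
    = (Fintype.card F : ℤ) * ((Fintype.card F : ℤ) ^ 3 - 1
      + sumNonzero L (fun y => (kerCount y : ℤ))) := by
  have h := sumNonzero_ann L hL kerSpace (s := 3) (by norm_num) fun v hv => finrank_kerSpace hv
  simp only [← sumNonzero_ind, ← sumNonzero_add, ← sumNonzero_mul]
  rw [← sumNonzero_congr (g := fun c => (factorCount c : ℤ))
    fun c _ hc => by simpa only [Nat.card_eq_fintype_card] using (kinds_weights hc).2.2.2]
  norm_num only [pow_one] at h
  exact h

end Sums

/-! ### The rank of a point -/

/-- The determinant of the symmetric matrix of `y`. -/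
def detVec (y : Fin 6 → F) : F :=
  y 0 * (y 3 * y 5 - y 4 ^ 2) - y 1 * (y 1 * y 5 - y 4 * y 2) + y 2 * (y 1 * y 4 - y 3 * y 2)

theorem det_toMat (y : Fin 6 → F) : (toMat y).det = detVec y := by
  rw [Matrix.det_fin_three]; simp [toMat, detVec]; ring

/-- The vanishing of the minors of size two of the symmetric matrix of `y`. -/
def MinorsVanish (y : Fin 6 → F) : Prop :=
  y 0 * y 3 = y 1 ^ 2 ∧ y 0 * y 5 = y 2 ^ 2 ∧ y 3 * y 5 = y 4 ^ 2 ∧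
    y 0 * y 4 = y 1 * y 2 ∧ y 3 * y 2 = y 1 * y 4 ∧ y 5 * y 1 = y 2 * y 4

/-- The points of rank one are those of the Veronese surface. -/
theorem minorsVanish_iff {y : Fin 6 → F} (hy : y ≠ 0) :
    MinorsVanish y ↔ ∃ (k : F) (u : Fin 3 → F), k ≠ 0 ∧ u ≠ 0 ∧ y = k • veronese u := by
  constructor
  · rintro ⟨h1, h2, h3, h4, h5, h6⟩
    by_cases h0 : y 0 = 0
    · have e1 : y 1 = 0 := by rw [h0, zero_mul] at h1; exact pow_eq_zero_iff two_ne_zero |>.1 h1.symm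
      have e2 : y 2 = 0 := by rw [h0, zero_mul] at h2; exact pow_eq_zero_iff two_ne_zero |>.1 h2.symm
      by_cases h0' : y 3 = 0
      · have e4 : y 4 = 0 := by
          rw [h0', zero_mul] at h3; exact pow_eq_zero_iff two_ne_zero |>.1 h3.symm
        refine ⟨y 5, ![0, 0, 1], ?_, ?_, ?_⟩
        · intro e5; apply hy; ext i; fin_cases i <;> assumption
        · intro h; simpa using congrFun h 2
        · ext i; fin_cases i <;> simp [veronese, *]
      · refine ⟨y 3, ![0, 1, y 4 / y 3], h0', ?_, ?_⟩
        · intro h; simpa using congrFun h 1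
        · ext i; fin_cases i <;> simp [veronese, *]
          · field_simp
          · field_simp; linear_combination h3
    · refine ⟨y 0, ![1, y 1 / y 0, y 2 / y 0], h0, ?_, ?_⟩
      · intro h; simpa using congrFun h 0
      · ext i; fin_cases i <;> simp [veronese] <;> field_simp
        · linear_combination h1
        · linear_combination h4
        · linear_combination h2
  · rintro ⟨k, u, -, -, rfl⟩
    simp only [MinorsVanish, veronese, Pi.smul_apply, smul_eq_mul, Matrix.cons_val]
    refine ⟨?_, ?_, ?_, ?_, ?_, ?_⟩ <;> ring

theorem toMat_ne_zero {y : Fin 6 → F} (hy : y ≠ 0) : toMat y ≠ 0 := by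
  intro h; apply hy
  rw [← toVec_toMat y, h]; ext i; fin_cases i <;> rfl

theorem rank_toMat_pos {y : Fin 6 → F} (hy : y ≠ 0) : 0 < (toMat y).rank := by
  rw [Nat.pos_iff_ne_zero]
  intro h
  apply toMat_ne_zero hy
  rw [Matrix.rank, Submodule.finrank_eq_zero, LinearMap.range_eq_bot] at h
  ext i j
  have := congrFun (LinearMap.congr_fun h (Pi.single j 1)) i
  simpa using this

theorem rank_toMat_le (y : Fin 6 → F) : (toMat y).rank ≤ 3 := by
  simpa using (toMat y).rank_le_width

theorem toMat_smul (k : F) (y : Fin 6 → F) : toMat (k • y) = k • toMat y := by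
  ext i j; fin_cases i <;> fin_cases j <;> rfl

theorem toMat_veronese (u : Fin 3 → F) : toMat (veronese u) = Matrix.vecMulVec u u := by
  ext i j
  fin_cases i <;> fin_cases j <;> simp [toMat, veronese, Matrix.vecMulVec_apply] <;> ring

theorem rank_eq_one_iff {y : Fin 6 → F} (hy : y ≠ 0) : (toMat y).rank = 1 ↔ MinorsVanish y := by
  constructor
  · intro h
    rw [Matrix.rank_eq_finrank_span_row, finrank_eq_one_iff'] at h
    obtain ⟨w, -, hw⟩ := h
    have hrow : ∀ i, ∃ c : F, (toMat y) i = c • (w : Fin 3 → F) := fun i => by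
      obtain ⟨c, hc⟩ := hw ⟨toMat y i, Submodule.subset_span ⟨i, rfl⟩⟩
      exact ⟨c, by rw [← Submodule.coe_smul, hc]⟩
    choose c hc using hrow
    have h00 : y 0 = c 0 * w.1 0 := congrFun (hc 0) 0
    have h01 : y 1 = c 0 * w.1 1 := congrFun (hc 0) 1
    have h02 : y 2 = c 0 * w.1 2 := congrFun (hc 0) 2
    have h10 : y 1 = c 1 * w.1 0 := congrFun (hc 1) 0
    have h11 : y 3 = c 1 * w.1 1 := congrFun (hc 1) 1
    have h12 : y 4 = c 1 * w.1 2 := congrFun (hc 1) 2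
    have h20 : y 2 = c 2 * w.1 0 := congrFun (hc 2) 0
    have h21 : y 4 = c 2 * w.1 1 := congrFun (hc 2) 1
    have h22 : y 5 = c 2 * w.1 2 := congrFun (hc 2) 2
    refine ⟨?_, ?_, ?_, ?_, ?_, ?_⟩
    · rw [pow_two]; nth_rw 1 [h01]; rw [h10, h00, h11]; ring
    · rw [pow_two]; nth_rw 1 [h02]; rw [h20, h00, h22]; ring
    · rw [pow_two]; nth_rw 1 [h12]; rw [h21, h11, h22]; ring
    · rw [h00, h12, h10, h02]; ring
    · rw [h11, h02, h01, h12]; ring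
    · rw [h22, h10, h20, h12]; ring
  · intro h
    obtain ⟨k, u, hk, hu, rfl⟩ := (minorsVanish_iff hy).1 h
    refine le_antisymm ?_ (rank_toMat_pos hy)
    rw [toMat_smul, toMat_veronese, ← Matrix.smul_vecMulVec]
    exact Matrix.rank_vecMulVec_le _ _

theorem rank_eq_three_iff {y : Fin 6 → F} : (toMat y).rank = 3 ↔ detVec y ≠ 0 := by
  rw [← det_toMat]
  constructor
  · intro h h0
    obtain ⟨v, hv, hv'⟩ := Matrix.exists_mulVec_eq_zero_iff.2 h0
    have := (toMat y).mulVecLin.finrank_range_add_finrank_ker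
    rw [Matrix.rank] at h
    rw [h, Module.finrank_fin_fun] at this
    have h2 : LinearMap.ker (toMat y).mulVecLin = ⊥ := Submodule.finrank_eq_zero.1 (by omega)
    exact hv ((Submodule.mem_bot F).1 (h2 ▸ (show v ∈ LinearMap.ker _ from hv')))
  · intro h
    simpa using Matrix.rank_of_det_ne_zero h

theorem rank_eq_two_iff {y : Fin 6 → F} (hy : y ≠ 0) :
    (toMat y).rank = 2 ↔ detVec y = 0 ∧ ¬ MinorsVanish y := by
  have h3 := rank_eq_three_iff (y := y)
  rw [← rank_eq_one_iff hy, ← not_ne_iff (a := detVec y), ← h3]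
  have := rank_toMat_pos hy
  have := rank_toMat_le y
  omega

theorem rank_lift (A : GL (Fin 3) F) (y : Fin 6 → F) :
    (toMat (lift A.1 y)).rank = (toMat y).rank := by
  have hA : IsUnit A.1.det := (Matrix.isUnit_iff_isUnit_det _).1 A.isUnit
  rw [toMat_lift, Matrix.rank_mul_eq_left_of_isUnit_det _ _ (by rwa [Matrix.det_transpose]),
    Matrix.rank_mul_eq_right_of_isUnit_det _ _ hA]

theorem rank_toMat_smul {k : F} (hk : k ≠ 0) (y : Fin 6 → F) :
    (toMat (k • y)).rank = (toMat y).rank := by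
  rw [toMat_smul]
  exact Matrix.rank_smul_of_mem_nonZeroDivisors _ (mem_nonZeroDivisors_of_ne_zero hk)

theorem mem_span_of_veronese_mem {u v : Fin 3 → F} {k : F} (hk : k ≠ 0)
    (h : veronese u = k • veronese v) : v ∈ F ∙ u := by
  have h1 : ann (F ∙ u) ≤ ann (F ∙ v) := fun a ha => by
    rw [mem_ann_span_singleton, dotProduct_comm] at ha ⊢
    have h2 := congrArg (fun z => bil z a a) h
    simp only [bil_smul, bil_veronese, ha] at h2
    have h3 : k * ((a ⬝ᵥ v) * (a ⬝ᵥ v)) = 0 := by rw [← h2]; ring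
    simpa [hk] using h3
  have hle : (F ∙ v) ≤ F ∙ u := by
    have h2 : ann (ann (F ∙ v)) ≤ ann (ann (F ∙ u)) := fun z hz => by
      rw [mem_ann] at hz ⊢; exact fun y hy => hz y (h1 hy)
    rwa [ann_ann, ann_ann] at h2
  exact hle (Submodule.mem_span_singleton_self v)

/-- The matrices in a tangent space of the Veronese surface are singular. -/
theorem detVec_eq_zero_of_mem_tangentSpace {v : Fin 3 → F} {y : Fin 6 → F}
    (h : y ∈ tangentSpace v) : detVec y = 0 := by
  obtain ⟨w, k, rfl⟩ := mem_tangentSpace.1 h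
  simp [detVec, symProd, veronese]
  ring

section Weights

variable [Fintype F]

theorem kerCount_add_one (y : Fin 6 → F) :
    kerCount y + 1 = Fintype.card F ^ (3 - (toMat y).rank) := by
  have h := ncard_ne_zero_mem (LinearMap.ker (toMat y).mulVecLin)
  have h2 := (toMat y).mulVecLin.finrank_range_add_finrank_ker
  rw [Module.finrank_fin_fun] at h2
  rw [Nat.card_eq_fintype_card] at h
  rw [Matrix.rank, Nat.sub_eq_of_eq_add' h2.symm, ← h]
  simp only [kerCount, mem_kerSpace_iff_mulVec, LinearMap.mem_ker, Matrix.mulVecLin_apply]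

theorem rankOneCount_eq_zero {y : Fin 6 → F} (hy : y ≠ 0) (h : (toMat y).rank ≠ 1) :
    rankOneCount y = 0 := by
  rw [rankOneCount, Set.ncard_eq_zero (Set.toFinite _), Set.eq_empty_iff_forall_notMem]
  rintro v ⟨hv, hyv⟩
  obtain ⟨k, rfl⟩ := Submodule.mem_span_singleton.1 hyv
  apply h
  rw [rank_eq_one_iff hy, minorsVanish_iff hy]
  refine ⟨k, v, ?_, hv, rfl⟩
  rintro rfl
  simp at hy

theorem rankOneCount_eq {y : Fin 6 → F} (hy : y ≠ 0) (h : (toMat y).rank = 1) :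
    rankOneCount y + 1 = Fintype.card F := by
  obtain ⟨k, u, hk, hu, rfl⟩ := (minorsVanish_iff hy).1 ((rank_eq_one_iff hy).1 h)
  have h1 := ncard_ne_zero_mem (F ∙ u)
  rw [finrank_span_singleton hu, pow_one, Nat.card_eq_fintype_card] at h1
  rw [← h1, rankOneCount]
  congr 2
  ext v
  refine and_congr_right fun hv => ?_
  constructor
  · intro hm
    obtain ⟨c, hc⟩ := Submodule.mem_span_singleton.1 hm
    have hc0 : c ≠ 0 := by rintro rfl; rw [zero_smul] at hc; exact hy hc.symm
    refine mem_span_of_veronese_mem (k := k⁻¹ * c) (mul_ne_zero (inv_ne_zero hk) hc0) ?_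
    rw [mul_smul, hc, smul_smul, inv_mul_cancel₀ hk, one_smul]
  · intro hm
    obtain ⟨c, rfl⟩ := Submodule.mem_span_singleton.1 hm
    have hc0 : c ≠ 0 := by rintro rfl; simp at hv
    refine Submodule.mem_span_singleton.2 ⟨k / c ^ 2, ?_⟩
    have : veronese (c • u) = c ^ 2 • veronese u := by
      ext i; fin_cases i <;> simp [veronese] <;> ring
    rw [this, smul_smul, div_mul_cancel₀ _ (pow_ne_zero 2 hc0)]

theorem tanCount_eq_zero {y : Fin 6 → F} (h : detVec y ≠ 0) : tanCount y = 0 := by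
  rw [tanCount, Set.ncard_eq_zero (Set.toFinite _), Set.eq_empty_iff_forall_notMem]
  exact fun v hv => h (detVec_eq_zero_of_mem_tangentSpace hv.2)

end Weights

/-- The number of points of rank `k` of a subspace. -/
noncomputable def rankCount (L : Submodule F (Fin 6 → F)) (k : ℕ) : ℕ :=
  {P : ℙ F (Fin 6 → F) | P.submodule ≤ L ∧ ptRank P = k}.ncard

theorem rankCount_mul (L : Submodule F (Fin 6 → F)) (k : ℕ) :
    rankCount L k * (Nat.card F - 1) = {y | y ≠ 0 ∧ y ∈ L ∧ (toMat y).rank = k}.ncard :=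
  ncard_points_mul L (fun y => (toMat y).rank = k) fun c v hc h => by rwa [rank_toMat_smul hc]

/-- The number of points of the plane on which all quadratic forms `a ↦ aᵀ M a`, for the matrices
`M` of the points of `L`, vanish. -/
noncomputable def isoCount (L : Submodule F (Fin 6 → F)) : ℕ :=
  {p : ℙ F (Fin 3 → F) | ∀ y ∈ L, bil y p.rep p.rep = 0}.ncard

theorem bil_smul_smul (y : Fin 6 → F) (k : F) (a : Fin 3 → F) :
    bil y (k • a) (k • a) = k ^ 2 * bil y a a := by
  simp only [bil_eq, Pi.smul_apply, smul_eq_mul]; ring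

theorem prodCoords_self_ne_zero {a : Fin 3 → F} (ha : a ≠ 0) : prodCoords a a ≠ 0 := by
  intro h
  apply ha
  have h0 := congrFun h 0; have h1 := congrFun h 3; have h2 := congrFun h 5
  simp [prodCoords] at h0 h1 h2
  ext i; fin_cases i <;> assumption

theorem prodCoords_smul_smul (k : F) (a : Fin 3 → F) :
    prodCoords (k • a) (k • a) = k ^ 2 • prodCoords a a := by
  ext i; fin_cases i <;> simp [prodCoords] <;> ring

theorem mem_span_of_prodCoords {a b : Fin 3 → F} {k : F} (hk : k ≠ 0)
    (h : prodCoords a a = k • prodCoords b b) : b ∈ F ∙ a := by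
  have h1 : ann (F ∙ a) ≤ ann (F ∙ b) := fun v hv => by
    rw [mem_ann_span_singleton] at hv ⊢
    have h2 := congrArg (fun z => z ⬝ᵥ veronese v) h
    simp only [smul_dotProduct, prodCoords_dotProduct, bil_veronese, hv] at h2
    have h3 : k * ((b ⬝ᵥ v) * (b ⬝ᵥ v)) = 0 := by rw [← smul_eq_mul, ← h2]; ring
    simpa [hk] using h3
  have hle : (F ∙ b) ≤ F ∙ a := by
    have h2 : ann (ann (F ∙ b)) ≤ ann (ann (F ∙ a)) := fun z hz => by
      rw [mem_ann] at hz ⊢; exact fun y hy => hz y (h1 hy)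
    rwa [ann_ann, ann_ann] at h2
  exact hle (Submodule.mem_span_singleton_self b)

theorem formOf_ne_zero {c : Fin 6 → F} (hc : c ≠ 0) : formOf c ≠ 0 := fun h =>
  hc (formOf_injective (h.trans formOf_zero.symm))

theorem mem_ann_prodCoords {L : Submodule F (Fin 6 → F)} {a : Fin 3 → F} :
    prodCoords a a ∈ ann L ↔ ∀ y ∈ L, bil y a a = 0 := by
  simp only [mem_ann, prodCoords_dotProduct]

theorem isDoubleLine_smul {c : F} {f : MvPolynomial (Fin 3) F} (hc : c ≠ 0)
    (h : IsDoubleLine f) : IsDoubleLine (c • f) := by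
  obtain ⟨k, a, hk, ha, rfl⟩ := h
  refine ⟨c * k, a, mul_ne_zero hc hk, ha, ?_⟩
  rw [MvPolynomial.smul_eq_C_mul, C_mul, mul_assoc]

/-- The square of the linear form `a` belongs to the web of `L` exactly if `a` is isotropic for all
points of `L`. -/
theorem ncard_doubleLines [Finite F] (L : Submodule F (Fin 6 → F)) :
    {p : ℙ F (MvPolynomial (Fin 3) F) | p.submodule ≤ webOf L ∧ IsDoubleLine p.rep}.ncard
      = isoCount L := by
  symm
  let g : ℙ F (Fin 3 → F) → ℙ F (MvPolynomial (Fin 3) F) := fun p =>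
    Projectivization.mk F (formOf (prodCoords p.rep p.rep))
      (formOf_ne_zero (prodCoords_self_ne_zero p.rep_nonzero))
  have hg : Function.Injective g := by
    intro p p' h
    simp only [g] at h
    rw [Projectivization.mk_eq_mk_iff'] at h
    obtain ⟨k, hk⟩ := h
    rw [← formOf_smul, formOf_injective.eq_iff] at hk
    have hk0 : k ≠ 0 := by
      rintro rfl
      exact prodCoords_self_ne_zero p.rep_nonzero (by simpa using hk.symm)
    obtain ⟨c, hc⟩ := Submodule.mem_span_singleton.1 (mem_span_of_prodCoords hk0 hk.symm)
    rw [← p.mk_rep, ← p'.mk_rep, Projectivization.mk_eq_mk_iff']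
    have hc0 : c ≠ 0 := by rintro rfl; rw [zero_smul] at hc; exact p'.rep_nonzero hc.symm
    exact ⟨c⁻¹, by rw [← hc, smul_smul, inv_mul_cancel₀ hc0, one_smul]⟩
  rw [isoCount, ← Set.ncard_image_of_injective _ hg]
  congr 1
  ext P
  have hQ : ∀ (c : F) v, c ≠ 0 → (v ∈ webOf L ∧ IsDoubleLine v) →
      (c • v ∈ webOf L ∧ IsDoubleLine (c • v)) :=
    fun c v hc h => ⟨Submodule.smul_mem _ _ h.1, isDoubleLine_smul hc h.2⟩
  simp only [Set.mem_image, Set.mem_ofPred_eq, submodule_le_iff]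
  constructor
  · rintro ⟨p, hp, rfl⟩
    rw [rep_mk_iff (fun v => v ∈ webOf L ∧ IsDoubleLine v) hQ]
    exact ⟨formOf_mem_webOf.2 (mem_ann_prodCoords.2 hp),
      isDoubleLine_iff.2 ⟨1, p.rep, one_ne_zero, p.rep_nonzero, (one_smul _ _).symm⟩⟩
  · rintro ⟨h1, k, a, hk, ha, h2⟩
    have hrep : P.rep = formOf (k • prodCoords a a) := by
      rw [h2, formOf_smul, pow_two, linForm_mul_linForm, MvPolynomial.smul_eq_C_mul]
    have hP : P = g (Projectivization.mk F a ha) := by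
      obtain ⟨c, hc⟩ := Projectivization.exists_smul_eq_mk_rep F a ha
      rw [← P.mk_rep]
      simp only [g]
      rw [Projectivization.mk_eq_mk_iff']
      refine ⟨k * (c : F)⁻¹ ^ 2, ?_⟩
      rw [hrep, ← formOf_smul, ← hc, Units.smul_def, prodCoords_smul_smul, smul_smul]
      congr 2
      field_simp
    refine ⟨Projectivization.mk F a ha, ?_, hP.symm⟩
    rw [rep_mk_iff (fun a => ∀ y ∈ L, bil y a a = 0) fun c v _ h y hy => by
      rw [bil_smul_smul, h y hy, mul_zero]]
    rw [hrep, formOf_mem_webOf] at h1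
    have h3 := Submodule.smul_mem _ k⁻¹ h1
    rw [smul_smul, inv_mul_cancel₀ hk, one_smul] at h3
    exact mem_ann_prodCoords.1 h3

/-! ### The distribution of a line from its numbers of points of rank one and two and of double lines -/

section Smul

variable {c : F} {f : MvPolynomial (Fin 3) F}

theorem isRealLinePair_smul (hc : c ≠ 0) (h : IsRealLinePair f) : IsRealLinePair (c • f) := by
  obtain ⟨a, b, hab, rfl⟩ := h
  refine ⟨c • a, b, ?_, ?_⟩
  · rw [LinearIndependent.pair_iff] at hab ⊢
    intro s t hst
    rw [smul_smul] at hst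
    have := hab _ _ hst
    exact ⟨(mul_eq_zero.1 this.1).resolve_right hc, this.2⟩
  · rw [linForm_mul_linForm, linForm_mul_linForm, ← formOf_smul]
    congr 1
    ext i; fin_cases i <;> simp [prodCoords] <;> ring

theorem isImaginaryLinePair_smul (hc : c ≠ 0) (h : IsImaginaryLinePair f) :
    IsImaginaryLinePair (c • f) := by
  obtain ⟨E, _, _, s, hE, hs, k, a, hk, ha, hf⟩ := h
  refine ⟨E, _, _, s, hE, hs, c * k, a, mul_ne_zero hc hk, ha, ?_⟩
  rw [MvPolynomial.smul_eq_C_mul, map_mul, hf, map_C, map_mul, C_mul]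
  ring

theorem isNonsingular_smul (hc : c ≠ 0) (h : IsNonsingular f) : IsNonsingular (c • f) := by
  obtain ⟨h1, h2⟩ := h
  refine ⟨Submodule.smul_mem _ _ h1, ?_⟩
  have : disc (c • f) = c ^ 3 * disc f := by
    simp only [disc, qcoeff, coeff_smul, smul_eq_mul]; ring
  rw [this]
  exact mul_ne_zero (pow_ne_zero 3 hc) h2

end Smul

theorem isDoubleLine_mem {f : MvPolynomial (Fin 3) F} (h : IsDoubleLine f) :
    f ∈ Forms F ∧ f ≠ 0 := by
  obtain ⟨k, a, hk, ha, rfl⟩ := h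
  rw [pow_two, linForm_mul_linForm, ← MvPolynomial.smul_eq_C_mul, ← formOf_smul]
  exact ⟨formOf_mem _, formOf_ne_zero (smul_ne_zero hk (prodCoords_self_ne_zero ha))⟩

theorem isRealLinePair_mem [Finite F] {f : MvPolynomial (Fin 3) F} (h : IsRealLinePair f) :
    f ∈ Forms F ∧ f ≠ 0 := by
  have hmem : f ∈ Forms F := by
    obtain ⟨a, b, -, rfl⟩ := h
    rw [linForm_mul_linForm]; exact formOf_mem _
  refine ⟨hmem, ?_⟩
  rintro rfl
  rw [← formOf_zero] at h
  have hq : 1 < Nat.card F := Finite.one_lt_card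
  have h1 := (weights_realLinePair h).2.1
  have h2 := ncard_ne_zero_mem (⊤ : Submodule F (Fin 3 → F))
  rw [finrank_top, Module.finrank_fin_fun] at h2
  simp only [singCount, Submodule.zero_mem, and_true] at h1
  simp only [Submodule.mem_top, and_true] at h2
  rw [h1] at h2
  nlinarith [pow_pos (zero_lt_one.trans hq) 2, pow_succ (Nat.card F) 2]

theorem mem_forms_of_map {E : Type u} [Field E] [Algebra F E] {f : MvPolynomial (Fin 3) F}
    (h : map (algebraMap F E) f ∈ Forms E) : f ∈ Forms F := by
  intro d hd
  refine h ?_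
  rw [coeff_map]
  exact (map_ne_zero _).2 hd

theorem isImaginaryLinePair_mem [Finite F] {f : MvPolynomial (Fin 3) F}
    (h : IsImaginaryLinePair f) : f ∈ Forms F ∧ f ≠ 0 := by
  have hmem : f ∈ Forms F := by
    obtain ⟨E, _, _, s, hE, hs, k, a, hk, ha, hf⟩ := h
    apply mem_forms_of_map (E := E)
    rw [hf, mul_assoc, linForm_mul_linForm, ← MvPolynomial.smul_eq_C_mul]
    exact Submodule.smul_mem _ _ (formOf_mem _)
  refine ⟨hmem, ?_⟩
  rintro rfl
  rw [← formOf_zero] at h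
  have hq : 1 < Nat.card F := Finite.one_lt_card
  have h1 := (weights_imaginaryLinePair h).2.1
  have h2 := ncard_ne_zero_mem (⊤ : Submodule F (Fin 3 → F))
  rw [finrank_top, Module.finrank_fin_fun] at h2
  simp only [singCount, Submodule.zero_mem, and_true] at h1
  simp only [Submodule.mem_top, and_true] at h2
  rw [h1] at h2
  nlinarith [pow_pos (zero_lt_one.trans hq) 2, pow_succ (Nat.card F) 2]

theorem isNonsingular_mem {f : MvPolynomial (Fin 3) F} (h : IsNonsingular f) :
    f ∈ Forms F ∧ f ≠ 0 := by
  refine ⟨h.1, ?_⟩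
  rintro rfl
  apply h.2
  simp [disc, qcoeff]

/-- A hyperplane contains `L` exactly if its conic belongs to the web of `L`, and it determines the
conic. -/
theorem hyperplaneOD_eq [Finite F] (L : Submodule F (Fin 6 → F)) :
    hyperplaneOD L = conicDistribution (webOf L) := by
  ext i
  fin_cases i
  · exact ncard_hyperplanes L _ (fun _ => isDoubleLine_mem) fun _ _ => isDoubleLine_smul
  · exact ncard_hyperplanes L _ (fun _ => isRealLinePair_mem) fun _ _ => isRealLinePair_smul
  · exact ncard_hyperplanes L _ (fun _ => isImaginaryLinePair_mem) fun _ _ => isImaginaryLinePair_smul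
  · exact ncard_hyperplanes L _ (fun _ => isNonsingular_mem) fun _ _ => isNonsingular_smul

section Solve

variable [Fintype F]

theorem kindCount_eq (L : Submodule F (Fin 6 → F)) (T : MvPolynomial (Fin 3) F → Prop)
    (hT : ∀ (c : F) f, c ≠ 0 → T f → T (c • f)) :
    kindCount L T = ({p : ℙ F (MvPolynomial (Fin 3) F) | p.submodule ≤ webOf L ∧ T p.rep}.ncard : ℤ)
      * ((Fintype.card F : ℤ) - 1) := by
  have hq : 1 ≤ Fintype.card F := Fintype.card_pos
  rw [kindCount, ← ncard_conics_mul L T hT, Nat.card_eq_fintype_card]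
  push_cast [hq]
  rfl

theorem sumNonzero_rank (L : Submodule F (Fin 6 → F)) (k : ℕ) (m : ℤ)
    [∀ y : Fin 6 → F, Decidable ((toMat y).rank = k)] :
    sumNonzero L (fun y => m * if (toMat y).rank = k then 1 else 0)
      = m * (rankCount L k * ((Fintype.card F : ℤ) - 1)) := by
  have hq : 1 ≤ Fintype.card F := Fintype.card_pos
  rw [sumNonzero_mul]
  congr 1
  have := rankCount_mul L k
  rw [Nat.card_eq_fintype_card] at this
  rw [show ((rankCount L k : ℤ) * ((Fintype.card F : ℤ) - 1))
    = ((rankCount L k * (Fintype.card F - 1) : ℕ) : ℤ) by push_cast [hq]; rfl, this]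
  convert sumNonzero_indicator L fun y => (toMat y).rank = k

theorem sumNonzero_rankOneCount (L : Submodule F (Fin 6 → F)) :
    sumNonzero L (fun y => (rankOneCount y : ℤ))
      = ((Fintype.card F : ℤ) - 1) ^ 2 * rankCount L 1 := by
  rw [sumNonzero_congr (h := fun y => ((Fintype.card F : ℤ) - 1) *
      if (toMat y).rank = 1 then 1 else 0), sumNonzero_rank L 1]
  · ring
  intro y _ hy
  split_ifs with h
  · have := rankOneCount_eq hy h
    rw [← this]; push_cast; ring
  · rw [rankOneCount_eq_zero hy h]; simp

theorem sumNonzero_kerCount (L : Submodule F (Fin 6 → F)) :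
    sumNonzero L (fun y => (kerCount y : ℤ))
      = ((Fintype.card F : ℤ) - 1) ^ 2 * ((Fintype.card F + 1) * rankCount L 1 + rankCount L 2) := by
  rw [sumNonzero_congr (h := fun y =>
      ((Fintype.card F : ℤ) ^ 2 - 1) * (if (toMat y).rank = 1 then 1 else 0)
      + ((Fintype.card F : ℤ) - 1) * (if (toMat y).rank = 2 then 1 else 0)),
    sumNonzero_add, sumNonzero_rank L 1, sumNonzero_rank L 2]
  · ring
  intro y _ hy
  have h1 := rank_toMat_pos hy
  have h2 := rank_toMat_le y
  have h3 := congrArg (Nat.cast : ℕ → ℤ) (kerCount_add_one y)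
  push_cast at h3
  rw [← eq_sub_iff_add_eq] at h3
  rw [h3]
  generalize (toMat y).rank = r at *
  interval_cases r <;> simp

/-- The numbers of conics of the four kinds in the web of a line, in terms of the numbers of its
points of rank one and two and of the number of double lines. -/
theorem distribution_relations (L : Submodule F (Fin 6 → F)) (hL : IsLine L) :
    let q : ℤ := Fintype.card F
    let D : Fin 4 → ℤ := fun i => conicDistribution (webOf L) i
    D 0 = isoCount L ∧
    D 0 + 2 * D 1 = q ^ 2 + q + 1 + q * ((q + 1) * rankCount L 1 + rankCount L 2) ∧
    D 1 - D 2 = q + q ^ 2 * rankCount L 1 ∧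
    D 0 + D 1 + D 2 + D 3 = q ^ 3 + q ^ 2 + q + 1 := by
  intro q D
  have hq : 1 < q := Nat.one_lt_cast.2 Fintype.one_lt_card
  have hq1 : q - 1 ≠ 0 := by omega
  have hq0 : q ≠ 0 := by omega
  have e0 := kindCount_eq L IsDoubleLine fun _ _ => isDoubleLine_smul
  have e1 := kindCount_eq L IsRealLinePair fun _ _ => isRealLinePair_smul
  have e2 := kindCount_eq L IsImaginaryLinePair fun _ _ => isImaginaryLinePair_smul
  have e3 := kindCount_eq L IsNonsingular fun _ _ => isNonsingular_smul
  change _ = D 0 * (q - 1) at e0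
  change _ = D 1 * (q - 1) at e1
  change _ = D 2 * (q - 1) at e2
  change _ = D 3 * (q - 1) at e3
  have k1 := kindCount_total L hL
  have k2 := kindCount_zeros L hL
  have k3 := kindCount_factor L hL
  rw [e0, e1, e2, e3] at k1 k2
  rw [e0, e1] at k3
  rw [sumNonzero_rankOneCount] at k2
  rw [sumNonzero_kerCount] at k3
  change _ = q ^ 4 - 1 at k1
  have t : D 0 + D 1 + D 2 + D 3 = q ^ 3 + q ^ 2 + q + 1 := by
    apply mul_right_cancel₀ hq1
    linear_combination k1
  refine ⟨?_, ?_, ?_, t⟩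
  · exact congrArg (Nat.cast : ℕ → ℤ) (ncard_doubleLines L)
  · apply mul_right_cancel₀ (pow_ne_zero 2 hq1)
    linear_combination k3
  · apply mul_right_cancel₀ (pow_ne_zero 2 hq1)
    apply mul_left_cancel₀ hq0
    linear_combination k2 - (q ^ 2 - 1) * (q - 1) * t

/-- A line all whose points have rank three determines a web with exactly one double line. -/
theorem isoCount_of_nonsingular (L : Submodule F (Fin 6 → F)) (hL : IsLine L)
    (h : ∀ y ∈ L, y ≠ 0 → detVec y ≠ 0) : isoCount L = 1 := by
  obtain ⟨d0, d1, d2, d3⟩ := distribution_relations L hL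
  have hr : ∀ k, k ≠ 3 → rankCount L k = 0 := by
    intro k hk
    rw [rankCount, Set.ncard_eq_zero (Set.toFinite _), Set.eq_empty_iff_forall_notMem]
    rintro P ⟨h1, h2⟩
    have := h _ (submodule_le_iff.1 h1) P.rep_nonzero
    rw [← rank_eq_three_iff] at this
    exact hk (h2.symm.trans this)
  rw [hr 1 (by norm_num), hr 2 (by norm_num)] at d1
  rw [hr 1 (by norm_num)] at d2
  have k := kindCount_sing L hL
  rw [kindCount_eq L IsDoubleLine fun _ _ => isDoubleLine_smul, kindCount_eq L IsRealLinePair fun _ _ => isRealLinePair_smul,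
    kindCount_eq L IsImaginaryLinePair fun _ _ => isImaginaryLinePair_smul,
    sumNonzero_congr (h := fun _ => 0 * 0) fun y hy hy0 => by
      rw [tanCount_eq_zero (h y hy hy0)]; simp, sumNonzero_mul] at k
  have hq : 1 < (Fintype.card F : ℤ) := by
    have := Fintype.one_lt_card (α := F); exact_mod_cast this
  set q : ℤ := (Fintype.card F : ℤ)
  set D : Fin 4 → ℤ := fun i => conicDistribution (webOf L) i
  change (q ^ 3 - 1) + ((q ^ 2 - 1) * (D 0 * (q - 1)) + (q - 1) * (D 1 * (q - 1))
    + (q - 1) * (D 2 * (q - 1))) = _ at k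
  have : D 0 = 1 := by
    apply mul_right_cancel₀ (pow_ne_zero 2 (sub_ne_zero.2 hq.ne'))
    apply mul_left_cancel₀ (show q ≠ 0 by omega)
    push_cast at d1 d2
    linear_combination k - (q - 1) ^ 2 * d1 + (q - 1) ^ 2 * d2
  rw [d0] at this
  exact_mod_cast this

end Solve

/-! ### Invariants of lines under the group -/

theorem isoCount_mul (L : Submodule F (Fin 6 → F)) :
    isoCount L * (Nat.card F - 1)
      = {a : Fin 3 → F | a ≠ 0 ∧ ∀ y ∈ L, bil y a a = 0}.ncard :=
  ncard_projectivization_mul (fun a => ∀ y ∈ L, bil y a a = 0) fun c v _ h y hy => by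
    rw [bil_smul_smul, h y hy, mul_zero]

theorem transpose_mulVec_injective (A : GL (Fin 3) F) :
    Function.Injective (A.1.transpose.mulVec) := by
  apply Matrix.mulVec_injective_of_isUnit
  rw [Matrix.isUnit_iff_isUnit_det, Matrix.det_transpose]
  exact (Matrix.isUnit_iff_isUnit_det _).1 A.isUnit

section Invariance

variable [Finite F]

theorem rankCount_map (A : GL (Fin 3) F) (L : Submodule F (Fin 6 → F)) (k : ℕ) :
    rankCount (L.map (lift A.1)) k = rankCount L k := by
  have hq : 1 < Nat.card F := Finite.one_lt_card
  apply Nat.eq_of_mul_eq_mul_right (Nat.sub_pos_of_lt hq)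
  rw [rankCount_mul, rankCount_mul, ← Set.ncard_image_of_injective
    {y | y ≠ 0 ∧ y ∈ L ∧ (toMat y).rank = k} (lift_injective A)]
  congr 1
  ext y
  constructor
  · rintro ⟨h0, ⟨x, hx, rfl⟩, h⟩
    refine ⟨x, ⟨?_, hx, by rwa [rank_lift] at h⟩, rfl⟩
    rintro rfl
    simp at h0
  · rintro ⟨x, ⟨h0, hx, h⟩, rfl⟩
    exact ⟨fun h' => h0 (lift_injective A (by rw [h', map_zero])), ⟨x, hx, rfl⟩, by rwa [rank_lift]⟩

theorem isoCount_map (A : GL (Fin 3) F) (L : Submodule F (Fin 6 → F)) :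
    isoCount (L.map (lift A.1)) = isoCount L := by
  have hq : 1 < Nat.card F := Finite.one_lt_card
  apply Nat.eq_of_mul_eq_mul_right (Nat.sub_pos_of_lt hq)
  rw [isoCount_mul, isoCount_mul,
    ← Set.ncard_image_of_injective _ (transpose_mulVec_injective A)]
  congr 1
  ext a
  have hinv : A.1.transpose.mulVec ((A⁻¹ : GL (Fin 3) F).1.transpose.mulVec a) = a := by
    rw [Matrix.mulVec_mulVec, ← Matrix.transpose_mul, ← Units.val_mul, inv_mul_cancel]
    simp
  constructor
  · rintro ⟨b, ⟨h0, hb⟩, rfl⟩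
    refine ⟨fun h' => h0 (transpose_mulVec_injective A (by rw [h', Matrix.mulVec_zero])), ?_⟩
    intro y hy
    rw [← bil_lift]
    exact hb _ ⟨y, hy, rfl⟩
  · rintro ⟨h0, ha⟩
    refine ⟨_, ⟨?_, ?_⟩, hinv⟩
    · intro h
      rw [h, Matrix.mulVec_zero] at hinv
      exact h0 hinv.symm
    · rintro _ ⟨y, hy, rfl⟩
      rw [bil_lift, hinv]
      exact ha y hy

end Invariance

theorem IsLine.map {L : Submodule F (Fin 6 → F)} (h : IsLine L) (A : GL (Fin 3) F) :
    IsLine (L.map (lift A.1)) := by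
  rw [IsLine, ← h]
  exact (Submodule.equivMapOfInjective _ (lift_injective A) L).finrank_eq.symm

/-- The numbers of points of rank one and of points of rank at most two of the line `L`, and the
number of double lines in its web. -/
def HasProfile (L : Submodule F (Fin 6 → F)) (r s h : ℕ) : Prop :=
  IsLine L ∧ rankCount L 1 = r ∧ rankCount L 1 + rankCount L 2 = s ∧ isoCount L = h

theorem HasProfile.of_kEquiv [Finite F] {L M : Submodule F (Fin 6 → F)} {r s h : ℕ}
    (hL : HasProfile L r s h) (hLM : KEquiv L M) : HasProfile M r s h := by
  obtain ⟨A, rfl⟩ := hLM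
  obtain ⟨h1, h2, h3, h4⟩ := hL
  exact ⟨h1.map A, by rw [rankCount_map, h2], by rw [rankCount_map, rankCount_map, h3],
    by rw [isoCount_map, h4]⟩

open Classical in
/-- The points of the plane are `(0, 0, 1)`, `(0, 1, t)` and `(1, s, t)`. -/
theorem ncard_plane_points [Finite F] (Q : (Fin 3 → F) → Prop)
    (hQ : ∀ (c : F) v, c ≠ 0 → Q v → Q (c • v)) :
    {p : ℙ F (Fin 3 → F) | Q p.rep}.ncard
      = (if Q ![0, 0, 1] then 1 else 0) + {t : F | Q ![0, 1, t]}.ncard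
        + {x : F × F | Q ![1, x.1, x.2]}.ncard := by
  have n1 : (![0, 0, 1] : Fin 3 → F) ≠ 0 := fun h => by simpa using congrFun h 2
  have n2 : ∀ t : F, (![0, 1, t] : Fin 3 → F) ≠ 0 := fun t h => by simpa using congrFun h 1
  have n3 : ∀ x : F × F, (![1, x.1, x.2] : Fin 3 → F) ≠ 0 := fun t h => by simpa using congrFun h 0
  let f2 : F → ℙ F (Fin 3 → F) := fun t => Projectivization.mk F _ (n2 t)
  let f3 : F × F → ℙ F (Fin 3 → F) := fun x => Projectivization.mk F _ (n3 x)
  have hset : {p : ℙ F (Fin 3 → F) | Q p.rep}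
      = {p | p = Projectivization.mk F _ n1 ∧ Q ![0, 0, 1]} ∪ f2 '' {t | Q ![0, 1, t]}
        ∪ f3 '' {x | Q ![1, x.1, x.2]} := by
    ext p
    simp only [Set.mem_ofPred_eq, Set.mem_union, Set.mem_image]
    constructor
    · intro h
      by_cases h0 : p.rep 0 = 0
      · left
        by_cases h1 : p.rep 1 = 0
        · left
          have h2 : p.rep 2 ≠ 0 := fun h2 => p.rep_nonzero (by ext i; fin_cases i <;> assumption)
          have hp : p = Projectivization.mk F _ n1 := by
            conv_lhs => rw [← p.mk_rep]
            rw [Projectivization.mk_eq_mk_iff']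
            exact ⟨p.rep 2, by ext i; fin_cases i <;> simp [h0, h1]⟩
          refine ⟨hp, ?_⟩
          rwa [hp, rep_mk_iff Q hQ] at h
        · right
          have hp : p = f2 (p.rep 2 / p.rep 1) := by
            conv_lhs => rw [← p.mk_rep]
            simp only [f2]
            rw [Projectivization.mk_eq_mk_iff']
            exact ⟨p.rep 1, by ext i; fin_cases i <;> simp [h0, mul_div_cancel₀ _ h1]⟩
          refine ⟨_, ?_, hp.symm⟩
          rwa [hp, rep_mk_iff Q hQ] at h
      · right
        have hp : p = f3 (p.rep 1 / p.rep 0, p.rep 2 / p.rep 0) := by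
          conv_lhs => rw [← p.mk_rep]
          simp only [f3]
          rw [Projectivization.mk_eq_mk_iff']
          exact ⟨p.rep 0, by ext i; fin_cases i <;> simp [mul_div_cancel₀ _ h0]⟩
        refine ⟨_, ?_, hp.symm⟩
        rwa [hp, rep_mk_iff Q hQ] at h
    · rintro ((⟨rfl, h⟩ | ⟨t, h, rfl⟩) | ⟨x, h, rfl⟩)
      all_goals rwa [rep_mk_iff Q hQ]
  have i2 : Function.Injective f2 := by
    intro s t h
    simp only [f2] at h
    rw [Projectivization.mk_eq_mk_iff'] at h
    obtain ⟨a, ha⟩ := h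
    have h1 := congrFun ha 1; have h2 := congrFun ha 2
    simp at h1 h2
    rw [← h2, h1, one_mul]
  have i3 : Function.Injective f3 := by
    intro s t h
    simp only [f3] at h
    rw [Projectivization.mk_eq_mk_iff'] at h
    obtain ⟨a, ha⟩ := h
    have h0 := congrFun ha 0; have h1 := congrFun ha 1; have h2 := congrFun ha 2
    simp at h0 h1 h2
    subst h0
    ext <;> simp [← h1, ← h2]
  have hfin : {p | p = Projectivization.mk F _ n1 ∧ Q ![0, 0, 1]}.Finite :=
    (Set.finite_singleton (Projectivization.mk F _ n1)).subset fun p hp => hp.1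
  have hfin2 := (Set.toFinite {t | Q ![0, 1, t]}).image f2
  rw [hset, Set.ncard_union_eq _ (hfin.union hfin2) ((Set.toFinite _).image _),
    Set.ncard_union_eq _ hfin hfin2, Set.ncard_image_of_injective _ i2,
    Set.ncard_image_of_injective _ i3]
  · congr 2
    split_ifs with hq <;> simp [hq]
  · rw [Set.disjoint_left]
    rintro p ⟨rfl, _⟩ ⟨t, _, ht⟩
    simp only [f2] at ht
    rw [Projectivization.mk_eq_mk_iff'] at ht
    obtain ⟨a, ha⟩ := ht
    simpa using congrFun ha 1
  · rw [Set.disjoint_left]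
    rintro p (⟨rfl, _⟩ | ⟨t, _, rfl⟩) ⟨x, _, hx⟩
    all_goals
      simp only [f2, f3] at hx
      rw [Projectivization.mk_eq_mk_iff'] at hx
      obtain ⟨a, ha⟩ := hx
      simpa using congrFun ha 0

section Span

variable {y z : Fin 6 → F}

theorem isLine_span_pair (h : LinearIndependent F ![y, z]) : IsLine (Submodule.span F {y, z}) :=
  finrank_span_pair h

theorem forall_mem_span_pair_bil (y z : Fin 6 → F) (a b : Fin 3 → F) :
    (∀ x ∈ Submodule.span F {y, z}, bil x a b = 0) ↔ bil y a b = 0 ∧ bil z a b = 0 := by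
  constructor
  · exact fun h => ⟨h y (Submodule.subset_span (by simp)), h z (Submodule.subset_span (by simp))⟩
  · rintro ⟨h1, h2⟩ x hx
    obtain ⟨s, t, rfl⟩ := Submodule.mem_span_pair.1 hx
    rw [bil_add, bil_smul, bil_smul, h1, h2, mul_zero, mul_zero, add_zero]

theorem add_smul_ne_zero (h : LinearIndependent F ![y, z]) (t : F) : y + t • z ≠ 0 := by
  rw [LinearIndependent.pair_iff] at h
  exact fun ht => by simpa using (h 1 t (by simpa using ht)).1

open Classical in
theorem rankCount_one_span_pair [Finite F] (h : LinearIndependent F ![y, z]) :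
    rankCount (Submodule.span F {y, z}) 1
      = (if MinorsVanish z then 1 else 0) + {t : F | MinorsVanish (y + t • z)}.ncard := by
  rw [rankCount]
  unfold ptRank
  rw [ncard_points_span_pair h (fun y => (toMat y).rank = 1)
    fun c v hc h => by rwa [rank_toMat_smul hc]]
  simp only [rank_eq_one_iff (show z ≠ 0 from h.ne_zero 1), rank_eq_one_iff (add_smul_ne_zero h _)]

theorem rankCount_one_add_two (L : Submodule F (Fin 6 → F)) [Finite F] :
    rankCount L 1 + rankCount L 2
      = {P : ℙ F (Fin 6 → F) | P.submodule ≤ L ∧ detVec P.rep = 0}.ncard := by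
  have : {P : ℙ F (Fin 6 → F) | P.submodule ≤ L ∧ detVec P.rep = 0}
      = {P | P.submodule ≤ L ∧ ptRank P = 1} ∪ {P | P.submodule ≤ L ∧ ptRank P = 2} := by
    ext P
    simp only [Set.mem_union, Set.mem_ofPred_eq, ← and_or_left]
    refine and_congr_right fun _ => ?_
    have h3 := rank_eq_three_iff (y := P.rep)
    rw [← not_iff_not, ← ne_eq, ← h3, ptRank]
    have := rank_toMat_pos P.rep_nonzero
    have := rank_toMat_le P.rep
    omega
  rw [this, Set.ncard_union_eq, rankCount, rankCount]
  rw [Set.disjoint_left]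
  rintro P ⟨_, h1⟩ ⟨_, h2⟩
  omega

theorem detVec_smul (c : F) (y : Fin 6 → F) : detVec (c • y) = c ^ 3 * detVec y := by
  simp only [detVec, Pi.smul_apply, smul_eq_mul]; ring

open Classical in
theorem rankCount_add_span_pair [Finite F] (h : LinearIndependent F ![y, z]) :
    rankCount (Submodule.span F {y, z}) 1 + rankCount (Submodule.span F {y, z}) 2
      = (if detVec z = 0 then 1 else 0) + {t : F | detVec (y + t • z) = 0}.ncard := by
  rw [rankCount_one_add_two]
  exact ncard_points_span_pair h (fun y => detVec y = 0) fun c v _ h => by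
    rw [detVec_smul, h, mul_zero]

open Classical in
theorem isoCount_span_pair [Finite F] (y z : Fin 6 → F) :
    isoCount (Submodule.span F {y, z})
      = (if y 5 = 0 ∧ z 5 = 0 then 1 else 0)
        + {t : F | y 3 + 2 * y 4 * t + y 5 * t ^ 2 = 0 ∧ z 3 + 2 * z 4 * t + z 5 * t ^ 2 = 0}.ncard
        + {x : F × F | y 0 + 2 * y 1 * x.1 + 2 * y 2 * x.2 + y 3 * x.1 ^ 2 + 2 * y 4 * (x.1 * x.2)
              + y 5 * x.2 ^ 2 = 0 ∧
            z 0 + 2 * z 1 * x.1 + 2 * z 2 * x.2 + z 3 * x.1 ^ 2 + 2 * z 4 * (x.1 * x.2)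
              + z 5 * x.2 ^ 2 = 0}.ncard := by
  rw [isoCount]
  simp only [forall_mem_span_pair_bil]
  rw [ncard_plane_points (fun a => bil y a a = 0 ∧ bil z a a = 0) fun c v _ h => by
    rw [bil_smul_smul, bil_smul_smul, h.1, h.2]; simp]
  have e1 : ∀ y : Fin 6 → F, bil y ![0, 0, 1] ![0, 0, 1] = y 5 := fun y => by simp [bil_eq]
  have e2 : ∀ (y : Fin 6 → F) (t : F), bil y ![0, 1, t] ![0, 1, t]
      = y 3 + 2 * y 4 * t + y 5 * t ^ 2 := fun y t => by simp [bil_eq]; ring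
  have e3 : ∀ (y : Fin 6 → F) (x : F × F), bil y ![1, x.1, x.2] ![1, x.1, x.2]
      = y 0 + 2 * y 1 * x.1 + 2 * y 2 * x.2 + y 3 * x.1 ^ 2 + 2 * y 4 * (x.1 * x.2)
              + y 5 * x.2 ^ 2 := fun y x => by simp [bil_eq]; ring
  simp only [e1, e2, e3]

end Span

/-! ### The invariants of the representatives -/

theorem ncard_eq_zero_of_forall {α : Type*} {P : α → Prop} (h : ∀ x, ¬ P x) :
    {x | P x}.ncard = 0 := by
  simp [h]

theorem ncard_eq_one_of_forall {α : Type*} {P : α → Prop} (a : α) (h : ∀ x, P x ↔ x = a) :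
    {x | P x}.ncard = 1 := by
  simp [h]

theorem ncard_eq_two_of_forall {α : Type*} {P : α → Prop} {a b : α} (hab : a ≠ b)
    (h : ∀ x, P x ↔ x = a ∨ x = b) : {x | P x}.ncard = 2 := by
  rw [← Set.ncard_pair hab]
  congr 1
  ext x; simp [h]

theorem ncard_eq_card_of_forall {α ι : Type*} [Fintype ι] {P : α → Prop} (f : ι → α)
    (hf : Function.Injective f) (h : ∀ x, P x ↔ ∃ t, x = f t) :
    {x | P x}.ncard = Fintype.card ι := by
  have : {x | P x} = f '' Set.univ := by ext x; simp [h, eq_comm]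
  rw [this, Set.ncard_image_of_injective _ hf, Set.ncard_univ, Nat.card_eq_fintype_card]

theorem neg_eq_self_of_two_eq_zero (h2 : (2 : F) = 0) (x : F) : -x = x := by
  linear_combination (-x) * h2

theorem sq_eq_sq_of_two_eq_zero (h2 : (2 : F) = 0) {x y : F} : x ^ 2 = y ^ 2 ↔ x = y := by
  rw [sq_eq_sq_iff_eq_or_eq_neg, neg_eq_self_of_two_eq_zero h2, or_self]

theorem one_ne_neg_one_of_two_ne_zero (h2 : (2 : F) ≠ 0) : (1 : F) ≠ -1 := fun h =>
  h2 (by linear_combination h)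

theorem sq_eq_one_iff_eq_or_eq_neg {t : F} : t ^ 2 = 1 ↔ t = 1 ∨ t = -1 := by
  rw [← sq_eq_sq_iff_eq_or_eq_neg, one_pow]

theorem one_sub_sq_iff {t : F} : 1 + -t ^ 2 = 0 ↔ t = 1 ∨ t = -1 := by
  rw [← sq_eq_one_iff_eq_or_eq_neg]
  constructor <;> intro h <;> linear_combination -h

theorem ne_zero_of_not_isSquare {d : F} (hd : ¬ IsSquare d) : d ≠ 0 := by
  rintro rfl; exact hd IsSquare.zero

theorem isSquare_of_mul_sq {d s t : F} (ht : t ≠ 0) (h : d * t ^ 2 = s ^ 2) : IsSquare d :=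
  ⟨s / t, by field_simp; linear_combination h⟩

theorem isSquare_mul_of_not_isSquare [Fintype F] {a b : F} (ha : ¬ IsSquare a) (hb : ¬ IsSquare b) :
    IsSquare (a * b) := by
  classical
  by_cases h2 : ringChar F = 2
  · exact FiniteField.isSquare_of_char_two h2 _
  have h1 := (quadraticChar_neg_one_iff_not_isSquare (F := F)).2 ha
  have h3 := (quadraticChar_neg_one_iff_not_isSquare (F := F)).2 hb
  rw [← quadraticChar_one_iff_isSquare
    (mul_ne_zero (ne_zero_of_not_isSquare ha) (ne_zero_of_not_isSquare hb)), map_mul, h1, h3]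
  norm_num

theorem isSquare_of_two_eq_zero [Fintype F] (h2 : (2 : F) = 0) (x : F) : IsSquare x :=
  FiniteField.isSquare_of_char_two
    (CharP.ringChar_of_prime_eq_zero Nat.prime_two (by exact_mod_cast h2)) x

theorem two_ne_zero_of_not_isSquare [Fintype F] {d : F} (hd : ¬ IsSquare d) : (2 : F) ≠ 0 :=
  fun h2 => hd (isSquare_of_two_eq_zero h2 d)

/-- If `v = -r ^ 2`, then exactly one of the two values below is a square, because their product is
the discriminant of an irreducible polynomial. -/
theorem isSquare_or_of_quadCond [Fintype F] (h2 : (2 : F) ≠ 0) {a v r : F} (hv : QuadCond a v)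
    (hr : -v = r ^ 2) :
    (IsSquare (-(2 * r + a * r ^ 2)) ∧ ¬ IsSquare (-(2 * -r + a * (-r) ^ 2))) ∨
    (IsSquare (-(2 * -r + a * (-r) ^ 2)) ∧ ¬ IsSquare (-(2 * r + a * r ^ 2))) := by
  have hr0 : r ≠ 0 := by rintro rfl; exact hv.1 (by linear_combination -hr)
  have hprod : ¬ IsSquare (-(2 * r + a * r ^ 2) * -(2 * -r + a * (-r) ^ 2)) := by
    rintro ⟨w, hw⟩
    apply hv.2 (-(a * r ^ 2 + w) / (2 * r ^ 2))
    field_simp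
    linear_combination (-a ^ 2 * r ^ 4 - w ^ 2 + 2 * a ^ 2 * r ^ 4) * hr + r ^ 2 * hw
  by_cases h : IsSquare (-(2 * r + a * r ^ 2)) <;>
    by_cases h' : IsSquare (-(2 * -r + a * (-r) ^ 2))
  · exact absurd (h.mul h') hprod
  · exact Or.inl ⟨h, h'⟩
  · exact Or.inr ⟨h', h⟩
  · exact absurd (isSquare_mul_of_not_isSquare h h') hprod

open Classical in
theorem HasProfile.span_pair [Finite F] {y z : Fin 6 → F} {r s h : ℕ}
    (hyz : LinearIndependent F ![y, z])
    (hr : (if MinorsVanish z then 1 else 0) + {t : F | MinorsVanish (y + t • z)}.ncard = r)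
    (hs : (if detVec z = 0 then 1 else 0) + {t : F | detVec (y + t • z) = 0}.ncard = s)
    (hh : (if y 5 = 0 ∧ z 5 = 0 then 1 else 0)
        + {t : F | y 3 + 2 * y 4 * t + y 5 * t ^ 2 = 0 ∧ z 3 + 2 * z 4 * t + z 5 * t ^ 2 = 0}.ncard
        + {x : F × F | y 0 + 2 * y 1 * x.1 + 2 * y 2 * x.2 + y 3 * x.1 ^ 2 + 2 * y 4 * (x.1 * x.2)
              + y 5 * x.2 ^ 2 = 0 ∧
            z 0 + 2 * z 1 * x.1 + 2 * z 2 * x.2 + z 3 * x.1 ^ 2 + 2 * z 4 * (x.1 * x.2)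
              + z 5 * x.2 ^ 2 = 0}.ncard = h) :
    HasProfile (Submodule.span F {y, z}) r s h :=
  ⟨isLine_span_pair hyz, by rw [rankCount_one_span_pair hyz, hr],
    by rw [rankCount_add_span_pair hyz, hs], by rw [isoCount_span_pair, hh]⟩

theorem profile_o5 [Fintype F] :
    HasProfile (lineOf fun x y : F => !![x, 0, 0; 0, y, 0; 0, 0, 0]) 2 (Fintype.card F + 1) 1 := by
  classical
  refine HasProfile.span_pair ?_ ?_ ?_ ?_
  · rw [LinearIndependent.pair_iff]
    intro s t h
    have h0 := congrFun h 0; have h1 := congrFun h 3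
    simp [toVec] at h0 h1
    exact ⟨by simpa using h0, by simpa using h1⟩
  · simp [MinorsVanish, toVec]
  · simp [detVec, toVec]
    omega
  · simp [toVec]

theorem profile_o6 [Fintype F] :
    HasProfile (lineOf fun x y : F => !![x, y, 0; y, 0, 0; 0, 0, 0])
      1 (Fintype.card F + 1) (Fintype.card F + 1) := by
  classical
  refine HasProfile.span_pair ?_ ?_ ?_ ?_
  · rw [LinearIndependent.pair_iff]
    intro s t h
    have h0 := congrFun h 0; have h1 := congrFun h 1
    simp [toVec] at h0 h1
    exact ⟨by simpa using h0, by simpa using h1⟩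
  · simp [MinorsVanish, toVec]
    exact ⟨0, by ext t; simp [eq_comm (a := (0 : F))]⟩
  · simp [detVec, toVec]
    omega
  · simp [toVec]
    omega

theorem profile_o8_1_odd [Fintype F] (h2 : (2 : F) ≠ 0) :
    HasProfile (lineOf fun x y : F => !![x, 0, 0; 0, y, 0; 0, 0, -y]) 1 2 2 := by
  classical
  refine HasProfile.span_pair ?_ ?_ ?_ ?_
  · rw [LinearIndependent.pair_iff]
    intro s t h
    have h0 := congrFun h 0; have h1 := congrFun h 3
    simp [toVec] at h0 h1
    exact ⟨by simpa using h0, by simpa using h1⟩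
  · simp [MinorsVanish, toVec]
  · simp [detVec, toVec]
  · simp [toVec]
    exact ncard_eq_two_of_forall (one_ne_neg_one_of_two_ne_zero h2) fun t => by
      exact one_sub_sq_iff

theorem profile_o8_1_even [Fintype F] (h2 : (2 : F) = 0) :
    HasProfile (lineOf fun x y : F => !![x, 0, 0; 0, y, 0; 0, 0, -y]) 1 2 1 := by
  classical
  refine HasProfile.span_pair ?_ ?_ ?_ ?_
  · rw [LinearIndependent.pair_iff]
    intro s t h
    have h0 := congrFun h 0; have h1 := congrFun h 3
    simp [toVec] at h0 h1
    exact ⟨by simpa using h0, by simpa using h1⟩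
  · simp [MinorsVanish, toVec]
  · simp [detVec, toVec]
  · simp [toVec, h2]
    exact ⟨1, by ext t; rw [Set.mem_singleton_iff, ← sq_eq_sq_of_two_eq_zero h2, Set.mem_ofPred_eq]; constructor <;> intro h <;> linear_combination -h⟩

theorem profile_o8_2 [Fintype F] {d : F} (hd : ¬ IsSquare d) :
    HasProfile (lineOf fun x y : F => !![x, 0, 0; 0, y, 0; 0, 0, -d * y]) 1 2 0 := by
  classical
  refine HasProfile.span_pair ?_ ?_ ?_ ?_
  · rw [LinearIndependent.pair_iff]
    intro s t h
    have h0 := congrFun h 0; have h1 := congrFun h 3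
    simp [toVec] at h0 h1
    exact ⟨by simpa using h0, by simpa using h1⟩
  · simp [MinorsVanish, toVec]
    simp [ne_zero_of_not_isSquare hd]
  · simp [detVec, toVec]
    simp [ne_zero_of_not_isSquare hd]
  · simp [toVec]
    refine ⟨ne_zero_of_not_isSquare hd, ncard_eq_zero_of_forall fun t h => ?_⟩
    have ht : t ≠ 0 := by rintro rfl; simp at h
    exact hd (isSquare_of_mul_sq (s := 1) ht (by linear_combination -h))

theorem profile_o8_3 [Fintype F] (h2 : (2 : F) = 0) :
    HasProfile (lineOf fun x y : F => !![x, 0, 0; 0, 0, y; 0, y, 0]) 1 2 (Fintype.card F + 1) := by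
  classical
  refine HasProfile.span_pair ?_ ?_ ?_ ?_
  · rw [LinearIndependent.pair_iff]
    intro s t h
    have h0 := congrFun h 0; have h1 := congrFun h 4
    simp [toVec] at h0 h1
    exact ⟨by simpa using h0, by simpa using h1⟩
  · simp [MinorsVanish, toVec]
    exact ⟨0, by ext t; simp +contextual [eq_comm]⟩
  · simp [detVec, toVec]
  · simp [toVec, h2]
    omega

theorem profile_o9 [Fintype F] :
    HasProfile (lineOf fun x y : F => !![x, 0, y; 0, y, 0; y, 0, 0]) 1 1 1 := by
  classical
  refine HasProfile.span_pair ?_ ?_ ?_ ?_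
  · rw [LinearIndependent.pair_iff]
    intro s t h
    have h0 := congrFun h 0; have h1 := congrFun h 3
    simp [toVec] at h0 h1
    exact ⟨by simpa using h0, by simpa using h1⟩
  · simp [MinorsVanish, toVec]
    exact ⟨0, by ext t; simp +contextual [eq_comm]⟩
  · simp [detVec, toVec]
  · simp [toVec]

theorem profile_o10 [Fintype F] {a v : F} (hv : QuadCond a v) :
    HasProfile (lineOf fun x y : F => !![v * x, y, 0; y, x + a * y, 0; 0, 0, 0])
      0 (Fintype.card F + 1) 1 := by
  classical
  refine HasProfile.span_pair ?_ ?_ ?_ ?_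
  · rw [LinearIndependent.pair_iff]
    intro s t h
    have h0 := congrFun h 0; have h1 := congrFun h 1
    simp [toVec] at h0 h1
    exact ⟨by simpa [hv.1] using h0, by simpa using h1⟩
  · simp [MinorsVanish, toVec]
    refine ncard_eq_zero_of_forall fun t h => ?_
    have ht : t ≠ 0 := by rintro rfl; exact hv.1 (by simpa using h)
    apply hv.2 (1 / t)
    field_simp
    linear_combination h
  · simp [detVec, toVec]
    omega
  · simp [toVec]
    refine ncard_eq_zero_of_forall fun x h => ?_
    have hx : x.1 ≠ 0 := fun h0 => hv.1 (by simpa [h0] using h.1)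
    apply hv.2 (1 / x.1)
    field_simp
    apply mul_right_cancel₀ hx
    linear_combination (a * x.1 + 1) * x.1 * h.1 - x.1 ^ 2 * h.2

theorem profile_o12_1_odd [Fintype F] (h2 : (2 : F) ≠ 0) :
    HasProfile (lineOf fun x y : F => !![0, x, 0; x, 0, y; 0, y, 0])
      0 (Fintype.card F + 1) (Fintype.card F + 2) := by
  classical
  refine HasProfile.span_pair ?_ ?_ ?_ ?_
  · rw [LinearIndependent.pair_iff]
    intro s t h
    have h0 := congrFun h 1; have h1 := congrFun h 4
    simp [toVec] at h0 h1
    exact ⟨by simpa using h0, by simpa using h1⟩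
  · simp [MinorsVanish, toVec]
  · simp [detVec, toVec]
    omega
  · simp [toVec, h2]
    rw [ncard_eq_card_of_forall (fun t : F => ((0 : F), t)) (fun s t h => by simpa using h)]
    · omega
    · rintro ⟨x, y⟩; simp +contextual [Prod.ext_iff]

theorem profile_o12_1_even [Fintype F] (h2 : (2 : F) = 0) :
    HasProfile (lineOf fun x y : F => !![0, x, 0; x, 0, y; 0, y, 0])
      0 (Fintype.card F + 1) (Fintype.card F ^ 2 + Fintype.card F + 1) := by
  classical
  refine HasProfile.span_pair ?_ ?_ ?_ ?_
  · rw [LinearIndependent.pair_iff]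
    intro s t h
    have h0 := congrFun h 1; have h1 := congrFun h 4
    simp [toVec] at h0 h1
    exact ⟨by simpa using h0, by simpa using h1⟩
  · simp [MinorsVanish, toVec]
  · simp [detVec, toVec]
    omega
  · simp [toVec, h2]
    ring

theorem profile_o12_3 [Fintype F] (h2 : (2 : F) = 0) :
    HasProfile (lineOf fun x y : F => !![0, x, 0; x, x + y, y; 0, y, 0])
      0 (Fintype.card F + 1) (Fintype.card F + 1) := by
  classical
  refine HasProfile.span_pair ?_ ?_ ?_ ?_
  · rw [LinearIndependent.pair_iff]
    intro s t h
    have h0 := congrFun h 1; have h1 := congrFun h 4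
    simp [toVec] at h0 h1
    exact ⟨by simpa using h0, by simpa using h1⟩
  · simp [MinorsVanish, toVec]
  · simp [detVec, toVec]
    omega
  · simp [toVec, h2]
    rw [ncard_eq_card_of_forall (fun t : F => ((0 : F), t)) (fun s t h => by simpa using h)]
    · omega
    · rintro ⟨x, y⟩; simp [Prod.ext_iff]

theorem profile_o13_1_odd [Fintype F] (h2 : (2 : F) ≠ 0) :
    HasProfile (lineOf fun x y : F => !![0, x, 0; x, y, 0; 0, 0, -y]) 0 2 3 := by
  classical
  refine HasProfile.span_pair ?_ ?_ ?_ ?_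
  · rw [LinearIndependent.pair_iff]
    intro s t h
    have h0 := congrFun h 1; have h1 := congrFun h 3
    simp [toVec] at h0 h1
    exact ⟨by simpa using h0, by simpa using h1⟩
  · simp [MinorsVanish, toVec]
  · simp [detVec, toVec]
  · simp [toVec, h2]
    rw [ncard_eq_two_of_forall (one_ne_neg_one_of_two_ne_zero h2) fun t => by
        exact one_sub_sq_iff,
      ncard_eq_one_of_forall ((0 : F), (0 : F)) fun x => by
        obtain ⟨x, y⟩ := x; simp +contextual [Prod.ext_iff]]

theorem profile_o13_1_even [Fintype F] (h2 : (2 : F) = 0) :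
    HasProfile (lineOf fun x y : F => !![0, x, 0; x, y, 0; 0, 0, -y]) 0 2 (Fintype.card F + 1) := by
  classical
  refine HasProfile.span_pair ?_ ?_ ?_ ?_
  · rw [LinearIndependent.pair_iff]
    intro s t h
    have h0 := congrFun h 1; have h1 := congrFun h 3
    simp [toVec] at h0 h1
    exact ⟨by simpa using h0, by simpa using h1⟩
  · simp [MinorsVanish, toVec]
  · simp [detVec, toVec]
  · simp [toVec, h2]
    rw [ncard_eq_one_of_forall (1 : F) fun t => by
        rw [← sq_eq_sq_of_two_eq_zero h2 (y := 1)]; constructor <;> intro h <;> linear_combination -h,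
      ncard_eq_card_of_forall (fun t : F => (t, t)) (fun s t h => by simpa using h) fun x => by
        obtain ⟨x, y⟩ := x
        rw [← sub_eq_add_neg, sub_eq_zero, sq_eq_sq_of_two_eq_zero h2]
        simp [Prod.ext_iff, eq_comm]]
    omega

theorem profile_o13_2 [Fintype F] (h2 : (2 : F) ≠ 0) {d : F} (hd : ¬ IsSquare d) :
    HasProfile (lineOf fun x y : F => !![0, x, 0; x, y, 0; 0, 0, -d * y]) 0 2 1 := by
  classical
  refine HasProfile.span_pair ?_ ?_ ?_ ?_
  · rw [LinearIndependent.pair_iff]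
    intro s t h
    have h0 := congrFun h 1; have h1 := congrFun h 3
    simp [toVec] at h0 h1
    exact ⟨by simpa using h0, by simpa using h1⟩
  · simp [MinorsVanish, toVec]
    exact ne_zero_of_not_isSquare hd
  · simp [detVec, toVec]
    simp [ne_zero_of_not_isSquare hd]
  · simp [toVec, h2]
    rw [if_neg (ne_zero_of_not_isSquare hd), ncard_eq_zero_of_forall,
      ncard_eq_one_of_forall ((0 : F), (0 : F)) fun x => by
        obtain ⟨x, y⟩ := x; simp +contextual [Prod.ext_iff, ne_zero_of_not_isSquare hd]]
    intro t h
    have ht : t ≠ 0 := by rintro rfl; simp at h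
    exact hd (isSquare_of_mul_sq (s := 1) ht (by linear_combination -h))

theorem profile_o13_3 [Fintype F] (h2 : (2 : F) = 0) :
    HasProfile (lineOf fun x y : F => !![0, x, 0; x, x + y, 0; 0, 0, y]) 0 2 1 := by
  classical
  refine HasProfile.span_pair ?_ ?_ ?_ ?_
  · rw [LinearIndependent.pair_iff]
    intro s t h
    have h0 := congrFun h 1; have h1 := congrFun h 5
    simp [toVec] at h0 h1
    exact ⟨by simpa using h0, by simpa using h1⟩
  · simp [MinorsVanish, toVec]
  · simp [detVec, toVec]
  · simp [toVec, h2]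
    exact ⟨0, 0, by ext ⟨x, y⟩; simp +contextual [Prod.ext_iff]⟩

theorem profile_o14_1_odd [Fintype F] (h2 : (2 : F) ≠ 0) :
    HasProfile (lineOf fun x y : F => !![x, 0, 0; 0, -(x + y), 0; 0, 0, y]) 0 3 4 := by
  classical
  refine HasProfile.span_pair ?_ ?_ ?_ ?_
  · rw [LinearIndependent.pair_iff]
    intro s t h
    have h0 := congrFun h 0; have h1 := congrFun h 5
    simp [toVec] at h0 h1
    exact ⟨by simpa using h0, by simpa using h1⟩
  · simp [MinorsVanish, toVec]
    exact ncard_eq_zero_of_forall fun t h => by simp [h.2.1] at h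
  · simp [detVec, toVec]
    rw [ncard_eq_two_of_forall (a := -1) (b := 0) (by simp) fun t => or_congr_left ?_]
    constructor <;> intro h <;> linear_combination -h
  · simp [toVec]
    have h1 := one_ne_neg_one_of_two_ne_zero h2
    have hset : {x : F × F | 1 + -x.1 ^ 2 = 0 ∧ -x.1 ^ 2 + x.2 ^ 2 = 0}
        = (({1, -1} : Set F) ×ˢ ({1, -1} : Set F)) := by
      ext ⟨x, y⟩
      simp only [Set.mem_ofPred_eq, Set.mem_prod, Set.mem_insert_iff, Set.mem_singleton_iff,
        ← sq_eq_one_iff_eq_or_eq_neg]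
      constructor
      · rintro ⟨h, h'⟩; exact ⟨by linear_combination -h, by linear_combination h' - h⟩
      · rintro ⟨h, h'⟩; exact ⟨by linear_combination -h, by linear_combination h' - h⟩
    rw [hset, Set.ncard_prod, Set.ncard_pair h1]

theorem profile_o14_1_even [Fintype F] (h2 : (2 : F) = 0) :
    HasProfile (lineOf fun x y : F => !![x, 0, 0; 0, -(x + y), 0; 0, 0, y]) 0 3 1 := by
  classical
  refine HasProfile.span_pair ?_ ?_ ?_ ?_
  · rw [LinearIndependent.pair_iff]
    intro s t h
    have h0 := congrFun h 0; have h1 := congrFun h 5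
    simp [toVec] at h0 h1
    exact ⟨by simpa using h0, by simpa using h1⟩
  · simp [MinorsVanish, toVec]
    exact ncard_eq_zero_of_forall fun t h => by simp [h.2.1] at h
  · simp [detVec, toVec]
    rw [ncard_eq_two_of_forall (a := -1) (b := 0) (by simp) fun t => or_congr_left ?_]
    constructor <;> intro h <;> linear_combination -h
  · simp [toVec, h2]
    refine ⟨1, 1, ?_⟩
    ext ⟨x, y⟩
    rw [Set.mem_singleton_iff, Prod.mk.injEq, ← sq_eq_sq_of_two_eq_zero h2,
      ← sq_eq_sq_of_two_eq_zero h2 (x := y), Set.mem_ofPred_eq]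
    constructor
    · rintro ⟨h, h'⟩; exact ⟨by linear_combination -h, by linear_combination h' - h⟩
    · rintro ⟨h, h'⟩; exact ⟨by linear_combination -h, by linear_combination h' - h⟩

theorem profile_o14_2 [Fintype F] {d : F} (hd : ¬ IsSquare d) :
    HasProfile (lineOf fun x y : F => !![x, 0, 0; 0, -d * (x + y), 0; 0, 0, y]) 0 3 0 := by
  classical
  refine HasProfile.span_pair ?_ ?_ ?_ ?_
  · rw [LinearIndependent.pair_iff]
    intro s t h
    have h0 := congrFun h 0; have h1 := congrFun h 5
    simp [toVec] at h0 h1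
    exact ⟨by simpa using h0, by simpa using h1⟩
  · simp [MinorsVanish, toVec]
    refine ⟨ne_zero_of_not_isSquare hd, ncard_eq_zero_of_forall fun t h => ?_⟩
    exact ne_zero_of_not_isSquare hd (by simpa [h.2.1] using h.1)
  · simp [detVec, toVec]
    rw [ncard_eq_two_of_forall (a := -1) (b := 0) (by simp) fun t => or_congr_left ?_]
    constructor
    · intro h
      apply mul_left_cancel₀ (ne_zero_of_not_isSquare hd)
      linear_combination -h
    · rintro rfl; ring
  · simp [toVec]
    refine ⟨ncard_eq_zero_of_forall fun t h => ne_zero_of_not_isSquare hd h.1,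
      ncard_eq_zero_of_forall fun x h => ?_⟩
    have hx : x.1 ≠ 0 := fun h0 => by simp [h0] at h
    exact hd (isSquare_of_mul_sq (s := 1) hx (by linear_combination -h.1))

theorem profile_o15_1_odd [Fintype F] (h2 : (2 : F) ≠ 0) {a v : F} (hv : QuadCond a v) (hs : IsSquare (-v)) :
    HasProfile (lineOf fun x y : F => !![v * y, x, 0; x, a * x + y, 0; 0, 0, x]) 0 1 2 := by
  classical
  refine HasProfile.span_pair ?_ ?_ ?_ ?_
  · rw [LinearIndependent.pair_iff]
    intro s t h
    have h0 := congrFun h 5; have h1 := congrFun h 0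
    simp [toVec] at h0 h1
    exact ⟨by simpa using h0, by simpa [hv.1] using h1⟩
  · simp [MinorsVanish, toVec]
    exact hv.1
  · simp [detVec, toVec]
    exact ncard_eq_zero_of_forall fun t h => hv.2 t (by linear_combination h)
  · simp [toVec]
    obtain ⟨r, hr⟩ := hs
    rw [← pow_two] at hr
    have key : ∀ r : F, -v = r ^ 2 → IsSquare (-(2 * r + a * r ^ 2)) →
        ¬ IsSquare (-(2 * -r + a * (-r) ^ 2)) →
        {x : F × F | 2 * x.1 + a * x.1 ^ 2 + x.2 ^ 2 = 0 ∧ v + x.1 ^ 2 = 0}.ncard = 2 := by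
      intro r hr hA hB
      obtain ⟨w, hw⟩ := hA
      have hw0 : w ≠ 0 := by
        rintro rfl
        have hr0 : r ≠ 0 := by rintro rfl; exact hv.1 (by linear_combination -hr)
        have : a * r = -2 := by
          apply mul_right_cancel₀ hr0; linear_combination -hw
        apply hv.2 (1 / r)
        field_simp
        linear_combination (-a * r - 1) * hr - r ^ 2 * this
      refine ncard_eq_two_of_forall (a := (r, w)) (b := (r, -w)) ?_ ?_
      · simp only [ne_eq, Prod.mk.injEq, true_and]
        intro h
        apply hw0
        apply (mul_eq_zero.1 (show (2 : F) * w = 0 by linear_combination h)).resolve_left h2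
      · rintro ⟨x, y⟩
        simp only [Prod.mk.injEq]
        constructor
        · rintro ⟨h3, h4⟩
          have hx : x ^ 2 = r ^ 2 := by linear_combination h4 + hr
          rcases sq_eq_sq_iff_eq_or_eq_neg.1 hx with rfl | rfl
          · have : y ^ 2 = w ^ 2 := by linear_combination h3 + hw
            rcases sq_eq_sq_iff_eq_or_eq_neg.1 this with rfl | rfl <;> simp
          · exact absurd ⟨y, by linear_combination -h3⟩ hB
        · rintro (⟨rfl, rfl⟩ | ⟨rfl, rfl⟩)
          · exact ⟨by linear_combination -hw, by linear_combination -hr⟩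
          · exact ⟨by linear_combination -hw, by linear_combination -hr⟩
    rcases isSquare_or_of_quadCond h2 hv hr with ⟨hA, hB⟩ | ⟨hA, hB⟩
    · exact key r hr hA hB
    · exact key (-r) (by rw [hr]; ring) hA (by rwa [neg_neg])

theorem profile_o15_1_even [Fintype F] (h2 : (2 : F) = 0) {a v : F} (hv : QuadCond a v) (hs : IsSquare (-v)) :
    HasProfile (lineOf fun x y : F => !![v * y, x, 0; x, a * x + y, 0; 0, 0, x]) 0 1 1 := by
  classical
  refine HasProfile.span_pair ?_ ?_ ?_ ?_
  · rw [LinearIndependent.pair_iff]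
    intro s t h
    have h0 := congrFun h 5; have h1 := congrFun h 0
    simp [toVec] at h0 h1
    exact ⟨by simpa using h0, by simpa [hv.1] using h1⟩
  · simp [MinorsVanish, toVec]
    exact hv.1
  · simp [detVec, toVec]
    exact ncard_eq_zero_of_forall fun t h => hv.2 t (by linear_combination h)
  · simp [toVec, h2]
    obtain ⟨r, hr⟩ := hs
    obtain ⟨w, hw⟩ := isSquare_of_two_eq_zero h2 (-(a * r ^ 2))
    refine ⟨r, w, ?_⟩
    ext ⟨x, y⟩
    rw [Set.mem_singleton_iff, Prod.mk.injEq, ← sq_eq_sq_of_two_eq_zero h2,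
      ← sq_eq_sq_of_two_eq_zero h2 (x := y), Set.mem_ofPred_eq]
    constructor
    · rintro ⟨h3, h4⟩
      exact ⟨by linear_combination h4 + hr, by linear_combination h3 + hw - a * h4 - a * hr⟩
    · rintro ⟨h3, h4⟩
      exact ⟨by linear_combination a * h3 + h4 - hw, by linear_combination h3 - hr⟩

theorem profile_o15_2 [Fintype F] {a v : F} (hv : QuadCond a v) (hs : ¬ IsSquare (-v)) :
    HasProfile (lineOf fun x y : F => !![v * y, x, 0; x, a * x + y, 0; 0, 0, x]) 0 1 0 := by
  classical
  refine HasProfile.span_pair ?_ ?_ ?_ ?_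
  · rw [LinearIndependent.pair_iff]
    intro s t h
    have h0 := congrFun h 5; have h1 := congrFun h 0
    simp [toVec] at h0 h1
    exact ⟨by simpa using h0, by simpa [hv.1] using h1⟩
  · simp [MinorsVanish, toVec]
    exact hv.1
  · simp [detVec, toVec]
    exact ncard_eq_zero_of_forall fun t h => hv.2 t (by linear_combination h)
  · simp [toVec]
    exact ncard_eq_zero_of_forall fun x h => hs ⟨x.1, by linear_combination -h.2⟩

theorem profile_o16_1_odd [Fintype F] (h2 : (2 : F) ≠ 0) :
    HasProfile (lineOf fun x y : F => !![0, 0, x; 0, x, y; x, y, 0]) 0 1 2 := by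
  classical
  refine HasProfile.span_pair ?_ ?_ ?_ ?_
  · rw [LinearIndependent.pair_iff]
    intro s t h
    have h0 := congrFun h 2; have h1 := congrFun h 4
    simp [toVec] at h0 h1
    exact ⟨by simpa using h0, by simpa using h1⟩
  · simp [MinorsVanish, toVec]
  · simp [detVec, toVec]
  · simp [toVec, h2]
    rw [ncard_eq_one_of_forall ((0 : F), (0 : F))]
    rintro ⟨x, y⟩
    simp only [Prod.mk.injEq]
    constructor
    · rintro ⟨h, rfl | rfl⟩
      · simpa [h2] using h
      · simpa using h
    · rintro ⟨rfl, rfl⟩; simp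

theorem profile_o16_1_even [Fintype F] (h2 : (2 : F) = 0) :
    HasProfile (lineOf fun x y : F => !![0, 0, x; 0, x, y; x, y, 0]) 0 1 (Fintype.card F + 1) := by
  classical
  refine HasProfile.span_pair ?_ ?_ ?_ ?_
  · rw [LinearIndependent.pair_iff]
    intro s t h
    have h0 := congrFun h 2; have h1 := congrFun h 4
    simp [toVec] at h0 h1
    exact ⟨by simpa using h0, by simpa using h1⟩
  · simp [MinorsVanish, toVec]
  · simp [detVec, toVec]
  · simp [toVec, h2]
    rw [ncard_eq_card_of_forall (fun t : F => ((0 : F), t)) (fun s t h => by simpa using h)]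
    · omega
    · rintro ⟨x, y⟩; simp [Prod.ext_iff]

theorem profile_o16_3 [Fintype F] (h2 : (2 : F) = 0) :
    HasProfile (lineOf fun x y : F => !![0, 0, x; 0, x, y; x, y, y]) 0 1 1 := by
  classical
  refine HasProfile.span_pair ?_ ?_ ?_ ?_
  · rw [LinearIndependent.pair_iff]
    intro s t h
    have h0 := congrFun h 2; have h1 := congrFun h 4
    simp [toVec] at h0 h1
    exact ⟨by simpa using h0, by simpa using h1⟩
  · simp [MinorsVanish, toVec]
  · simp [detVec, toVec]
  · simp [toVec, h2]
    exact ⟨0, 0, by ext ⟨x, y⟩; simp [Prod.ext_iff]⟩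

/-- The determinant at the point `(x, y)` of the last representative. -/
theorem cubic_ne_zero {a b c : F} (h : ∀ t : F, t ^ 3 + c * t ^ 2 - b * t + a ≠ 0) {x y : F}
    (hxy : ¬ (x = 0 ∧ y = 0)) : x ^ 3 + c * x ^ 2 * y - b * x * y ^ 2 + a * y ^ 3 ≠ 0 := by
  intro h0
  by_cases hy : y = 0
  · subst hy
    exact hxy ⟨by simpa using h0, rfl⟩
  · apply h (x / y)
    field_simp
    linear_combination h0

theorem profile_o17 [Fintype F] {a b c : F} (h : ∀ t : F, t ^ 3 + c * t ^ 2 - b * t + a ≠ 0) :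
    HasProfile (lineOf fun x y : F => !![a⁻¹ * x, y, 0; y, b * y - c * x, x; 0, x, y]) 0 0 1 := by
  classical
  have ha : a ≠ 0 := by simpa using h 0
  have hli : LinearIndependent F ![toVec !![a⁻¹ * (1 : F), 0, 0; 0, b * 0 - c * 1, 1; 0, 1, 0],
      toVec !![a⁻¹ * (0 : F), 1, 0; 1, b * 1 - c * 0, 0; 0, 0, 1]] := by
    rw [LinearIndependent.pair_iff]
    intro s t h
    have h0 := congrFun h 4; have h1 := congrFun h 5
    simp [toVec] at h0 h1
    exact ⟨h0, h1⟩
  have hns : ∀ y ∈ lineOf fun x y : F => !![a⁻¹ * x, y, 0; y, b * y - c * x, x; 0, x, y],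
      y ≠ 0 → detVec y ≠ 0 := by
    intro w hw hw0 hd
    obtain ⟨x, y, rfl⟩ := Submodule.mem_span_pair.1 hw
    refine cubic_ne_zero h (x := x) (y := y) ?_ ?_
    · rintro ⟨rfl, rfl⟩; simp at hw0
    · simp [detVec, toVec] at hd
      field_simp at hd
      linear_combination -hd
  have h1 : rankCount (lineOf fun x y : F => !![a⁻¹ * x, y, 0; y, b * y - c * x, x; 0, x, y]) 1
      + rankCount (lineOf fun x y : F => !![a⁻¹ * x, y, 0; y, b * y - c * x, x; 0, x, y]) 2 = 0 := by
    rw [rankCount_one_add_two, Set.ncard_eq_zero (Set.toFinite _), Set.eq_empty_iff_forall_notMem]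
    rintro P ⟨hP, hd⟩
    exact hns _ (submodule_le_iff.1 hP) P.rep_nonzero hd
  exact ⟨isLine_span_pair hli, by omega, h1, isoCount_of_nonsingular _ (isLine_span_pair hli) hns⟩

/-! ### The webs of the representatives -/

/-- To identify a web, it suffices to span the solutions of two linear equations by four vectors. -/
theorem webOf_span_pair {y z : Fin 6 → F} (c : Fin 4 → Fin 6 → F)
    (hc : ∀ i, c i ⬝ᵥ y = 0 ∧ c i ⬝ᵥ z = 0)
    (hspan : ∀ d : Fin 6 → F, d ⬝ᵥ y = 0 → d ⬝ᵥ z = 0 →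
      ∃ k : Fin 4 → F, d = k 0 • c 0 + k 1 • c 1 + k 2 • c 2 + k 3 • c 3)
    {f : Fin 4 → MvPolynomial (Fin 3) F} (hf : ∀ i, f i = formOf (c i)) :
    webOf (Submodule.span F {y, z}) = systemOf (f 0) (f 1) (f 2) (f 3) := by
  have hann : ∀ d, d ∈ ann (Submodule.span F {y, z}) ↔ d ⬝ᵥ y = 0 ∧ d ⬝ᵥ z = 0 := fun d => by
    rw [mem_ann_span_pair, dotProduct_comm, dotProduct_comm z]
  apply le_antisymm
  · rintro g hg
    have hg1 := (mem_webOf.1 hg).1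
    rw [← formOf_formCoords hg1, formOf_mem_webOf, hann] at hg
    obtain ⟨k, hk⟩ := hspan _ hg.1 hg.2
    rw [← formOf_formCoords hg1, hk]
    simp only [formOf_add, formOf_smul, ← hf]
    have hm : ∀ i, f i ∈ systemOf (f 0) (f 1) (f 2) (f 3) := fun i =>
      Submodule.subset_span (by fin_cases i <;> simp)
    exact add_mem (add_mem (add_mem (Submodule.smul_mem _ _ (hm 0)) (Submodule.smul_mem _ _ (hm 1)))
      (Submodule.smul_mem _ _ (hm 2))) (Submodule.smul_mem _ _ (hm 3))
  · rw [systemOf, Submodule.span_le]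
    have hm : ∀ i, f i ∈ webOf (Submodule.span F {y, z}) := fun i => by
      rw [hf, formOf_mem_webOf, hann]; exact hc i
    rintro g (rfl | rfl | rfl | rfl)
    · exact hm 0
    · exact hm 1
    · exact hm 2
    · exact hm 3

set_option maxHeartbeats 4000000 in
theorem webOf_of_tableRow {t : Label} {L : Submodule F (Fin 6 → F)}
    {W : Submodule F (MvPolynomial (Fin 3) F)} (h : TableRow t L W) : webOf L = W := by
  cases h with
  | r5 =>
    refine webOf_span_pair ![![0,1,0,0,0,0], ![0,0,1,0,0,0], ![0,0,0,0,1,0], ![0,0,0,0,0,1]]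
      ?_ ?_ (f := ![_, _, _, _]) ?_
    · intro i; fin_cases i <;> simp [toVec, dotProduct, Fin.sum_univ_succ]
    · intro d h0 h1
      simp [toVec, dotProduct, Fin.sum_univ_succ] at h0 h1
      refine ⟨![d 1, d 2, d 4, d 5], ?_⟩
      ext i; fin_cases i <;> simp <;> grind
    · intro i; fin_cases i <;> simp [formOf]
  | r6 =>
    refine webOf_span_pair ![![0,0,1,0,0,0], ![0,0,0,1,0,0], ![0,0,0,0,1,0], ![0,0,0,0,0,1]]
      ?_ ?_ (f := ![_, _, _, _]) ?_
    · intro i; fin_cases i <;> simp [toVec, dotProduct, Fin.sum_univ_succ]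
    · intro d h0 h1
      simp [toVec, dotProduct, Fin.sum_univ_succ] at h0 h1
      refine ⟨![d 2, d 3, d 4, d 5], ?_⟩
      ext i; fin_cases i <;> simp <;> grind
    · intro i; fin_cases i <;> simp [formOf]
  | r8_1 =>
    refine webOf_span_pair ![![0,1,0,0,0,0], ![0,0,1,0,0,0], ![0,0,0,0,1,0], ![0,0,0,1,0,1]]
      ?_ ?_ (f := ![_, _, _, _]) ?_
    · intro i; fin_cases i <;> simp [toVec, dotProduct, Fin.sum_univ_succ]
    · intro d h0 h1
      simp [toVec, dotProduct, Fin.sum_univ_succ] at h0 h1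
      refine ⟨![d 1, d 2, d 4, d 3], ?_⟩
      ext i; fin_cases i <;> simp <;> grind
    · intro i; fin_cases i <;> simp [formOf]
  | r8_2 e he =>
    refine webOf_span_pair ![![0,1,0,0,0,0], ![0,0,1,0,0,0], ![0,0,0,0,1,0], ![0,0,0,e,0,1]]
      ?_ ?_ (f := ![_, _, _, _]) ?_
    · intro i; fin_cases i <;> simp [toVec, dotProduct, Fin.sum_univ_succ]
    · intro d h0 h1
      simp [toVec, dotProduct, Fin.sum_univ_succ] at h0 h1
      refine ⟨![d 1, d 2, d 4, d 5], ?_⟩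
      ext i; fin_cases i <;> simp <;> grind
    · intro i; fin_cases i <;> simp [formOf]
  | r8_3 h2 =>
    refine webOf_span_pair ![![0,1,0,0,0,0], ![0,0,1,0,0,0], ![0,0,0,1,0,0], ![0,0,0,0,0,1]]
      ?_ ?_ (f := ![_, _, _, _]) ?_
    · intro i; fin_cases i <;> simp [toVec, dotProduct, Fin.sum_univ_succ]
    · intro d h0 h1
      simp [toVec, dotProduct, Fin.sum_univ_succ] at h0 h1
      refine ⟨![d 1, d 2, d 3, d 5], ?_⟩
      ext i; fin_cases i <;> simp <;> grind
    · intro i; fin_cases i <;> simp [formOf]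
  | r9 =>
    refine webOf_span_pair ![![0,1,0,0,0,0], ![0,0,1,-1,0,0], ![0,0,0,0,1,0], ![0,0,0,0,0,1]]
      ?_ ?_ (f := ![_, _, _, _]) ?_
    · intro i; fin_cases i <;> simp [toVec, dotProduct, Fin.sum_univ_succ]
    · intro d h0 h1
      simp [toVec, dotProduct, Fin.sum_univ_succ] at h0 h1
      refine ⟨![d 1, d 2, d 4, d 5], ?_⟩
      ext i; fin_cases i <;> simp <;> grind
    · intro i; fin_cases i <;> simp [formOf] <;> ring
  | r10 a v hv =>
    have hv0 := hv.1
    refine webOf_span_pair ![![v⁻¹,a,0,-1,0,0], ![0,0,1,0,0,0], ![0,0,0,0,1,0], ![0,0,0,0,0,1]]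
      ?_ ?_ (f := ![_, _, _, _]) ?_
    · intro i; fin_cases i <;> simp [toVec, dotProduct, Fin.sum_univ_succ] <;> grind
    · intro d h0 h1
      simp [toVec, dotProduct, Fin.sum_univ_succ] at h0 h1
      refine ⟨![-d 3, d 2, d 4, d 5], ?_⟩
      ext i; fin_cases i <;> simp <;> grind
    · intro i; fin_cases i <;> simp [formOf] <;> ring
  | r12_1 =>
    refine webOf_span_pair ![![1,0,0,0,0,0], ![0,0,1,0,0,0], ![0,0,0,1,0,0], ![0,0,0,0,0,1]]
      ?_ ?_ (f := ![_, _, _, _]) ?_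
    · intro i; fin_cases i <;> simp [toVec, dotProduct, Fin.sum_univ_succ]
    · intro d h0 h1
      simp [toVec, dotProduct, Fin.sum_univ_succ] at h0 h1
      refine ⟨![d 0, d 2, d 3, d 5], ?_⟩
      ext i; fin_cases i <;> simp <;> grind
    · intro i; fin_cases i <;> simp [formOf]
  | r12_3 h2 =>
    refine webOf_span_pair ![![1,0,0,0,0,0], ![0,0,1,0,0,0], ![0,1,0,1,1,0], ![0,0,0,0,0,1]]
      ?_ ?_ (f := ![_, _, _, _]) ?_
    · intro i; fin_cases i <;> simp [toVec, dotProduct, Fin.sum_univ_succ] <;> grind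
    · intro d h0 h1
      simp [toVec, dotProduct, Fin.sum_univ_succ] at h0 h1
      refine ⟨![d 0, d 2, d 1, d 5], ?_⟩
      ext i; fin_cases i <;> simp <;> grind
    · intro i; fin_cases i <;> simp [formOf] <;> ring
  | r13_1 =>
    refine webOf_span_pair ![![1,0,0,0,0,0], ![0,0,1,0,0,0], ![0,0,0,1,0,1], ![0,0,0,0,1,0]]
      ?_ ?_ (f := ![_, _, _, _]) ?_
    · intro i; fin_cases i <;> simp [toVec, dotProduct, Fin.sum_univ_succ]
    · intro d h0 h1
      simp [toVec, dotProduct, Fin.sum_univ_succ] at h0 h1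
      refine ⟨![d 0, d 2, d 3, d 4], ?_⟩
      ext i; fin_cases i <;> simp <;> grind
    · intro i; fin_cases i <;> simp [formOf]
  | r13_2 e he =>
    refine webOf_span_pair ![![1,0,0,0,0,0], ![0,0,1,0,0,0], ![0,0,0,e,0,1], ![0,0,0,0,1,0]]
      ?_ ?_ (f := ![_, _, _, _]) ?_
    · intro i; fin_cases i <;> simp [toVec, dotProduct, Fin.sum_univ_succ]
    · intro d h0 h1
      simp [toVec, dotProduct, Fin.sum_univ_succ] at h0 h1
      refine ⟨![d 0, d 2, d 5, d 4], ?_⟩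
      ext i; fin_cases i <;> simp <;> grind
    · intro i; fin_cases i <;> simp [formOf]
  | r13_3 h2 =>
    refine webOf_span_pair ![![1,0,0,0,0,0], ![0,0,1,0,0,0], ![0,1,0,1,0,1], ![0,0,0,0,1,0]]
      ?_ ?_ (f := ![_, _, _, _]) ?_
    · intro i; fin_cases i <;> simp [toVec, dotProduct, Fin.sum_univ_succ] <;> grind
    · intro d h0 h1
      simp [toVec, dotProduct, Fin.sum_univ_succ] at h0 h1
      refine ⟨![d 0, d 2, d 1, d 4], ?_⟩
      ext i; fin_cases i <;> simp <;> grind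
    · intro i; fin_cases i <;> simp [formOf] <;> ring
  | r14_1 =>
    refine webOf_span_pair ![![0,1,0,0,0,0], ![0,0,1,0,0,0], ![1,0,0,1,0,1], ![0,0,0,0,1,0]]
      ?_ ?_ (f := ![_, _, _, _]) ?_
    · intro i; fin_cases i <;> simp [toVec, dotProduct, Fin.sum_univ_succ]
    · intro d h0 h1
      simp [toVec, dotProduct, Fin.sum_univ_succ] at h0 h1
      refine ⟨![d 1, d 2, d 0, d 4], ?_⟩
      ext i; fin_cases i <;> simp <;> grind
    · intro i; fin_cases i <;> simp [formOf]
  | r14_2 e he =>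
    refine webOf_span_pair ![![0,1,0,0,0,0], ![0,0,1,0,0,0], ![e,0,0,1,0,e], ![0,0,0,0,1,0]]
      ?_ ?_ (f := ![_, _, _, _]) ?_
    · intro i; fin_cases i <;> simp [toVec, dotProduct, Fin.sum_univ_succ]
    · intro d h0 h1
      simp [toVec, dotProduct, Fin.sum_univ_succ] at h0 h1
      refine ⟨![d 1, d 2, d 3, d 4], ?_⟩
      ext i; fin_cases i <;> simp <;> grind
    · intro i; fin_cases i <;> simp [formOf]
  | r15_1 a v hv hs =>
    have hv0 := hv.1
    refine webOf_span_pair ![![0,0,1,0,0,0], ![0,0,0,0,1,0], ![0,1,0,0,0,-1], ![v⁻¹,a,0,-1,0,0]]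
      ?_ ?_ (f := ![_, _, _, _]) ?_
    · intro i; fin_cases i <;> simp [toVec, dotProduct, Fin.sum_univ_succ] <;> grind
    · intro d h0 h1
      simp [toVec, dotProduct, Fin.sum_univ_succ] at h0 h1
      refine ⟨![d 2, d 4, -d 5, -d 3], ?_⟩
      ext i; fin_cases i <;> simp <;> grind
    · intro i; fin_cases i <;> simp [formOf] <;> ring
  | r15_2 a v hv hs =>
    have hv0 := hv.1
    refine webOf_span_pair ![![0,0,1,0,0,0], ![0,0,0,0,1,0], ![0,1,0,0,0,-1], ![v⁻¹,a,0,-1,0,0]]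
      ?_ ?_ (f := ![_, _, _, _]) ?_
    · intro i; fin_cases i <;> simp [toVec, dotProduct, Fin.sum_univ_succ] <;> grind
    · intro d h0 h1
      simp [toVec, dotProduct, Fin.sum_univ_succ] at h0 h1
      refine ⟨![d 2, d 4, -d 5, -d 3], ?_⟩
      ext i; fin_cases i <;> simp <;> grind
    · intro i; fin_cases i <;> simp [formOf] <;> ring
  | r16_1 =>
    refine webOf_span_pair ![![1,0,0,0,0,0], ![0,1,0,0,0,0], ![0,0,1,-1,0,0], ![0,0,0,0,0,1]]
      ?_ ?_ (f := ![_, _, _, _]) ?_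
    · intro i; fin_cases i <;> simp [toVec, dotProduct, Fin.sum_univ_succ]
    · intro d h0 h1
      simp [toVec, dotProduct, Fin.sum_univ_succ] at h0 h1
      refine ⟨![d 0, d 1, d 2, d 5], ?_⟩
      ext i; fin_cases i <;> simp <;> grind
    · intro i; fin_cases i <;> simp [formOf] <;> ring
  | r16_3 h2 =>
    refine webOf_span_pair ![![1,0,0,0,0,0], ![0,1,0,0,0,0], ![0,0,1,1,0,0], ![0,0,0,0,1,1]]
      ?_ ?_ (f := ![_, _, _, _]) ?_
    · intro i; fin_cases i <;> simp [toVec, dotProduct, Fin.sum_univ_succ] <;> grind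
    · intro d h0 h1
      simp [toVec, dotProduct, Fin.sum_univ_succ] at h0 h1
      refine ⟨![d 0, d 1, d 2, d 4], ?_⟩
      ext i; fin_cases i <;> simp <;> grind
    · intro i; fin_cases i <;> simp [formOf]
  | r17 a b c h =>
    have ha : a ≠ 0 := by simpa using h 0
    refine webOf_span_pair ![![0,0,1,0,0,0], ![0,1,0,0,0,-1], ![a,0,0,0,-1,0], ![0,b,0,-1,-c,0]]
      ?_ ?_ (f := ![_, _, _, _]) ?_
    · intro i; fin_cases i <;> simp [toVec, dotProduct, Fin.sum_univ_succ] <;> grind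
    · intro d h0 h1
      simp [toVec, dotProduct, Fin.sum_univ_succ] at h0 h1
      refine ⟨![d 2, -d 5, a⁻¹ * d 0, -d 3], ?_⟩
      ext i; fin_cases i <;> simp <;> grind
    · intro i; fin_cases i <;> simp [formOf] <;> ring

/-! ### The tables of distributions -/

theorem even_card_iff [Fintype F] : Even (Fintype.card F) ↔ (2 : F) = 0 := by
  constructor
  · intro h
    have h2 : ringChar F = 2 := FiniteField.even_card_iff_char_two.2 (Nat.even_iff.1 h)
    have := ringChar.Nat.cast_ringChar (R := F)
    rw [h2] at this; exact_mod_cast this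
  · intro h
    exact Nat.even_iff.2 (FiniteField.even_card_iff_char_two.1
      (CharP.ringChar_of_prime_eq_zero Nat.prime_two (by exact_mod_cast h)))

theorem odd_card_iff [Fintype F] : Odd (Fintype.card F) ↔ (2 : F) ≠ 0 := by
  rw [← Nat.not_even_iff_odd, even_card_iff]

/-- The profiles of the lines with a given label for odd order `q`. -/
def oddProfile (q : ℕ) : Label → ℕ × ℕ × ℕ
  | .o5 => (2, q + 1, 1)
  | .o6 => (1, q + 1, q + 1)
  | .o8_1 => (1, 2, 2)
  | .o8_2 => (1, 2, 0)
  | .o9 => (1, 1, 1)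
  | .o10 => (0, q + 1, 1)
  | .o12_1 => (0, q + 1, q + 2)
  | .o13_1 => (0, 2, 3)
  | .o13_2 => (0, 2, 1)
  | .o14_1 => (0, 3, 4)
  | .o14_2 => (0, 3, 0)
  | .o15_1 => (0, 1, 2)
  | .o15_2 => (0, 1, 0)
  | .o16_1 => (0, 1, 2)
  | .o17 => (0, 0, 1)
  | .o8_3 | .o12_3 | .o13_3 | .o16_3 => 0

/-- The profiles of the lines with a given label for even order `q`. -/
def evenProfile (q : ℕ) : Label → ℕ × ℕ × ℕ
  | .o5 => (2, q + 1, 1)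
  | .o6 => (1, q + 1, q + 1)
  | .o8_1 => (1, 2, 1)
  | .o8_3 => (1, 2, q + 1)
  | .o9 => (1, 1, 1)
  | .o10 => (0, q + 1, 1)
  | .o12_1 => (0, q + 1, q ^ 2 + q + 1)
  | .o12_3 => (0, q + 1, q + 1)
  | .o13_1 => (0, 2, q + 1)
  | .o13_3 => (0, 2, 1)
  | .o14_1 => (0, 3, 1)
  | .o15_1 => (0, 1, 1)
  | .o16_1 => (0, 1, q + 1)
  | .o16_3 => (0, 1, 1)
  | .o17 => (0, 0, 1)
  | .o8_2 | .o13_2 | .o14_2 | .o15_2 => 0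

theorem occurs_of_hasType [Fintype F] {t : Label} {L : Submodule F (Fin 6 → F)}
    (h : HasType t L) : t.Occurs (Fintype.card F) := by
  obtain ⟨L₀, W₀, h1, -⟩ := h
  cases h1 <;> first | trivial | exact even_card_iff.2 ‹_› |
    exact odd_card_iff.2 (two_ne_zero_of_not_isSquare ‹_›)

section

variable [Fintype F]

theorem profile_odd_of_tableRow (h2 : (2 : F) ≠ 0) {t : Label} {L : Submodule F (Fin 6 → F)}
    {W : Submodule F (MvPolynomial (Fin 3) F)} (h : TableRow t L W) :
    HasProfile L (oddProfile (Fintype.card F) t).1 (oddProfile (Fintype.card F) t).2.1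
      (oddProfile (Fintype.card F) t).2.2 := by
  cases h with
  | r5 => exact profile_o5
  | r6 => exact profile_o6
  | r8_1 => exact profile_o8_1_odd h2
  | r8_2 d hd => exact profile_o8_2 hd
  | r9 => exact profile_o9
  | r10 a v hv => exact profile_o10 hv
  | r12_1 => exact profile_o12_1_odd h2
  | r13_1 => exact profile_o13_1_odd h2
  | r13_2 d hd => exact profile_o13_2 h2 hd
  | r14_1 => exact profile_o14_1_odd h2
  | r14_2 d hd => exact profile_o14_2 hd
  | r15_1 a v hv hs => exact profile_o15_1_odd h2 hv hs
  | r15_2 a v hv hs => exact profile_o15_2 hv hs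
  | r16_1 => exact profile_o16_1_odd h2
  | r17 a b c h => exact profile_o17 h
  | r8_3 h => exact absurd h h2
  | r12_3 h => exact absurd h h2
  | r13_3 h => exact absurd h h2
  | r16_3 h => exact absurd h h2

theorem profile_even_of_tableRow (h2 : (2 : F) = 0) {t : Label} {L : Submodule F (Fin 6 → F)}
    {W : Submodule F (MvPolynomial (Fin 3) F)} (h : TableRow t L W) :
    HasProfile L (evenProfile (Fintype.card F) t).1 (evenProfile (Fintype.card F) t).2.1
      (evenProfile (Fintype.card F) t).2.2 := by
  cases h with
  | r5 => exact profile_o5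
  | r6 => exact profile_o6
  | r8_1 => exact profile_o8_1_even h2
  | r8_3 => exact profile_o8_3 h2
  | r9 => exact profile_o9
  | r10 a v hv => exact profile_o10 hv
  | r12_1 => exact profile_o12_1_even h2
  | r12_3 => exact profile_o12_3 h2
  | r13_1 => exact profile_o13_1_even h2
  | r13_3 => exact profile_o13_3 h2
  | r14_1 => exact profile_o14_1_even h2
  | r15_1 a v hv hs => exact profile_o15_1_even h2 hv hs
  | r16_1 => exact profile_o16_1_even h2
  | r16_3 => exact profile_o16_3 h2
  | r17 a b c h => exact profile_o17 h
  | r8_2 d hd => exact absurd h2 (two_ne_zero_of_not_isSquare hd)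
  | r13_2 d hd => exact absurd h2 (two_ne_zero_of_not_isSquare hd)
  | r14_2 d hd => exact absurd h2 (two_ne_zero_of_not_isSquare hd)
  | r15_2 a v hv hs => exact absurd h2 (two_ne_zero_of_not_isSquare hs)

theorem profile_odd_of_hasType (h2 : (2 : F) ≠ 0) {t : Label} {L : Submodule F (Fin 6 → F)}
    (h : HasType t L) : HasProfile L (oddProfile (Fintype.card F) t).1
      (oddProfile (Fintype.card F) t).2.1 (oddProfile (Fintype.card F) t).2.2 := by
  obtain ⟨L₀, W₀, h1, h3⟩ := h
  exact (profile_odd_of_tableRow h2 h1).of_kEquiv h3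

theorem profile_even_of_hasType (h2 : (2 : F) = 0) {t : Label} {L : Submodule F (Fin 6 → F)}
    (h : HasType t L) : HasProfile L (evenProfile (Fintype.card F) t).1
      (evenProfile (Fintype.card F) t).2.1 (evenProfile (Fintype.card F) t).2.2 := by
  obtain ⟨L₀, W₀, h1, h3⟩ := h
  exact (profile_even_of_tableRow h2 h1).of_kEquiv h3

/-- The distribution determined by a profile. -/
theorem conicDistribution_of_profile {L : Submodule F (Fin 6 → F)} {r s h : ℕ}
    (hL : HasProfile L r s h) (i : Fin 4) :
    let q : ℚ := Fintype.card F
    (conicDistribution (webOf L) i : ℚ) =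
      (![(h : ℚ), (q ^ 2 + q + 1 + q * (q * r + s) - h) / 2,
        (q ^ 2 + q + 1 + q * (q * r + s) - h) / 2 - q - q ^ 2 * r,
        q ^ 3 + q ^ 2 + q + 1 - h - (q ^ 2 + q + 1 + q * (q * r + s) - h) + q + q ^ 2 * r] :
          Fin 4 → ℚ) i := by
  intro q
  obtain ⟨h1, h2, h3, h4⟩ := hL
  obtain ⟨d0, d1, d2, d3⟩ := distribution_relations L h1
  have h3' : (rankCount L 2 : ℚ) = s - r := by
    rw [← h3, h2]; push_cast; ring
  have e0 : (conicDistribution (webOf L) 0 : ℚ) = h := by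
    have := congrArg (Int.cast : ℤ → ℚ) d0; push_cast at this; rw [this, h4]
  have e1 : (conicDistribution (webOf L) 0 : ℚ) + 2 * conicDistribution (webOf L) 1
      = q ^ 2 + q + 1 + q * ((q + 1) * rankCount L 1 + rankCount L 2) := by
    have := congrArg (Int.cast : ℤ → ℚ) d1; push_cast at this; exact this
  have e2 : (conicDistribution (webOf L) 1 : ℚ) - conicDistribution (webOf L) 2
      = q + q ^ 2 * rankCount L 1 := by
    have := congrArg (Int.cast : ℤ → ℚ) d2; push_cast at this; exact this
  have e3 : (conicDistribution (webOf L) 0 : ℚ) + conicDistribution (webOf L) 1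
      + conicDistribution (webOf L) 2 + conicDistribution (webOf L) 3
      = q ^ 3 + q ^ 2 + q + 1 := by
    have := congrArg (Int.cast : ℤ → ℚ) d3; push_cast at this; exact this
  rw [h2, h3'] at e1
  rw [h2] at e2
  have f1 : (conicDistribution (webOf L) 1 : ℚ)
      = (q ^ 2 + q + 1 + q * (q * r + s) - h) / 2 := by linear_combination (e1 - e0) / 2
  have f2 : (conicDistribution (webOf L) 2 : ℚ)
      = (q ^ 2 + q + 1 + q * (q * r + s) - h) / 2 - q - q ^ 2 * r := by
    linear_combination f1 - e2
  fin_cases i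
  · exact e0
  · exact f1
  · exact f2
  · simp only [Fin.reduceFinMk, Matrix.cons_val]
    linear_combination e3 - e0 - f1 - f2

theorem conicDistribution_odd (h2 : (2 : F) ≠ 0) {t : Label} {L : Submodule F (Fin 6 → F)}
    (h : HasType t L) (i : Fin 4) :
    (conicDistribution (webOf L) i : ℚ) = tableOdd (Fintype.card F) t i := by
  have hp := profile_odd_of_hasType h2 h
  have ht := occurs_of_hasType h
  have hne := odd_card_iff.2 h2
  rw [← Nat.not_even_iff_odd] at hne
  rw [conicDistribution_of_profile hp]
  cases t
  all_goals first
    | exact absurd ht hne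
    | (fin_cases i <;> simp [oddProfile, tableOdd] <;> ring)

theorem conicDistribution_even (h2 : (2 : F) = 0) {t : Label} {L : Submodule F (Fin 6 → F)}
    (h : HasType t L) (i : Fin 4) :
    (conicDistribution (webOf L) i : ℚ) = tableEven (Fintype.card F) t i := by
  have hp := profile_even_of_hasType h2 h
  have ht := occurs_of_hasType h
  have hne := even_card_iff.2 h2
  rw [← Nat.not_odd_iff_even] at hne
  rw [conicDistribution_of_profile hp]
  cases t
  all_goals first
    | exact absurd ht hne
    | (fin_cases i <;> simp [evenProfile, tableEven] <;> ring)

/-- The distribution determines the profile. -/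
theorem profile_eq_of_conicDistribution_eq {L L' : Submodule F (Fin 6 → F)} {r s h r' s' h' : ℕ}
    (hL : HasProfile L r s h) (hL' : HasProfile L' r' s' h')
    (e : conicDistribution (webOf L) = conicDistribution (webOf L')) :
    r = r' ∧ s = s' ∧ h = h' := by
  have hq : (Fintype.card F : ℚ) ≠ 0 := Nat.cast_ne_zero.2 Fintype.card_ne_zero
  have d := conicDistribution_of_profile hL
  have d' := conicDistribution_of_profile hL'
  rw [e] at d
  have h0 := (d 0).symm.trans (d' 0)
  have h1 := (d 1).symm.trans (d' 1)
  have h2 := (d 2).symm.trans (d' 2)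
  simp only [Matrix.cons_val] at h0 h1 h2
  have hr : (r : ℚ) = r' := by
    apply mul_left_cancel₀ (pow_ne_zero 2 hq)
    linear_combination h1 - h2
  have hs : (s : ℚ) = s' := by
    apply mul_left_cancel₀ hq
    linear_combination 2 * h1 + h0 - (Fintype.card F : ℚ) ^ 2 * hr
  exact ⟨by exact_mod_cast hr, by exact_mod_cast hs, by exact_mod_cast h0⟩

theorem conicDistribution_eq_of_profile_eq {L L' : Submodule F (Fin 6 → F)} {r s h : ℕ}
    (hL : HasProfile L r s h) (hL' : HasProfile L' r s h) :
    conicDistribution (webOf L) = conicDistribution (webOf L') := by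
  ext i
  have := (conicDistribution_of_profile hL i).trans (conicDistribution_of_profile hL' i).symm
  exact_mod_cast this

end

/-- Equal profiles occur only for the exceptional pair. -/
theorem oddProfile_eq_iff {q : ℕ} (hq : 3 ≤ q) (hodd : Odd q) {t t' : Label} (ht : t.Occurs q)
    (ht' : t'.Occurs q) : oddProfile q t = oddProfile q t' ↔ t = t' ∨ Exceptional q t t' := by
  have hne := hodd
  rw [← Nat.not_even_iff_odd] at hne
  have hq2 : q ≠ 2 := by omega
  cases t
  all_goals first
    | exact absurd ht hne
    | (cases t'
       all_goals first
        | exact absurd ht' hne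
        | (simp [oddProfile, Exceptional, hodd, hne, hq2] <;> omega))

/-- Equal profiles occur only for the exceptional pairs; the second one satisfies `q + 1 = 3`. -/
theorem evenProfile_eq_iff {q : ℕ} (hq : 2 ≤ q) (heven : Even q) {t t' : Label} (ht : t.Occurs q)
    (ht' : t'.Occurs q) : evenProfile q t = evenProfile q t' ↔ t = t' ∨ Exceptional q t t' := by
  have hne := heven
  rw [← Nat.not_odd_iff_even] at hne
  have hq2 : q ^ 2 ≠ 0 := by positivity
  cases t
  all_goals first
    | exact absurd ht hne
    | (cases t'
       all_goals first
        | exact absurd ht' hne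
        | (simp [evenProfile, Exceptional, heven, hne] <;> omega))

/-! ### Two further invariants, and the distinctness of the orbits -/

/-- The line `L` has a singular point with a kernel vector that is isotropic for all points of
`L`. -/
def HasIsotropicKernel (L : Submodule F (Fin 6 → F)) : Prop :=
  ∃ y ∈ L, y ≠ 0 ∧ ∃ k : Fin 3 → F, k ≠ 0 ∧ y ∈ kerSpace k ∧ ∀ z ∈ L, bil z k k = 0

/-- The points of the line `L` have a common kernel vector. -/
def HasCommonKernel (L : Submodule F (Fin 6 → F)) : Prop :=
  ∃ k : Fin 3 → F, k ≠ 0 ∧ ∀ y ∈ L, y ∈ kerSpace k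

theorem exists_transpose_mulVec_eq (A : GL (Fin 3) F) {k : Fin 3 → F} (hk : k ≠ 0) :
    ∃ k', k' ≠ 0 ∧ A.1.transpose.mulVec k' = k := by
  have hinv : A.1.transpose.mulVec ((A⁻¹ : GL (Fin 3) F).1.transpose.mulVec k) = k := by
    rw [Matrix.mulVec_mulVec, ← Matrix.transpose_mul, ← Units.val_mul, inv_mul_cancel]
    simp
  refine ⟨_, fun h => hk ?_, hinv⟩
  rw [h, Matrix.mulVec_zero] at hinv
  exact hinv.symm

theorem HasIsotropicKernel.of_kEquiv {L M : Submodule F (Fin 6 → F)} (h : HasIsotropicKernel L)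
    (hLM : KEquiv L M) : HasIsotropicKernel M := by
  obtain ⟨A, rfl⟩ := hLM
  obtain ⟨y, hy, hy0, k, hk, hyk, hz⟩ := h
  obtain ⟨k', hk', rfl⟩ := exists_transpose_mulVec_eq A hk
  refine ⟨_, ⟨y, hy, rfl⟩, fun h => hy0 (lift_injective A (by rw [h, map_zero])), k', hk',
    (lift_mem_kerSpace_iff A _ _).2 hyk, ?_⟩
  rintro _ ⟨z, hzL, rfl⟩
  rw [bil_lift]; exact hz z hzL

theorem HasCommonKernel.of_kEquiv {L M : Submodule F (Fin 6 → F)} (h : HasCommonKernel L)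
    (hLM : KEquiv L M) : HasCommonKernel M := by
  obtain ⟨A, rfl⟩ := hLM
  obtain ⟨k, hk, hyk⟩ := h
  obtain ⟨k', hk', rfl⟩ := exists_transpose_mulVec_eq A hk
  refine ⟨k', hk', ?_⟩
  rintro _ ⟨z, hzL, rfl⟩
  exact (lift_mem_kerSpace_iff A _ _).2 (hyk z hzL)

theorem detVec_eq_zero_of_mem_kerSpace {y : Fin 6 → F} {k : Fin 3 → F} (hk : k ≠ 0)
    (h : y ∈ kerSpace k) : detVec y = 0 := by
  rw [← det_toMat]
  exact Matrix.exists_mulVec_eq_zero_iff.1 ⟨k, hk, mem_kerSpace_iff_mulVec.1 h⟩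

theorem mem_kerSpace_coords {y : Fin 6 → F} {k : Fin 3 → F} :
    y ∈ kerSpace k ↔ y 0 * k 0 + y 1 * k 1 + y 2 * k 2 = 0 ∧
      y 1 * k 0 + y 3 * k 1 + y 4 * k 2 = 0 ∧ y 2 * k 0 + y 4 * k 1 + y 5 * k 2 = 0 := by
  rw [mem_kerSpace]
  constructor
  · intro h
    have h0 := h (Pi.single 0 1); have h1 := h (Pi.single 1 1); have h2 := h (Pi.single 2 1)
    simp [bil_eq] at h0 h1 h2
    exact ⟨h0, h1, h2⟩
  · rintro ⟨h0, h1, h2⟩ b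
    rw [bil_eq]
    linear_combination b 0 * h0 + b 1 * h1 + b 2 * h2

theorem not_hasIsotropicKernel_o15 {a v : F} (hv : QuadCond a v) :
    ¬ HasIsotropicKernel (lineOf fun x y : F => !![v * y, x, 0; x, a * x + y, 0; 0, 0, x]) := by
  rintro ⟨w, hw, hw0, k, hk, hwk, hz⟩
  obtain ⟨x, y, rfl⟩ := Submodule.mem_span_pair.1 hw
  have hd := detVec_eq_zero_of_mem_kerSpace hk hwk
  have hx : x = 0 := by
    by_contra hx
    apply hv.2 (y / x)
    simp [detVec, toVec] at hd
    field_simp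
    apply mul_left_cancel₀ hx
    linear_combination hd
  subst hx
  have hy : y ≠ 0 := by rintro rfl; simp at hw0
  obtain ⟨h0, h1, -⟩ := mem_kerSpace_coords.1 hwk
  simp [toVec, hy, hv.1] at h0 h1
  have := hz _ (Submodule.subset_span (Set.mem_insert _ _))
  simp [bil_eq, toVec, h0, h1] at this
  apply hk
  ext i; fin_cases i <;> assumption

theorem hasIsotropicKernel_o16_1 :
    HasIsotropicKernel (lineOf fun x y : F => !![0, 0, x; 0, x, y; x, y, 0]) := by
  refine ⟨_, Submodule.subset_span (Set.mem_insert_of_mem _ rfl), ?_, Pi.single 0 1, ?_, ?_, ?_⟩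
  · intro h; simpa [toVec] using congrFun h 4
  · intro h; simpa using congrFun h 0
  · simp [mem_kerSpace_coords, toVec]
  · intro z hz
    obtain ⟨x, y, rfl⟩ := Submodule.mem_span_pair.1 hz
    simp [bil_eq, toVec]

theorem hasIsotropicKernel_o16_3 :
    HasIsotropicKernel (lineOf fun x y : F => !![0, 0, x; 0, x, y; x, y, y]) := by
  refine ⟨_, Submodule.subset_span (Set.mem_insert_of_mem _ rfl), ?_, Pi.single 0 1, ?_, ?_, ?_⟩
  · intro h; simpa [toVec] using congrFun h 4
  · intro h; simpa using congrFun h 0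
  · simp [mem_kerSpace_coords, toVec]
  · intro z hz
    obtain ⟨x, y, rfl⟩ := Submodule.mem_span_pair.1 hz
    simp [bil_eq, toVec]

theorem hasCommonKernel_o10 (a v : F) :
    HasCommonKernel (lineOf fun x y : F => !![v * x, y, 0; y, x + a * y, 0; 0, 0, 0]) := by
  refine ⟨Pi.single 2 1, ?_, ?_⟩
  · intro h; simpa using congrFun h 2
  · intro z hz
    obtain ⟨x, y, rfl⟩ := Submodule.mem_span_pair.1 hz
    simp [mem_kerSpace_coords, toVec]

theorem not_hasCommonKernel_o14_1 :
    ¬ HasCommonKernel (lineOf fun x y : F => !![x, 0, 0; 0, -(x + y), 0; 0, 0, y]) := by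
  rintro ⟨k, hk, h⟩
  have h1 := mem_kerSpace_coords.1 (h _ (Submodule.subset_span (Set.mem_insert _ _)))
  have h2 := mem_kerSpace_coords.1 (h _ (Submodule.subset_span (Set.mem_insert_of_mem _ rfl)))
  simp [toVec] at h1 h2
  apply hk
  ext i; fin_cases i
  · exact h1.1
  · exact h1.2
  · exact h2.2

theorem hasIsotropicKernel_iff_of_hasType {t : Label} {L : Submodule F (Fin 6 → F)}
    (h : HasType t L) (ht : t = .o15_1 ∨ t = .o15_2 ∨ t = .o16_1 ∨ t = .o16_3) :
    HasIsotropicKernel L ↔ (t = .o16_1 ∨ t = .o16_3) := by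
  obtain ⟨L₀, W₀, h1, h3⟩ := h
  rw [show HasIsotropicKernel L ↔ HasIsotropicKernel L₀ from
    ⟨fun h => h.of_kEquiv h3.symm, fun h => h.of_kEquiv h3⟩]
  cases h1 with
  | r15_1 a v hv hs => simpa using not_hasIsotropicKernel_o15 hv
  | r15_2 a v hv hs => simpa using not_hasIsotropicKernel_o15 hv
  | r16_1 => simpa using hasIsotropicKernel_o16_1
  | r16_3 h2 => simpa using hasIsotropicKernel_o16_3
  | _ => simp at ht

theorem not_kEquiv_o10_o14_1 {L M : Submodule F (Fin 6 → F)} (h : HasType .o10 L)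
    (h' : HasType .o14_1 M) : ¬ KEquiv L M := by
  intro hLM
  obtain ⟨L₀, W₀, h1, h3⟩ := h
  obtain ⟨M₀, V₀, h1', h3'⟩ := h'
  cases h1 with
  | r10 a v hv =>
  cases h1' with
  | r14_1 =>
    exact not_hasCommonKernel_o14_1
      ((hasCommonKernel_o10 a v).of_kEquiv (h3.trans (hLM.trans h3'.symm)))

theorem not_kEquiv_of_exceptional {q : ℕ} {t t' : Label} {L M : Submodule F (Fin 6 → F)}
    (h : HasType t L) (h' : HasType t' M) (he : Exceptional q t t') : ¬ KEquiv L M := by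
  intro hLM
  have hiff : HasIsotropicKernel L ↔ HasIsotropicKernel M :=
    ⟨fun h => h.of_kEquiv hLM, fun h => h.of_kEquiv hLM.symm⟩
  rcases he with ⟨_, he⟩ | ⟨_, he⟩ | ⟨_, he⟩
  all_goals
    rw [Sym2.eq_iff] at he
    rcases he with ⟨rfl, rfl⟩ | ⟨rfl, rfl⟩
  · rw [hasIsotropicKernel_iff_of_hasType h (by simp),
      hasIsotropicKernel_iff_of_hasType h' (by simp)] at hiff
    simp at hiff
  · rw [hasIsotropicKernel_iff_of_hasType h (by simp),
      hasIsotropicKernel_iff_of_hasType h' (by simp)] at hiff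
    simp at hiff
  · rw [hasIsotropicKernel_iff_of_hasType h (by simp),
      hasIsotropicKernel_iff_of_hasType h' (by simp)] at hiff
    simp at hiff
  · rw [hasIsotropicKernel_iff_of_hasType h (by simp),
      hasIsotropicKernel_iff_of_hasType h' (by simp)] at hiff
    simp at hiff
  · exact not_kEquiv_o10_o14_1 h h' hLM
  · exact not_kEquiv_o10_o14_1 h' h hLM.symm

theorem three_le_card_of_odd [Fintype F] (h : Odd (Fintype.card F)) : 3 ≤ Fintype.card F := by
  have h1 := Fintype.one_lt_card (α := F)
  obtain ⟨k, hk⟩ := h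
  omega

/-- Two lines with labels have the same distribution exactly if the labels agree or form one of
the exceptional pairs. -/
theorem conicDistribution_eq_iff [Fintype F] {t t' : Label} {L L' : Submodule F (Fin 6 → F)}
    (h : HasType t L) (h' : HasType t' L') :
    conicDistribution (webOf L) = conicDistribution (webOf L') ↔
      t = t' ∨ Exceptional (Fintype.card F) t t' := by
  by_cases h2 : (2 : F) = 0
  · rw [← evenProfile_eq_iff Fintype.one_lt_card (even_card_iff.2 h2) (occurs_of_hasType h)
      (occurs_of_hasType h')]
    have p := profile_even_of_hasType h2 h
    have p' := profile_even_of_hasType h2 h'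
    constructor
    · intro e
      obtain ⟨e1, e2, e3⟩ := profile_eq_of_conicDistribution_eq p p' e
      exact Prod.ext e1 (Prod.ext e2 e3)
    · intro e
      rw [← e] at p'
      exact conicDistribution_eq_of_profile_eq p p'
  · have hodd := odd_card_iff.2 h2
    rw [← oddProfile_eq_iff (three_le_card_of_odd hodd) hodd (occurs_of_hasType h)
      (occurs_of_hasType h')]
    have p := profile_odd_of_hasType h2 h
    have p' := profile_odd_of_hasType h2 h'
    constructor
    · intro e
      obtain ⟨e1, e2, e3⟩ := profile_eq_of_conicDistribution_eq p p' e
      exact Prod.ext e1 (Prod.ext e2 e3)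
    · intro e
      rw [← e] at p'
      exact conicDistribution_eq_of_profile_eq p p'

theorem label_eq_of_kEquiv [Fintype F] {t t' : Label} {L L' : Submodule F (Fin 6 → F)}
    (h : HasType t L) (h' : HasType t' L') (hLL' : KEquiv L L') : t = t' := by
  have e : conicDistribution (webOf L) = conicDistribution (webOf L') := by
    by_cases h2 : (2 : F) = 0
    · exact conicDistribution_eq_of_profile_eq (profile_even_of_hasType h2 h)
        ((profile_even_of_hasType h2 h).of_kEquiv hLL')
    · exact conicDistribution_eq_of_profile_eq (profile_odd_of_hasType h2 h)
        ((profile_odd_of_hasType h2 h).of_kEquiv hLL')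
  exact ((conicDistribution_eq_iff h h').1 e).resolve_right
    fun he => not_kEquiv_of_exceptional h h' he hLL'

theorem HasType.of_kEquiv {t : Label} {L M : Submodule F (Fin 6 → F)} (h : HasType t L)
    (hLM : KEquiv L M) : HasType t M := by
  obtain ⟨L₀, W₀, h1, h3⟩ := h
  exact ⟨L₀, W₀, h1, h3.trans hLM⟩

theorem TableRow.hasType {t : Label} {L : Submodule F (Fin 6 → F)}
    {W : Submodule F (MvPolynomial (Fin 3) F)} (h : TableRow t L W) : HasType t L :=
  ⟨L, W, h, KEquiv.refl L⟩

/-! ### The existence of parameters -/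

section

variable [Fintype F]

/-- The values of `t ↦ (1 - v t ^ 2) / (v t)` at nonzero arguments do not exhaust the field. -/
theorem exists_quadCond {v : F} (hv : v ≠ 0) : ∃ a, QuadCond a v := by
  by_contra! h
  have hsurj : Function.Surjective (fun t : Fˣ => (1 - v * (t : F) ^ 2) / (v * t)) := by
    intro a
    have ha := h a
    unfold QuadCond at ha
    push Not at ha
    obtain ⟨t, ht⟩ := ha hv
    have ht0 : t ≠ 0 := by rintro rfl; simp at ht
    refine ⟨Units.mk0 t ht0, ?_⟩
    simp only [Units.val_mk0]
    field_simp
    linear_combination -ht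
  have h1 := Nat.card_le_card_of_surjective _ hsurj
  rw [Nat.card_units] at h1
  have : 0 < Nat.card F := Nat.card_pos
  omega

/-- A non-injective polynomial function on a finite field omits a value. -/
theorem exists_cubic : ∃ a b c : F, ∀ t : F, t ^ 3 + c * t ^ 2 - b * t + a ≠ 0 := by
  have hni : ¬ Function.Injective (fun t : F => t ^ 3 - t ^ 2) := fun h =>
    zero_ne_one (h (a₁ := 0) (a₂ := 1) (by simp))
  rw [Finite.injective_iff_surjective] at hni
  unfold Function.Surjective at hni
  push Not at hni
  obtain ⟨a, ha⟩ := hni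
  exact ⟨-a, 0, -1, fun t h => ha t (by linear_combination h)⟩

theorem exists_hasType_iff (t : Label) :
    (∃ L : Submodule F (Fin 6 → F), HasType t L) ↔ t.Occurs (Fintype.card F) := by
  constructor
  · rintro ⟨L, h⟩; exact occurs_of_hasType h
  · intro h
    have hns : Odd (Fintype.card F) → ∃ d : F, ¬ IsSquare d := fun ho =>
      FiniteField.exists_nonsquare fun hc => by
        have he := Nat.even_iff.2 (FiniteField.even_card_iff_char_two.1 hc)
        exact Nat.not_even_iff_odd.2 ho he
    obtain ⟨a1, ha1⟩ := exists_quadCond (F := F) (v := -1) (by simp)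
    obtain ⟨a, b, c, habc⟩ := exists_cubic (F := F)
    cases t with
    | o5 => exact ⟨_, TableRow.r5.hasType⟩
    | o6 => exact ⟨_, TableRow.r6.hasType⟩
    | o8_1 => exact ⟨_, TableRow.r8_1.hasType⟩
    | o8_2 => obtain ⟨d, hd⟩ := hns h; exact ⟨_, (TableRow.r8_2 d hd).hasType⟩
    | o8_3 => exact ⟨_, (TableRow.r8_3 (even_card_iff.1 h)).hasType⟩
    | o9 => exact ⟨_, TableRow.r9.hasType⟩
    | o10 => exact ⟨_, (TableRow.r10 a1 (-1) ha1).hasType⟩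
    | o12_1 => exact ⟨_, TableRow.r12_1.hasType⟩
    | o12_3 => exact ⟨_, (TableRow.r12_3 (even_card_iff.1 h)).hasType⟩
    | o13_1 => exact ⟨_, TableRow.r13_1.hasType⟩
    | o13_2 => obtain ⟨d, hd⟩ := hns h; exact ⟨_, (TableRow.r13_2 d hd).hasType⟩
    | o13_3 => exact ⟨_, (TableRow.r13_3 (even_card_iff.1 h)).hasType⟩
    | o14_1 => exact ⟨_, TableRow.r14_1.hasType⟩
    | o14_2 => obtain ⟨d, hd⟩ := hns h; exact ⟨_, (TableRow.r14_2 d hd).hasType⟩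
    | o15_1 => exact ⟨_, (TableRow.r15_1 a1 (-1) ha1 (by simp)).hasType⟩
    | o15_2 =>
      obtain ⟨d, hd⟩ := hns h
      obtain ⟨a2, ha2⟩ := exists_quadCond (v := -d) (neg_ne_zero.2 (ne_zero_of_not_isSquare hd))
      exact ⟨_, (TableRow.r15_2 a2 (-d) ha2 (by rwa [neg_neg])).hasType⟩
    | o16_1 => exact ⟨_, TableRow.r16_1.hasType⟩
    | o16_3 => exact ⟨_, (TableRow.r16_3 (even_card_iff.1 h)).hasType⟩
    | o17 => exact ⟨_, (TableRow.r17 a b c habc).hasType⟩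

end

/-- For each parity fifteen labels occur. -/
theorem ncard_occurs (q : ℕ) : {t : Label | t.Occurs q}.ncard = 15 := by
  rcases Nat.even_or_odd q with h | h
  · have hn := Nat.not_odd_iff_even.2 h
    have : {t : Label | t.Occurs q} = ((⟨(([.o5, .o6, .o8_1, .o8_3, .o9, .o10, .o12_1, .o12_3,
        .o13_1, .o13_3, .o14_1, .o15_1, .o16_1, .o16_3, .o17] : List Label) : Multiset Label), by simp⟩ : Finset Label) : Set Label) := by
      ext t; cases t <;> simp [Label.Occurs, h, hn]
    rw [this, Set.ncard_coe_finset]; rfl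
  · have hn := Nat.not_even_iff_odd.2 h
    have : {t : Label | t.Occurs q} = ((⟨(([.o5, .o6, .o8_1, .o8_2, .o9, .o10, .o12_1,
        .o13_1, .o13_2, .o14_1, .o14_2, .o15_1, .o15_2, .o16_1, .o17] : List Label) : Multiset Label), by simp⟩ :
          Finset Label) : Set Label) := by
      ext t; cases t <;> simp [Label.Occurs, h, hn]
    rw [this, Set.ncard_coe_finset]; rfl

/-! ### Independence of the representatives of their parameters -/

theorem lift_eq (A : Matrix (Fin 3) (Fin 3) F) (y : Fin 6 → F) :
    lift A y = ![bil y (A 0) (A 0), bil y (A 0) (A 1), bil y (A 0) (A 2), bil y (A 1) (A 1),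
      bil y (A 1) (A 2), bil y (A 2) (A 2)] := by
  rw [lift_apply]
  ext i
  fin_cases i <;>
    simp [toVec, toMat, bil_eq, Matrix.mul_apply, Fin.sum_univ_three] <;>
    ring

/-- To compute a transformed point, compare coordinates. -/
theorem lift_eq_of_coords {A : Matrix (Fin 3) (Fin 3) F} {y z : Fin 6 → F}
    (h0 : bil y (A 0) (A 0) = z 0) (h1 : bil y (A 0) (A 1) = z 1) (h2 : bil y (A 0) (A 2) = z 2)
    (h3 : bil y (A 1) (A 1) = z 3) (h4 : bil y (A 1) (A 2) = z 4) (h5 : bil y (A 2) (A 2) = z 5) :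
    lift A y = z := by
  rw [lift_eq]
  ext i; fin_cases i
  exacts [h0, h1, h2, h3, h4, h5]

theorem span_pair_eq {V : Type*} [AddCommGroup V] [Module F V] {y z y' z' : V} {p q r s : F}
    (hy : y = p • y' + q • z') (hz : z = r • y' + s • z') (hd : p * s - q * r ≠ 0) :
    Submodule.span F {y, z} = Submodule.span F {y', z'} := by
  obtain ⟨D, hD⟩ : ∃ D, p * s - q * r = D := ⟨_, rfl⟩
  rw [hD] at hd
  apply le_antisymm
  · rw [Submodule.span_le]
    rintro _ (rfl | rfl)
    · exact Submodule.mem_span_pair.2 ⟨p, q, hy.symm⟩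
    · exact Submodule.mem_span_pair.2 ⟨r, s, hz.symm⟩
  · have h1 : y' = (s / D) • y + (-q / D) • z := by
      rw [hy, hz]
      match_scalars <;> field_simp
      · linear_combination -hD
      · ring
    have h2 : z' = (-r / D) • y + (p / D) • z := by
      rw [hy, hz]
      match_scalars <;> field_simp
      · linear_combination -hD
      · ring
    rw [Submodule.span_le]
    rintro _ (rfl | rfl)
    · exact Submodule.mem_span_pair.2 ⟨_, _, h1.symm⟩
    · exact Submodule.mem_span_pair.2 ⟨_, _, h2.symm⟩

/-- To show that two lines are equivalent, it suffices to transform the matrices of two points. -/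
theorem kEquiv_span_pair {y z y' z' : Fin 6 → F} (A : Matrix (Fin 3) (Fin 3) F) (p q r s : F)
    (hA : A.det ≠ 0) (hd : p * s - q * r ≠ 0) (hy : lift A y = p • y' + q • z')
    (hz : lift A z = r • y' + s • z') :
    KEquiv (Submodule.span F {y, z}) (Submodule.span F {y', z'}) := by
  refine ⟨Matrix.GeneralLinearGroup.mkOfDetNeZero A hA, ?_⟩
  rw [Submodule.map_span, Set.image_pair]
  exact (span_pair_eq hy hz hd).symm

theorem kEquiv_o8_2 [Fintype F] {d s : F} (hs : s ≠ 0) :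
    KEquiv (lineOf fun x y : F => !![x, 0, 0; 0, y, 0; 0, 0, -d * y])
      (lineOf fun x y : F => !![x, 0, 0; 0, y, 0; 0, 0, -(d * s ^ 2) * y]) := by
  refine kEquiv_span_pair !![1, 0, 0; 0, 1, 0; 0, 0, s] 1 0 0 1 ?_ (by simp) ?_ ?_
  · simpa [Matrix.det_fin_three] using hs
  · refine lift_eq_of_coords ?_ ?_ ?_ ?_ ?_ ?_ <;> simp [bil_eq, toVec]
  · refine lift_eq_of_coords ?_ ?_ ?_ ?_ ?_ ?_ <;> simp [bil_eq, toVec]; exact Or.inl (by ring)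

theorem kEquiv_o13_2 [Fintype F] {d s : F} (hs : s ≠ 0) :
    KEquiv (lineOf fun x y : F => !![0, x, 0; x, y, 0; 0, 0, -d * y])
      (lineOf fun x y : F => !![0, x, 0; x, y, 0; 0, 0, -(d * s ^ 2) * y]) := by
  refine kEquiv_span_pair !![1, 0, 0; 0, 1, 0; 0, 0, s] 1 0 0 1 ?_ (by simp) ?_ ?_
  · simpa [Matrix.det_fin_three] using hs
  · refine lift_eq_of_coords ?_ ?_ ?_ ?_ ?_ ?_ <;> simp [bil_eq, toVec]
  · refine lift_eq_of_coords ?_ ?_ ?_ ?_ ?_ ?_ <;> simp [bil_eq, toVec]; exact Or.inl (by ring)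

theorem kEquiv_o14_2 [Fintype F] {d s : F} (hs : s ≠ 0) :
    KEquiv (lineOf fun x y : F => !![x, 0, 0; 0, -d * (x + y), 0; 0, 0, y])
      (lineOf fun x y : F => !![x, 0, 0; 0, -(d * s ^ 2) * (x + y), 0; 0, 0, y]) := by
  refine kEquiv_span_pair !![1, 0, 0; 0, s, 0; 0, 0, 1] 1 0 0 1 ?_ (by simp) ?_ ?_
  · simpa [Matrix.det_fin_three] using hs
  · refine lift_eq_of_coords ?_ ?_ ?_ ?_ ?_ ?_ <;> simp [bil_eq, toVec]; exact Or.inl (by ring)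
  · refine lift_eq_of_coords ?_ ?_ ?_ ?_ ?_ ?_ <;> simp [bil_eq, toVec]; exact Or.inl (by ring)

theorem exists_eq_mul_sq [Fintype F] {d d' : F} (hd : ¬ IsSquare d) (hd' : ¬ IsSquare d') :
    ∃ s, s ≠ 0 ∧ d' = d * s ^ 2 := by
  obtain ⟨w, hw⟩ := isSquare_mul_of_not_isSquare hd hd'
  have h0 := ne_zero_of_not_isSquare hd
  have h0' := ne_zero_of_not_isSquare hd'
  refine ⟨w / d, div_ne_zero ?_ h0, ?_⟩
  · rintro rfl; simp [h0, h0'] at hw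
  · field_simp; linear_combination hw

/-- The image of `e ↦ e ^ 2 + e` is a subgroup of index two in even characteristic. -/
theorem exists_sq_add_self [Fintype F] (h2 : (2 : F) = 0) {a b : F} (ha : ∀ e, e ^ 2 + e ≠ a)
    (hb : ∀ e, e ^ 2 + e ≠ b) : ∃ e, e ^ 2 + e = a + b := by
  let φ : F →+ F :=
    { toFun := fun e => e ^ 2 + e
      map_zero' := by simp
      map_add' := fun x y => by linear_combination x * y * h2 }
  have hker : Nat.card φ.ker = 2 := by
    have : (φ.ker : Set F) = {0, 1} := by
      ext e
      change e ^ 2 + e = 0 ↔ e = 0 ∨ e = 1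
      constructor
      · intro h
        rcases mul_eq_zero.1 (show e * (e + 1) = 0 by linear_combination h) with h | h
        · exact Or.inl h
        · exact Or.inr (by linear_combination h - h2)
      · rintro (rfl | rfl)
        · simp
        · linear_combination h2
    change (φ.ker : Set F).ncard = 2
    rw [this, Set.ncard_pair zero_ne_one]
  have hidx : φ.range.index = 2 := by
    have h1 := φ.ker.card_mul_index
    rw [hker, AddSubgroup.index_ker] at h1
    have h3 := φ.range.card_mul_index
    have hpos : 0 < Nat.card φ.range := Nat.card_pos
    rw [← h1, mul_comm 2] at h3
    exact Nat.eq_of_mul_eq_mul_left hpos h3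
  have ha' : a ∉ φ.range := fun ⟨e, he⟩ => ha e he
  have hb' : b ∉ φ.range := fun ⟨e, he⟩ => hb e he
  have := (AddSubgroup.add_mem_iff_of_index_two hidx (a := a) (b := b)).2 (by simp [ha', hb'])
  exact this

theorem QuadCond.ne_zero_left [Fintype F] (h2 : (2 : F) = 0) {a v : F} (hv : QuadCond a v) :
    a ≠ 0 := by
  rintro rfl
  obtain ⟨w, hw⟩ := isSquare_of_two_eq_zero h2 v
  have hw0 : w ≠ 0 := by rintro rfl; exact hv.1 (by simpa using hw)
  apply hv.2 (1 / w)
  rw [hw]; field_simp; simp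

/-- The element `1 / (a ^ 2 * v)`, which for even order is the Artin-Schreier invariant of the
quadratic, is not in the image of `e ↦ e ^ 2 + e`. -/
theorem QuadCond.sq_add_self_ne {a v : F} (hv : QuadCond a v)
    (ha : a ≠ 0) (e : F) : e ^ 2 + e ≠ 1 / (a ^ 2 * v) := by
  intro h
  have hv0 := hv.1
  apply hv.2 (a * e)
  rw [eq_div_iff (mul_ne_zero (pow_ne_zero 2 ha) hv0)] at h
  linear_combination h

/-- The discriminant of the quadratic is not a square. -/
theorem QuadCond.not_isSquare {a v : F} (h2 : (2 : F) ≠ 0) (hv : QuadCond a v) :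
    ¬ IsSquare (v * (a ^ 2 * v + 4)) := by
  rintro ⟨w, hw⟩
  have hv0 := hv.1
  apply hv.2 ((-a * v + w) / (2 * v))
  field_simp
  linear_combination -hw

/-- Any two irreducible quadratics over a finite field are related by an affine substitution. -/
theorem QuadCond.exists_relation [Fintype F] {a v a' v' : F} (hv : QuadCond a v)
    (hv' : QuadCond a' v') :
    ∃ m n : F, n ≠ 0 ∧ a' * v' = n * a * v - 2 * m ∧ v' = n ^ 2 * v + m * n * a * v - m ^ 2 := by
  by_cases h2 : (2 : F) = 0
  · have ha := hv.ne_zero_left h2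
    have ha' := hv'.ne_zero_left h2
    have hv0 := hv.1
    have hv0' := hv'.1
    obtain ⟨e, he⟩ := exists_sq_add_self h2 (hv.sq_add_self_ne ha) (hv'.sq_add_self_ne ha')
    refine ⟨a' * v' * e, a' * v' / (a * v), ?_, ?_, ?_⟩
    · exact div_ne_zero (mul_ne_zero ha' hv0') (mul_ne_zero ha hv0)
    · field_simp; linear_combination e * h2
    · field_simp at he ⊢
      linear_combination he + (a ^ 2 * v - a ^ 2 * v * a' ^ 2 * v' * e) * h2
  · obtain ⟨n, hn, h⟩ := exists_eq_mul_sq (hv.not_isSquare h2) (hv'.not_isSquare h2)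
    refine ⟨(n * a * v - a' * v') / 2, n, hn, by field_simp; ring, ?_⟩
    field_simp
    linear_combination h

theorem kEquiv_o10 [Fintype F] {a v a' v' : F} (hv : QuadCond a v) (hv' : QuadCond a' v') :
    KEquiv (lineOf fun x y : F => !![v * x, y, 0; y, x + a * y, 0; 0, 0, 0])
      (lineOf fun x y : F => !![v' * x, y, 0; y, x + a' * y, 0; 0, 0, 0]) := by
  obtain ⟨m, n, hn, h1, h3⟩ := hv.exists_relation hv'
  refine kEquiv_span_pair !![n, m, 0; 0, 1, 0; 0, 0, 1] (1 - a' * m) m (a - a' * (n + m * a))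
    (n + m * a) ?_ ?_ ?_ ?_
  · simpa [Matrix.det_fin_three] using hn
  · convert hn using 1; ring
  · refine lift_eq_of_coords ?_ ?_ ?_ ?_ ?_ ?_ <;> simp [bil_eq, toVec]
    · linear_combination m * h1 - h3
    · ring
  · refine lift_eq_of_coords ?_ ?_ ?_ ?_ ?_ ?_ <;> simp [bil_eq, toVec]
    · linear_combination (n + m * a) * h1 - a * h3
    · ring
    · ring

/-- For odd order, the normal form of the lines of the kind `o15_1`. -/
theorem kEquiv_o15_1_odd [Fintype F] (h2 : (2 : F) ≠ 0) {a v : F} (hv : QuadCond a v)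
    (hs : IsSquare (-v)) : ∃ d : F, ¬ IsSquare d ∧
    KEquiv (lineOf fun x y : F => !![v * y, x, 0; x, a * x + y, 0; 0, 0, x])
      (Submodule.span F {![1, 0, 0, d, 0, 1], ![0, 1, 0, 0, 0, 0]}) := by
  obtain ⟨r, hr⟩ := hs
  have hr0 : r ≠ 0 := by rintro rfl; exact hv.1 (by linear_combination -hr)
  have hps : ¬ IsSquare ((2 * r + a * r ^ 2) * (-2 * r + a * r ^ 2)) := by
    intro h
    apply hv.not_isSquare h2
    convert h using 1
    linear_combination (-4 + a ^ 2 * (r ^ 2 - v)) * hr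
  have hm : (-2 : F) * r ^ 2 ≠ 0 := mul_ne_zero (neg_ne_zero.2 h2) (pow_ne_zero 2 hr0)
  by_cases hp : IsSquare (2 * r + a * r ^ 2)
  · obtain ⟨w, hw⟩ := hp
    have hw0 : w ≠ 0 := by
      rintro rfl; rw [hw] at hps; simp at hps
    refine ⟨-2 * r + a * r ^ 2, fun h => hps (IsSquare.mul ⟨w, hw⟩ h), ?_⟩
    refine kEquiv_span_pair !![1 / w, r / w, 0; 1, -r, 0; 0, 0, 1] 1 (-a * r ^ 2 / w) 0
      (-2 * r ^ 2 / w) ?_ ?_ ?_ ?_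
    · have : (1 / w * -r - r / w) = (-2 * r) / w := by field_simp; ring
      simp [Matrix.det_fin_three] at this ⊢
      rw [this]
      exact div_ne_zero (neg_ne_zero.2 (mul_ne_zero h2 hr0)) hw0
    · simpa using ⟨⟨h2, hr0⟩, hw0⟩
    · refine lift_eq_of_coords ?_ ?_ ?_ ?_ ?_ ?_ <;> simp [bil_eq, toVec] <;> field_simp
      · linear_combination hw
      · ring
      · ring
    · refine lift_eq_of_coords ?_ ?_ ?_ ?_ ?_ ?_ <;> simp [bil_eq, toVec] <;> field_simp
      · linear_combination -hr
      · linear_combination -hr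
      · linear_combination -hr
  · have hs : IsSquare (-2 * r + a * r ^ 2) := by
      by_contra hs
      exact hps (isSquare_mul_of_not_isSquare hp hs)
    obtain ⟨w, hw⟩ := hs
    have hw0 : w ≠ 0 := by
      rintro rfl; rw [hw] at hps; simp at hps
    refine ⟨2 * r + a * r ^ 2, hp, ?_⟩
    refine kEquiv_span_pair !![1 / w, -r / w, 0; 1, r, 0; 0, 0, 1] 1 (-a * r ^ 2 / w) 0
      (-2 * r ^ 2 / w) ?_ ?_ ?_ ?_
    · have : (1 / w * r - -r / w) = (2 * r) / w := by field_simp; ring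
      simp [Matrix.det_fin_three] at this ⊢
      rw [this]
      exact div_ne_zero (mul_ne_zero h2 hr0) hw0
    · simpa using ⟨⟨h2, hr0⟩, hw0⟩
    · refine lift_eq_of_coords ?_ ?_ ?_ ?_ ?_ ?_ <;> simp [bil_eq, toVec] <;> field_simp
      · linear_combination hw
      · ring
      · ring
    · refine lift_eq_of_coords ?_ ?_ ?_ ?_ ?_ ?_ <;> simp [bil_eq, toVec] <;> field_simp
      · linear_combination -hr
      · linear_combination -hr
      · linear_combination -hr

theorem kEquiv_split {d s : F} (hs : s ≠ 0) :
    KEquiv (Submodule.span F {![1, 0, 0, d, 0, 1], ![0, 1, 0, 0, 0, 0]})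
      (Submodule.span F {![1, 0, 0, d * s ^ 2, 0, 1], ![0, 1, 0, 0, 0, 0]}) := by
  refine kEquiv_span_pair !![1, 0, 0; 0, s, 0; 0, 0, 1] 1 0 0 s ?_ (by simpa using hs) ?_ ?_
  · simpa [Matrix.det_fin_three] using hs
  · refine lift_eq_of_coords ?_ ?_ ?_ ?_ ?_ ?_ <;> simp [bil_eq]; exact Or.inl (by ring)
  · refine lift_eq_of_coords ?_ ?_ ?_ ?_ ?_ ?_ <;> simp [bil_eq]

/-- For even order, the lines of the kind `o15_1` can be normalized to `v = 1`. -/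
theorem kEquiv_o15_1_even [Fintype F] (h2 : (2 : F) = 0) {a v : F} (hv : QuadCond a v) :
    ∃ a', QuadCond a' 1 ∧
    KEquiv (lineOf fun x y : F => !![v * y, x, 0; x, a * x + y, 0; 0, 0, x])
      (lineOf fun x y : F => !![1 * y, x, 0; x, a' * x + y, 0; 0, 0, x]) := by
  obtain ⟨r, hr⟩ := isSquare_of_two_eq_zero h2 v
  obtain ⟨w, hw⟩ := isSquare_of_two_eq_zero h2 r
  have hr0 : r ≠ 0 := by rintro rfl; exact hv.1 (by linear_combination hr)
  have hw0 : w ≠ 0 := by rintro rfl; exact hr0 (by linear_combination hw)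
  refine ⟨r * a, ⟨one_ne_zero, fun t ht => hv.2 (t / r) ?_⟩, ?_⟩
  · rw [hr]; field_simp; linear_combination ht
  refine kEquiv_span_pair !![1, 0, 0; 0, r, 0; 0, 0, w] r 0 0 v ?_ ?_ ?_ ?_
  · simp [Matrix.det_fin_three, hr0, hw0]
  · simp [hr0, hv.1]
  · refine lift_eq_of_coords ?_ ?_ ?_ ?_ ?_ ?_ <;> simp [bil_eq, toVec]
    · ring
    · exact hw.symm
  · refine lift_eq_of_coords ?_ ?_ ?_ ?_ ?_ ?_ <;> simp [bil_eq, toVec]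
    exact hr.symm

/-- For even order the parameters `a` with `QuadCond a 1` have inverses outside the additive subgroup
of the elements `e ^ 2 + e`, so that the inverses of two of them differ by such an element. -/
theorem kEquiv_o15_one [Fintype F] (h2 : (2 : F) = 0) {a a' : F} (ha : QuadCond a 1)
    (ha' : QuadCond a' 1) :
    KEquiv (lineOf fun x y : F => !![1 * y, x, 0; x, a * x + y, 0; 0, 0, x])
      (lineOf fun x y : F => !![1 * y, x, 0; x, a' * x + y, 0; 0, 0, x]) := by
  have h0 := ha.ne_zero_left h2
  have h0' := ha'.ne_zero_left h2
  have hne : ∀ b : F, QuadCond b 1 → b ≠ 0 → ∀ e : F, e ^ 2 + e ≠ 1 / b := fun b hb hb0 e he => by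
    apply hb.sq_add_self_ne hb0 (e ^ 2)
    have : (1 : F) / (b ^ 2 * 1) = (1 / b) ^ 2 := by field_simp
    rw [this, ← he]; linear_combination -e ^ 3 * h2
  obtain ⟨e, he⟩ := exists_sq_add_self h2 (hne a ha h0) (hne a' ha' h0')
  obtain ⟨R, hR⟩ := isSquare_of_two_eq_zero h2 (a / a')
  have hR0 : R ≠ 0 := by rintro rfl; simp [h0, h0'] at hR
  have hef : a / a' = 1 + a * (e * (1 + e)) := by
    field_simp at he ⊢
    linear_combination -he - a' * h2
  refine kEquiv_span_pair !![e, 1 + e, 0; 1 + e, e, 0; 0, 0, R] (a / a') ((1 + e) ^ 2 * a) 0 1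
    ?_ ?_ ?_ ?_
  · simp [Matrix.det_fin_three]
    have : e * e * R - (1 + e) * (1 + e) * R = -R := by linear_combination -e * R * h2
    rw [this]; exact neg_ne_zero.2 hR0
  · simp [h0, h0']
  · refine lift_eq_of_coords ?_ ?_ ?_ ?_ ?_ ?_ <;> simp [bil_eq, toVec]
    · linear_combination e * (1 + e) * h2
    · rw [hef]; linear_combination (e ^ 2 + e) * h2
    · field_simp; linear_combination (e * (1 + e) - a * e - a) * h2
    · exact hR.symm
  · refine lift_eq_of_coords ?_ ?_ ?_ ?_ ?_ ?_ <;> simp [bil_eq, toVec]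
    · linear_combination (e ^ 2 + e) * h2
    · linear_combination (e ^ 2 + e) * h2
    · linear_combination (e ^ 2 + e) * h2

/-! ### Lines of the kind `o15_2` -/

/-- A similarity of the anisotropic form `v X ^ 2 + Y ^ 2` transforms the block pencil with
parameters `a`, `v` into the one with parameters `a'`, `v`. -/
theorem kEquiv_o15_similarity {a a' v c g h R : F} (hk : h ^ 2 + v * g ^ 2 ≠ 0)
    (hR : R ≠ 0)
    (hc : (h ^ 2 - v * g ^ 2 - a * v * g * h) * c = R ^ 2)
    (ha' : (h ^ 2 - v * g ^ 2 - a * v * g * h) * a' = 4 * g * h + a * (h ^ 2 - v * g ^ 2)) :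
    KEquiv (lineOf fun x y : F => !![v * y, x, 0; x, a * x + y, 0; 0, 0, x])
      (Submodule.span F {![0, 1, 0, a', 0, c], ![v, 0, 0, 1, 0, 0]}) := by
  have hρ : h ^ 2 - v * g ^ 2 - a * v * g * h ≠ 0 := by
    intro h0; rw [h0, zero_mul] at hc; exact hR (pow_eq_zero_iff two_ne_zero |>.1 hc.symm)
  refine kEquiv_span_pair !![h, -v * g, 0; g, h, 0; 0, 0, R]
    (h ^ 2 - v * g ^ 2 - a * v * g * h) (a * v * g ^ 2 - 2 * g * h) 0 (h ^ 2 + v * g ^ 2) ?_ ?_ ?_ ?_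
  · have : h * h * R + v * g * g * R = (h ^ 2 + v * g ^ 2) * R := by ring
    simp [Matrix.det_fin_three]
    rw [this]; exact mul_ne_zero hk hR
  · simpa using ⟨hρ, hk⟩
  · refine lift_eq_of_coords ?_ ?_ ?_ ?_ ?_ ?_ <;> simp [bil_eq, toVec]
    · ring
    · ring
    · linear_combination -ha'
    · linear_combination -hc
  · refine lift_eq_of_coords ?_ ?_ ?_ ?_ ?_ ?_ <;> simp [bil_eq, toVec] <;> ring

/-- If `-v` is not a square, all admissible values of the parameters `a` and `c` give equivalent
lines. -/
theorem kEquiv_o15_anisotropic [Fintype F] {a a' v c : F} (hv : QuadCond a v)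
    (hv' : QuadCond a' v) (hs : ¬ IsSquare (-v)) (hc : c ≠ 0) :
    KEquiv (lineOf fun x y : F => !![v * y, x, 0; x, a * x + y, 0; 0, 0, x])
      (Submodule.span F {![0, 1, 0, a', 0, c], ![v, 0, 0, 1, 0, 0]}) := by
  have h2 := two_ne_zero_of_not_isSquare hs
  have hv0 := hv.1
  have aniso : ∀ h : F, h ^ 2 + v * 1 ^ 2 ≠ 0 := fun h h0 =>
    hs ⟨h, by linear_combination -h0⟩
  by_cases haa : a' = a
  · subst haa
    by_cases hcs : IsSquare c
    · obtain ⟨R, hR⟩ := hcs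
      refine kEquiv_o15_similarity (g := 0) (h := 1) (R := R) (by simp) ?_ ?_ ?_
      · rintro rfl; simp at hR; exact hc hR
      · rw [hR]; ring
      · ring
    · obtain ⟨R, hR⟩ := isSquare_mul_of_not_isSquare hs hcs
      refine kEquiv_o15_similarity (g := 1) (h := 0) (R := R) (aniso 0) ?_ ?_ ?_
      · rintro rfl; simp [hv0] at hR; exact hc hR
      · linear_combination hR
      · ring
  obtain ⟨e, he⟩ : ∃ e, a' - a = e := ⟨_, rfl⟩
  have he0 : e ≠ 0 := by rw [← he]; exact sub_ne_zero.2 haa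
  have ha' : a' = a + e := by rw [← he]; ring
  -- the square root of the product of the two discriminants
  obtain ⟨ω, hω⟩ := isSquare_mul_of_not_isSquare (hv.not_isSquare h2) (hv'.not_isSquare h2)
  obtain ⟨W, hW⟩ : ∃ W, W ^ 2 = (a ^ 2 * v + 4) * (a' ^ 2 * v + 4) :=
    ⟨ω / v, by field_simp; linear_combination -hω⟩
  obtain ⟨w, hw⟩ := isSquare_mul_of_not_isSquare (hv.not_isSquare h2) hs
  obtain ⟨w, hw⟩ : ∃ w, w ^ 2 = -(a ^ 2 * v + 4) :=
    ⟨w / v, by field_simp; linear_combination -hw⟩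
  have key : ∀ W : F, W ^ 2 = (a ^ 2 * v + 4) * (a' ^ 2 * v + 4) →
      IsSquare (-2 * (4 + a * a' * v + W) * c) → -2 * (4 + a * a' * v + W) * c ≠ 0 →
      KEquiv (lineOf fun x y : F => !![v * y, x, 0; x, a * x + y, 0; 0, 0, x])
        (Submodule.span F {![0, 1, 0, a', 0, c], ![v, 0, 0, 1, 0, 0]}) := by
    rintro W hW ⟨R, hR⟩ hne
    have hw0 : w ≠ 0 := by
      rintro rfl
      have : a ^ 2 * v + 4 = 0 := by linear_combination hw
      exact hv.not_isSquare h2 (by rw [this, mul_zero]; exact IsSquare.zero)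
    have hR0 : R ≠ 0 := by rintro rfl; simp only [mul_zero] at hR; exact hne hR
    -- the similarity is given by a root of a quadratic with discriminant `W ^ 2`
    have hτ : ((4 + a * a' * v + W) / (2 * e)) ^ 2 - v
        = (4 + a * a' * v + W) / (2 * e) * (4 + a * a' * v) / e := by
      field_simp
      rw [ha'] at hW ⊢
      linear_combination hW
    have hρ : ((4 + a * a' * v + W) / (2 * e)) ^ 2 - v
        - a * v * ((4 + a * a' * v + W) / (2 * e)) = -2 * (4 + a * a' * v + W) * (w / (2 * e)) ^ 2 := by
      rw [hτ]
      field_simp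
      rw [ha']
      linear_combination (4 + a * (a + e) * v + W) * hw
    refine kEquiv_o15_similarity (g := 1) (h := (4 + a * a' * v + W) / (2 * e))
      (R := R * (w / (2 * e))) (aniso _)
      (mul_ne_zero hR0 (div_ne_zero hw0 (mul_ne_zero h2 he0))) ?_ ?_
    · linear_combination c * hρ + (w / (2 * e)) ^ 2 * hR
    · have h3 : e * ((4 + a * a' * v + W) / (2 * e) * (4 + a * a' * v) / e)
        = (4 + a * a' * v + W) / (2 * e) * (4 + a * a' * v) := by field_simp
      have h4 := congrArg (e * ·) hτ
      simp only [h3] at h4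
      rw [← he] at h4 ⊢
      linear_combination h4
  have hprod : ¬ IsSquare ((-2 * (4 + a * a' * v + W)) * (-2 * (4 + a * a' * v + -W))) := by
    rintro ⟨r, hr⟩
    apply hs
    refine isSquare_of_mul_sq (s := r) (t := 4 * e)
      (mul_ne_zero (by rw [show (4 : F) = 2 * 2 by norm_num]; exact mul_ne_zero h2 h2) he0) ?_
    rw [ha'] at hW hr
    linear_combination hr + 4 * hW
  have hA : -2 * (4 + a * a' * v + W) ≠ 0 := by
    intro h0; rw [h0] at hprod; simp at hprod
  have hB : -2 * (4 + a * a' * v + -W) ≠ 0 := by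
    intro h0; rw [h0] at hprod; simp at hprod
  by_cases h1 : IsSquare (-2 * (4 + a * a' * v + W) * c)
  · exact key W hW h1 (mul_ne_zero hA hc)
  · refine key (-W) (by rw [neg_sq]; exact hW) ?_ (mul_ne_zero hB hc)
    by_contra h3
    obtain ⟨r, hr⟩ := isSquare_mul_of_not_isSquare h1 h3
    exact hprod (isSquare_of_mul_sq (s := r) hc (by linear_combination hr))

/-- Lines of the kind `o15_2`: for a fixed parameter `v` all admissible values of `a` are equivalent,
and `v` may be multiplied by a square. -/
theorem kEquiv_o15_2 [Fintype F] {a v a' v' : F} (hv : QuadCond a v) (hv' : QuadCond a' v')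
    (hs : ¬ IsSquare (-v)) (hs' : ¬ IsSquare (-v')) :
    KEquiv (lineOf fun x y : F => !![v * y, x, 0; x, a * x + y, 0; 0, 0, x])
      (lineOf fun x y : F => !![v' * y, x, 0; x, a' * x + y, 0; 0, 0, x]) := by
  obtain ⟨s, hs0, hvs⟩ := exists_eq_mul_sq hs hs'
  have hvs' : v' = v * s ^ 2 := by linear_combination -hvs
  have hq : QuadCond (s * a') v := ⟨hv.1, fun t ht => hv'.2 (t / s) (by
    rw [hvs']; field_simp; linear_combination ht)⟩
  refine (kEquiv_o15_anisotropic hv hq hs hs0).trans (KEquiv.symm ?_)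
  refine kEquiv_span_pair !![1 / s, 0, 0; 0, 1, 0; 0, 0, 1] (1 / s) 0 0 1 ?_ ?_ ?_ ?_
  · simpa [Matrix.det_fin_three] using hs0
  · simpa using hs0
  · refine lift_eq_of_coords ?_ ?_ ?_ ?_ ?_ ?_ <;> simp [bil_eq, toVec, hs0]
  · refine lift_eq_of_coords ?_ ?_ ?_ ?_ ?_ ?_ <;> simp [bil_eq, toVec, hvs']
    field_simp

/-! ### Lines without singular points -/

/-- The binary cubic form with coefficients `a`, `b`, `c`, `d`. -/
def binaryCubic (a b c d x y : F) : F := a * x ^ 3 + b * x ^ 2 * y + c * x * y ^ 2 + d * y ^ 3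

/-- The line of all matrices `!![0, x, y; x, c * x + d * y, 0; y, 0, a * x + b * y]`. The negative
of the determinant on this line is the binary cubic form with coefficients `a`, `b`, `c`, `d`. -/
def cubicLine (a b c d : F) : Submodule F (Fin 6 → F) :=
  Submodule.span F {![0, 1, 0, c, 0, a], ![0, 0, 1, d, 0, b]}

/-- A linear substitution and a scaling of the cubic form do not change the orbit of the line. -/
theorem kEquiv_cubicLine {a b c d a' b' c' d' α β γ δ l : F} (hΔ : α * δ - β * γ ≠ 0) (hl : l ≠ 0)
    (ha : a' = l * binaryCubic a b c d α γ)
    (hb : b' = l * (3 * a * α ^ 2 * β + b * (α ^ 2 * δ + 2 * α * β * γ)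
      + c * (2 * α * γ * δ + β * γ ^ 2) + 3 * d * γ ^ 2 * δ))
    (hc : c' = l * (3 * a * α * β ^ 2 + b * (2 * α * β * δ + β ^ 2 * γ)
      + c * (α * δ ^ 2 + 2 * β * γ * δ) + 3 * d * γ * δ ^ 2))
    (hd : d' = l * binaryCubic a b c d β δ) :
    KEquiv (cubicLine a b c d) (cubicLine a' b' c' d') := by
  obtain ⟨D, hD⟩ : ∃ D, D = α * δ - β * γ := ⟨_, rfl⟩
  rw [← hD] at hΔ
  -- the first column kills the entries in the positions `(1, 2)` and `(2, 1)`
  refine kEquiv_span_pair !![1 / (l * D), 0, 0;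
    ((δ * γ * c + β * α * a) * β + (δ * γ * d + β * α * b) * δ) / D, δ, -β;
    ((δ * γ * d + β * α * b) * γ + (δ * γ * c + β * α * a) * α) / D, -γ, α]
    (δ / (l * D)) (-γ / (l * D)) (-β / (l * D)) (α / (l * D)) ?_ ?_ ?_ ?_
  · have : (δ * α - β * γ) ≠ 0 := by rw [mul_comm δ]; rwa [← hD]
    simp only [Matrix.det_fin_three, Matrix.of_apply, Matrix.cons_val]
    field_simp
    simpa using ⟨this, hl, hΔ⟩
  · have : δ * α - γ * β ≠ 0 := by rw [mul_comm δ, mul_comm γ]; rwa [← hD]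
    field_simp
    simpa using ⟨this, hl, hΔ⟩
  · refine lift_eq_of_coords ?_ ?_ ?_ ?_ ?_ ?_ <;> simp [bil_eq, binaryCubic, ha, hb, hc, hd] <;> field_simp
    all_goals rw [hD]; ring
  · refine lift_eq_of_coords ?_ ?_ ?_ ?_ ?_ ?_ <;> simp [bil_eq, binaryCubic, ha, hb, hc, hd] <;> field_simp
    all_goals rw [hD]; ring

theorem binaryCubic_leading_ne_zero {a b c d : F}
    (h : ∀ x y, binaryCubic a b c d x y = 0 → x = 0 ∧ y = 0) : a ≠ 0 :=
  fun h0 => one_ne_zero (h 1 0 (by simp [binaryCubic, h0])).1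

open Polynomial in
/-- Two binary cubic forms without zeros over a finite field have zeros in the same cubic
extension. -/
theorem exists_cubic_extension [Finite F] {a b c d a' b' c' d' : F}
    (h : ∀ x y, binaryCubic a b c d x y = 0 → x = 0 ∧ y = 0)
    (h' : ∀ x y, binaryCubic a' b' c' d' x y = 0 → x = 0 ∧ y = 0) :
    ∃ (E : Type u) (_ : Field E) (_ : Algebra F E) (θ τ : E), Module.finrank F E = 3 ∧
      (algebraMap F E a * θ ^ 3 + algebraMap F E b * θ ^ 2 + algebraMap F E c * θ
        + algebraMap F E d = 0) ∧
      (algebraMap F E a' * τ ^ 3 + algebraMap F E b' * τ ^ 2 + algebraMap F E c' * τ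
        + algebraMap F E d' = 0) ∧
      ∀ r s t : F, algebraMap F E r * τ ^ 2 + algebraMap F E s * τ + algebraMap F E t = 0 →
        r = 0 ∧ s = 0 ∧ t = 0 := by
  have ha := binaryCubic_leading_ne_zero h
  have ha' := binaryCubic_leading_ne_zero h'
  have irr : ∀ {a b c d : F}, a ≠ 0 → (∀ x y, binaryCubic a b c d x y = 0 → x = 0 ∧ y = 0) →
      Irreducible (Cubic.toPoly ⟨a, b, c, d⟩) := by
    intro a b c d ha h
    refine Polynomial.irreducible_of_degree_le_three_of_not_isRoot ?_ fun x hx => ?_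
    · rw [Cubic.natDegree_of_a_ne_zero' ha]; simp
    · exact one_ne_zero (h x 1 (by simpa [Cubic.toPoly, binaryCubic, IsRoot] using hx)).2
  have : Fact (Irreducible (Cubic.toPoly ⟨a, b, c, d⟩)) := ⟨irr ha h⟩
  have : Fact (Irreducible (Cubic.toPoly ⟨a', b', c', d'⟩)) := ⟨irr ha' h'⟩
  have rk : ∀ {a b c d : F}, a ≠ 0 →
      Module.finrank F (AdjoinRoot (Cubic.toPoly ⟨a, b, c, d⟩)) = 3 := by
    intro a b c d ha
    exact finrank_quotient_span_eq_natDegree.trans (Cubic.natDegree_of_a_ne_zero' ha)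
  have : Module.Finite F (AdjoinRoot (Cubic.toPoly ⟨a', b', c', d'⟩)) :=
    Module.finite_of_finrank_pos (by rw [rk ha']; norm_num)
  have : Finite (AdjoinRoot (Cubic.toPoly ⟨a', b', c', d'⟩)) := Module.finite_of_finite F
  obtain ⟨f⟩ : Nonempty (AdjoinRoot (Cubic.toPoly ⟨a, b, c, d⟩) →ₐ[F]
      AdjoinRoot (Cubic.toPoly ⟨a', b', c', d'⟩)) :=
    FiniteField.nonempty_algHom_of_finrank_dvd (by rw [rk ha, rk ha'])
  have hroot : ∀ {a b c d : F}, aeval (AdjoinRoot.root (Cubic.toPoly ⟨a, b, c, d⟩))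
      (Cubic.toPoly ⟨a, b, c, d⟩) = 0 := fun {a b c d} => by
    rw [AdjoinRoot.aeval_eq, AdjoinRoot.mk_self]
  have ev : ∀ {E : Type u} [Field E] [Algebra F E] (x : E) (a b c d : F),
      aeval x (Cubic.toPoly ⟨a, b, c, d⟩) = algebraMap F E a * x ^ 3 + algebraMap F E b * x ^ 2
        + algebraMap F E c * x + algebraMap F E d := fun x a b c d => by
    simp [Cubic.toPoly]
  refine ⟨AdjoinRoot (Cubic.toPoly ⟨a', b', c', d'⟩), inferInstance, inferInstance,
    f (AdjoinRoot.root (Cubic.toPoly ⟨a, b, c, d⟩)), AdjoinRoot.root _, rk ha', ?_, ?_, ?_⟩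
  · have h1 := congrArg f (hroot (a := a) (b := b) (c := c) (d := d))
    rwa [← Polynomial.aeval_algHom_apply, map_zero, ev] at h1
  · rw [← ev]; exact hroot
  · intro r s t hrst
    have h3 : AdjoinRoot.mk (Cubic.toPoly ⟨a', b', c', d'⟩) (Cubic.toPoly ⟨0, r, s, t⟩) = 0 := by
      rw [← AdjoinRoot.aeval_eq, ev, map_zero, zero_mul, zero_add]
      exact hrst
    have h4 := Polynomial.eq_zero_of_dvd_of_natDegree_lt (AdjoinRoot.mk_eq_zero.1 h3) (by
      rw [Cubic.natDegree_of_a_ne_zero' ha']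
      exact lt_of_le_of_lt (Cubic.natDegree_of_a_eq_zero (by rfl)) (by norm_num))
    rw [Cubic.toPoly_eq_zero_iff] at h4
    have := Cubic.ext_iff.1 h4
    exact ⟨this.2.1, this.2.2.1, this.2.2.2⟩

/-- Two binary cubic forms without zeros are equivalent under linear substitutions and scalings:
a zero `θ` of one of them in the cubic field generated by a zero `τ` of the other is a fractional
linear function of `τ`, since `1`, `τ`, `θ`, `τ * θ` are linearly dependent. -/
theorem exists_substitution [Finite F] {a b c d a' b' c' d' : F}
    (h : ∀ x y, binaryCubic a b c d x y = 0 → x = 0 ∧ y = 0)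
    (h' : ∀ x y, binaryCubic a' b' c' d' x y = 0 → x = 0 ∧ y = 0) :
    ∃ α β γ δ l : F, α * δ - β * γ ≠ 0 ∧ l ≠ 0 ∧
      a' = l * binaryCubic a b c d α γ ∧
      b' = l * (3 * a * α ^ 2 * β + b * (α ^ 2 * δ + 2 * α * β * γ)
        + c * (2 * α * γ * δ + β * γ ^ 2) + 3 * d * γ ^ 2 * δ) ∧
      c' = l * (3 * a * α * β ^ 2 + b * (2 * α * β * δ + β ^ 2 * γ)
        + c * (α * δ ^ 2 + 2 * β * γ * δ) + 3 * d * γ * δ ^ 2) ∧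
      d' = l * binaryCubic a b c d β δ := by
  have ha := binaryCubic_leading_ne_zero h
  have ha' := binaryCubic_leading_ne_zero h'
  obtain ⟨E, _, _, θ, τ, hE, hθ, hτ, hq⟩ := exists_cubic_extension h h'
  have : Module.Finite F E := Module.finite_of_finrank_pos (by rw [hE]; norm_num)
  -- `θ` is not in `F`
  have hθF : ∀ t : F, θ ≠ algebraMap F E t := by
    rintro t rfl
    have := h t 1 (by
      apply (algebraMap F E).injective
      simpa [binaryCubic] using hθ)
    exact one_ne_zero this.2
  have hdep : ¬ LinearIndependent F ![1, τ, θ, τ * θ] := fun hli => by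
    have := hli.fintype_card_le_finrank
    rw [hE] at this
    simp at this
  obtain ⟨g, hg, i, hi⟩ := Fintype.not_linearIndependent_iff.1 hdep
  simp only [Fin.sum_univ_four, Matrix.cons_val, Algebra.smul_def] at hg
  obtain ⟨α, hα⟩ : ∃ α, α = -g 1 := ⟨_, rfl⟩
  obtain ⟨β, hβ⟩ : ∃ β, β = -g 0 := ⟨_, rfl⟩
  obtain ⟨γ, hγ⟩ : ∃ γ, γ = g 3 := ⟨_, rfl⟩
  obtain ⟨δ, hδ⟩ : ∃ δ, δ = g 2 := ⟨_, rfl⟩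
  have hrel : θ * (algebraMap F E γ * τ + algebraMap F E δ)
      = algebraMap F E α * τ + algebraMap F E β := by
    rw [hα, hβ, hγ, hδ, map_neg, map_neg]; linear_combination hg
  have hden : algebraMap F E γ * τ + algebraMap F E δ ≠ 0 := by
    intro h0
    obtain ⟨-, h1, h2⟩ := hq 0 γ δ (by simpa using h0)
    rw [h0, mul_zero] at hrel
    obtain ⟨-, h3, h4⟩ := hq 0 α β (by simpa using hrel.symm)
    rw [h1] at hγ; rw [h2] at hδ; rw [h3] at hα; rw [h4] at hβ
    apply hi
    fin_cases i
    · simpa using hβ.symm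
    · simpa using hα.symm
    · exact hδ.symm
    · exact hγ.symm
  have hΔ : α * δ - β * γ ≠ 0 := by
    intro h0
    have hE0 := congrArg (algebraMap F E) h0
    simp only [map_sub, map_mul, map_zero] at hE0
    by_cases hγ0 : γ = 0
    · have hδ0 : algebraMap F E δ ≠ 0 := by rintro h1; rw [hγ0, h1] at hden; simp at hden
      have hα0 : α = 0 := by
        have hd0 : δ ≠ 0 := by rintro rfl; simp at hδ0
        rw [hγ0, mul_zero, sub_zero] at h0
        exact (mul_eq_zero.1 h0).resolve_right hd0
      apply hθF (β / δ)
      rw [map_div₀, eq_div_iff hδ0]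
      rw [hγ0, hα0] at hrel
      simpa using hrel
    · have hγE : algebraMap F E γ ≠ 0 := by
        rw [Ne, map_eq_zero]; exact hγ0
      apply hθF (α / γ)
      rw [map_div₀, eq_div_iff hγE]
      apply mul_right_cancel₀ hden
      linear_combination algebraMap F E γ * hrel - hE0
  have hlead : binaryCubic a b c d α γ ≠ 0 := fun h0 => by
    obtain ⟨h1, h2⟩ := h _ _ h0
    rw [h1, h2] at hΔ
    simp at hΔ
  -- the transformed form vanishes at `τ`
  have hcomp : algebraMap F E (binaryCubic a b c d α γ) * τ ^ 3
      + algebraMap F E (3 * a * α ^ 2 * β + b * (α ^ 2 * δ + 2 * α * β * γ)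
        + c * (2 * α * γ * δ + β * γ ^ 2) + 3 * d * γ ^ 2 * δ) * τ ^ 2
      + algebraMap F E (3 * a * α * β ^ 2 + b * (2 * α * β * δ + β ^ 2 * γ)
        + c * (α * δ ^ 2 + 2 * β * γ * δ) + 3 * d * γ * δ ^ 2) * τ
      + algebraMap F E (binaryCubic a b c d β δ) = 0 := by
    simp only [binaryCubic, map_add, map_mul, map_pow, map_ofNat]
    have h1 := congrArg (fun x => x * (algebraMap F E γ * τ + algebraMap F E δ) ^ 3) hθ
    have h2 : ∀ A B C D e f : E, θ * e = f →
        (A * θ ^ 3 + B * θ ^ 2 + C * θ + D) * e ^ 3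
          = A * f ^ 3 + B * f ^ 2 * e + C * f * e ^ 2 + D * e ^ 3 := by
      rintro A B C D e f rfl; ring
    simp only [h2 _ _ _ _ _ _ hrel, zero_mul] at h1
    linear_combination h1
  obtain ⟨B, hB⟩ : ∃ B, B = 3 * a * α ^ 2 * β + b * (α ^ 2 * δ + 2 * α * β * γ)
      + c * (2 * α * γ * δ + β * γ ^ 2) + 3 * d * γ ^ 2 * δ := ⟨_, rfl⟩
  obtain ⟨C, hC⟩ : ∃ C, C = 3 * a * α * β ^ 2 + b * (2 * α * β * δ + β ^ 2 * γ)
      + c * (α * δ ^ 2 + 2 * β * γ * δ) + 3 * d * γ * δ ^ 2 := ⟨_, rfl⟩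
  rw [← hB, ← hC] at hcomp
  obtain ⟨h1, h2, h3⟩ := hq (binaryCubic a b c d α γ * b' - a' * B)
    (binaryCubic a b c d α γ * c' - a' * C)
    (binaryCubic a b c d α γ * d' - a' * binaryCubic a b c d β δ) (by
    simp only [map_sub, map_mul]
    linear_combination algebraMap F E (binaryCubic a b c d α γ) * hτ - algebraMap F E a' * hcomp)
  refine ⟨α, β, γ, δ, a' / binaryCubic a b c d α γ, hΔ, div_ne_zero ha' hlead, ?_, ?_, ?_, ?_⟩
  · field_simp
  · rw [← hB]; field_simp; linear_combination h1
  · rw [← hC]; field_simp; linear_combination h2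
  · field_simp; linear_combination h3

theorem kEquiv_cubicLine_of_forall [Finite F] {a b c d a' b' c' d' : F}
    (h : ∀ x y, binaryCubic a b c d x y = 0 → x = 0 ∧ y = 0)
    (h' : ∀ x y, binaryCubic a' b' c' d' x y = 0 → x = 0 ∧ y = 0) :
    KEquiv (cubicLine a b c d) (cubicLine a' b' c' d') := by
  obtain ⟨α, β, γ, δ, l, hΔ, hl, h1, h2, h3, h4⟩ := exists_substitution h h'
  exact kEquiv_cubicLine hΔ hl h1 h2 h3 h4

theorem exists_GL_transpose_of_ne_zero {a : Fin 3 → F} (ha : a ≠ 0) :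
    ∃ A : GL (Fin 3) F, A.1.transpose.mulVec (Pi.single 0 1) = a := by
  obtain ⟨A, hA⟩ := exists_GL_of_ne_zero ha
  refine ⟨Matrix.GeneralLinearGroup.mkOfDetNeZero A.1.transpose ?_, ?_⟩
  · rw [Matrix.det_transpose]
    exact ((Matrix.isUnit_iff_isUnit_det _).1 A.isUnit).ne_zero
  · simpa [Matrix.GeneralLinearGroup.mkOfDetNeZero] using hA

theorem IsLine.exists_eq_span {L : Submodule F (Fin 6 → F)} (hL : IsLine L) :
    ∃ y z, LinearIndependent F ![y, z] ∧ L = Submodule.span F {y, z} := by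
  have : FiniteDimensional F L := inferInstance
  let b := Module.finBasisOfFinrankEq F L hL
  have hli : LinearIndependent F ![(b 0 : Fin 6 → F), b 1] := by
    have := b.linearIndependent.map' L.subtype L.ker_subtype
    have h2 : (![(b 0 : Fin 6 → F), b 1]) = L.subtype ∘ b := by
      ext i j; fin_cases i <;> rfl
    rw [h2]; exact this
  refine ⟨b 0, b 1, hli, (Submodule.eq_of_le_of_finrank_eq ?_ ?_).symm⟩
  · rw [Submodule.span_le]
    rintro x (rfl | rfl)
    · exact (b 0).2
    · exact (b 1).2
  · rw [finrank_span_pair hli]; exact hL.symm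

theorem detVec_lift (A : Matrix (Fin 3) (Fin 3) F) (y : Fin 6 → F) :
    detVec (lift A y) = A.det ^ 2 * detVec y := by
  rw [← det_toMat, toMat_lift, Matrix.det_mul, Matrix.det_mul, Matrix.det_transpose, det_toMat]
  ring

/-- A line is nonsingular if its points have rank three. -/
def IsNonsingularLine (L : Submodule F (Fin 6 → F)) : Prop :=
  IsLine L ∧ ∀ y ∈ L, detVec y = 0 → y = 0

theorem IsNonsingularLine.of_kEquiv {L M : Submodule F (Fin 6 → F)} (h : IsNonsingularLine L)
    (hLM : KEquiv L M) : IsNonsingularLine M := by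
  obtain ⟨A, rfl⟩ := hLM
  refine ⟨h.1.map A, ?_⟩
  rintro _ ⟨y, hy, rfl⟩ h0
  rw [detVec_lift] at h0
  have hA : A.1.det ≠ 0 := ((Matrix.isUnit_iff_isUnit_det _).1 A.isUnit).ne_zero
  rw [h.2 y hy ((mul_eq_zero.1 h0).resolve_left (pow_ne_zero 2 hA)), map_zero]

/-- On a nonsingular line there is a vector isotropic for all matrices of the line. Taking it as
the first basis vector, the line becomes the line of a binary cubic form without zeros. -/
theorem IsNonsingularLine.exists_kEquiv_cubicLine [Finite F] {L : Submodule F (Fin 6 → F)}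
    (h : IsNonsingularLine L) : ∃ a b c d : F, KEquiv L (cubicLine a b c d) ∧
      ∀ x y, binaryCubic a b c d x y = 0 → x = 0 ∧ y = 0 := by
  have := Fintype.ofFinite F
  obtain ⟨v, hv, hLv⟩ : ∃ a : Fin 3 → F, a ≠ 0 ∧ ∀ y ∈ L, bil y a a = 0 := by
    have h1 := isoCount_mul L
    rw [isoCount_of_nonsingular L h.1 fun y hy h0 h' => h0 (h.2 y hy h'), one_mul] at h1
    have hq : 1 < Nat.card F := Finite.one_lt_card
    have : {a : Fin 3 → F | a ≠ 0 ∧ ∀ y ∈ L, bil y a a = 0}.ncard ≠ 0 := by omega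
    exact Set.nonempty_of_ncard_ne_zero this
  obtain ⟨A, hA⟩ := exists_GL_transpose_of_ne_zero hv
  have hLM : KEquiv L (L.map (lift A.1)) := ⟨A, rfl⟩
  have hM := h.of_kEquiv hLM
  have h0 : ∀ y ∈ L.map (lift A.1), y 0 = 0 := by
    rintro _ ⟨y, hy, rfl⟩
    have := hLv y hy
    rw [← hA, ← bil_lift] at this
    simpa [bil_eq] using this
  generalize L.map (lift A.1) = M at hLM hM h0
  obtain ⟨y, z, hyz, rfl⟩ := hM.1.exists_eq_span
  have hy0 := h0 y (Submodule.subset_span (by simp))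
  have hz0 := h0 z (Submodule.subset_span (by simp))
  have hD : y 1 * z 2 - y 2 * z 1 ≠ 0 := by
    intro hD
    have hsing : ∀ p r : F, p * y 1 + r * z 1 = 0 → p * y 2 + r * z 2 = 0 → p = 0 ∧ r = 0 := by
      intro p r h1 h2
      refine LinearIndependent.pair_iff.1 hyz p r (hM.2 _ (Submodule.mem_span_pair.2 ⟨p, r, rfl⟩) ?_)
      simp [detVec, hy0, hz0, h1, h2]
    obtain ⟨h1, h2⟩ := hsing (z 2) (-y 2) (by linear_combination hD) (by ring)
    obtain ⟨h3, h4⟩ := hsing (z 1) (-y 1) (by ring) (by linear_combination -hD)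
    have := hsing 1 0 (by simpa using h4) (by simpa using h2)
    exact one_ne_zero this.1
  obtain ⟨p, hp⟩ : ∃ p : Fin 6 → F, p = (z 2 / (y 1 * z 2 - y 2 * z 1)) • y
    + (-y 2 / (y 1 * z 2 - y 2 * z 1)) • z := ⟨_, rfl⟩
  obtain ⟨r, hr⟩ : ∃ r : Fin 6 → F, r = (-z 1 / (y 1 * z 2 - y 2 * z 1)) • y
    + (y 1 / (y 1 * z 2 - y 2 * z 1)) • z := ⟨_, rfl⟩
  have hspan : Submodule.span F {p, r} = Submodule.span F {y, z} := by
    refine span_pair_eq hp hr ?_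
    have h1 : z 2 / (y 1 * z 2 - y 2 * z 1) * (y 1 / (y 1 * z 2 - y 2 * z 1))
        - -y 2 / (y 1 * z 2 - y 2 * z 1) * (-z 1 / (y 1 * z 2 - y 2 * z 1))
        = 1 / (y 1 * z 2 - y 2 * z 1) := by
      rw [eq_div_iff hD]
      linear_combination
        ((y 1 * z 2 - y 2 * z 1) / (y 1 * z 2 - y 2 * z 1) + 1) * div_self hD
    rw [h1]; exact one_div_ne_zero hD
  have hp1 : p 0 = 0 ∧ p 1 = 1 ∧ p 2 = 0 := by
    simp only [hp, Pi.add_apply, Pi.smul_apply, smul_eq_mul, hy0, hz0]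
    exact ⟨by ring, by linear_combination div_self hD, by ring⟩
  have hr1 : r 0 = 0 ∧ r 1 = 0 ∧ r 2 = 1 := by
    simp only [hr, Pi.add_apply, Pi.smul_apply, smul_eq_mul, hy0, hz0]
    exact ⟨by ring, by ring, by linear_combination div_self hD⟩
  have hK : KEquiv (Submodule.span F {y, z})
      (cubicLine (p 5) (r 5 - 2 * p 4) (p 3 - 2 * r 4) (r 3)) := by
    rw [← hspan]
    refine kEquiv_span_pair !![1, 0, 0; -r 4, 1, 0; -p 4, 0, 1] 1 0 0 1 ?_ ?_ ?_ ?_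
    · simp [Matrix.det_fin_three]
    · simp
    · refine lift_eq_of_coords ?_ ?_ ?_ ?_ ?_ ?_ <;> simp [bil_eq, hp1] <;> ring
    · refine lift_eq_of_coords ?_ ?_ ?_ ?_ ?_ ?_ <;> simp [bil_eq, hr1] <;> ring
  refine ⟨_, _, _, _, hLM.trans hK, fun x w h0 => ?_⟩
  have hN := hM.of_kEquiv hK
  have h1 := hN.2 _ (Submodule.mem_span_pair.2 ⟨x, w, rfl⟩) (by
    simp [detVec]
    rw [binaryCubic] at h0
    linear_combination -h0)
  exact ⟨by simpa using congrFun h1 1, by simpa using congrFun h1 2⟩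

theorem HasProfile.isNonsingularLine [Finite F] {L : Submodule F (Fin 6 → F)} {r h : ℕ}
    (hL : HasProfile L r 0 h) : IsNonsingularLine L := by
  refine ⟨hL.1, fun y hy h0 => ?_⟩
  by_contra hy0
  have h1 := hL.2.2.1
  rw [rankCount_one_add_two, Set.ncard_eq_zero (Set.toFinite _),
    Set.eq_empty_iff_forall_notMem] at h1
  refine h1 (Projectivization.mk F y hy0) ⟨submodule_le_iff.2 ?_, ?_⟩
  · exact (rep_mk_iff (· ∈ L) (fun c v _ h => L.smul_mem c h) hy0).2 hy
  · exact (rep_mk_iff (fun y => detVec y = 0)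
      (fun c v _ h => by rw [detVec_smul, h, mul_zero]) hy0).2 h0

/-- All lines without singular points are equivalent. -/
theorem IsNonsingularLine.kEquiv [Finite F] {L M : Submodule F (Fin 6 → F)}
    (hL : IsNonsingularLine L) (hM : IsNonsingularLine M) : KEquiv L M := by
  obtain ⟨a, b, c, d, h1, h2⟩ := hL.exists_kEquiv_cubicLine
  obtain ⟨a', b', c', d', h3, h4⟩ := hM.exists_kEquiv_cubicLine
  exact (h1.trans (kEquiv_cubicLine_of_forall h2 h4)).trans h3.symm

/-! ### Independence of the parameters -/

/-- The orbit of a representative does not depend on the choice of its parameters. -/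
theorem kEquiv_of_tableRow [Fintype F] {t : Label} {L L' : Submodule F (Fin 6 → F)}
    {W W' : Submodule F (MvPolynomial (Fin 3) F)} (h : TableRow t L W) (h' : TableRow t L' W') :
    KEquiv L L' := by
  cases h <;> cases h'
  case r8_2.r8_2 d hd _ hd' =>
    obtain ⟨s, hs, rfl⟩ := exists_eq_mul_sq hd hd'
    exact kEquiv_o8_2 hs
  case r10.r10 a v hv _ _ hv' => exact kEquiv_o10 hv hv'
  case r13_2.r13_2 d hd _ hd' =>
    obtain ⟨s, hs, rfl⟩ := exists_eq_mul_sq hd hd'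
    exact kEquiv_o13_2 hs
  case r14_2.r14_2 d hd _ hd' =>
    obtain ⟨s, hs, rfl⟩ := exists_eq_mul_sq hd hd'
    exact kEquiv_o14_2 hs
  case r15_1.r15_1 a v hv hs _ _ hv' hs' =>
    by_cases h2 : (2 : F) = 0
    · obtain ⟨b, hb, h1⟩ := kEquiv_o15_1_even h2 hv
      obtain ⟨b', hb', h1'⟩ := kEquiv_o15_1_even h2 hv'
      exact (h1.trans (kEquiv_o15_one h2 hb hb')).trans h1'.symm
    · obtain ⟨d, hd, h1⟩ := kEquiv_o15_1_odd h2 hv hs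
      obtain ⟨d', hd', h1'⟩ := kEquiv_o15_1_odd h2 hv' hs'
      obtain ⟨s, hs0, rfl⟩ := exists_eq_mul_sq hd hd'
      exact (h1.trans (kEquiv_split hs0)).trans h1'.symm
  case r15_2.r15_2 a v hv hs _ _ hv' hs' => exact kEquiv_o15_2 hv hv' hs hs'
  case r17.r17 a b c h _ _ _ h' =>
    exact (profile_o17 h).isNonsingularLine.kEquiv (profile_o17 h').isNonsingularLine
  all_goals exact KEquiv.refl _

theorem HasType.kEquiv [Fintype F] {t : Label} {L L' : Submodule F (Fin 6 → F)}
    (h : HasType t L) (h' : HasType t L') : KEquiv L L' := by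
  obtain ⟨M, W, h1, h2⟩ := h
  obtain ⟨M', W', h1', h2'⟩ := h'
  exact (h2.symm.trans (kEquiv_of_tableRow h1 h1')).trans h2'

/-! ### Normal forms of binary quadratic forms and of lines with a point of rank one -/

/-- Congruence normal forms of symmetric `2 × 2` matrices. -/
theorem exists_binary_normalForm {n₁ n₂ n₃ : F} (h : ¬ (n₁ = 0 ∧ n₂ = 0 ∧ n₃ = 0)) :
    ∃ α β γ δ m₁ m₂ m₃ : F, α * δ - β * γ ≠ 0 ∧
      n₁ * α ^ 2 + 2 * n₂ * (α * β) + n₃ * β ^ 2 = m₁ ∧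
      n₁ * (α * γ) + n₂ * (α * δ + β * γ) + n₃ * (β * δ) = m₂ ∧
      n₁ * γ ^ 2 + 2 * n₂ * (γ * δ) + n₃ * δ ^ 2 = m₃ ∧
      ((m₁ ≠ 0 ∧ m₂ = 0 ∧ m₃ = 0) ∨ (m₁ ≠ 0 ∧ m₂ = 0 ∧ m₃ = -m₁) ∨
        (∃ d, ¬ IsSquare d ∧ m₁ ≠ 0 ∧ m₂ = 0 ∧ m₃ = -d * m₁) ∨
        ((2 : F) = 0 ∧ m₁ = 0 ∧ m₂ ≠ 0 ∧ m₃ = 0)) := by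
  by_cases h1 : n₁ = 0
  · by_cases h3 : n₃ = 0
    · have h2 : n₂ ≠ 0 := fun h2 => h ⟨h1, h2, h3⟩
      by_cases hc : (2 : F) = 0
      · exact ⟨1, 0, 0, 1, 0, n₂, 0, by simp, by simp [h1], by simp, by simp [h3],
          Or.inr (Or.inr (Or.inr ⟨hc, rfl, h2, rfl⟩))⟩
      · refine ⟨1, 1, 1, -1, 2 * n₂, 0, -(2 * n₂), ?_, ?_, ?_, ?_,
          Or.inr (Or.inl ⟨mul_ne_zero hc h2, rfl, rfl⟩)⟩
        · rw [show (1 : F) * -1 - 1 * 1 = -2 by norm_num]; exact neg_ne_zero.2 hc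
        all_goals rw [h1, h3]; ring
    · by_cases h2 : n₂ = 0
      · exact ⟨0, 1, 1, 0, n₃, 0, 0, by simp, by simp, by simp [h2], by simp [h1],
          Or.inl ⟨h3, rfl, rfl⟩⟩
      · refine ⟨0, 1, n₃ / n₂, -1, n₃, 0, -n₃, ?_, ?_, ?_, ?_, Or.inr (Or.inl ⟨h3, rfl, rfl⟩)⟩
        · simpa using ⟨h3, h2⟩
        · ring
        · field_simp; ring
        · rw [h1]; field_simp; ring
  · obtain ⟨e, he⟩ : ∃ e, e = (n₂ ^ 2 - n₁ * n₃) / n₁ ^ 2 := ⟨_, rfl⟩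
    have he' : n₃ = n₂ ^ 2 / n₁ - e * n₁ := by rw [he]; field_simp; ring
    by_cases hs : IsSquare e
    · obtain ⟨s, hs⟩ := hs
      by_cases h0 : s = 0
      · refine ⟨1, 0, -n₂ / n₁, 1, n₁, 0, 0, by simp, by simp, ?_, ?_, Or.inl ⟨h1, rfl, rfl⟩⟩
        · field_simp; ring
        · rw [he', hs, h0]; field_simp; ring
      · refine ⟨1, 0, -n₂ / (n₁ * s), 1 / s, n₁, 0, -n₁, by simpa using h0, by simp, ?_, ?_,
          Or.inr (Or.inl ⟨h1, rfl, rfl⟩)⟩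
        · field_simp; ring
        · rw [he', hs]; field_simp; ring
    · refine ⟨1, 0, -n₂ / n₁, 1, n₁, 0, -e * n₁, by simp, by simp, ?_, ?_,
        Or.inr (Or.inr (Or.inl ⟨e, hs, h1, rfl, rfl⟩))⟩
      · field_simp; ring
      · rw [he']; field_simp; ring

theorem exists_hasType_of_kEquiv {L M : Submodule F (Fin 6 → F)} (hLM : KEquiv L M)
    (h : ∃ t, HasType t M) : ∃ t, HasType t L := by
  obtain ⟨t, ht⟩ := h
  exact ⟨t, ht.of_kEquiv hLM.symm⟩

theorem IsLine.exists_eq_span_of_mem {L : Submodule F (Fin 6 → F)} (hL : IsLine L) {y : Fin 6 → F}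
    (hy : y ∈ L) (hy0 : y ≠ 0) : ∃ z, LinearIndependent F ![y, z] ∧ L = Submodule.span F {y, z} := by
  obtain ⟨b, c, hbc, rfl⟩ := hL.exists_eq_span
  obtain ⟨r, s, rfl⟩ := Submodule.mem_span_pair.1 hy
  have hli : ∀ z, Submodule.span F {b, c} = Submodule.span F {r • b + s • c, z} →
      LinearIndependent F ![r • b + s • c, z] := by
    intro z hz
    rw [linearIndependent_iff_card_eq_finrank_span]
    have : Set.range ![r • b + s • c, z] = {r • b + s • c, z} := by
      simp [Matrix.range_cons, Set.pair_comm]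
    rw [this]
    change _ = Module.finrank F (Submodule.span F {r • b + s • c, z})
    rw [← hz]
    exact hL.symm
  by_cases hr : r = 0
  · have hs : s ≠ 0 := by rintro rfl; simp [hr] at hy0
    have h := (span_pair_eq (y := r • b + s • c) (z := b) (y' := b) (z' := c) rfl
      (r := 1) (s := 0) (by simp) (by simpa using hs)).symm
    exact ⟨b, hli _ h, h⟩
  · have h := (span_pair_eq (y := r • b + s • c) (z := c) (y' := b) (z' := c) rfl
      (r := 0) (s := 1) (by simp) (by simpa using hr)).symm
    exact ⟨c, hli _ h, h⟩

/-- A congruence of the last two rows and columns. -/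
theorem kEquiv_block {α β γ δ : F} (hd : α * δ - β * γ ≠ 0) (y z : Fin 6 → F) :
    KEquiv (Submodule.span F {y, z}) (Submodule.span F
      {lift !![1, 0, 0; 0, α, β; 0, γ, δ] y, lift !![1, 0, 0; 0, α, β; 0, γ, δ] z}) :=
  kEquiv_span_pair !![1, 0, 0; 0, α, β; 0, γ, δ] 1 0 0 1
    (by simpa [Matrix.det_fin_three] using hd) (by simp) (by simp) (by simp)

theorem lift_block (α β γ δ : F) (y : Fin 6 → F) :
    lift !![1, 0, 0; 0, α, β; 0, γ, δ] y = ![y 0, α * y 1 + β * y 2, γ * y 1 + δ * y 2,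
      y 3 * α ^ 2 + 2 * y 4 * (α * β) + y 5 * β ^ 2,
      y 3 * (α * γ) + y 4 * (α * δ + β * γ) + y 5 * (β * δ),
      y 3 * γ ^ 2 + 2 * y 4 * (γ * δ) + y 5 * δ ^ 2] := by
  refine lift_eq_of_coords ?_ ?_ ?_ ?_ ?_ ?_ <;> simp [bil_eq] <;> ring

set_option maxHeartbeats 1000000 in
theorem exists_hasType_rank_one_normalForm {b₁ b₂ m₁ m₂ m₃ : F}
    (h : (m₁ ≠ 0 ∧ m₂ = 0 ∧ m₃ = 0) ∨ (m₁ ≠ 0 ∧ m₂ = 0 ∧ m₃ = -m₁) ∨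
        (∃ d, ¬ IsSquare d ∧ m₁ ≠ 0 ∧ m₂ = 0 ∧ m₃ = -d * m₁) ∨
        ((2 : F) = 0 ∧ m₁ = 0 ∧ m₂ ≠ 0 ∧ m₃ = 0)) :
    ∃ t, HasType t (Submodule.span F {![1, 0, 0, 0, 0, 0], ![0, b₁, b₂, m₁, m₂, m₃]}) := by
  rcases h with ⟨h1, rfl, rfl⟩ | ⟨h1, rfl, rfl⟩ | ⟨d, hd, h1, rfl, rfl⟩ | ⟨h2, rfl, hm, rfl⟩
  · by_cases hb : b₂ = 0
    · refine exists_hasType_of_kEquiv ?_ ⟨_, (TableRow.r5 (F := F)).hasType⟩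
      refine kEquiv_span_pair !![1, -b₁ / m₁, 0; 0, 1, 0; 0, 0, 1] 1 0 (-b₁ ^ 2 / m₁) m₁ ?_ ?_ ?_ ?_
      · simp [Matrix.det_fin_three]
      · simpa using h1
      · refine lift_eq_of_coords ?_ ?_ ?_ ?_ ?_ ?_ <;> simp [bil_eq, toVec]
      · refine lift_eq_of_coords ?_ ?_ ?_ ?_ ?_ ?_ <;> simp [bil_eq, toVec, hb] <;> field_simp <;> ring
    · refine exists_hasType_of_kEquiv ?_ ⟨_, (TableRow.r9 (F := F)).hasType⟩
      refine kEquiv_span_pair !![1, -b₁ / m₁, 0; 0, 1, 0; 0, 0, m₁ / b₂]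
        1 0 (-b₁ ^ 2 / m₁) m₁ ?_ ?_ ?_ ?_
      · simpa [Matrix.det_fin_three] using ⟨h1, hb⟩
      · simpa using h1
      · refine lift_eq_of_coords ?_ ?_ ?_ ?_ ?_ ?_ <;> simp [bil_eq, toVec]
      · refine lift_eq_of_coords ?_ ?_ ?_ ?_ ?_ ?_ <;> simp [bil_eq, toVec] <;> field_simp <;> ring
  · refine exists_hasType_of_kEquiv ?_ ⟨_, (TableRow.r8_1 (F := F)).hasType⟩
    refine kEquiv_span_pair !![1, -b₁ / m₁, b₂ / m₁; 0, 1, 0; 0, 0, 1]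
      1 0 ((b₂ ^ 2 - b₁ ^ 2) / m₁) m₁ ?_ ?_ ?_ ?_
    · simp [Matrix.det_fin_three]
    · simpa using h1
    · refine lift_eq_of_coords ?_ ?_ ?_ ?_ ?_ ?_ <;> simp [bil_eq, toVec]
    · refine lift_eq_of_coords ?_ ?_ ?_ ?_ ?_ ?_ <;> simp [bil_eq, toVec] <;> field_simp <;> ring
  · have hd0 := ne_zero_of_not_isSquare hd
    refine exists_hasType_of_kEquiv ?_ ⟨_, (TableRow.r8_2 (F := F) d hd).hasType⟩
    refine kEquiv_span_pair !![1, -b₁ / m₁, b₂ / (d * m₁); 0, 1, 0; 0, 0, 1]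
      1 0 ((b₂ ^ 2 / d - b₁ ^ 2) / m₁) m₁ ?_ ?_ ?_ ?_
    · simp [Matrix.det_fin_three]
    · simpa using h1
    · refine lift_eq_of_coords ?_ ?_ ?_ ?_ ?_ ?_ <;> simp [bil_eq, toVec]
    · refine lift_eq_of_coords ?_ ?_ ?_ ?_ ?_ ?_ <;> simp [bil_eq, toVec] <;> field_simp <;> ring
  · refine exists_hasType_of_kEquiv ?_ ⟨_, (TableRow.r8_3 (F := F) h2).hasType⟩
    refine kEquiv_span_pair !![1, -b₂ / m₂, -b₁ / m₂; 0, 1, 0; 0, 0, 1]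
      1 0 (-2 * b₁ * b₂ / m₂) m₂ ?_ ?_ ?_ ?_
    · simp [Matrix.det_fin_three]
    · simpa using hm
    · refine lift_eq_of_coords ?_ ?_ ?_ ?_ ?_ ?_ <;> simp [bil_eq, toVec]
    · refine lift_eq_of_coords ?_ ?_ ?_ ?_ ?_ ?_ <;> simp [bil_eq, toVec] <;> field_simp <;> ring

/-- Lines with a point of rank one. -/
theorem exists_hasType_of_rank_one {L : Submodule F (Fin 6 → F)} (hL : IsLine L)
    {y : Fin 6 → F} (hy : y ∈ L) (hy0 : y ≠ 0) (hr : MinorsVanish y) : ∃ t, HasType t L := by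
  obtain ⟨k, u, hk, hu, rfl⟩ := (minorsVanish_iff hy0).1 hr
  obtain ⟨A, hA⟩ := exists_GL_of_ne_zero hu
  have hLM : KEquiv L (L.map (lift (A⁻¹ : GL (Fin 3) F).1)) := ⟨A⁻¹, rfl⟩
  refine exists_hasType_of_kEquiv hLM ?_
  have hM := hL.map A⁻¹
  have hE : (![1, 0, 0, 0, 0, 0] : Fin 6 → F) ∈ L.map (lift (A⁻¹ : GL (Fin 3) F).1) := by
    refine ⟨veronese u, ?_, ?_⟩
    · have := L.smul_mem k⁻¹ hy
      rwa [smul_smul, inv_mul_cancel₀ hk, one_smul] at this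
    · rw [← hA, ← lift_veronese, lift_inv_lift]
      ext i; fin_cases i <;> simp [veronese]
  generalize L.map (lift (A⁻¹ : GL (Fin 3) F).1) = M at hM hE
  obtain ⟨z, hz, rfl⟩ := hM.exists_eq_span_of_mem hE (fun h => by simpa using congrFun h 0)
  have hspan : Submodule.span F {(![1, 0, 0, 0, 0, 0] : Fin 6 → F), z}
      = Submodule.span F {![1, 0, 0, 0, 0, 0], ![0, z 1, z 2, z 3, z 4, z 5]} :=
    span_pair_eq (p := 1) (q := 0) (r := z 0) (s := 1) (by simp)
      (by ext i; fin_cases i <;> simp) (by simp)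
  rw [hspan]
  by_cases hN : z 3 = 0 ∧ z 4 = 0 ∧ z 5 = 0
  · obtain ⟨h3, h4, h5⟩ := hN
    refine exists_hasType_of_kEquiv ?_ ⟨_, (TableRow.r6 (F := F)).hasType⟩
    by_cases h1 : z 1 = 0
    · have h2 : z 2 ≠ 0 := by
        intro h2
        have := (LinearIndependent.pair_iff.1 hz (-z 0) 1
          (by ext i; fin_cases i <;> simp [h1, h2, h3, h4, h5])).2
        exact one_ne_zero this
      refine kEquiv_span_pair !![1, 0, 0; 0, 0, 1; 0, 1, 0] 1 0 0 (z 2) ?_ ?_ ?_ ?_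
      · simp [Matrix.det_fin_three]
      · simpa using h2
      · refine lift_eq_of_coords ?_ ?_ ?_ ?_ ?_ ?_ <;> simp [bil_eq, toVec]
      · refine lift_eq_of_coords ?_ ?_ ?_ ?_ ?_ ?_ <;> simp [bil_eq, toVec, h1, h3, h4, h5]
    · refine kEquiv_span_pair !![1, 0, 0; 0, 1, 0; 0, -z 2 / z 1, 1] 1 0 0 (z 1) ?_ ?_ ?_ ?_
      · simp [Matrix.det_fin_three]
      · simpa using h1
      · refine lift_eq_of_coords ?_ ?_ ?_ ?_ ?_ ?_ <;> simp [bil_eq, toVec]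
      · refine lift_eq_of_coords ?_ ?_ ?_ ?_ ?_ ?_ <;> simp [bil_eq, toVec, h3, h4, h5]
        field_simp
        ring
  · obtain ⟨α, β, γ, δ, m₁, m₂, m₃, hd, e1, e2, e3, hm⟩ := exists_binary_normalForm hN
    refine exists_hasType_of_kEquiv (kEquiv_block hd _ _) ?_
    rw [lift_block, lift_block]
    have := exists_hasType_rank_one_normalForm (b₁ := α * z 1 + β * z 2)
      (b₂ := γ * z 1 + δ * z 2) hm
    simpa [e1, e2, e3] using this

/-! ### Lines with a singular point whose kernel is isotropic for all points of the line -/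

/-- A pencil of binary quadratic forms without forms of rank one. -/
theorem exists_hasType_pencil {n₁ n₂ n₃ p r s : F}
    (h : ∀ x y : F, (x * n₁ + y * p) * (x * n₃ + y * s) = (x * n₂ + y * r) ^ 2 → x = 0 ∧ y = 0) :
    ∃ t, HasType t (Submodule.span F {(![0, 0, 0, n₁, n₂, n₃] : Fin 6 → F),
      ![0, 0, 0, p, r, s]}) := by
  -- the form `α X + β Y + γ Z` vanishes on the pencil
  obtain ⟨α, hα⟩ : ∃ α, α = n₂ * s - n₃ * r := ⟨_, rfl⟩
  obtain ⟨β, hβ⟩ : ∃ β, β = n₃ * p - n₁ * s := ⟨_, rfl⟩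
  obtain ⟨γ, hγ⟩ : ∃ γ, γ = n₁ * r - n₂ * p := ⟨_, rfl⟩
  have hα0 : α ≠ 0 := by
    intro h0
    rw [h0] at hα
    obtain ⟨h1, h2⟩ := h r (-n₂) (by linear_combination (r * n₁ - n₂ * p) * hα)
    obtain ⟨h3, h4⟩ := h s (-n₃) (by linear_combination (n₂ * s - n₃ * r) * hα)
    exact one_ne_zero (h 1 0 (by simp [neg_eq_zero.1 h2, neg_eq_zero.1 h4])).1
  have hγ0 : γ ≠ 0 := by
    intro h0
    rw [h0] at hγ
    obtain ⟨h1, h2⟩ := h r (-n₂) (by linear_combination (-(r * n₃ - n₂ * s)) * hγ)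
    obtain ⟨h3, h4⟩ := h p (-n₁) (by linear_combination (n₁ * r - n₂ * p) * hγ)
    exact one_ne_zero (h 1 0 (by simp [neg_eq_zero.1 h2, neg_eq_zero.1 h4])).1
  have hQ : QuadCond (-β / γ) (-γ / α) := by
    refine ⟨div_ne_zero (neg_ne_zero.2 hγ0) hα0, fun t ht => hα0 ?_⟩
    have ht' : γ * t ^ 2 - β * t + α = 0 := by
      field_simp at ht
      linear_combination -ht
    obtain ⟨h1, h2⟩ := h (-t * (s + t * r)) (t * (n₂ * t + n₃)) (by
      have e1 : -t * (s + t * r) * n₁ + t * (n₂ * t + n₃) * p = α := by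
        rw [hγ, hβ] at ht'; linear_combination -ht'
      have e2 : -t * (s + t * r) * n₂ + t * (n₂ * t + n₃) * r = -t * α := by rw [hα]; ring
      have e3 : -t * (s + t * r) * n₃ + t * (n₂ * t + n₃) * s = t ^ 2 * α := by rw [hα]; ring
      rw [e1, e2, e3]; ring)
    rw [hγ, hβ] at ht'
    linear_combination n₁ * h1 + p * h2 + ht'
  refine exists_hasType_of_kEquiv ?_ ⟨_, (TableRow.r10 (F := F) _ _ hQ).hasType⟩
  refine kEquiv_span_pair !![0, 1, 0; 0, 0, 1; 1, 0, 0]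
    (n₃ + β / γ * n₂) n₂ (s + β / γ * r) r ?_ ?_ ?_ ?_
  · simp [Matrix.det_fin_three]
  · intro h0
    apply hα0
    rw [hα]
    linear_combination -h0
  · refine lift_eq_of_coords ?_ ?_ ?_ ?_ ?_ ?_ <;> simp [bil_eq, toVec] <;> field_simp
    · rw [hα, hβ, hγ]; ring
    · ring
  · refine lift_eq_of_coords ?_ ?_ ?_ ?_ ?_ ?_ <;> simp [bil_eq, toVec] <;> field_simp
    · rw [hα, hβ, hγ]; ring
    · ring

/-- The matrix `diag(e, n)` is congruent to a multiple of one of the normal forms; in characteristic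
two the coordinate `p` cannot always be removed. -/
theorem exists_hasType_o13 [Fintype F] {e n p : F} (he : e ≠ 0) (hn : n ≠ 0) :
    ∃ t, HasType t (Submodule.span F {(![0, 0, 0, e, 0, n] : Fin 6 → F), ![0, 1, 0, p, 0, 0]}) := by
  obtain ⟨f, hf⟩ : ∃ f, n = -f * e := ⟨-n / e, by field_simp⟩
  have hf0 : f ≠ 0 := by rintro rfl; simp at hf; exact hn hf
  by_cases hfs : IsSquare f
  · obtain ⟨σ, hσ⟩ := hfs
    have hσ0 : σ ≠ 0 := by rintro rfl; simp at hσ; exact hf0 hσ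
    by_cases hp : p = 0 ∨ (2 : F) ≠ 0
    · obtain ⟨c, hc⟩ : ∃ c, p + 2 * c = 0 := by
        rcases hp with hp | hp
        · exact ⟨0, by simp [hp]⟩
        · exact ⟨-p / 2, by field_simp; ring⟩
      refine exists_hasType_of_kEquiv ?_ ⟨_, (TableRow.r13_1 (F := F)).hasType⟩
      refine kEquiv_span_pair !![1, 0, 0; c, 1, 0; 0, 0, 1 / σ] 0 e 1 0 ?_ ?_ ?_ ?_
      · simpa [Matrix.det_fin_three] using hσ0
      · simpa using he
      · refine lift_eq_of_coords ?_ ?_ ?_ ?_ ?_ ?_ <;> simp [bil_eq, toVec]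
        rw [hf, hσ]; field_simp
      · refine lift_eq_of_coords ?_ ?_ ?_ ?_ ?_ ?_ <;> simp [bil_eq, toVec]
        linear_combination hc
    · push Not at hp
      obtain ⟨hp, h2⟩ := hp
      refine exists_hasType_of_kEquiv ?_ ⟨_, (TableRow.r13_3 (F := F) h2).hasType⟩
      refine kEquiv_span_pair !![p, 0, 0; 0, 1, 0; 0, 0, 1 / σ] 0 e p 0 ?_ ?_ ?_ ?_
      · simpa [Matrix.det_fin_three] using ⟨hp, hσ0⟩
      · simpa using ⟨he, hp⟩
      · refine lift_eq_of_coords ?_ ?_ ?_ ?_ ?_ ?_ <;> simp [bil_eq, toVec]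
        rw [hf, hσ]; field_simp
        linear_combination -h2
      · refine lift_eq_of_coords ?_ ?_ ?_ ?_ ?_ ?_ <;> simp [bil_eq, toVec]
  · have h2 := two_ne_zero_of_not_isSquare hfs
    refine exists_hasType_of_kEquiv ?_ ⟨_, (TableRow.r13_2 (F := F) f hfs).hasType⟩
    refine kEquiv_span_pair !![1, 0, 0; -p / 2, 1, 0; 0, 0, 1] 0 e 1 0 ?_ ?_ ?_ ?_
    · simp [Matrix.det_fin_three]
    · simpa using he
    · refine lift_eq_of_coords ?_ ?_ ?_ ?_ ?_ ?_ <;> simp [bil_eq, toVec]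
      rw [hf]; ring
    · refine lift_eq_of_coords ?_ ?_ ?_ ?_ ?_ ?_ <;> simp [bil_eq, toVec]
      field_simp; ring

theorem exists_hasType_o12 {n p : F} :
    ∃ t, HasType t (Submodule.span F {(![0, 0, 0, n, 1, 0] : Fin 6 → F), ![0, 1, 0, p, 0, 0]}) := by
  by_cases h : (2 : F) ≠ 0 ∨ (n = 0 ∧ p = 0)
  · obtain ⟨c, d, hc, hd⟩ : ∃ c d, p + 2 * c = 0 ∧ n + 2 * d = 0 := by
      rcases h with h | ⟨h1, h2⟩
      · exact ⟨-p / 2, -n / 2, by field_simp; ring, by field_simp; ring⟩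
      · exact ⟨0, 0, by simp [h2], by simp [h1]⟩
    refine exists_hasType_of_kEquiv ?_ ⟨_, (TableRow.r12_1 (F := F)).hasType⟩
    refine kEquiv_span_pair !![1, 0, 0; c, 1, d; 0, 0, 1] 0 1 1 0 ?_ ?_ ?_ ?_
    · simp [Matrix.det_fin_three]
    · simp
    · refine lift_eq_of_coords ?_ ?_ ?_ ?_ ?_ ?_ <;> simp [bil_eq, toVec]
      linear_combination hd
    · refine lift_eq_of_coords ?_ ?_ ?_ ?_ ?_ ?_ <;> simp [bil_eq, toVec]
      linear_combination hc
  · push Not at h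
    obtain ⟨h2, hnp⟩ := h
    refine exists_hasType_of_kEquiv ?_ ⟨_, (TableRow.r12_3 (F := F) h2).hasType⟩
    by_cases hp : p = 0
    · have hn : n ≠ 0 := fun hn => hnp hn hp
      refine kEquiv_span_pair !![-1, 0, n; 0, 1, 0; 1, 0, 0] n 0 (-1) 1 ?_ ?_ ?_ ?_
      · simpa [Matrix.det_fin_three] using hn
      · simpa using hn
      · refine lift_eq_of_coords ?_ ?_ ?_ ?_ ?_ ?_ <;> simp [bil_eq, toVec]
      · refine lift_eq_of_coords ?_ ?_ ?_ ?_ ?_ ?_ <;> simp [bil_eq, toVec, hp]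
    · refine kEquiv_span_pair !![p, 0, n - 1; 0, 1, 0; 0, 0, 1] (n - 1) 1 p 0 ?_ ?_ ?_ ?_
      · simpa [Matrix.det_fin_three] using hp
      · simpa using hp
      · refine lift_eq_of_coords ?_ ?_ ?_ ?_ ?_ ?_ <;> simp [bil_eq, toVec]
      · refine lift_eq_of_coords ?_ ?_ ?_ ?_ ?_ ?_ <;> simp [bil_eq, toVec]

theorem exists_hasType_o16 {n : F} :
    ∃ t, HasType t (Submodule.span F {(![0, 0, 0, n, 1, 0] : Fin 6 → F), ![0, 1, 0, 0, 0, 1]}) := by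
  by_cases h : (2 : F) ≠ 0 ∨ n = 0
  · obtain ⟨c, d, hc, hd⟩ : ∃ c d, n + 2 * c = 0 ∧ c ^ 2 + 2 * d = 0 := by
      rcases h with h | h
      · exact ⟨-n / 2, -(-n / 2) ^ 2 / 2, by field_simp; ring, by field_simp; ring⟩
      · exact ⟨0, 0, by simp [h], by simp⟩
    refine exists_hasType_of_kEquiv ?_ ⟨_, (TableRow.r16_1 (F := F)).hasType⟩
    refine kEquiv_span_pair !![1, 0, 0; -c, 0, 1; d, 1, c] 0 1 1 0 ?_ ?_ ?_ ?_
    · simp [Matrix.det_fin_three]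
    · simp
    · refine lift_eq_of_coords ?_ ?_ ?_ ?_ ?_ ?_ <;> simp [bil_eq, toVec]
      linear_combination hc
    · refine lift_eq_of_coords ?_ ?_ ?_ ?_ ?_ ?_ <;> simp [bil_eq, toVec]
      linear_combination hd
  · push Not at h
    obtain ⟨h2, hn⟩ := h
    refine exists_hasType_of_kEquiv ?_ ⟨_, (TableRow.r16_3 (F := F) h2).hasType⟩
    refine kEquiv_span_pair !![n, 0, 0; 0, 0, 1; 0, 1 / n, 0] 0 (1 / n) 1 0 ?_ ?_ ?_ ?_
    · simpa [Matrix.det_fin_three] using hn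
    · simpa using hn
    · refine lift_eq_of_coords ?_ ?_ ?_ ?_ ?_ ?_ <;> simp [bil_eq, toVec]
      field_simp
    · refine lift_eq_of_coords ?_ ?_ ?_ ?_ ?_ ?_ <;> simp [bil_eq, toVec, hn]

/-- The coordinate `p` can be removed, in characteristic two by means of a square root. -/
theorem exists_hasType_o16_general [Fintype F] {n p s : F} (hs : s ≠ 0) :
    ∃ t, HasType t (Submodule.span F {(![0, 0, 0, n, 1, 0] : Fin 6 → F), ![0, 1, 0, p, 0, s]}) := by
  refine exists_hasType_of_kEquiv ?_ (exists_hasType_o16 (n := n))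
  by_cases hn : n = 0
  · obtain ⟨c, d, hcd, hc⟩ : ∃ c d, p + c ^ 2 * s + 2 * d = 0 ∧ 2 * c = 0 := by
      by_cases h2 : (2 : F) = 0
      · obtain ⟨c, hc⟩ := isSquare_of_two_eq_zero h2 (-p / s)
        refine ⟨c, 0, ?_, by simp [h2]⟩
        rw [sq, ← hc]; field_simp; ring
      · exact ⟨0, -p / 2, by field_simp; ring, by simp⟩
    refine kEquiv_span_pair !![s, 0, 0; d, 1, c; -(c * s), 0, 1] 1 0 0 s ?_ ?_ ?_ ?_
    · simpa [Matrix.det_fin_three] using hs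
    · simpa using hs
    · refine lift_eq_of_coords ?_ ?_ ?_ ?_ ?_ ?_ <;> simp [bil_eq, hn]
      linear_combination hc
    · refine lift_eq_of_coords ?_ ?_ ?_ ?_ ?_ ?_ <;> simp [bil_eq]
      · linear_combination hcd
      · ring
  · refine kEquiv_span_pair !![s, 0, 0; 0, 1, 0; p / n, 0, 1] 1 0 (p / n) s ?_ ?_ ?_ ?_
    · simpa [Matrix.det_fin_three] using hs
    · simpa using hs
    · refine lift_eq_of_coords ?_ ?_ ?_ ?_ ?_ ?_ <;> simp [bil_eq]
    · refine lift_eq_of_coords ?_ ?_ ?_ ?_ ?_ ?_ <;> simp [bil_eq]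
      field_simp

/-- Lines with a point of rank two and isotropic kernel spanned by `e₀`. -/
theorem exists_hasType_isotropic [Fintype F] {n₁ n₂ n₃ b₁ b₂ p r s : F}
    (h : ∀ x y : F, MinorsVanish (x • (![0, 0, 0, n₁, n₂, n₃] : Fin 6 → F)
      + y • ![0, b₁, b₂, p, r, s]) → x = 0 ∧ y = 0) :
    ∃ t, HasType t (Submodule.span F {(![0, 0, 0, n₁, n₂, n₃] : Fin 6 → F),
      ![0, b₁, b₂, p, r, s]}) := by
  by_cases hb : b₁ = 0 ∧ b₂ = 0
  · obtain ⟨rfl, rfl⟩ := hb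
    refine exists_hasType_pencil fun x y hxy => h x y ?_
    simpa [MinorsVanish] using hxy
  have hN : n₁ * n₃ - n₂ ^ 2 ≠ 0 := fun h0 => one_ne_zero (h 1 0 (by
    simp [MinorsVanish]; linear_combination h0)).1
  -- transform `b` into `(1, 0)`
  obtain ⟨α, β, γ, δ, hd, h1, h2⟩ : ∃ α β γ δ : F, α * δ - β * γ ≠ 0 ∧ α * b₁ + β * b₂ = 1 ∧
      γ * b₁ + δ * b₂ = 0 := by
    by_cases hb1 : b₁ = 0
    · have hb2 : b₂ ≠ 0 := fun h => hb ⟨hb1, h⟩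
      exact ⟨0, 1 / b₂, 1, 0, by simpa using hb2, by field_simp; ring, by simp [hb1]⟩
    · exact ⟨1 / b₁, 0, -b₂, b₁, by simp [hb1], by field_simp; ring, by ring⟩
  refine exists_hasType_of_kEquiv (kEquiv_block hd _ _) ?_
  rw [lift_block, lift_block]
  obtain ⟨m₁, hm₁⟩ : ∃ m, m = n₁ * α ^ 2 + 2 * n₂ * (α * β) + n₃ * β ^ 2 := ⟨_, rfl⟩
  obtain ⟨m₂, hm₂⟩ : ∃ m, m = n₁ * (α * γ) + n₂ * (α * δ + β * γ) + n₃ * (β * δ) := ⟨_, rfl⟩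
  obtain ⟨m₃, hm₃⟩ : ∃ m, m = n₁ * γ ^ 2 + 2 * n₂ * (γ * δ) + n₃ * δ ^ 2 := ⟨_, rfl⟩
  have hM : m₁ * m₃ - m₂ ^ 2 ≠ 0 := by
    have : m₁ * m₃ - m₂ ^ 2 = (α * δ - β * γ) ^ 2 * (n₁ * n₃ - n₂ ^ 2) := by
      rw [hm₁, hm₂, hm₃]; ring
    rw [this]; exact mul_ne_zero (pow_ne_zero 2 hd) hN
  obtain ⟨p', hp'⟩ : ∃ m, m = p * α ^ 2 + 2 * r * (α * β) + s * β ^ 2 := ⟨_, rfl⟩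
  obtain ⟨r', hr'⟩ : ∃ m, m = p * (α * γ) + r * (α * δ + β * γ) + s * (β * δ) := ⟨_, rfl⟩
  obtain ⟨s', hs'⟩ : ∃ m, m = p * γ ^ 2 + 2 * r * (γ * δ) + s * δ ^ 2 := ⟨_, rfl⟩
  simp only [Matrix.cons_val, ← hm₁, ← hm₂, ← hm₃, ← hp', ← hr', ← hs', h1, h2, mul_zero, add_zero]
  clear hm₁ hm₂ hm₃ hp' hr' hs' h1 h2 hd h hN hb
  by_cases h3 : m₃ = 0
  · have hm2 : m₂ ≠ 0 := by rintro rfl; simp [h3] at hM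
    have hK : KEquiv (Submodule.span F {(![0, 0, 0, m₁, m₂, m₃] : Fin 6 → F),
        ![0, 1, 0, p', r', s']}) (Submodule.span F {(![0, 0, 0, m₁ / m₂, 1, 0] : Fin 6 → F),
        ![0, 1, 0, p', 0, s']}) := by
      refine kEquiv_span_pair !![1, 0, 0; 0, 1, 0; -r', 0, 1] m₂ 0 0 1 ?_ ?_ ?_ ?_
      · simp [Matrix.det_fin_three]
      · simpa using hm2
      · refine lift_eq_of_coords ?_ ?_ ?_ ?_ ?_ ?_ <;> simp [bil_eq, h3]
        field_simp
      · refine lift_eq_of_coords ?_ ?_ ?_ ?_ ?_ ?_ <;> simp [bil_eq]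
    refine exists_hasType_of_kEquiv hK ?_
    by_cases hs : s' = 0
    · rw [hs]; exact exists_hasType_o12
    · exact exists_hasType_o16_general hs
  · refine exists_hasType_of_kEquiv ?_ (exists_hasType_o13
      (e := m₁ - m₂ ^ 2 / m₃) (n := m₃)
      (p := p' - 2 * r' * m₂ / m₃ + s' * m₂ ^ 2 / m₃ ^ 2 - s' / m₃ * (m₁ - m₂ ^ 2 / m₃)) ?_ h3)
    · refine kEquiv_span_pair !![1, 0, 0; 0, 1, -m₂ / m₃; -r' + s' * m₂ / m₃, 0, 1]
        1 0 (s' / m₃) 1 ?_ ?_ ?_ ?_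
      · simp [Matrix.det_fin_three]
      · simp
      · refine lift_eq_of_coords ?_ ?_ ?_ ?_ ?_ ?_ <;> simp [bil_eq] <;> field_simp <;> ring
      · refine lift_eq_of_coords ?_ ?_ ?_ ?_ ?_ ?_ <;> simp [bil_eq] <;> field_simp <;> ring
    · rw [sub_ne_zero]; intro h0; apply hM; rw [h0]; field_simp; ring

/-! ### Lines with singular points, none of which has a kernel isotropic for the whole line -/

/-- Pencils of diagonal matrices, up to permutations of the coordinates. -/
theorem exists_hasType_diagonal_of_isSquare {u w : F} (hu : u ≠ 0) (h : ∃ g, g ≠ 0 ∧ u * w = g ^ 2)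
    :
    ∃ t, HasType t (Submodule.span F {(![1, 0, 0, u, 0, 0] : Fin 6 → F), ![0, 0, 0, w, 0, 1]}) := by
  obtain ⟨g, hg0, hg⟩ := h
  have hw : w = g ^ 2 / u := by field_simp; linear_combination hg
  by_cases hs : IsSquare (-u)
  · obtain ⟨k, hk⟩ := hs
    have hk0 : k ≠ 0 := by rintro rfl; simp at hk; exact hu hk
    have hu' : u = -(k * k) := by rw [← hk, neg_neg]
    refine exists_hasType_of_kEquiv ?_ ⟨_, (TableRow.r14_1 (F := F)).hasType⟩
    refine kEquiv_span_pair !![1, 0, 0; 0, 1 / k, 0; 0, 0, g / u] 1 0 0 (g ^ 2 / u ^ 2) ?_ ?_ ?_ ?_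
    · simpa [Matrix.det_fin_three] using ⟨hk0, hg0, hu⟩
    · simpa using ⟨hg0, hu⟩
    · refine lift_eq_of_coords ?_ ?_ ?_ ?_ ?_ ?_ <;> simp [bil_eq, toVec]
      rw [hu']; field_simp
    · refine lift_eq_of_coords ?_ ?_ ?_ ?_ ?_ ?_ <;> simp [bil_eq, toVec] <;> (try rw [hw, hu']) <;> field_simp
  · refine exists_hasType_of_kEquiv ?_ ⟨_, (TableRow.r14_2 (F := F) _ hs).hasType⟩
    refine kEquiv_span_pair !![1, 0, 0; 0, 1, 0; 0, 0, g / u] 1 0 0 (g ^ 2 / u ^ 2) ?_ ?_ ?_ ?_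
    · simpa [Matrix.det_fin_three] using ⟨hg0, hu⟩
    · simpa using ⟨hg0, hu⟩
    · refine lift_eq_of_coords ?_ ?_ ?_ ?_ ?_ ?_ <;> simp [bil_eq, toVec]
    · refine lift_eq_of_coords ?_ ?_ ?_ ?_ ?_ ?_ <;> simp [bil_eq, toVec] <;> (try rw [hw]) <;> field_simp

/-- Two of the three coefficients of the relation between the diagonal entries agree up to
squares. -/
theorem exists_hasType_diagonal [Fintype F] {u w : F} (hu : u ≠ 0) (hw : w ≠ 0) :
    ∃ t, HasType t (Submodule.span F {(![1, 0, 0, u, 0, 0] : Fin 6 → F), ![0, 0, 0, w, 0, 1]}) := by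
  have swap : ∀ u w : F, u ≠ 0 → KEquiv
      (Submodule.span F {(![1, 0, 0, u, 0, 0] : Fin 6 → F), ![0, 0, 0, w, 0, 1]})
      (Submodule.span F {(![1, 0, 0, 1 / u, 0, 0] : Fin 6 → F), ![0, 0, 0, -w / u, 0, 1]}) := by
    intro u w hu
    refine kEquiv_span_pair !![0, 1, 0; 1, 0, 0; 0, 0, 1] u 0 w 1 ?_ ?_ ?_ ?_
    · simp [Matrix.det_fin_three]
    · simpa using hu
    · refine lift_eq_of_coords ?_ ?_ ?_ ?_ ?_ ?_ <;> simp [bil_eq, hu]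
    · refine lift_eq_of_coords ?_ ?_ ?_ ?_ ?_ ?_ <;> simp [bil_eq]
      field_simp; ring
  have flip : KEquiv
      (Submodule.span F {(![1, 0, 0, u, 0, 0] : Fin 6 → F), ![0, 0, 0, w, 0, 1]})
      (Submodule.span F {(![1, 0, 0, w, 0, 0] : Fin 6 → F), ![0, 0, 0, u, 0, 1]}) := by
    refine kEquiv_span_pair !![0, 0, 1; 0, 1, 0; 1, 0, 0] 0 1 1 0 ?_ ?_ ?_ ?_
    · simp [Matrix.det_fin_three]
    · simp
    · refine lift_eq_of_coords ?_ ?_ ?_ ?_ ?_ ?_ <;> simp [bil_eq]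
    · refine lift_eq_of_coords ?_ ?_ ?_ ?_ ?_ ?_ <;> simp [bil_eq]
  have key : ∀ u w : F, u ≠ 0 → w ≠ 0 → IsSquare (-w) →
      ∃ g, g ≠ 0 ∧ 1 / u * (-w / u) = g ^ 2 := by
    rintro u w hu hw ⟨k, hk⟩
    refine ⟨k / u, div_ne_zero ?_ hu, by rw [hk]; field_simp⟩
    rintro rfl; simp at hk; exact hw hk
  by_cases h1 : IsSquare (u * w)
  · obtain ⟨g, hg⟩ := h1
    refine exists_hasType_diagonal_of_isSquare hu ⟨g, ?_, by rw [hg, sq]⟩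
    rintro rfl; simp at hg; exact hg.elim hu hw
  by_cases h2 : IsSquare (-w)
  · exact exists_hasType_of_kEquiv (swap u w hu)
      (exists_hasType_diagonal_of_isSquare (one_div_ne_zero hu) (key u w hu hw h2))
  by_cases h3 : IsSquare (-u)
  · exact exists_hasType_of_kEquiv (flip.trans (swap w u hw))
      (exists_hasType_diagonal_of_isSquare (one_div_ne_zero hw) (key w u hw hu h3))
  · exact absurd (by simpa [mul_comm] using isSquare_mul_of_not_isSquare h2 h3) h1

/-- Lines with exactly one singular point, whose kernel is not isotropic. -/
theorem exists_hasType_o15 {v a c : F} (hc : c ≠ 0) (hv : QuadCond a v) :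
    ∃ t, HasType t (Submodule.span F {(![0, 0, 0, v, 0, 1] : Fin 6 → F), ![c, 0, 0, 0, 1, a]}) := by
  have hq : QuadCond (a / c) (v * c ^ 2) := ⟨mul_ne_zero hv.1 (pow_ne_zero 2 hc), fun t ht =>
    hv.2 (c * t) (by field_simp at ht; linear_combination ht)⟩
  have hK : KEquiv (Submodule.span F {(![0, 0, 0, v, 0, 1] : Fin 6 → F), ![c, 0, 0, 0, 1, a]})
      (lineOf fun x y : F => !![v * c ^ 2 * y, x, 0; x, a / c * x + y, 0; 0, 0, x]) := by
    refine kEquiv_span_pair !![0, c, 0; 0, 0, 1; 1, 0, 0] 0 1 c 0 ?_ ?_ ?_ ?_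
    · simpa [Matrix.det_fin_three] using hc
    · simpa using hc
    · refine lift_eq_of_coords ?_ ?_ ?_ ?_ ?_ ?_ <;> simp [bil_eq, toVec]
      exact Or.inl (by ring)
    · refine lift_eq_of_coords ?_ ?_ ?_ ?_ ?_ ?_ <;> simp [bil_eq, toVec]
      field_simp
  by_cases hs : IsSquare (-(v * c ^ 2))
  · exact exists_hasType_of_kEquiv hK ⟨_, (TableRow.r15_1 _ _ hq hs).hasType⟩
  · exact exists_hasType_of_kEquiv hK ⟨_, (TableRow.r15_2 _ _ hq hs).hasType⟩

/-- Lines with at least two singular points, whose kernels are not isotropic: the two matrices can be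
diagonalized simultaneously. -/
theorem exists_hasType_o14 [Fintype F] {n₁ n₂ n₃ p r s : F}
    (hN : n₁ * n₃ - n₂ ^ 2 ≠ 0) (hP : ¬ (p = 0 ∧ r = 0 ∧ s = 0)) (hs : p * s = r ^ 2)
    (hiso : ¬ HasIsotropicKernel (Submodule.span F {(![0, 0, 0, n₁, n₂, n₃] : Fin 6 → F),
      ![1, 0, 0, p, r, s]})) :
    ∃ t, HasType t (Submodule.span F {(![0, 0, 0, n₁, n₂, n₃] : Fin 6 → F),
      ![1, 0, 0, p, r, s]}) := by
  obtain ⟨α, β, γ, δ, k₁, k₂, k₃, hd, e1, e2, e3, hk⟩ := exists_binary_normalForm hP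
  have hK := kEquiv_block hd (![0, 0, 0, n₁, n₂, n₃] : Fin 6 → F) ![1, 0, 0, p, r, s]
  refine exists_hasType_of_kEquiv hK ?_
  have hiso' := fun h => hiso (HasIsotropicKernel.of_kEquiv h hK.symm)
  rw [lift_block, lift_block] at hiso' ⊢
  simp only [Matrix.cons_val, e1, e2, e3, mul_zero, add_zero] at hiso' ⊢
  have hkd : k₁ * k₃ - k₂ ^ 2 = 0 := by
    rw [← e1, ← e2, ← e3]
    linear_combination (α * δ - β * γ) ^ 2 * hs
  obtain ⟨hk1, rfl, rfl⟩ : k₁ ≠ 0 ∧ k₂ = 0 ∧ k₃ = 0 := by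
    rcases hk with h | ⟨h1, rfl, rfl⟩ | ⟨d, hd, h1, rfl, rfl⟩ | ⟨-, rfl, h2, rfl⟩
    · exact h
    · exact absurd (by linear_combination -hkd) (mul_ne_zero h1 h1)
    · exact absurd (by linear_combination -hkd)
        (mul_ne_zero (ne_zero_of_not_isSquare hd) (mul_ne_zero h1 h1))
    · exact absurd (by linear_combination -hkd) (mul_ne_zero h2 h2)
  obtain ⟨m₁, hm₁⟩ : ∃ m, m = n₁ * α ^ 2 + 2 * n₂ * (α * β) + n₃ * β ^ 2 := ⟨_, rfl⟩
  obtain ⟨m₂, hm₂⟩ : ∃ m, m = n₁ * (α * γ) + n₂ * (α * δ + β * γ) + n₃ * (β * δ) := ⟨_, rfl⟩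
  obtain ⟨m₃, hm₃⟩ : ∃ m, m = n₁ * γ ^ 2 + 2 * n₂ * (γ * δ) + n₃ * δ ^ 2 := ⟨_, rfl⟩
  have hM : m₁ * m₃ - m₂ ^ 2 ≠ 0 := by
    have : m₁ * m₃ - m₂ ^ 2 = (α * δ - β * γ) ^ 2 * (n₁ * n₃ - n₂ ^ 2) := by
      rw [hm₁, hm₂, hm₃]; ring
    rw [this]; exact mul_ne_zero (pow_ne_zero 2 hd) hN
  rw [← hm₁, ← hm₂, ← hm₃] at hiso' ⊢
  -- otherwise the kernel of the second matrix is isotropic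
  have h3 : m₃ ≠ 0 := by
    rintro rfl
    refine hiso' ⟨![1, 0, 0, k₁, 0, 0], Submodule.subset_span (by simp),
      fun h => by simpa using congrFun h 0, ![0, 0, 1], fun h => by simpa using congrFun h 2, ?_, ?_⟩
    · rw [mem_kerSpace_coords]; simp
    · rw [forall_mem_span_pair_bil]; simp [bil_eq]
  refine exists_hasType_of_kEquiv ?_ (exists_hasType_diagonal (u := k₁)
    (w := (m₁ - m₂ ^ 2 / m₃) / m₃) hk1 ?_)
  · refine kEquiv_span_pair !![1, 0, 0; 0, 1, -m₂ / m₃; 0, 0, 1] 0 m₃ 1 0 ?_ ?_ ?_ ?_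
    · simp [Matrix.det_fin_three]
    · simpa using h3
    · refine lift_eq_of_coords ?_ ?_ ?_ ?_ ?_ ?_ <;> simp [bil_eq] <;> field_simp <;> ring
    · refine lift_eq_of_coords ?_ ?_ ?_ ?_ ?_ ?_ <;> simp [bil_eq]
  · refine div_ne_zero ?_ h3
    rw [sub_ne_zero]; intro h0; apply hM; rw [h0]; field_simp; ring

/-- Lines with a single singular point whose kernel is not isotropic: after normalizing the singular
matrix, the remaining binary quadratic polynomial without zeros gives the parameters of `o15`. -/
theorem exists_hasType_of_det_ne_zero [Fintype F] {n₁ n₂ n₃ p r s : F}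
    (hN : n₁ * n₃ - n₂ ^ 2 ≠ 0)
    (h : ∀ t, (p + t * n₁) * (s + t * n₃) - (r + t * n₂) ^ 2 ≠ 0) :
    ∃ t, HasType t (Submodule.span F {(![0, 0, 0, n₁, n₂, n₃] : Fin 6 → F),
      ![1, 0, 0, p, r, s]}) := by
  obtain ⟨α, β, γ, δ, m₁, m₂, m₃, hd, e1, e2, e3, hm⟩ := exists_binary_normalForm
    (n₁ := n₁) (n₂ := n₂) (n₃ := n₃) (by rintro ⟨rfl, rfl, rfl⟩; simp at hN)
  refine exists_hasType_of_kEquiv (kEquiv_block hd _ _) ?_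
  rw [lift_block, lift_block]
  simp only [Matrix.cons_val, e1, e2, e3, mul_zero, add_zero]
  obtain ⟨p', hp'⟩ : ∃ m, m = p * α ^ 2 + 2 * r * (α * β) + s * β ^ 2 := ⟨_, rfl⟩
  obtain ⟨r', hr'⟩ : ∃ m, m = p * (α * γ) + r * (α * δ + β * γ) + s * (β * δ) := ⟨_, rfl⟩
  obtain ⟨s', hs'⟩ : ∃ m, m = p * γ ^ 2 + 2 * r * (γ * δ) + s * δ ^ 2 := ⟨_, rfl⟩
  have h' : ∀ t, (p' + t * m₁) * (s' + t * m₃) - (r' + t * m₂) ^ 2 ≠ 0 := by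
    intro t
    have : (p' + t * m₁) * (s' + t * m₃) - (r' + t * m₂) ^ 2
        = (α * δ - β * γ) ^ 2 * ((p + t * n₁) * (s + t * n₃) - (r + t * n₂) ^ 2) := by
      rw [hp', hr', hs', ← e1, ← e2, ← e3]; ring
    rw [this]; exact mul_ne_zero (pow_ne_zero 2 hd) (h t)
  have hM : m₁ * m₃ - m₂ ^ 2 ≠ 0 := by
    have : m₁ * m₃ - m₂ ^ 2 = (α * δ - β * γ) ^ 2 * (n₁ * n₃ - n₂ ^ 2) := by
      rw [← e1, ← e2, ← e3]; ring
    rw [this]; exact mul_ne_zero (pow_ne_zero 2 hd) hN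
  rw [← hp', ← hr', ← hs']
  clear e1 e2 e3 hp' hr' hs' h hN hd
  by_cases hm2 : m₂ = 0
  · subst hm2
    have h1 : m₁ ≠ 0 := by rintro rfl; simp at hM
    have h3 : m₃ ≠ 0 := by rintro rfl; simp at hM
    have hr : r' ≠ 0 := by
      rintro rfl
      exact h' (-p' / m₁) (by field_simp; ring)
    have hq : QuadCond ((s' - p' * m₃ / m₁) / r') (m₁ / m₃) := by
      refine ⟨div_ne_zero h1 h3, fun t ht => h' (r' * t / m₃ - p' / m₁) ?_⟩
      field_simp at ht
      have : (p' + (r' * t / m₃ - p' / m₁) * m₁) * (s' + (r' * t / m₃ - p' / m₁) * m₃)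
          - (r' + (r' * t / m₃ - p' / m₁) * 0) ^ 2
          = r' * (t * (m₁ * t * r' + (m₁ * s' - m₃ * p')) - m₃ * r') / m₃ := by
        field_simp
        ring
      rw [this, ht]; ring
    refine exists_hasType_of_kEquiv ?_ (exists_hasType_o15 (one_div_ne_zero hr) hq)
    refine kEquiv_span_pair 1 m₃ 0 (p' * m₃ / m₁) r' ?_ ?_ ?_ ?_
    · simp
    · simpa using ⟨h3, hr⟩
    · rw [lift_one]
      ext i; fin_cases i <;> simp
      field_simp
    · rw [lift_one]
      ext i; fin_cases i <;> simp <;> field_simp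
      ring
  · -- an alternating matrix in characteristic two, where every element is a square
    obtain ⟨h2, rfl, -, rfl⟩ : (2 : F) = 0 ∧ m₁ = 0 ∧ m₂ ≠ 0 ∧ m₃ = 0 := by
      rcases hm with h | h | ⟨d, -, h⟩ | h
      · exact absurd h.2.1 hm2
      · exact absurd h.2.1 hm2
      · exact absurd h.2.1 hm2
      · exact h
    obtain ⟨g, hg⟩ := isSquare_of_two_eq_zero h2 (p' * s')
    refine absurd ?_ (h' ((g - r') / m₂))
    rw [div_mul_cancel₀ _ hm2]
    linear_combination hg

/-- Lines without points of rank one, spanned by a matrix with kernel vector `e₀` and a block diagonal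
matrix for which `e₀` is not isotropic. -/
theorem exists_hasType_not_isotropic [Fintype F] {n₁ n₂ n₃ p r s : F}
    (hr : ∀ x y : F, MinorsVanish (x • (![0, 0, 0, n₁, n₂, n₃] : Fin 6 → F)
      + y • ![1, 0, 0, p, r, s]) → x = 0 ∧ y = 0)
    (hiso : ¬ HasIsotropicKernel (Submodule.span F {(![0, 0, 0, n₁, n₂, n₃] : Fin 6 → F),
      ![1, 0, 0, p, r, s]})) :
    ∃ t, HasType t (Submodule.span F {(![0, 0, 0, n₁, n₂, n₃] : Fin 6 → F),
      ![1, 0, 0, p, r, s]}) := by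
  have hN : n₁ * n₃ - n₂ ^ 2 ≠ 0 := fun h0 => one_ne_zero (hr 1 0 (by
    simp [MinorsVanish]; linear_combination h0)).1
  by_cases h : ∀ t, (p + t * n₁) * (s + t * n₃) - (r + t * n₂) ^ 2 ≠ 0
  · exact exists_hasType_of_det_ne_zero hN h
  push Not at h
  obtain ⟨t, ht⟩ := h
  have hspan : Submodule.span F {(![0, 0, 0, n₁, n₂, n₃] : Fin 6 → F), ![1, 0, 0, p, r, s]}
      = Submodule.span F {(![0, 0, 0, n₁, n₂, n₃] : Fin 6 → F),
        ![1, 0, 0, p + t * n₁, r + t * n₂, s + t * n₃]} :=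
    span_pair_eq (p := 1) (q := 0) (r := -t) (s := 1) (by simp)
      (by ext i; fin_cases i <;> simp) (by simp)
  rw [hspan] at hiso ⊢
  refine exists_hasType_o14 hN ?_ (by linear_combination ht) hiso
  rintro ⟨h1, h2, h3⟩
  exact one_ne_zero (hr t 1 (by
    simp [MinorsVanish, add_comm (t * n₁), add_comm (t * n₂), add_comm (t * n₃), h1, h2, h3])).2

theorem minorsVanish_lift (A : GL (Fin 3) F) {y : Fin 6 → F} (h : MinorsVanish (lift A.1 y)) :
    MinorsVanish y := by
  by_cases hy : y = 0
  · simp [hy, MinorsVanish]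
  have hy' : lift A.1 y ≠ 0 := fun h => hy (lift_injective A (by rw [h, map_zero]))
  obtain ⟨k, u, hk, hu, h⟩ := (minorsVanish_iff hy').1 h
  refine (minorsVanish_iff hy).2 ⟨k, (A⁻¹ : GL (Fin 3) F).1.mulVec u, hk, ?_, ?_⟩
  · intro h0
    apply hu
    have := congrArg (A.1.mulVec) h0
    rwa [Matrix.mulVec_mulVec, ← Units.val_mul, mul_inv_cancel, Units.val_one, Matrix.one_mulVec,
      Matrix.mulVec_zero] at this
  · rw [← lift_inv_lift A y, h, map_smul, lift_veronese]

/-- Every line belongs to one of the orbits. -/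
theorem exists_hasType [Fintype F] {L : Submodule F (Fin 6 → F)} (hL : IsLine L) :
    ∃ t, HasType t L := by
  by_cases h1 : ∃ y ∈ L, y ≠ 0 ∧ MinorsVanish y
  · obtain ⟨y, hy, hy0, hr⟩ := h1
    exact exists_hasType_of_rank_one hL hy hy0 hr
  by_cases h2 : ∀ y ∈ L, detVec y = 0 → y = 0
  · obtain ⟨a, b, c, h⟩ := exists_cubic (F := F)
    exact exists_hasType_of_kEquiv
      (IsNonsingularLine.kEquiv ⟨hL, h2⟩ (profile_o17 h).isNonsingularLine)
      ⟨_, (TableRow.r17 a b c h).hasType⟩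
  push Not at h1
  -- a kernel vector of a singular point, isotropic if possible, becomes the first basis vector
  obtain ⟨y, hy, hy0, k, hk, hyk, hiso⟩ : ∃ y ∈ L, y ≠ 0 ∧ ∃ k : Fin 3 → F, k ≠ 0 ∧ y ∈ kerSpace k ∧
      (HasIsotropicKernel L → ∀ z ∈ L, bil z k k = 0) := by
    by_cases hiso : HasIsotropicKernel L
    · obtain ⟨y, hy, hy0, k, hk, hyk, h⟩ := hiso
      exact ⟨y, hy, hy0, k, hk, hyk, fun _ => h⟩
    · push Not at h2
      obtain ⟨y, hy, hd, hy0⟩ := h2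
      rw [← det_toMat] at hd
      obtain ⟨k, hk, h⟩ := Matrix.exists_mulVec_eq_zero_iff.2 hd
      exact ⟨y, hy, hy0, k, hk, mem_kerSpace_iff_mulVec.2 h, fun h => absurd h hiso⟩
  obtain ⟨A, hA⟩ := exists_GL_transpose_of_ne_zero hk
  have hK : KEquiv L (L.map (lift A.1)) := ⟨A, rfl⟩
  refine exists_hasType_of_kEquiv hK ?_
  have hM := hL.map A
  have h1' : ∀ x ∈ L.map (lift A.1), MinorsVanish x → x = 0 := by
    rintro _ ⟨x, hx, rfl⟩ h
    by_contra h0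
    exact h1 x hx (fun h => h0 (by rw [h, map_zero])) (minorsVanish_lift A h)
  have hiso' : HasIsotropicKernel (L.map (lift A.1)) → ∀ z ∈ L.map (lift A.1), z 0 = 0 := by
    rintro h _ ⟨z, hz, rfl⟩
    have := hiso (h.of_kEquiv hK.symm) z hz
    rw [← hA, ← bil_lift] at this
    simpa [bil_eq] using this
  have hyM : lift A.1 y ∈ L.map (lift A.1) := ⟨y, hy, rfl⟩
  have hyM0 : lift A.1 y ≠ 0 := fun h => hy0 (lift_injective A (by rw [h, map_zero]))
  have hyk' : lift A.1 y ∈ kerSpace (Pi.single 0 1 : Fin 3 → F) :=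
    (lift_mem_kerSpace_iff A _ _).2 (by rwa [hA])
  rw [kerSpace_single] at hyk'
  generalize L.map (lift A.1) = M at *
  generalize lift A.1 y = w at *
  obtain ⟨z, hwz, rfl⟩ := hM.exists_eq_span_of_mem hyM hyM0
  obtain ⟨n₁, n₂, n₃, rfl⟩ : ∃ n₁ n₂ n₃, w = ![0, 0, 0, n₁, n₂, n₃] :=
    ⟨w 3, w 4, w 5, by ext i; fin_cases i <;> simp [hyk']⟩
  obtain ⟨c, b₁, b₂, p, r, s, rfl⟩ : ∃ c b₁ b₂ p r s, z = ![c, b₁, b₂, p, r, s] :=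
    ⟨z 0, z 1, z 2, z 3, z 4, z 5, by ext i; fin_cases i <;> simp⟩
  have hpair : ∀ x y : F, MinorsVanish (x • (![0, 0, 0, n₁, n₂, n₃] : Fin 6 → F)
      + y • ![c, b₁, b₂, p, r, s]) → x = 0 ∧ y = 0 := fun x y h =>
    LinearIndependent.pair_iff.1 hwz x y (h1' _ (Submodule.mem_span_pair.2 ⟨x, y, rfl⟩) h)
  by_cases hc : c = 0
  · subst hc
    exact exists_hasType_isotropic hpair
  have hK' : KEquiv (Submodule.span F {(![0, 0, 0, n₁, n₂, n₃] : Fin 6 → F),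
      ![c, b₁, b₂, p, r, s]}) (Submodule.span F {(![0, 0, 0, n₁, n₂, n₃] : Fin 6 → F),
      ![1, 0, 0, (p - b₁ ^ 2 / c) / c, (r - b₁ * b₂ / c) / c, (s - b₂ ^ 2 / c) / c]}) := by
    refine kEquiv_span_pair !![1, 0, 0; -b₁ / c, 1, 0; -b₂ / c, 0, 1] 1 0 0 c ?_ ?_ ?_ ?_
    · simp [Matrix.det_fin_three]
    · simpa using hc
    · refine lift_eq_of_coords ?_ ?_ ?_ ?_ ?_ ?_ <;> simp [bil_eq]
    · refine lift_eq_of_coords ?_ ?_ ?_ ?_ ?_ ?_ <;> simp [bil_eq] <;> field_simp <;> ring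
  refine exists_hasType_of_kEquiv hK' (exists_hasType_not_isotropic ?_ ?_)
  · obtain ⟨B, hB⟩ := hK'
    intro x y h
    have hmem : x • (![0, 0, 0, n₁, n₂, n₃] : Fin 6 → F) + y • ![1, 0, 0, (p - b₁ ^ 2 / c) / c,
        (r - b₁ * b₂ / c) / c, (s - b₂ ^ 2 / c) / c] ∈ Submodule.span F
        {(![0, 0, 0, n₁, n₂, n₃] : Fin 6 → F),
        ![1, 0, 0, (p - b₁ ^ 2 / c) / c, (r - b₁ * b₂ / c) / c, (s - b₂ ^ 2 / c) / c]} :=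
      Submodule.mem_span_pair.2 ⟨x, y, rfl⟩
    rw [hB] at hmem
    obtain ⟨u, hu, hux⟩ := hmem
    rw [← hux] at h
    rw [h1' u hu (minorsVanish_lift B h), map_zero] at hux
    have hy : y = 0 := by simpa using (congrFun hux 0).symm
    refine ⟨?_, hy⟩
    rw [hy, zero_smul, add_zero] at hux
    exact (hpair x 0 (by rw [zero_smul, add_zero, ← hux]; simp [MinorsVanish])).1
  · intro h
    have := hiso' (h.of_kEquiv hK'.symm) _ (Submodule.subset_span (Set.mem_insert_of_mem _ rfl))
    exact hc (by simpa using this)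

/-! ### The conic determined by a point of rank two -/

theorem symProd_eq (v w : Fin 3 → F) :
    symProd v w = veronese (v + w) - veronese v - veronese w := by
  ext i; fin_cases i <;> simp [symProd, veronese] <;> ring

theorem symProd_mem_conicPlane {m : Submodule F (Fin 3 → F)} {v w : Fin 3 → F} (hv : v ∈ m)
    (hw : w ∈ m) : symProd v w ∈ conicPlane m := by
  rw [symProd_eq]
  exact sub_mem (sub_mem (Submodule.subset_span ⟨_, m.add_mem hv hw, rfl⟩)
    (Submodule.subset_span ⟨_, hv, rfl⟩)) (Submodule.subset_span ⟨_, hw, rfl⟩)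

/-- The plane of the conic of the line `a · u = 0` consists of the matrices with kernel
vector `a`. -/
theorem conicPlane_ann {a : Fin 3 → F} (ha : a ≠ 0) : conicPlane (ann (F ∙ a)) = kerSpace a := by
  apply le_antisymm
  · rw [conicPlane, Submodule.span_le]
    rintro _ ⟨v, hv, rfl⟩
    have h := mem_ann_span_singleton.1 hv
    exact mem_kerSpace.2 fun b => by rw [bil_veronese, h, zero_mul]
  · intro y hy
    obtain ⟨v, w, hvw, hv, hw, -⟩ := exists_basis_ann ha
    obtain ⟨r, s, t, rfl⟩ := exists_of_mem_kerSpace ha hvw hv hw hy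
    have hv' := mem_ann_span_singleton.2 hv
    have hw' := mem_ann_span_singleton.2 hw
    exact add_mem (add_mem (Submodule.smul_mem _ _ (Submodule.subset_span ⟨v, hv', rfl⟩))
      (Submodule.smul_mem _ _ (symProd_mem_conicPlane hv' hw')))
      (Submodule.smul_mem _ _ (Submodule.subset_span ⟨w, hw', rfl⟩))

theorem isPlaneLine_iff {m : Submodule F (Fin 3 → F)} :
    IsPlaneLine m ↔ ∃ a : Fin 3 → F, a ≠ 0 ∧ m = ann (F ∙ a) := by
  constructor
  · intro h
    have h1 : Module.finrank F (ann m) = 1 := by rw [finrank_ann, h]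
    obtain ⟨a, ha, h2⟩ := finrank_eq_one_iff'.1 h1
    refine ⟨a.1, fun h => ha (Subtype.ext h), ?_⟩
    have h3 : ann m = F ∙ a.1 := by
      apply le_antisymm
      · intro b hb
        obtain ⟨c, hc⟩ := h2 ⟨b, hb⟩
        exact Submodule.mem_span_singleton.2 ⟨c, congrArg Subtype.val hc⟩
      · rw [Submodule.span_le]; rintro _ rfl; exact a.2
    rw [← h3, ann_ann]
  · rintro ⟨a, ha, rfl⟩
    exact finrank_ann_span_singleton ha

/-- The kernel of a symmetric matrix of rank two is one-dimensional. -/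
theorem mem_span_of_mem_kerSpace {y : Fin 6 → F} (hr : (toMat y).rank = 2) {a b : Fin 3 → F}
    (ha : a ≠ 0) (hya : y ∈ kerSpace a) (hyb : y ∈ kerSpace b) : b ∈ F ∙ a := by
  have h2 := (toMat y).mulVecLin.finrank_range_add_finrank_ker
  rw [Module.finrank_fin_fun, show Module.finrank F (toMat y).mulVecLin.range = 2 from hr] at h2
  have h3 : F ∙ a = LinearMap.ker (toMat y).mulVecLin := by
    apply Submodule.eq_of_le_of_finrank_eq
    · rw [Submodule.span_le]
      rintro _ rfl
      simpa using mem_kerSpace_iff_mulVec.1 hya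
    · rw [finrank_span_singleton ha]; omega
  rw [h3]
  simpa using mem_kerSpace_iff_mulVec.1 hyb

theorem exists_mem_kerSpace {y : Fin 6 → F} (h : detVec y = 0) :
    ∃ a : Fin 3 → F, a ≠ 0 ∧ y ∈ kerSpace a := by
  rw [← det_toMat] at h
  obtain ⟨a, ha, h⟩ := Matrix.exists_mulVec_eq_zero_iff.2 h
  exact ⟨a, ha, mem_kerSpace_iff_mulVec.2 h⟩

theorem detVec_rep_eq_zero {P : ℙ F (Fin 6 → F)} (hP : ptRank P = 2) : detVec P.rep = 0 :=
  ((rank_eq_two_iff P.rep_nonzero).1 hP).1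

/-- The conic of a point of rank two is the image of the line dual to its kernel. -/
theorem isConicOf_iff {P : ℙ F (Fin 6 → F)} (hP : ptRank P = 2) {a : Fin 3 → F} (ha : a ≠ 0)
    (hPa : P.rep ∈ kerSpace a) {m : Submodule F (Fin 3 → F)} :
    IsConicOf P m ↔ m = ann (F ∙ a) := by
  constructor
  · rintro ⟨h1, h2⟩
    obtain ⟨b, hb, rfl⟩ := isPlaneLine_iff.1 h1
    rw [conicPlane_ann hb, submodule_le_iff] at h2
    have h3 := mem_span_of_mem_kerSpace hP hb h2 hPa
    obtain ⟨c, rfl⟩ := Submodule.mem_span_singleton.1 h3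
    have hc : c ≠ 0 := by rintro rfl; simp at ha
    rw [Submodule.span_singleton_smul_eq (IsUnit.mk0 c hc)]
  · rintro rfl
    exact ⟨isPlaneLine_iff.2 ⟨a, ha, rfl⟩, by rwa [conicPlane_ann ha, submodule_le_iff]⟩

theorem existsUnique_isConicOf {P : ℙ F (Fin 6 → F)} (hP : ptRank P = 2) :
    ∃! m, IsConicOf P m := by
  obtain ⟨a, ha, hPa⟩ := exists_mem_kerSpace (detVec_rep_eq_zero hP)
  exact ⟨ann (F ∙ a), (isConicOf_iff hP ha hPa).2 rfl, fun m hm => (isConicOf_iff hP ha hPa).1 hm⟩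

theorem mem_hyperplaneOf_prodCoords {a : Fin 3 → F} {y : Fin 6 → F} :
    y ∈ hyperplaneOf (formOf (prodCoords a a)) ↔ bil y a a = 0 := by
  rw [mem_hyperplaneOf, formCoords_formOf, prodCoords_dotProduct]

/-- The only hyperplane of a double line through the conic of the line `a · u = 0` is that of the
square of this linear form. -/
theorem isConicHyperplane_iff {a : Fin 3 → F} (ha : a ≠ 0) {H : Submodule F (Fin 6 → F)} :
    IsConicHyperplane (ann (F ∙ a)) H ↔ H = hyperplaneOf (formOf (prodCoords a a)) := by
  constructor
  · rintro ⟨⟨f, ⟨k, b, hk, hb, rfl⟩, rfl⟩, h⟩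
    have hf : C k * linForm b ^ 2 = k • formOf (prodCoords b b) := by
      rw [pow_two, linForm_mul_linForm, MvPolynomial.smul_eq_C_mul]
    rw [hf] at h ⊢
    have hH : hyperplaneOf (k • formOf (prodCoords b b)) = hyperplaneOf (formOf (prodCoords b b)) :=
      (hyperplaneOf_eq_iff (Submodule.smul_mem _ _ (formOf_mem _)) (formOf_mem _)).2 ⟨k, hk, rfl⟩
    rw [hH] at h ⊢
    have hle : ann (F ∙ a) ≤ ann (F ∙ b) := by
      intro v hv
      by_cases hv0 : v = 0
      · rw [hv0]; exact zero_mem _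
      have h1 := h (Projectivization.mk F _ (veronese_ne_zero hv0))
        ⟨v, hv, hv0, Projectivization.submodule_mk _ _⟩
      rw [Projectivization.submodule_mk, Submodule.span_singleton_le_iff_mem,
        mem_hyperplaneOf_prodCoords, bil_veronese] at h1
      exact mem_ann_span_singleton.2 (mul_self_eq_zero.1 h1)
    have heq := Submodule.eq_of_le_of_finrank_eq hle
      (by rw [finrank_ann_span_singleton ha, finrank_ann_span_singleton hb])
    have heq2 : F ∙ a = F ∙ b := by rw [← ann_ann (F ∙ a), heq, ann_ann]
    obtain ⟨c, rfl⟩ := Submodule.mem_span_singleton.1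
      (heq2 ▸ Submodule.mem_span_singleton_self b : b ∈ F ∙ a)
    have hc : c ≠ 0 := by rintro rfl; simp at hb
    rw [prodCoords_smul_smul, formOf_smul]
    exact (hyperplaneOf_eq_iff (Submodule.smul_mem _ _ (formOf_mem _)) (formOf_mem _)).2
      ⟨c ^ 2, pow_ne_zero 2 hc, rfl⟩
  · rintro rfl
    refine ⟨⟨_, ⟨1, a, one_ne_zero, ha, ?_⟩, rfl⟩, ?_⟩
    · rw [C_1, one_mul, pow_two, linForm_mul_linForm]
    · rintro P ⟨v, hv, -, hPv⟩
      rw [hPv, Submodule.span_singleton_le_iff_mem, mem_hyperplaneOf_prodCoords, bil_veronese,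
        mem_ann_span_singleton.1 hv, zero_mul]

/-! ### Exterior points -/

theorem veronese_symProd_independent {v w : Fin 3 → F} (h : LinearIndependent F ![v, w]) {r s t : F}
    (h0 : r • veronese v + s • symProd v w + t • veronese w = 0) : r = 0 ∧ s = 0 ∧ t = 0 := by
  obtain ⟨A, rfl, rfl⟩ := exists_GL_of_linearIndependent h
  rw [← lift_veronese, ← lift_veronese, ← lift_symProd, ← map_smul, ← map_smul, ← map_smul,
    ← map_add, ← map_add] at h0
  have h1 := lift_injective A (h0.trans (map_zero _).symm)
  have h2 := congrFun h1 3; have h3 := congrFun h1 4; have h4 := congrFun h1 5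
  simp [veronese, symProd] at h2 h3 h4
  exact ⟨h2, h3, h4⟩

theorem IsPlaneLine.exists_basis {m : Submodule F (Fin 3 → F)} (hm : IsPlaneLine m) {v : Fin 3 → F}
    (hv : v ∈ m) (hv0 : v ≠ 0) : ∃ w ∈ m, LinearIndependent F ![v, w] ∧
      ∀ u ∈ m, ∃ α β : F, u = α • v + β • w := by
  have hlt : (F ∙ v) < m := by
    refine lt_of_le_of_ne (by rwa [Submodule.span_singleton_le_iff_mem]) fun h => ?_
    have := finrank_span_singleton (K := F) hv0
    rw [h, hm] at this
    norm_num at this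
  obtain ⟨w, hw, hwv⟩ := SetLike.exists_of_lt hlt
  have hli : LinearIndependent F ![v, w] := by
    rw [LinearIndependent.pair_iff' hv0]
    exact fun c hc => hwv (Submodule.mem_span_singleton.2 ⟨c, hc⟩)
  refine ⟨w, hw, hli, fun u hu => ?_⟩
  have h : Submodule.span F {v, w} = m := by
    apply Submodule.eq_of_le_of_finrank_eq
    · rw [Submodule.span_le]; rintro x (rfl | rfl) <;> assumption
    · rw [finrank_span_pair hli]; exact hm.symm
  rw [← h] at hu
  obtain ⟨α, β, h⟩ := Submodule.mem_span_pair.1 hu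
  exact ⟨α, β, h.symm⟩

/-- A point of rank two is exterior if and only if it lies in a tangent plane of the Veronese
surface. -/
theorem isExterior_iff {P : ℙ F (Fin 6 → F)} (hP : ptRank P = 2) :
    IsExterior P ↔ ∃ v : Fin 3 → F, v ≠ 0 ∧ P.rep ∈ tangentSpace v := by
  constructor
  · rintro ⟨-, m, T, hm, ⟨hT, hTm, Q, ⟨⟨v, hv, hv0, hQv⟩, hQT⟩, hQ⟩, hPT⟩
    rw [submodule_le_iff] at hPT
    rw [hQv, Submodule.span_singleton_le_iff_mem] at hQT
    obtain ⟨w, hw, hvw, hspan⟩ := hm.exists_basis hv hv0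
    -- coordinates in the plane of the conic
    have hplane : ∀ y ∈ conicPlane m, ∃ r s t : F,
        y = r • veronese v + s • symProd v w + t • veronese w := by
      intro y hy
      induction hy using Submodule.span_induction with
      | mem x hx =>
        obtain ⟨u, hu, rfl⟩ := hx
        obtain ⟨α, β, rfl⟩ := hspan u hu
        exact ⟨α ^ 2, α * β, β ^ 2, by ext i; fin_cases i <;> simp [veronese, symProd] <;> ring⟩
      | zero => exact ⟨0, 0, 0, by simp⟩
      | add x y _ _ hx hy =>
        obtain ⟨r, s, t, rfl⟩ := hx
        obtain ⟨r', s', t', rfl⟩ := hy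
        exact ⟨r + r', s + s', t + t', by module⟩
      | smul c x _ hx =>
        obtain ⟨r, s, t, rfl⟩ := hx
        exact ⟨c * r, c * s, c * t, by module⟩
    obtain ⟨r, s, t, hrst⟩ := hplane _ (hTm hPT)
    have ht : t = 0 := by
      by_contra ht
      -- otherwise there is a second point of the conic on `T`
      have hu0 : s • v + t • w ≠ 0 := fun h0 =>
        ht (LinearIndependent.pair_iff.1 hvw s t h0).2
      have hver : veronese (s • v + t • w) = (s ^ 2 - t * r) • veronese v + t • P.rep := by
        rw [hrst]
        ext i; fin_cases i <;> simp [veronese, symProd] <;> ring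
      have h1 := hQ (Projectivization.mk F _ (veronese_ne_zero hu0))
        ⟨⟨_, m.add_mem (m.smul_mem s hv) (m.smul_mem t hw), hu0,
          Projectivization.submodule_mk _ _⟩, by
          rw [Projectivization.submodule_mk, Submodule.span_singleton_le_iff_mem, hver]
          exact add_mem (T.smul_mem _ hQT) (T.smul_mem _ hPT)⟩
      have h2 : veronese (s • v + t • w) ∈ F ∙ veronese v := by
        rw [← hQv, ← h1, Projectivization.submodule_mk]
        exact Submodule.mem_span_singleton_self _
      obtain ⟨c, hc⟩ := Submodule.mem_span_singleton.1 h2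
      have := veronese_symProd_independent hvw (r := s ^ 2 - c) (s := s * t) (t := t ^ 2) (by
        have h3 : veronese (s • v + t • w) = s ^ 2 • veronese v + (s * t) • symProd v w
            + t ^ 2 • veronese w := by
          ext i; fin_cases i <;> simp [veronese, symProd] <;> ring
        rw [sub_smul, hc, h3]; abel)
      exact pow_ne_zero 2 ht this.2.2
    refine ⟨v, hv0, mem_tangentSpace.2 ⟨s • w, r, ?_⟩⟩
    rw [hrst, ht]
    ext i; fin_cases i <;> simp [veronese, symProd] <;> ring
  · rintro ⟨v, hv0, h⟩
    obtain ⟨w, k, hwk⟩ := mem_tangentSpace.1 h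
    have hvw : LinearIndependent F ![v, w] := by
      rw [LinearIndependent.pair_iff' hv0]
      rintro c rfl
      have h1 := (rank_eq_two_iff P.rep_nonzero).1 hP
      apply h1.2
      rw [hwk]
      simp [MinorsVanish, symProd, veronese]
      refine ⟨?_, ?_, ?_, ?_, ?_, ?_⟩ <;> ring
    have hind := fun {r s t : F} => veronese_symProd_independent hvw (r := r) (s := s) (t := t)
    have hv : v ∈ Submodule.span F {v, w} := Submodule.subset_span (by simp)
    have hw : w ∈ Submodule.span F {v, w} := Submodule.subset_span (by simp)
    refine ⟨hP, Submodule.span F {v, w}, Submodule.span F {veronese v, symProd v w},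
      finrank_span_pair hvw, ⟨?_, ?_, Projectivization.mk F _ (veronese_ne_zero hv0),
        ⟨⟨v, hv, hv0, Projectivization.submodule_mk _ _⟩, ?_⟩, ?_⟩, ?_⟩
    · refine finrank_span_pair (LinearIndependent.pair_iff.2 fun r s h => ?_)
      have := hind (r := r) (s := s) (t := 0) (by rw [zero_smul, add_zero]; exact h)
      exact ⟨this.1, this.2.1⟩
    · rw [Submodule.span_le]
      rintro x (rfl | rfl)
      · exact Submodule.subset_span ⟨v, hv, rfl⟩
      · exact symProd_mem_conicPlane hv hw
    · rw [Projectivization.submodule_mk, Submodule.span_singleton_le_iff_mem]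
      exact Submodule.subset_span (by simp)
    · rintro Q ⟨⟨u, hu, hu0, hQu⟩, hQT⟩
      rw [hQu, Submodule.span_singleton_le_iff_mem] at hQT
      obtain ⟨α, β, rfl⟩ := Submodule.mem_span_pair.1 hu
      obtain ⟨r, s, hrs⟩ := Submodule.mem_span_pair.1 hQT
      have h3 : veronese (α • v + β • w) = α ^ 2 • veronese v + (α * β) • symProd v w
          + β ^ 2 • veronese w := by
        ext i; fin_cases i <;> simp [veronese, symProd] <;> ring
      have hβ := (hind (r := α ^ 2 - r) (s := α * β - s) (t := β ^ 2) (by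
        rw [h3] at hrs
        rw [sub_smul, sub_smul]
        linear_combination (exp := 1) -hrs)).2.2
      have hβ0 : β = 0 := pow_eq_zero_iff two_ne_zero |>.1 hβ
      rw [hβ0, zero_smul, add_zero] at hu0 hQu
      have hα : α ≠ 0 := by rintro rfl; simp at hu0
      apply Projectivization.submodule_injective
      rw [hQu, Projectivization.submodule_mk]
      have : veronese (α • v) = α ^ 2 • veronese v := by
        ext i; fin_cases i <;> simp [veronese] <;> ring
      rw [this, Submodule.span_singleton_smul_eq (IsUnit.mk0 _ (pow_ne_zero 2 hα))]
    · rw [submodule_le_iff, hwk]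
      exact add_mem (Submodule.subset_span (by simp))
        (Submodule.smul_mem _ _ (Submodule.subset_span (by simp)))

/-! ### Lines with exactly one singular point -/

/-- If the only singular point of a line has rank two, then the double lines of the web
correspond to the tangent planes of the Veronese surface through that point. -/
theorem isoCount_mul_eq_sum_tanCount [Fintype F] {L : Submodule F (Fin 6 → F)} (hL : IsLine L)
    (h1 : rankCount L 1 = 0) (h2 : rankCount L 2 = 1) :
    (isoCount L : ℤ) * ((Fintype.card F : ℤ) - 1) ^ 2
      = sumNonzero L (fun y => (tanCount y : ℤ)) := by
  obtain ⟨d0, d1, d2, -⟩ := distribution_relations L hL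
  rw [h1, h2] at d1
  rw [h1] at d2
  have k := kindCount_sing L hL
  rw [kindCount_eq L IsDoubleLine fun _ _ => isDoubleLine_smul,
    kindCount_eq L IsRealLinePair fun _ _ => isRealLinePair_smul,
    kindCount_eq L IsImaginaryLinePair fun _ _ => isImaginaryLinePair_smul] at k
  set q : ℤ := (Fintype.card F : ℤ)
  set D : Fin 4 → ℤ := fun i => conicDistribution (webOf L) i
  change (q ^ 3 - 1) + ((q ^ 2 - 1) * (D 0 * (q - 1)) + (q - 1) * (D 1 * (q - 1))
    + (q - 1) * (D 2 * (q - 1))) = _ at k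
  rw [← d0]
  have hq : q ≠ 0 := by
    have := Fintype.card_pos (α := F)
    simp only [q]
    omega
  apply mul_left_cancel₀ hq
  push_cast at d1 d2
  linear_combination k - (q - 1) ^ 2 * d1 + (q - 1) ^ 2 * d2

/-- The web contains a double line exactly if the only singular point lies in a tangent plane. -/
theorem isoCount_ne_zero_iff [Fintype F] {L : Submodule F (Fin 6 → F)} (hL : IsLine L)
    (h1 : rankCount L 1 = 0) (h2 : rankCount L 2 = 1) :
    isoCount L ≠ 0 ↔ ∃ y ∈ L, y ≠ 0 ∧ ∃ v : Fin 3 → F, v ≠ 0 ∧ y ∈ tangentSpace v := by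
  classical
  have k := isoCount_mul_eq_sum_tanCount hL h1 h2
  have hq : 1 < (Fintype.card F : ℤ) := by
    have := Fintype.one_lt_card (α := F); exact_mod_cast this
  have h3 : isoCount L = 0 ↔ sumNonzero L (fun y => (tanCount y : ℤ)) = 0 := by
    rw [← k]
    have : ((Fintype.card F : ℤ) - 1) ^ 2 ≠ 0 := pow_ne_zero 2 (by omega)
    simp [this]
  rw [Ne, h3, sumNonzero, Finset.sum_eq_zero_iff_of_nonneg fun _ _ => by positivity]
  push Not
  constructor
  · rintro ⟨y, hy, h⟩
    obtain ⟨hy0, hyL⟩ := (Finset.mem_filter.1 hy).2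
    have h4 : {v : Fin 3 → F | v ≠ 0 ∧ y ∈ tangentSpace v}.ncard ≠ 0 := fun h0 => h (by
      rw [tanCount, h0, Nat.cast_zero])
    obtain ⟨v, hv⟩ := Set.nonempty_of_ncard_ne_zero h4
    exact ⟨y, hyL, hy0, v, hv⟩
  · rintro ⟨y, hyL, hy0, v, hv⟩
    refine ⟨y, Finset.mem_filter.2 ⟨Finset.mem_univ _, hy0, hyL⟩, ?_⟩
    have h4 : {v : Fin 3 → F | v ≠ 0 ∧ y ∈ tangentSpace v}.ncard ≠ 0 :=
      Set.ncard_ne_zero_of_mem (a := v) hv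
    exact Nat.cast_ne_zero.2 h4

/-- The point of rank two, if it is the only singular point of the line. -/
theorem exists_unique_singular_point [Fintype F] {L : Submodule F (Fin 6 → F)}
    (h1 : rankCount L 1 = 0) (h2 : rankCount L 2 = 1) :
    ∃ P : ℙ F (Fin 6 → F), P.submodule ≤ L ∧ ptRank P = 2 ∧
      (∀ Q : ℙ F (Fin 6 → F), Q.submodule ≤ L → ptRank Q = 2 → Q = P) ∧
      ∀ y ∈ L, y ≠ 0 → detVec y = 0 → ∃ c : F, c ≠ 0 ∧ y = c • P.rep := by
  obtain ⟨P, hP⟩ := Set.ncard_eq_one.1 h2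
  have hP' : P ∈ ({P} : Set (ℙ F (Fin 6 → F))) := rfl
  rw [← hP] at hP'
  have huniq : ∀ Q : ℙ F (Fin 6 → F), Q.submodule ≤ L → ptRank Q = 2 → Q = P := by
    intro Q hQ hQ2
    have : Q ∈ {P : ℙ F (Fin 6 → F) | P.submodule ≤ L ∧ ptRank P = 2} := ⟨hQ, hQ2⟩
    rw [hP] at this
    exact this
  refine ⟨P, hP'.1, hP'.2, huniq, fun y hy hy0 hd => ?_⟩
  have hyL : (Projectivization.mk F y hy0).submodule ≤ L := by
    rwa [Projectivization.submodule_mk, Submodule.span_singleton_le_iff_mem]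
  have hd' : detVec (Projectivization.mk F y hy0).rep = 0 :=
    (rep_mk_iff (fun y => detVec y = 0)
      (fun c v _ h => by rw [detVec_smul, h, mul_zero]) hy0).2 hd
  have hr1 : ptRank (Projectivization.mk F y hy0) ≠ 1 := by
    intro h
    have h3 : rankCount L 1 ≠ 0 := Set.ncard_ne_zero_of_mem (a := Projectivization.mk F y hy0)
      ⟨hyL, h⟩
    exact h3 h1
  have hr2 : ptRank (Projectivization.mk F y hy0) = 2 := by
    have h3 : ptRank (Projectivization.mk F y hy0) ≠ 3 := fun h =>
      (rank_eq_three_iff.1 h) hd'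
    have h4 : ptRank (Projectivization.mk F y hy0) ≤ 3 := rank_toMat_le _
    have h5 : 0 < ptRank (Projectivization.mk F y hy0) :=
      rank_toMat_pos (Projectivization.rep_nonzero _)
    omega
  have := huniq _ hyL hr2
  rw [← P.mk_rep, Projectivization.mk_eq_mk_iff'] at this
  obtain ⟨c, hc⟩ := this
  exact ⟨c, by rintro rfl; rw [zero_smul] at hc; exact hy0 hc.symm, hc.symm⟩

theorem rankCount_three [Fintype F] {L : Submodule F (Fin 6 → F)} (hL : IsLine L) :
    rankCount L 1 + rankCount L 2 + rankCount L 3 = Fintype.card F + 1 := by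
  have htot : {P : ℙ F (Fin 6 → F) | P.submodule ≤ L}.ncard = Fintype.card F + 1 := by
    have h1 := ncard_points_mul L (fun _ => True) fun _ _ _ _ => trivial
    have h2 := ncard_ne_zero_mem L
    simp only [and_true] at h1
    rw [← h1, hL, Nat.card_eq_fintype_card] at h2
    have hq := Fintype.one_lt_card (α := F)
    obtain ⟨k, hk⟩ : ∃ k, Fintype.card F = k + 1 := ⟨Fintype.card F - 1, by omega⟩
    rw [hk] at h2 hq ⊢
    rw [Nat.add_sub_cancel] at h2
    apply Nat.eq_of_mul_eq_mul_right (show 0 < k by omega)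
    nlinarith
  rw [rankCount_one_add_two, ← htot, rankCount, ← Set.ncard_union_eq _ (Set.toFinite _)
    (Set.toFinite _)]
  · congr 1
    ext P
    have : ptRank P = 3 ↔ detVec P.rep ≠ 0 := rank_eq_three_iff
    simp only [Set.mem_union, Set.mem_ofPred_eq, this]
    tauto
  · rw [Set.disjoint_left]
    rintro P ⟨-, h⟩ ⟨-, h'⟩
    exact (rank_eq_three_iff.1 h') h

/-- The criterion for the hyperplane of the conic of the singular point to contain the line. -/
theorem conicCriterion_of_unique [Fintype F] {L : Submodule F (Fin 6 → F)} {T : ℙ F (Fin 6 → F) → Prop}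
    {t s : Label} (h1 : rankCount L 1 = 0) (h2 : rankCount L 2 = 1)
    (hT : ∀ P, T P → ptRank P = 2) (hex : ∃ P : ℙ F (Fin 6 → F), P.submodule ≤ L ∧ T P)
    (hs : HasType s L ↔ HasIsotropicKernel L) (ht : HasType t L ↔ ¬ HasIsotropicKernel L) :
    ConicCriterion T t s L := by
  obtain ⟨P, hPL, hP2, huniq, hsing⟩ := exists_unique_singular_point h1 h2
  obtain ⟨a, ha, hPa⟩ := exists_mem_kerSpace (detVec_rep_eq_zero hP2)
  have hiso : HasIsotropicKernel L ↔ L ≤ hyperplaneOf (formOf (prodCoords a a)) := by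
    constructor
    · rintro ⟨y, hy, hy0, k, hk, hyk, h⟩ z hz
      obtain ⟨c, hc, rfl⟩ := hsing y hy hy0 (detVec_eq_zero_of_mem_kerSpace hk hyk)
      have hPk : P.rep ∈ kerSpace k := by
        have := (kerSpace k).smul_mem c⁻¹ hyk
        rwa [smul_smul, inv_mul_cancel₀ hc, one_smul] at this
      obtain ⟨b, rfl⟩ := Submodule.mem_span_singleton.1 (mem_span_of_mem_kerSpace hP2 hk hPk hPa)
      rw [mem_hyperplaneOf_prodCoords, bil_smul_smul, h z hz, mul_zero]
    · intro h
      exact ⟨P.rep, submodule_le_iff.1 hPL, P.rep_nonzero, a, ha, hPa,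
        fun z hz => mem_hyperplaneOf_prodCoords.1 (h hz)⟩
  refine ⟨P, ann (F ∙ a), hyperplaneOf (formOf (prodCoords a a)), ?_, ?_, ?_, ?_, ?_⟩
  · obtain ⟨Q, hQL, hTQ⟩ := hex
    have hQP := huniq Q hQL (hT Q hTQ)
    rw [hQP] at hTQ
    ext R
    exact ⟨fun h => huniq R h.1 (hT R h.2), by rintro rfl; exact ⟨hPL, hTQ⟩⟩
  · ext m; exact isConicOf_iff hP2 ha hPa
  · ext H; exact isConicHyperplane_iff ha
  · rw [hs, hiso]
  · rw [ht, hiso]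

/-- The two labels of an exceptional pair with one singular point are told apart by the
isotropic kernel. -/
theorem hasType_iff_hasIsotropicKernel {L : Submodule F (Fin 6 → F)} {s : Label}
    (hs : s = .o16_1 ∨ s = .o16_3) (h : HasType .o15_1 L ∨ HasType s L) :
    (HasType s L ↔ HasIsotropicKernel L) ∧ (HasType .o15_1 L ↔ ¬ HasIsotropicKernel L) := by
  have k1 : HasType .o15_1 L → ¬ HasIsotropicKernel L := fun h1 => by
    rw [hasIsotropicKernel_iff_of_hasType h1 (Or.inl rfl)]; simp
  have k2 : HasType s L → HasIsotropicKernel L := fun h1 => by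
    rw [hasIsotropicKernel_iff_of_hasType h1 (by tauto)]; exact hs
  tauto

/-! ### The two pairs of orbits with equal distributions -/

/-- For odd order, an exterior point is one in a tangent plane of the Veronese surface, and by
`isoCount_ne_zero_iff` this is detected by the number of double lines. -/
theorem pointODOdd_eq_iff [Fintype F] {L : Submodule F (Fin 6 → F)} (hL : IsLine L) :
    pointODOdd L = ![0, 1, 0, Fintype.card F] ↔
      rankCount L 1 = 0 ∧ rankCount L 2 = 1 ∧ isoCount L ≠ 0 := by
  have hr := rankCount_three hL
  have hpart : {P : ℙ F (Fin 6 → F) | P.submodule ≤ L ∧ IsExterior P}.ncard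
      + {P : ℙ F (Fin 6 → F) | P.submodule ≤ L ∧ IsInterior P}.ncard = rankCount L 2 := by
    rw [rankCount, ← Set.ncard_union_eq _ (Set.toFinite _) (Set.toFinite _)]
    · congr 1
      ext P
      simp only [Set.mem_union, Set.mem_ofPred_eq, IsExterior, IsInterior]
      constructor
      · rintro (⟨a, b, _⟩ | ⟨a, b, _⟩) <;> exact ⟨a, b⟩
      · rintro ⟨a, b⟩
        by_cases h : ∃ m T, IsPlaneLine m ∧ IsTangentLine m T ∧ P.submodule ≤ T
        exacts [Or.inl ⟨a, b, h⟩, Or.inr ⟨a, b, h⟩]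
    · rw [Set.disjoint_left]
      rintro P ⟨-, h⟩ ⟨-, h'⟩
      exact h'.2 h.2
  have hiff : pointODOdd L = ![0, 1, 0, Fintype.card F] ↔ rankCount L 1 = 0 ∧
      {P : ℙ F (Fin 6 → F) | P.submodule ≤ L ∧ IsExterior P}.ncard = 1 ∧
      {P : ℙ F (Fin 6 → F) | P.submodule ≤ L ∧ IsInterior P}.ncard = 0 ∧
      rankCount L 3 = Fintype.card F := by
    constructor
    · intro h
      exact ⟨congrFun h 0, congrFun h 1, congrFun h 2, congrFun h 3⟩
    · rintro ⟨h0, h1, h2, h3⟩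
      ext i; fin_cases i
      exacts [h0, h1, h2, h3]
  rw [hiff]
  constructor
  · rintro ⟨h1, h2, h3, -⟩
    have h4 : rankCount L 2 = 1 := by omega
    refine ⟨h1, h4, (isoCount_ne_zero_iff hL h1 h4).2 ?_⟩
    obtain ⟨P, hPL, hP⟩ := Set.nonempty_of_ncard_ne_zero (by rw [h2]; exact one_ne_zero)
    exact ⟨P.rep, submodule_le_iff.1 hPL, P.rep_nonzero, (isExterior_iff hP.1).1 hP⟩
  · rintro ⟨h1, h2, h3⟩
    obtain ⟨y, hy, hy0, v, hv, hyv⟩ := (isoCount_ne_zero_iff hL h1 h2).1 h3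
    obtain ⟨P, hPL, hP2, huniq, hsing⟩ := exists_unique_singular_point h1 h2
    obtain ⟨c, hc, rfl⟩ := hsing y hy hy0 (detVec_eq_zero_of_mem_tangentSpace hyv)
    have hPv : P.rep ∈ tangentSpace v := by
      have := (tangentSpace v).smul_mem c⁻¹ hyv
      rwa [smul_smul, inv_mul_cancel₀ hc, one_smul] at this
    have hE : {P : ℙ F (Fin 6 → F) | P.submodule ≤ L ∧ IsExterior P}.ncard ≠ 0 :=
      Set.ncard_ne_zero_of_mem (a := P) ⟨hPL, (isExterior_iff hP2).2 ⟨v, hv, hPv⟩⟩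
    omega

/-- The line has a nonzero point whose quadratic form vanishes identically. In characteristic two
these are the points of the nucleus plane. -/
def HasAlternatingPoint (L : Submodule F (Fin 6 → F)) : Prop :=
  ∃ y ∈ L, y ≠ 0 ∧ ∀ a, bil y a a = 0

theorem HasAlternatingPoint.of_kEquiv {L M : Submodule F (Fin 6 → F)} (h : HasAlternatingPoint L)
    (hLM : KEquiv L M) : HasAlternatingPoint M := by
  obtain ⟨A, rfl⟩ := hLM
  obtain ⟨y, hy, hy0, h⟩ := h
  exact ⟨_, ⟨y, hy, rfl⟩, fun h => hy0 (lift_injective A (by rw [h, map_zero])),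
    fun a => by rw [bil_lift]; exact h _⟩

theorem forall_bil_eq_zero_iff (h2 : (2 : F) = 0) {y : Fin 6 → F} :
    (∀ a, bil y a a = 0) ↔ y 0 = 0 ∧ y 3 = 0 ∧ y 5 = 0 := by
  constructor
  · intro h
    have e0 := h ![1, 0, 0]; have e1 := h ![0, 1, 0]; have e2 := h ![0, 0, 1]
    simp [bil_eq] at e0 e1 e2
    exact ⟨e0, e1, e2⟩
  · rintro ⟨h0, h3, h5⟩ a
    rw [bil_eq, h0, h3, h5]
    linear_combination (y 1 * a 0 * a 1 + y 2 * a 0 * a 2 + y 4 * a 1 * a 2) * h2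

theorem pointODEven_eq_iff [Fintype F] (h2 : (2 : F) = 0) {L : Submodule F (Fin 6 → F)} (hL : IsLine L) :
    pointODEven L = ![0, 0, 1, Fintype.card F] ↔
      rankCount L 1 = 0 ∧ rankCount L 2 = 1 ∧ ¬ HasAlternatingPoint L := by
  have hr := rankCount_three hL
  have hpart : {P : ℙ F (Fin 6 → F) | P.submodule ≤ L ∧ IsNuclear P}.ncard
      + {P : ℙ F (Fin 6 → F) | P.submodule ≤ L ∧ IsNonNuclear P}.ncard = rankCount L 2 := by
    rw [rankCount, ← Set.ncard_union_eq _ (Set.toFinite _) (Set.toFinite _)]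
    · congr 1
      ext P
      simp only [Set.mem_union, Set.mem_ofPred_eq, IsNuclear, IsNonNuclear]
      tauto
    · rw [Set.disjoint_left]
      rintro P ⟨-, h⟩ ⟨-, h'⟩
      exact h'.2 h.2
  have hiff : pointODEven L = ![0, 0, 1, Fintype.card F] ↔ rankCount L 1 = 0 ∧
      {P : ℙ F (Fin 6 → F) | P.submodule ≤ L ∧ IsNuclear P}.ncard = 0 ∧
      {P : ℙ F (Fin 6 → F) | P.submodule ≤ L ∧ IsNonNuclear P}.ncard = 1 ∧
      rankCount L 3 = Fintype.card F := by
    constructor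
    · intro h
      exact ⟨congrFun h 0, congrFun h 1, congrFun h 2, congrFun h 3⟩
    · rintro ⟨h0, h1, h2, h3⟩
      ext i; fin_cases i
      exacts [h0, h1, h2, h3]
  rw [hiff]
  have hnuc : ∀ P : ℙ F (Fin 6 → F), ptRank P = 2 → (IsNuclear P ↔ ∀ a, bil P.rep a a = 0) :=
    fun P hP => by rw [forall_bil_eq_zero_iff h2, IsNuclear]; tauto
  have hkey : rankCount L 1 = 0 → rankCount L 2 = 1 → (HasAlternatingPoint L ↔
      {P : ℙ F (Fin 6 → F) | P.submodule ≤ L ∧ IsNuclear P}.ncard ≠ 0) := by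
    intro h1 h3
    constructor
    · rintro ⟨y, hy, hy0, h⟩
      obtain ⟨P, hPL, hP2, huniq, hsing⟩ := exists_unique_singular_point h1 h3
      have hd : detVec y = 0 := by
        obtain ⟨e0, e3, e5⟩ := (forall_bil_eq_zero_iff h2).1 h
        rw [detVec, e0, e3, e5]
        linear_combination y 1 * y 2 * y 4 * h2
      obtain ⟨c, hc, rfl⟩ := hsing y hy hy0 hd
      refine Set.ncard_ne_zero_of_mem (a := P) ⟨hPL, (hnuc P hP2).2 fun a => ?_⟩
      have := h a
      rw [bil_smul] at this
      exact (mul_eq_zero.1 this).resolve_left hc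
    · intro h
      obtain ⟨P, hPL, hP⟩ := Set.nonempty_of_ncard_ne_zero h
      exact ⟨P.rep, submodule_le_iff.1 hPL, P.rep_nonzero, (hnuc P hP.1).1 hP⟩
  constructor
  · rintro ⟨h1, h3, h4, -⟩
    have h5 : rankCount L 2 = 1 := by omega
    exact ⟨h1, h5, fun h => (hkey h1 h5).1 h h3⟩
  · rintro ⟨h1, h3, h4⟩
    rw [hkey h1 h3, not_not] at h4
    omega

theorem hasAlternatingPoint_iff_of_hasType (h2 : (2 : F) = 0) {t : Label}
    {L : Submodule F (Fin 6 → F)} (h : HasType t L) (ht : t = .o15_1 ∨ t = .o16_1 ∨ t = .o16_3) :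
    HasAlternatingPoint L ↔ t = .o16_1 := by
  obtain ⟨M, W, hM, hK⟩ := h
  have hML : HasAlternatingPoint L ↔ HasAlternatingPoint M :=
    ⟨fun h => h.of_kEquiv hK.symm, fun h => h.of_kEquiv hK⟩
  rw [hML]
  rcases ht with rfl | rfl | rfl <;> cases hM
  case inl.r15_1 a v hv hs =>
    simp only [reduceCtorEq, iff_false]
    rintro ⟨y, hy, hy0, h⟩
    obtain ⟨r, s, rfl⟩ := Submodule.mem_span_pair.1 hy
    obtain ⟨e0, -, e5⟩ := (forall_bil_eq_zero_iff h2).1 h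
    simp [toVec, hv.1] at e0 e5
    simp [e0, e5] at hy0
  case inr.inl.r16_1 =>
    simp only [iff_true]
    refine ⟨toVec !![0, 0, 0; 0, 0, 1; 0, 1, 0], Submodule.subset_span (by simp), fun h => ?_,
      (forall_bil_eq_zero_iff h2).2 (by simp [toVec])⟩
    simpa [toVec] using congrFun h 4
  case inr.inr.r16_3 _ =>
    simp only [reduceCtorEq, iff_false]
    rintro ⟨y, hy, hy0, h⟩
    obtain ⟨r, s, rfl⟩ := Submodule.mem_span_pair.1 hy
    obtain ⟨-, e3, e5⟩ := (forall_bil_eq_zero_iff h2).1 h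
    simp [toVec] at e3 e5
    simp [e3, e5] at hy0

theorem criterion_odd [Fintype F] (h2 : (2 : F) ≠ 0) {L : Submodule F (Fin 6 → F)} (hL : IsLine L) :
    (pointODOdd L = ![0, 1, 0, Fintype.card F] ↔ HasType .o15_1 L ∨ HasType .o16_1 L) ∧
    (pointODOdd L = ![0, 1, 0, Fintype.card F] → ConicCriterion IsExterior .o15_1 .o16_1 L) := by
  have hiff : pointODOdd L = ![0, 1, 0, Fintype.card F] ↔ HasType .o15_1 L ∨ HasType .o16_1 L := by
    rw [pointODOdd_eq_iff hL]
    constructor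
    · rintro ⟨h1, h3, h4⟩
      obtain ⟨t, ht⟩ := exists_hasType hL
      obtain ⟨-, p1, p2, p3⟩ := profile_odd_of_hasType h2 ht
      have hq := three_le_card_of_odd (odd_card_iff.2 h2)
      have hocc := occurs_of_hasType ht
      have hodd := odd_card_iff.2 h2
      rw [← Nat.not_even_iff_odd] at hodd
      rw [h1] at p1 p2
      rw [h3] at p2
      rw [p3] at h4
      cases t <;> simp [oddProfile, Label.Occurs] at p1 p2 h4 hocc <;>
        first | exact Or.inl ht | exact Or.inr ht
    · rintro (h | h) <;> obtain ⟨-, p1, p2, p3⟩ := profile_odd_of_hasType h2 h <;>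
        simp only [oddProfile] at p1 p2 p3 <;> omega
  refine ⟨hiff, fun h => ?_⟩
  have h3 := (pointODOdd_eq_iff hL).1 h
  have hk := hasType_iff_hasIsotropicKernel (Or.inl rfl) (hiff.1 h)
  have hE : {P : ℙ F (Fin 6 → F) | P.submodule ≤ L ∧ IsExterior P}.ncard = 1 := congrFun h 1
  obtain ⟨P, hP⟩ := Set.nonempty_of_ncard_ne_zero (hE.trans_ne one_ne_zero)
  exact conicCriterion_of_unique h3.1 h3.2.1 (fun P hP => hP.1) ⟨P, hP.1, hP.2⟩ hk.1 hk.2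

theorem criterion_even [Fintype F] (h2 : (2 : F) = 0) {L : Submodule F (Fin 6 → F)} (hL : IsLine L)
    :
    (pointODEven L = ![0, 0, 1, Fintype.card F] ↔ HasType .o15_1 L ∨ HasType .o16_3 L) ∧
    (pointODEven L = ![0, 0, 1, Fintype.card F] →
      ConicCriterion IsNonNuclear .o15_1 .o16_3 L) := by
  have hiff : pointODEven L = ![0, 0, 1, Fintype.card F] ↔
      HasType .o15_1 L ∨ HasType .o16_3 L := by
    rw [pointODEven_eq_iff h2 hL]
    constructor
    · rintro ⟨h1, h3, h4⟩
      obtain ⟨t, ht⟩ := exists_hasType hL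
      obtain ⟨-, p1, p2, p3⟩ := profile_even_of_hasType h2 ht
      have hq := Fintype.one_lt_card (α := F)
      have hocc := occurs_of_hasType ht
      have heven := even_card_iff.2 h2
      rw [← Nat.not_odd_iff_even] at heven
      rw [h1] at p1 p2
      rw [h3] at p2
      cases t <;> simp [evenProfile, Label.Occurs] at p1 p2 hocc <;>
        first | exact Or.inl ht | exact Or.inr ht | omega | exact absurd hocc heven |
          exact absurd ((hasAlternatingPoint_iff_of_hasType h2 ht (by simp)).2 rfl) h4
    · rintro (h | h) <;> obtain ⟨-, p1, p2, p3⟩ := profile_even_of_hasType h2 h <;>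
        simp only [evenProfile] at p1 p2 p3 <;>
        refine ⟨p1, by omega, ?_⟩ <;>
        rw [hasAlternatingPoint_iff_of_hasType h2 h (by simp)] <;> simp
  refine ⟨hiff, fun h => ?_⟩
  have h3 := (pointODEven_eq_iff h2 hL).1 h
  have hk := hasType_iff_hasIsotropicKernel (Or.inr rfl) (hiff.1 h)
  have hE : {P : ℙ F (Fin 6 → F) | P.submodule ≤ L ∧ IsNonNuclear P}.ncard = 1 := congrFun h 2
  obtain ⟨P, hP⟩ := Set.nonempty_of_ncard_ne_zero (hE.trans_ne one_ne_zero)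
  exact conicCriterion_of_unique h3.1 h3.2.1 (fun P hP => hP.1) ⟨P, hP.1, hP.2⟩ hk.1 hk.2

/-! ### The number of orbits -/

theorem isLine_of_hasType [Fintype F] {t : Label} {L : Submodule F (Fin 6 → F)} (h : HasType t L) :
    IsLine L := by
  by_cases h2 : (2 : F) = 0
  · exact (profile_even_of_hasType h2 h).1
  · exact (profile_odd_of_hasType h2 h).1

theorem kEquiv_iff_label_eq [Fintype F] {t t' : Label} {L L' : Submodule F (Fin 6 → F)} (h : HasType t L)
    (h' : HasType t' L') : KEquiv L L' ↔ t = t' :=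
  ⟨label_eq_of_kEquiv h h', by rintro rfl; exact h.kEquiv h'⟩

/-- The orbits of lines are in bijection with the labels that occur. -/
theorem ncard_orbits (F : Type u) [Field F] [Fintype F] :
    {O : Set (Submodule F (Fin 6 → F)) | ∃ L, IsLine L ∧ O = {M | KEquiv L M}}.ncard = 15 := by
  have horb : ∀ {t : Label} {L : Submodule F (Fin 6 → F)}, HasType t L →
      {M | KEquiv L M} = {M | HasType t M} := fun h => by
    ext M
    exact ⟨fun hM => h.of_kEquiv hM, fun hM => h.kEquiv hM⟩
  have himage : {O : Set (Submodule F (Fin 6 → F)) | ∃ L, IsLine L ∧ O = {M | KEquiv L M}}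
      = (fun t : Label => {M | HasType t M}) '' {t | t.Occurs (Fintype.card F)} := by
    ext O
    constructor
    · rintro ⟨L, hL, rfl⟩
      obtain ⟨t, ht⟩ := exists_hasType hL
      exact ⟨t, occurs_of_hasType ht, (horb ht).symm⟩
    · rintro ⟨t, ht, rfl⟩
      obtain ⟨L, hL⟩ := (exists_hasType_iff (F := F) t).2 ht
      exact ⟨L, isLine_of_hasType hL, (horb hL).symm⟩
  rw [himage, Set.InjOn.ncard_image, ncard_occurs]
  intro t ht t' _ h
  obtain ⟨L, hL⟩ := (exists_hasType_iff (F := F) t).2 ht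
  have hL' : L ∈ {M | HasType t' M} := by
    have : L ∈ {M | HasType t M} := hL
    rwa [show {M : Submodule F (Fin 6 → F) | HasType t M} = {M | HasType t' M} from h] at this
  exact label_eq_of_kEquiv hL hL' (KEquiv.refl L)

end WebsOfConics

theorem mainTheorem5 (F : Type u) [Field F] [Fintype F] (q : ℕ) (hq : Fintype.card F = q) :
    -- webs of conics and lines correspond to each other, up to the two equivalences
    (∀ L : Submodule F (Fin 6 → F), IsLine L → IsWeb (webOf L)) ∧
    (∀ W : Submodule F (MvPolynomial (Fin 3) F), IsWeb W → ∃! L, IsLine L ∧ webOf L = W) ∧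
    (∀ L L' : Submodule F (Fin 6 → F), IsLine L → IsLine L' →
      (KEquiv L L' ↔ ProjEquiv (webOf L) (webOf L'))) ∧
    -- the representatives and their webs; the fifteen orbits
    (∀ (t : Label) (L : Submodule F (Fin 6 → F)) (W : Submodule F (MvPolynomial (Fin 3) F)),
      TableRow t L W → IsLine L ∧ webOf L = W) ∧
    (∀ t : Label, (∃ L : Submodule F (Fin 6 → F), HasType t L) ↔ t.Occurs q) ∧
    (∀ L : Submodule F (Fin 6 → F), IsLine L → ∃! t, HasType t L) ∧
    (∀ (t t' : Label) (L L' : Submodule F (Fin 6 → F)), HasType t L → HasType t' L' →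
      (KEquiv L L' ↔ t = t')) ∧
    {O : Set (Submodule F (Fin 6 → F)) | ∃ L, IsLine L ∧ O = {M | KEquiv L M}}.ncard = 15 ∧
    -- the distributions
    (∀ (t : Label) (L : Submodule F (Fin 6 → F)), HasType t L →
      hyperplaneOD L = conicDistribution (webOf L) ∧
      (Odd q → ∀ i, (conicDistribution (webOf L) i : ℚ) = tableOdd q t i) ∧
      (Even q → ∀ i, (conicDistribution (webOf L) i : ℚ) = tableEven q t i)) ∧
    -- the distribution is a complete invariant, apart from the exceptional pairs
    (∀ (t t' : Label) (L L' : Submodule F (Fin 6 → F)), HasType t L → HasType t' L' →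
      (hyperplaneOD L = hyperplaneOD L' ↔ KEquiv L L' ∨ Exceptional q t t')) ∧
    (∀ (t t' : Label) (L L' : Submodule F (Fin 6 → F)), HasType t L → HasType t' L' →
      (conicDistribution (webOf L) = conicDistribution (webOf L') ↔
        ProjEquiv (webOf L) (webOf L') ∨ Exceptional q t t')) ∧
    -- every point of rank two determines a conic, and the geometric criterion
    (∀ P : ℙ F (Fin 6 → F), ptRank P = 2 → ∃! m, IsConicOf P m) ∧
    (Odd q → ∀ L : Submodule F (Fin 6 → F), IsLine L →
      (pointODOdd L = ![0, 1, 0, q] ↔ HasType .o15_1 L ∨ HasType .o16_1 L) ∧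
      (pointODOdd L = ![0, 1, 0, q] → ConicCriterion IsExterior .o15_1 .o16_1 L)) ∧
    (Even q → ∀ L : Submodule F (Fin 6 → F), IsLine L →
      (pointODEven L = ![0, 0, 1, q] ↔ HasType .o15_1 L ∨ HasType .o16_3 L) ∧
      (pointODEven L = ![0, 0, 1, q] → ConicCriterion IsNonNuclear .o15_1 .o16_3 L)) := by
  subst hq
  have hdist : ∀ (t : Label) (L : Submodule F (Fin 6 → F)), HasType t L →
      hyperplaneOD L = conicDistribution (webOf L) := fun t L _ => hyperplaneOD_eq L
  have hcomplete : ∀ (t t' : Label) (L L' : Submodule F (Fin 6 → F)), HasType t L →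
      HasType t' L' → (conicDistribution (webOf L) = conicDistribution (webOf L') ↔
        KEquiv L L' ∨ Exceptional (Fintype.card F) t t') := fun t t' L L' h h' => by
    rw [conicDistribution_eq_iff h h', kEquiv_iff_label_eq h h']
  refine ⟨fun L hL => isWeb_webOf hL, fun W hW => existsUnique_line_of_isWeb hW,
    fun L L' _ _ => kEquiv_iff_projEquiv L L',
    fun t L W h => ⟨isLine_of_hasType h.hasType, webOf_of_tableRow h⟩,
    exists_hasType_iff, fun L hL => ?_, fun t t' L L' h h' => kEquiv_iff_label_eq h h',
    ncard_orbits F, fun t L h => ⟨hdist t L h, fun ho => conicDistribution_odd (odd_card_iff.1 ho) h,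
      fun he => conicDistribution_even (even_card_iff.1 he) h⟩,
    fun t t' L L' h h' => ?_, fun t t' L L' h h' => ?_, fun P hP => existsUnique_isConicOf hP,
    fun ho L hL => criterion_odd (odd_card_iff.1 ho) hL,
    fun he L hL => criterion_even (even_card_iff.1 he) hL⟩
  · obtain ⟨t, ht⟩ := exists_hasType hL
    exact ⟨t, ht, fun t' ht' => label_eq_of_kEquiv ht' ht (KEquiv.refl L)⟩
  · rw [hdist t L h, hdist t' L' h', hcomplete t t' L L' h h']
  · rw [hcomplete t t' L L' h h', kEquiv_iff_projEquiv]
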